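/- **Diffusion phenomenon for partially dissipative systems.** Let $n\ge1$, $d\ge1$, $\mathrm D=-\mathrm i\partial$, and let $\mathcal T\{\ell\}$ be the set of $f\in C^\infty([0,\infty))$ with $|\partial_t^kf(t)|\le C_k(1+t)^{-\ell-k}$ for all $k$ (entrywise for matrices). Let $A_1,\dots,A_n,B\in\mathcal T\{0\}\otimes\mathbb C^{d\times d}$, $A(t,\xi)=\sum_kA_k(t)\xi_k$, and assume - (B1) for $t\ge0$ the matrices $A_k(t)$ are self-adjoint and $B(t)\ge0$; - (B2) for $t\ge0$ the matrix $B(t)$ has $d$ eigenvalues $0=\delta_1(t)<\delta_2(t)<\dots<\delta_d(t)$, and $\liminf_{t\to\infty}|\delta_i(t)-\delta_j(t)|>0$ for $i\ne j$; - (B3) for all $\epsilon_0,\dots,\epsilon_{d-1}>0$ there are $c>0$ and $T\ge0$ with $\frac1c\|v\|^2\le\sum_{j=0}^{d-1}\epsilon_j\|B(t)A(t,\xi)^jv\|^2\le c\|v\|^2$ for all $t\ge T$, $|\xi|=1$, $v\in\mathbb C^d$. Then there is $M$ with $M,M^{-1}\in\mathcal T\{0\}$ and $M^{-1}BM=\mathrm{diag}(\delta_1,\dots,\delta_d)$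 on $[0,\infty)$. Fix any such $M$ and put $\mathcal D=\mathrm i\,\mathrm{diag}(\delta_1,\dots,\delta_d)$, $R_1(t,\xi)=M^{-1}A(t,\xi)M+(\mathrm D_tM^{-1})M$. Define $N_K,F_K$ recursively by $N_0=\mathrm I$, $F_0=0$ and, with $$B_K=\mathrm D_tN_K-[\mathcal D,N_K]-R_1N_K+N_KF_K,$$ $F_{K+1}=F_K-\mathrm{diag}\,B_K$, $N_{K+1}=N_K+N^{(K+1)}$, where $N^{(K+1)}$ has zero diagonal and $[\mathcal D,N^{(K+1)}]=B_K-\mathrm{diag}\,B_K$. Let $R_3=-N_2^{-1}B_2$ (where $N_2$ is invertible), let $f_1$ be the upper-left corner entry of $F_2$, and let $\Xi_2(t,s,\xi)=\exp\big(\mathrm i\int_s^tf_1(\theta,\xi)\,\mathrm d\theta\big)$. Then $$f_1(t,\xi)=\mathrm i\,\xi^\top\boldsymbol\alpha(t)\xi+\boldsymbol\beta(t)^\top\xi+\gamma(t)\qquad(t\ge0,\ \xi\in\mathbb R^n)$$ with $\boldsymbol\alpha(t)\in\mathbb C^{n\times n}$ symmetric, $\boldsymbol\beta(t)\in\mathbb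 C^n$, $\gamma(t)\in\mathbb C$, and there is $c>0$ such that $\mathrm{Re}\,\boldsymbol\alpha(t)$ is positive definite uniformly in $t\ge1/c$, $N_2(t,\xi)$ is invertible for $|\xi|\le c$, $t\ge1/c$, and the following holds for every $t_0\ge1/c$. Let $\mathcal E(t,0,\xi)$ be the fundamental solution of $\mathrm D_t\mathcal E=(A(t,\xi)+\mathrm iB(t))\mathcal E$, $\mathcal E(0,0,\xi)=\mathrm I$, and let $\mathcal E_2(t,t_0,0)$ be that of $\mathrm D_t\mathcal E_2=(\mathcal D(t)+F_2(t,0)+R_3(t,0))\mathcal E_2$, $\mathcal E_2(t_0,t_0,0)=\mathrm I$. Both exist, and so does the limit $$W_2(t_0)=\lim_{t\to\infty}\Xi_2(t,t_0,0)^{-1}e_1^\top\mathcal E_2(t,t_0,0).$$ Let $\chi\in C_0^\infty(\mathbb R^n)$ with $\chi=1$ near $0$ and $\operatorname{supp}\chi\subset\{|\xi|<c\}$. For $U_0\in L^2(\mathbb R^n;\mathbb C^d)$ the formula $$\widehat w_0(\xi)=W_2(t_0)N_2^{-1}(t_0,\xi)M^{-1}(t_0)\mathcal E(t_0,0,\xi)\chi(\xi)\widehat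 U_0(\xi)$$ defines a function $w_0\in L^2(\mathbb R^n)$. There is a constant $C$, independent of $U_0$, such that whenever $U\in C([0,\infty);L^2)$ is the weak solution of $$\mathrm D_tU=\sum_{k=1}^nA_k(t)\mathrm D_{x_k}U+\mathrm iB(t)U,\qquad U(0)=U_0,$$ and $w\in C([t_0,\infty);L^2)$ is the weak solution of $$\partial_tw=\nabla\cdot\boldsymbol\alpha(t)\nabla w+\boldsymbol\beta(t)\cdot\nabla w+\mathrm i\gamma(t)w,\qquad w(t_0)=w_0,$$ then, with $K(t,\xi)=M(t)N_2(t,\xi)e_1$, for all $t\ge t_0$ one has $K(t,\mathrm D)w(t)\in L^2$ and $$\|U(t)-K(t,\mathrm D)w(t)\|_{L^2}\le C(1+t)^{-1/2}\log(\mathrm e+t)\,\|U_0\|_{L^2}.$$ -/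

import Mathlib

open MeasureTheory Filter Topology Set Complex Matrix
open scoped ContDiff FourierTransform SchwartzMap LineDeriv ComplexOrder

noncomputable section

namespace Diffusion

/-- The Euclidean space `ℝⁿ`. -/
abbrev Space (n : ℕ) : Type := EuclideanSpace ℝ (Fin n)

/-- The space `L²(ℝⁿ; F)`. -/
abbrev L2 (n : ℕ) (F : Type) [NormedAddCommGroup F] : Type :=
  Lp F 2 (volume : Measure (Space n))

/-- Complex `d × d` matrices. -/
abbrev Mat (d : ℕ) : Type := Matrix (Fin d) (Fin d) ℂ

/-- The symbol class `𝒯{ℓ}`: smooth functions on `[0, ∞)` whose `k`-th derivative is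
`O((1 + t)^{-(ℓ + k)})` for every `k`. -/
def SymbolClass (ℓ : ℕ) (f : ℝ → ℂ) : Prop :=
  ContDiffOn ℝ ∞ f (Ici 0) ∧
    ∀ k : ℕ, ∃ C : ℝ, ∀ t : ℝ, 0 ≤ t →
      ‖iteratedDerivWithin k f (Ici 0) t‖ ≤ C * (1 / (1 + t)) ^ (ℓ + k)

/-- A matrix valued function all of whose entries belong to `𝒯{ℓ}`. -/
def MatSymbolClass {d : ℕ} (ℓ : ℕ) (X : ℝ → Mat d) : Prop :=
  ∀ i j, SymbolClass ℓ (fun t => X t i j)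

/-- The symbol `A(t, ξ) = ∑ₖ ξₖ Aₖ(t)`. -/
def symbolA {n d : ℕ} (A : Fin n → ℝ → Mat d) (t : ℝ) (ξ : Space n) : Mat d :=
  ∑ k, (ξ k : ℂ) • A k t

/-- Condition (B1). -/
def CondB1 {n d : ℕ} (A : Fin n → ℝ → Mat d) (B : ℝ → Mat d) : Prop :=
  ∀ t : ℝ, 0 ≤ t → (∀ k, (A k t).IsHermitian) ∧ (B t).PosSemidef

/-- Condition (B2): `0 = δ₁(t) < δ₂(t) < ⋯ < δ_d(t)` are the eigenvalues of `B(t)`, and they stay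
separated as `t → ∞`. (Indices start at `0` here.) -/
def CondB2 {d : ℕ} [NeZero d] (B : ℝ → Mat d) (δ : Fin d → ℝ → ℝ) : Prop :=
  (∀ t : ℝ, 0 ≤ t → δ 0 t = 0 ∧ StrictMono (fun i => δ i t) ∧
    ∀ i, Module.End.HasEigenvalue (Matrix.toLin' (B t)) (δ i t : ℂ)) ∧
  ∀ i j, i ≠ j → 0 < liminf (fun t => |δ i t - δ j t|) atTop

/-- Condition (B3), the uniform Kalman rank condition. -/
def CondB3 {n d : ℕ} (A : Fin n → ℝ → Mat d) (B : ℝ → Mat d) : Prop :=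
  ∀ ε : Fin d → ℝ, (∀ j, 0 < ε j) → ∃ c : ℝ, 0 < c ∧ ∃ T : ℝ, 0 ≤ T ∧
    ∀ t : ℝ, T ≤ t → ∀ ξ : Space n, ‖ξ‖ = 1 → ∀ v : EuclideanSpace ℂ (Fin d),
      1 / c * ‖v‖ ^ 2 ≤
          ∑ j : Fin d, ε j * ‖Matrix.toEuclideanLin (B t * symbolA A t ξ ^ (j : ℕ)) v‖ ^ 2 ∧
        ∑ j : Fin d, ε j * ‖Matrix.toEuclideanLin (B t * symbolA A t ξ ^ (j : ℕ)) v‖ ^ 2 ≤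
          c * ‖v‖ ^ 2

/-- `U ∈ C([0, ∞); L²(ℝⁿ; ℂᵈ))` is the weak solution to
`D_t U = ∑ₖ Aₖ(t) D_{xₖ} U + i B(t) U`, `U(0) = U₀`, where `D = -i ∂`; that is, of
`∂_t U = ∑ₖ Aₖ(t) ∂ₖ U - B(t) U`, tested with Schwartz functions of `x`. -/
def IsSystemSolution {n d : ℕ} (A : Fin n → ℝ → Mat d) (B : ℝ → Mat d)
    (U₀ : L2 n (EuclideanSpace ℂ (Fin d))) (U : ℝ → L2 n (EuclideanSpace ℂ (Fin d))) : Prop :=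
  ContinuousOn U (Ici 0) ∧ U 0 = U₀ ∧
    ∀ (i : Fin d) (φ : 𝓢(Space n, ℂ)) (t : ℝ), 0 ≤ t →
      HasDerivWithinAt (fun τ : ℝ => ∫ x, U τ x i * φ x)
        (-(∑ k, ∑ j, A k t i j * ∫ x, U t x j * (∂_{(EuclideanSpace.single k 1 : Space n)} φ) x)
          - ∑ j, B t i j * ∫ x, U t x j * φ x)
        (Ici 0) t

/-- `w ∈ C([t₀, ∞); L²(ℝⁿ))` is a weak solution to
`∂_t w = ∇ · α(t) ∇ w + β(t) · ∇ w + i γ(t) w`, `w(t₀) = w₀`, tested with Schwartz functions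
of `x`. -/
def IsParabolicSolution {n : ℕ} (α : ℝ → Matrix (Fin n) (Fin n) ℂ) (β : ℝ → Fin n → ℂ)
    (γ : ℝ → ℂ) (t₀ : ℝ) (w₀ : L2 n ℂ) (w : ℝ → L2 n ℂ) : Prop :=
  ContinuousOn w (Ici t₀) ∧ w t₀ = w₀ ∧
    ∀ (φ : 𝓢(Space n, ℂ)) (t : ℝ), t₀ ≤ t →
      HasDerivWithinAt (fun τ : ℝ => ∫ x, w τ x * φ x)
        ((∑ i, ∑ j, α t i j * ∫ x, w t x *
            (∂_{(EuclideanSpace.single i 1 : Space n)}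
              (∂_{(EuclideanSpace.single j 1 : Space n)} φ)) x)
          - (∑ i, β t i * ∫ x, w t x * (∂_{(EuclideanSpace.single i 1 : Space n)} φ) x)
          + I * γ t * ∫ x, w t x * φ x)
        (Ici t₀) t

/-- The product of the symbol `m` and the Fourier transform of `f` belongs to `L²`. Mathlib's
Fourier transform has the kernel `exp(-2πi⟨x, ξ⟩)`, so that `D = -i∂` corresponds to `2πξ`. -/
def MultiplierDefined {n : ℕ} {F G : Type} [NormedAddCommGroup F] [InnerProductSpace ℂ F]
    [CompleteSpace F] [NormedAddCommGroup G] (m : Space n → F → G) (f : L2 n F) : Prop :=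
  MemLp (fun ξ : Space n => m ((2 * Real.pi) • ξ) ((𝓕 f : L2 n F) ξ)) 2 volume

open Classical in
/-- The Fourier multiplier `m(D) f`, where `D = -i∂` (and `0` if `m(D) f ∉ L²`). -/
def fourierMultiplier {n : ℕ} {F G : Type} [NormedAddCommGroup F] [InnerProductSpace ℂ F]
    [CompleteSpace F] [NormedAddCommGroup G] [InnerProductSpace ℂ G] [CompleteSpace G]
    (m : Space n → F → G) (f : L2 n F) : L2 n G :=
  if h : MultiplierDefined m f then 𝓕⁻ (h.toLp _ : L2 n G) else 0

/-- `M(t)` diagonalises `B(t)`, with `M, M⁻¹ ∈ 𝒯{0}`. -/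
def IsDiagonaliser {d : ℕ} (B : ℝ → Mat d) (δ : Fin d → ℝ → ℝ) (M : ℝ → Mat d) : Prop :=
  MatSymbolClass 0 M ∧ MatSymbolClass 0 (fun t => (M t)⁻¹) ∧
    ∀ t : ℝ, 0 ≤ t → IsUnit (M t) ∧
      (M t)⁻¹ * B t * M t = Matrix.diagonal (fun i => (δ i t : ℂ))

/-- `D_t X = -i X'`, entry by entry, on `[0, ∞)`. -/
def Dt {d : ℕ} (X : ℝ → Mat d) (t : ℝ) : Mat d :=
  Matrix.of fun i j => -I * derivWithin (fun τ => X τ i j) (Ici 0) t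

/-- `𝒟(t) = i diag(δ₁(t), …, δ_d(t))`. -/
def calD {d : ℕ} (δ : Fin d → ℝ → ℝ) (t : ℝ) : Mat d :=
  Matrix.diagonal fun i => I * (δ i t : ℂ)

/-- `R₁(t, ξ) = M⁻¹ A(t, ξ) M + (D_t M⁻¹) M`. -/
def R1 {n d : ℕ} (A : Fin n → ℝ → Mat d) (M : ℝ → Mat d) (t : ℝ) (ξ : Space n) : Mat d :=
  (M t)⁻¹ * symbolA A t ξ * M t + Dt (fun τ => (M τ)⁻¹) t * M t

/-- The matrix `(D_t - 𝒟 - R₁) N - N (D_t - 𝒟 - F) = D_t N - [𝒟, N] - R₁ N + N F`. -/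
def hierarchyError {n d : ℕ} (A : Fin n → ℝ → Mat d) (δ : Fin d → ℝ → ℝ) (M N F : ℝ → Mat d)
    (t : ℝ) (ξ : Space n) : Mat d :=
  Dt N t - (calD δ t * N t - N t * calD δ t) - R1 A M t ξ * N t + N t * F t

/-- The solution `N`, with vanishing diagonal, of `[𝒟, N] = X - diag X`. -/
def solveCommutator {d : ℕ} (δ : Fin d → ℝ → ℝ) (t : ℝ) (X : Mat d) : Mat d :=
  Matrix.of fun i j => if i = j then 0 else X i j / (I * ((δ i t : ℂ) - (δ j t : ℂ)))

/-- The diagonalisation hierarchy: the pair `(N_K(·, ξ), F_K(·, ξ))`. It starts with `(I, 0)`;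
with `B_K = (D_t - 𝒟 - R₁) N_K - N_K (D_t - 𝒟 - F_K)`, the next corrections are
`F^{(K+1)} = -diag B_K` and the solution `N^{(K+1)}` of `[𝒟, N^{(K+1)}] = B_K + F^{(K+1)}` with
vanishing diagonal. -/
def hierarchy {n d : ℕ} (A : Fin n → ℝ → Mat d) (δ : Fin d → ℝ → ℝ) (M : ℝ → Mat d)
    (ξ : Space n) : ℕ → (ℝ → Mat d) × (ℝ → Mat d)
  | 0 => (fun _ => 1, fun _ => 0)
  | K + 1 =>
    (fun t => (hierarchy A δ M ξ K).1 t + solveCommutator δ t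
        (hierarchyError A δ M (hierarchy A δ M ξ K).1 (hierarchy A δ M ξ K).2 t ξ),
      fun t => (hierarchy A δ M ξ K).2 t - Matrix.diagonal
        (hierarchyError A δ M (hierarchy A δ M ξ K).1 (hierarchy A δ M ξ K).2 t ξ).diag)

/-- `N_K(t, ξ)`. -/
def matN {n d : ℕ} (A : Fin n → ℝ → Mat d) (δ : Fin d → ℝ → ℝ) (M : ℝ → Mat d) (K : ℕ)
    (t : ℝ) (ξ : Space n) : Mat d :=
  (hierarchy A δ M ξ K).1 t

/-- `F_K(t, ξ)`, a diagonal matrix. -/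
def matF {n d : ℕ} (A : Fin n → ℝ → Mat d) (δ : Fin d → ℝ → ℝ) (M : ℝ → Mat d) (K : ℕ)
    (t : ℝ) (ξ : Space n) : Mat d :=
  (hierarchy A δ M ξ K).2 t

/-- The remainder `R_{K+1}(t, ξ) = -N_K⁻¹ B_K` of
`(D_t - 𝒟 - R₁) N_K = N_K (D_t - 𝒟 - F_K - R_{K+1})`. -/
def remainder {n d : ℕ} (A : Fin n → ℝ → Mat d) (δ : Fin d → ℝ → ℝ) (M : ℝ → Mat d) (K : ℕ)
    (t : ℝ) (ξ : Space n) : Mat d :=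
  -((matN A δ M K t ξ)⁻¹ *
    hierarchyError A δ M (hierarchy A δ M ξ K).1 (hierarchy A δ M ξ K).2 t ξ)

/-- The upper-left corner entry `f₁(t, ξ)` of `F_K(t, ξ)`. -/
def cornerF {n d : ℕ} [NeZero d] (A : Fin n → ℝ → Mat d) (δ : Fin d → ℝ → ℝ) (M : ℝ → Mat d)
    (K : ℕ) (t : ℝ) (ξ : Space n) : ℂ :=
  matF A δ M K t ξ 0 0

/-- `Ξ_K(t, s, ξ) = exp(i ∫ₛᵗ f₁(θ, ξ) dθ)`. -/
def Xi {n d : ℕ} [NeZero d] (A : Fin n → ℝ → Mat d) (δ : Fin d → ℝ → ℝ) (M : ℝ → Mat d)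
    (K : ℕ) (t s : ℝ) (ξ : Space n) : ℂ :=
  Complex.exp (I * ∫ θ in s..t, cornerF A δ M K θ ξ)

/-- `Φ` is the fundamental solution on `[s, ∞)` of `D_t Φ = G(t) Φ`, `Φ(s) = I`. -/
def IsFundamentalSolution {d : ℕ} (G : ℝ → Mat d) (s : ℝ) (Φ : ℝ → Mat d) : Prop :=
  Φ s = 1 ∧ ∀ t : ℝ, s ≤ t → ∀ i j,
    HasDerivWithinAt (fun τ => Φ τ i j) (I * (G t * Φ t) i j) (Ici s) t

/-- The symbol `K(t, ξ) = M(t) N₂(t, ξ) e₁`, acting on scalars. -/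
def symbolK {n d : ℕ} [NeZero d] (A : Fin n → ℝ → Mat d) (δ : Fin d → ℝ → ℝ) (M : ℝ → Mat d)
    (t : ℝ) (ξ : Space n) (z : ℂ) : EuclideanSpace ℂ (Fin d) :=
  z • WithLp.toLp 2 (fun i => (M t * matN A δ M 2 t ξ) i 0)

/-- The symbol `W N₂⁻¹(t₀, ξ) M⁻¹(t₀) E(t₀, 0, ξ) χ(ξ)` (`E ξ` stands for `E(t₀, 0, ξ)`, and `W`
is a row vector), which maps the Fourier transform of `U₀` to that of the data `w₀`. -/
def symbolData {n d : ℕ} (A : Fin n → ℝ → Mat d) (δ : Fin d → ℝ → ℝ) (M : ℝ → Mat d)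
    (t₀ : ℝ) (W : Fin d → ℂ) (E : Space n → Mat d) (χ : Space n → ℂ)
    (ξ : Space n) (v : EuclideanSpace ℂ (Fin d)) : ℂ :=
  W ⬝ᵥ (((matN A δ M 2 t₀ ξ)⁻¹ * (M t₀)⁻¹ * E ξ) *ᵥ (χ ξ • fun i => v i))

end Diffusion

end

/-! After the Fourier transform the system becomes, for each frequency, the ordinary differential
equation `D_t x = (A(t, ξ) + iB(t)) x`. Since `A` is Hermitian and `B ≥ 0`, every solution is
contractive. Only the kernel of `B`, which is one-dimensional, escapes direct damping, so the
long-time behaviour is that of a single scalar mode near `ξ = 0`.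

Away from `ξ = 0` the Kalman condition gives exponential decay, uniformly for `‖ξ‖ ≥ c₀`
(`exists_norm_le_exp`). The energy `‖x‖²` is corrected by terms `Im ⟨B Aʲ x, B Aʲ⁺¹ x⟩` of size
`1/‖ξ‖`, with weights from `exists_weights`. Their derivatives supply the dissipation that `B` alone
does not give.

For small `ξ` and large `t`, conjugation by `M N₂` makes the system diagonal up to a remainder of
size `(1+t)⁻³ + ‖ξ‖³` (`polyMat_hierarchy`, `exists_reduced_bounds`). The columns of `M` are
orthogonal, so the quadratic part of the corner entry `f₁` is a sum of terms with non-negative real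
part. Its positivity is again the Kalman condition, applied to the kernel vector `M e₁`
(`exists_parabolicity`). The only non-integrable part of `Im f₁` that could be negative is half the
logarithmic derivative of `‖M e₁‖²`, and it integrates to a bounded quantity. Hence `Ξ₂` obeys a
Gaussian bound (`exists_norm_Xi_le`).

Dividing the reduced system by `Ξ₂` removes the leading diagonal entry, while all other entries stay
damped. At `ξ = 0` the remainder is integrable, so the leading component converges; this is the row
`W₂`. Put `r = ‖ξ‖`. Comparing the solution at `ξ` with the one at `0` that has the same value at
`t₀` gives a deviation from the limit of order `r + r³(t - t₀) + (1+t)⁻¹`, up to a growth factor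
`exp(a r³ (t - t₀))` (`exists_norm_sub_limit_le`). The Gaussian bound absorbs that growth and turns
the deviation into `(1+t)^{-1/2}` (`parabolic_decay_le`, `exists_low_frequency`). The logarithm in
the final rate is a mere weakening of this bound.

It remains to identify weak solutions with these symbols. Uniqueness of weak solutions on the
Fourier side shows that both the system and the parabolic problem are solved by their fundamental
matrices (`weak_solution_eq`). Plancherel then reduces the estimate to the pointwise one in
`exists_symbol_estimate`. -/

noncomputable section
namespace Diffusion
-- Comparison principles and linear ordinary differential equations
section ODE
open scoped Matrix.Norms.L2Operator

theorem hasDerivWithinAt_matrix {d : ℕ} {Φ : ℝ → Mat d} {Φ' : Mat d} {s : Set ℝ} {t : ℝ} :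
    HasDerivWithinAt Φ Φ' s t ↔
      ∀ i j, HasDerivWithinAt (fun τ => Φ τ i j) (Φ' i j) s t := by
  constructor
  · intro h i j
    exact hasDerivWithinAt_pi.1 (hasDerivWithinAt_pi.1 h i) j
  · intro h
    exact hasDerivWithinAt_pi.2 fun i => hasDerivWithinAt_pi.2 (h i)

/-- Comparison principle for scalar linear differential inequalities. -/
theorem le_of_deriv_le {f f' a b φ φ' α : ℝ → ℝ} {t₀ t₁ : ℝ}
    (hf : ∀ t, t₀ ≤ t → t ≤ t₁ → HasDerivWithinAt f (f' t) (Ici t₀) t)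
    (hα : ∀ t, t₀ ≤ t → t ≤ t₁ → HasDerivWithinAt α (a t) (Ici t₀) t)
    (hφ : ∀ t, t₀ ≤ t → t ≤ t₁ → HasDerivWithinAt φ (φ' t) (Ici t₀) t)
    (hle : ∀ t, t₀ ≤ t → t ≤ t₁ → f' t ≤ a t * f t + b t)
    (hge : ∀ t, t₀ ≤ t → t ≤ t₁ → a t * φ t + b t ≤ φ' t) (h₀ : f t₀ ≤ φ t₀) :
    ∀ t, t₀ ≤ t → t ≤ t₁ → f t ≤ φ t := by
  intro t ht ht1
  -- The barrier principle needs a strict inequality between derivatives. The term `ε e^{α + t}`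
  -- grows at rate `a + 1`, strictly faster than the equation allows; afterwards `ε → 0`.
  have key : ∀ ε : ℝ, 0 < ε → f t ≤ φ t + ε * Real.exp (α t + t) := by
    intro ε hε
    have hd : ∀ s, t₀ ≤ s → s ≤ t₁ → HasDerivWithinAt (fun s => φ s + ε * Real.exp (α s + s))
        (φ' s + ε * (Real.exp (α s + s) * (a s + 1))) (Ici t₀) s := fun s h h1 =>
      (hφ s h h1).add ((((hα s h h1).add (hasDerivWithinAt_id s _)).exp).const_mul ε)
    refine image_le_of_deriv_right_lt_deriv_boundary' (f := f) (f' := f') (a := t₀) (b := t₁)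
      (B := fun s => φ s + ε * Real.exp (α s + s))
      (B' := fun s => φ' s + ε * (Real.exp (α s + s) * (a s + 1)))
      ?_ ?_ ?_ ?_ ?_ ?_ ⟨ht, ht1⟩
    · exact fun s hs => (hf s hs.1 hs.2).continuousWithinAt.mono Icc_subset_Ici_self
    · exact fun s hs => (hf s hs.1 hs.2.le).mono (Ici_subset_Ici.2 hs.1)
    · have := Real.exp_pos (α t₀ + t₀)
      nlinarith [mul_pos hε this]
    · exact fun s hs => (hd s hs.1 hs.2).continuousWithinAt.mono Icc_subset_Ici_self
    · exact fun s hs => (hd s hs.1 hs.2.le).mono (Ici_subset_Ici.2 hs.1)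
    · intro s hs hfs
      have h1 := hle s hs.1 hs.2.le
      have h2 := hge s hs.1 hs.2.le
      have h3 := mul_pos hε (Real.exp_pos (α s + s))
      rw [hfs] at h1
      nlinarith
  refine le_of_forall_pos_le_add fun ε hε => ?_
  have h := key (ε / Real.exp (α t + t)) (div_pos hε (Real.exp_pos _))
  rwa [div_mul_cancel₀ _ (Real.exp_pos _).ne'] at h

section Vector

variable {V : Type*} [NormedAddCommGroup V] [InnerProductSpace ℂ V]

theorem hasDerivWithinAt_norm_sq {g : ℝ → V} {g' : V} {s : Set ℝ} {t : ℝ}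
    (h : HasDerivWithinAt g g' s t) :
    HasDerivWithinAt (fun τ => ‖g τ‖ ^ 2) (2 * (inner ℂ (g t) g').re) s t := by
  let _ := InnerProductSpace.complexToReal (G := V)
  have := HasDerivWithinAt.norm_sq (F := V) (f := g) h
  rwa [real_inner_eq_re_inner ℂ] at this

/-- Comparison principle for the norm of a vector valued function. -/
theorem norm_le_of_re_inner_deriv_le {g g' : ℝ → V} {a b φ φ' α : ℝ → ℝ} {t₀ t₁ : ℝ}
    (hg : ∀ t, t₀ ≤ t → t ≤ t₁ → HasDerivWithinAt g (g' t) (Ici t₀) t)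
    (hα : ∀ t, t₀ ≤ t → t ≤ t₁ → HasDerivWithinAt α (a t) (Ici t₀) t)
    (hφ : ∀ t, t₀ ≤ t → t ≤ t₁ → HasDerivWithinAt φ (φ' t) (Ici t₀) t)
    (hle : ∀ t, t₀ ≤ t → t ≤ t₁ → (inner ℂ (g t) (g' t)).re ≤ a t * ‖g t‖ ^ 2 + b t * ‖g t‖)
    (hge : ∀ t, t₀ ≤ t → t ≤ t₁ → a t * φ t + b t ≤ φ' t)
    (hφ0 : ∀ t, t₀ ≤ t → t ≤ t₁ → 0 ≤ φ t) (h₀ : ‖g t₀‖ ≤ φ t₀) :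
    ∀ t, t₀ ≤ t → t ≤ t₁ → ‖g t‖ ≤ φ t := by
  intro t ht ht1
  have key : ∀ ε : ℝ, 0 < ε → ‖g t‖ ≤ φ t + ε * Real.exp (α t + t) := by
    intro ε hε
    have hpos : ∀ s, t₀ ≤ s → s ≤ t₁ → 0 < φ s + ε * Real.exp (α s + s) := fun s h h1 =>
      add_pos_of_nonneg_of_pos (hφ0 s h h1) (mul_pos hε (Real.exp_pos _))
    have hd : ∀ s, t₀ ≤ s → s ≤ t₁ → HasDerivWithinAt (fun s => φ s + ε * Real.exp (α s + s))
        (φ' s + ε * (Real.exp (α s + s) * (a s + 1))) (Ici t₀) s := fun s h h1 =>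
      (hφ s h h1).add ((((hα s h h1).add (hasDerivWithinAt_id s _)).exp).const_mul ε)
    have hn := fun s h h1 => hasDerivWithinAt_norm_sq (hg s h h1)
    -- The squares are compared because the norm itself need not be differentiable where `g`
    -- vanishes. At a contact point the barrier is positive, so the factor `‖g s‖` can be identified
    -- and the strict inequality survives multiplication by it.
    have := image_le_of_deriv_right_lt_deriv_boundary' (f := fun s => ‖g s‖ ^ 2)
      (f' := fun s => 2 * (inner ℂ (g s) (g' s)).re) (a := t₀) (b := t₁)
      (B := fun s => (φ s + ε * Real.exp (α s + s)) ^ 2)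
      (B' := fun s => ((2 : ℕ) : ℝ) * (φ s + ε * Real.exp (α s + s)) ^ (2 - 1)
        * (φ' s + ε * (Real.exp (α s + s) * (a s + 1))))
      ?_ ?_ ?_ ?_ ?_ ?_ ⟨ht, ht1⟩
    · exact le_of_sq_le_sq this (hpos t ht ht1).le
    · exact fun s hs => (hn s hs.1 hs.2).continuousWithinAt.mono Icc_subset_Ici_self
    · exact fun s hs => (hn s hs.1 hs.2.le).mono (Ici_subset_Ici.2 hs.1)
    · have := mul_pos hε (Real.exp_pos (α t₀ + t₀))
      exact pow_le_pow_left₀ (norm_nonneg _) (by linarith) 2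
    · exact fun s hs => ((hd s hs.1 hs.2).pow 2).continuousWithinAt.mono Icc_subset_Ici_self
    · exact fun s hs => ((hd s hs.1 hs.2.le).pow 2).mono (Ici_subset_Ici.2 hs.1)
    · intro s hs hfs
      have h1 := hle s hs.1 hs.2.le
      have h2 := hge s hs.1 hs.2.le
      have h3 := mul_pos hε (Real.exp_pos (α s + s))
      have h4 := hpos s hs.1 hs.2.le
      have h5 : ‖g s‖ = φ s + ε * Real.exp (α s + s) := by
        have := congrArg Real.sqrt hfs
        simpa [Real.sqrt_sq, h4.le] using this
      rw [h5] at h1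
      have h6 : a s * (φ s + ε * Real.exp (α s + s)) + b s
          < φ' s + ε * (Real.exp (α s + s) * (a s + 1)) := by nlinarith
      have h7 := mul_lt_mul_of_pos_left h6 h4
      norm_num
      nlinarith
  refine le_of_forall_pos_le_add fun ε hε => ?_
  have h := key (ε / Real.exp (α t + t)) (div_pos hε (Real.exp_pos _))
  rwa [div_mul_cancel₀ _ (Real.exp_pos _).ne'] at h

end Vector

/-- The terms of the Peano–Baker series for `Φ' = G Φ`, `Φ(s) = x`. -/
def peanoBaker {E : Type*} [NormedAddCommGroup E] [NormedSpace ℝ E] (G : ℝ → E →L[ℝ] E) (s : ℝ)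
    (x : E) : ℕ → ℝ → E
  | 0 => fun _ => x
  | k + 1 => fun t => ∫ τ in s..t, G τ (peanoBaker G s x k τ)

section Existence

variable {E : Type*} [NormedAddCommGroup E] [NormedSpace ℝ E] {G : ℝ → E →L[ℝ] E}

theorem continuous_peanoBaker [CompleteSpace E] (hG : Continuous G) (s : ℝ) (x : E) (k : ℕ) :
    Continuous (peanoBaker G s x k) := by
  induction k with
  | zero => exact continuous_const
  | succ k ih =>
    have : Continuous fun τ => G τ (peanoBaker G s x k τ) := hG.clm_apply ih
    exact continuous_iff_continuousAt.2 fun t =>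
      (intervalIntegral.integral_hasDerivAt_right (this.intervalIntegrable _ _)
        (this.stronglyMeasurableAtFilter _ _) this.continuousAt).continuousAt

/-- Iterated integration of a bounded operator produces the factorial, and so an exponential series
as locally uniform majorant. This is what justifies termwise differentiation of the Peano–Baker
series. -/
theorem norm_peanoBaker_le [CompleteSpace E] (hG : Continuous G) (s : ℝ) (x : E) {K r : ℝ}
    (hK : ∀ t, |t - s| ≤ r → ‖G t‖ ≤ K) (k : ℕ) :
    ∀ t, |t - s| ≤ r → ‖peanoBaker G s x k t‖ ≤ ‖x‖ * (K ^ k * |t - s| ^ k / k.factorial) := by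
  induction k with
  | zero => intro t _; simp [peanoBaker]
  | succ k ih =>
    intro t ht
    have hK0 : 0 ≤ K := (norm_nonneg _).trans (hK t ht)
    have hcont : Continuous fun τ => G τ (peanoBaker G s x k τ) :=
      hG.clm_apply (continuous_peanoBaker hG s x k)
    calc ‖∫ τ in s..t, G τ (peanoBaker G s x k τ)‖
        ≤ ∫ τ in uIoc s t, ‖G τ (peanoBaker G s x k τ)‖ :=
          intervalIntegral.norm_integral_le_integral_norm_uIoc
      _ ≤ ∫ τ in uIoc s t, (K * (‖x‖ * (K ^ k / k.factorial))) * |τ - s| ^ k := by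
          refine setIntegral_mono_on ?_ ?_ measurableSet_uIoc ?_
          · exact (intervalIntegrable_iff.1 (hcont.norm.intervalIntegrable s t))
          · exact intervalIntegrable_iff.1
              (Continuous.intervalIntegrable (by fun_prop) s t)
          · intro τ hτ
            have hτ' : |τ - s| ≤ r := (abs_sub_left_of_mem_uIcc (uIoc_subset_uIcc hτ)).trans
              (by rwa [abs_sub_comm] at *)
            calc ‖G τ (peanoBaker G s x k τ)‖ ≤ ‖G τ‖ * ‖peanoBaker G s x k τ‖ :=
                  (G τ).le_opNorm _
              _ ≤ K * (‖x‖ * (K ^ k * |τ - s| ^ k / k.factorial)) :=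
                  mul_le_mul (hK τ hτ') (ih τ hτ') (norm_nonneg _) hK0
              _ = _ := by ring
      _ = _ := by
          rw [integral_const_mul, integral_pow_abs_sub_uIoc, Nat.factorial_succ]
          push_cast
          field_simp
          ring

/-- Linear equations with continuous coefficients have global solutions. -/
theorem exists_linear_solution [CompleteSpace E] (hG : Continuous G) (s : ℝ) (x : E) :
    ∃ Φ : ℝ → E, Φ s = x ∧ ∀ t, HasDerivAt Φ (G t (Φ t)) t := by
  have hder : ∀ k t, HasDerivAt (peanoBaker G s x (k + 1)) (G t (peanoBaker G s x k t)) t := by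
    intro k t
    have : Continuous fun τ => G τ (peanoBaker G s x k τ) :=
      hG.clm_apply (continuous_peanoBaker hG s x k)
    exact intervalIntegral.integral_hasDerivAt_right (this.intervalIntegrable _ _)
        (this.stronglyMeasurableAtFilter _ _) this.continuousAt
  refine ⟨fun t => x + ∑' k, peanoBaker G s x (k + 1) t, ?_, fun t => ?_⟩
  · simp [peanoBaker]
  · set r := |t - s| + 1 with hr
    obtain ⟨K, hK⟩ : ∃ K, ∀ τ, |τ - s| ≤ r → ‖G τ‖ ≤ K := by
      obtain ⟨K, hK⟩ := (isCompact_closedBall s r).exists_bound_of_continuousOn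
        (f := G) hG.continuousOn
      exact ⟨K, fun τ hτ => hK τ (by rwa [Metric.mem_closedBall, Real.dist_eq])⟩
    have hK0 : 0 ≤ K := (norm_nonneg _).trans (hK s (by simp [hr]; positivity))
    have hb : ∀ k τ, τ ∈ Metric.ball s r →
        ‖peanoBaker G s x k τ‖ ≤ ‖x‖ * ((K * r) ^ k / k.factorial) := by
      intro k τ hτ
      rw [Metric.mem_ball, Real.dist_eq] at hτ
      refine (norm_peanoBaker_le hG s x hK k τ hτ.le).trans ?_
      rw [← mul_pow]
      gcongr
    have hsum : Summable fun k : ℕ => ‖x‖ * ((K * r) ^ k / k.factorial) :=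
      (Real.summable_pow_div_factorial _).mul_left _
    have htm : t ∈ Metric.ball s r := by
      rw [Metric.mem_ball, Real.dist_eq]; linarith
    have hS : Summable fun k => peanoBaker G s x k t :=
      Summable.of_norm_bounded hsum fun k => hb k t htm
    have hd := hasDerivAt_tsum_of_isPreconnected (hsum.mul_left K) Metric.isOpen_ball
      (convex_ball s r).isPreconnected (fun k τ _ => hder k τ) (fun k τ hτ => ?_)
      (Metric.mem_ball_self (by positivity)) (?_) htm
    · convert hd.const_add x using 1
      rw [← (G t).map_tsum hS, hS.tsum_eq_zero_add]
      rfl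
    · have hτ' := hτ
      rw [Metric.mem_ball, Real.dist_eq] at hτ'
      exact ((G τ).le_opNorm _).trans
        (mul_le_mul (hK τ hτ'.le) (hb k τ hτ) (norm_nonneg _) hK0)
    · simp [peanoBaker, summable_zero]

end Existence

/-- Fundamental solutions exist for coefficients which are continuous on `[s, ∞)`. -/
theorem exists_isFundamentalSolution {d : ℕ} {G : ℝ → Mat d} {s : ℝ}
    (hG : ContinuousOn G (Ici s)) (X₀ : Mat d) :
    ∃ Φ : ℝ → Mat d, Φ s = X₀ ∧
      ∀ t, s ≤ t → HasDerivWithinAt Φ (G t * Φ t) (Ici s) t := by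
  -- Freezing the coefficient to the left of `s` makes it continuous on the whole line, as the
  -- two-sided existence theorem requires.
  have hc : Continuous fun t => G (max t s) :=
    hG.comp_continuous (by fun_prop) fun t => mem_Ici.2 (le_max_right t s)
  obtain ⟨Φ, h0, h⟩ := exists_linear_solution
    (G := fun t => ContinuousLinearMap.mul ℝ (Mat d) (G (max t s)))
    ((ContinuousLinearMap.mul ℝ (Mat d)).continuous.comp hc) s X₀
  refine ⟨Φ, h0, fun t ht => ?_⟩
  have := (h t).hasDerivWithinAt (s := Ici s)
  simpa [max_eq_left ht] using this

theorem linear_solution_unique {d : ℕ} {G Φ Ψ : ℝ → Mat d} {s : ℝ}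
    (hG : ContinuousOn G (Ici s)) (h0 : Φ s = Ψ s)
    (hΦ : ∀ t, s ≤ t → HasDerivWithinAt Φ (G t * Φ t) (Ici s) t)
    (hΨ : ∀ t, s ≤ t → HasDerivWithinAt Ψ (G t * Ψ t) (Ici s) t) :
    ∀ t, s ≤ t → Φ t = Ψ t := by
  intro t ht
  obtain ⟨K, hK⟩ := isCompact_Icc.exists_bound_of_continuousOn
    (hG.mono (Icc_subset_Ici_self : Icc s t ⊆ Ici s))
  refine ODE_solution_unique_of_mem_Icc_right (v := fun t X => G t * X) (s := fun _ => univ)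
    (K := K.toNNReal) (a := s) (b := t) ?_ ?_ ?_ (fun _ _ => mem_univ _) ?_ ?_
    (fun _ _ => mem_univ _) h0 ⟨ht, le_rfl⟩
  · intro τ hτ
    refine LipschitzOnWith.of_dist_le_mul fun X _ Y _ => ?_
    rw [dist_eq_norm, dist_eq_norm, ← mul_sub]
    exact (norm_mul_le _ _).trans (mul_le_mul_of_nonneg_right
      ((hK τ ⟨hτ.1, hτ.2.le⟩).trans (Real.le_coe_toNNReal K)) (norm_nonneg _))
  · exact fun τ hτ => (hΦ τ hτ.1).continuousWithinAt.mono Icc_subset_Ici_self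
  · exact fun τ hτ => (hΦ τ hτ.1).mono (Ici_subset_Ici.2 hτ.1)
  · exact fun τ hτ => (hΨ τ hτ.1).continuousWithinAt.mono Icc_subset_Ici_self
  · exact fun τ hτ => (hΨ τ hτ.1).mono (Ici_subset_Ici.2 hτ.1)

end ODE

/-! ### Calculus of the symbol classes and of polynomial symbols -/

section Symbols

/-- Functions whose derivatives up to order `k` satisfy the estimates of the symbol class
`𝒯{ℓ}`. -/
def Sym : ℕ → ℕ → (ℝ → ℂ) → Prop
  | 0, ℓ, f => ContinuousOn f (Ici 0) ∧ ∃ C : ℝ, ∀ t : ℝ, 0 ≤ t → ‖f t‖ ≤ C * (1 / (1 + t)) ^ ℓ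
  | k + 1, ℓ, f => (∃ C : ℝ, ∀ t : ℝ, 0 ≤ t → ‖f t‖ ≤ C * (1 / (1 + t)) ^ ℓ) ∧
      ∃ g, Sym k (ℓ + 1) g ∧ ∀ t, 0 ≤ t → HasDerivWithinAt f (g t) (Ici 0) t

theorem Sym.bound {k ℓ : ℕ} {f : ℝ → ℂ} (h : Sym k ℓ f) :
    ∃ C : ℝ, 0 ≤ C ∧ ∀ t : ℝ, 0 ≤ t → ‖f t‖ ≤ C * (1 / (1 + t)) ^ ℓ := by
  have : ∃ C : ℝ, ∀ t : ℝ, 0 ≤ t → ‖f t‖ ≤ C * (1 / (1 + t)) ^ ℓ := by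
    cases k with
    | zero => exact h.2
    | succ k => exact h.1
  obtain ⟨C, hC⟩ := this
  refine ⟨C, ?_, hC⟩
  simpa using (norm_nonneg _).trans (hC 0 le_rfl)

theorem Sym.continuousOn {k ℓ : ℕ} {f : ℝ → ℂ} (h : Sym k ℓ f) : ContinuousOn f (Ici 0) := by
  cases k with
  | zero => exact h.1
  | succ k =>
    obtain ⟨_, g, _, hg⟩ := h
    exact fun t ht => (hg t ht).continuousWithinAt

theorem Sym.of_succ {k ℓ : ℕ} {f : ℝ → ℂ} (h : Sym (k + 1) ℓ f) : Sym k ℓ f := by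
  induction k generalizing ℓ f with
  | zero => exact ⟨h.continuousOn, h.1⟩
  | succ k ih =>
    obtain ⟨hb, g, hg, hfg⟩ := h
    exact ⟨hb, g, ih hg, hfg⟩

theorem Sym.congr {k ℓ : ℕ} {f g : ℝ → ℂ} (h : Sym k ℓ f) (hfg : ∀ t, 0 ≤ t → g t = f t) :
    Sym k ℓ g := by
  cases k with
  | zero =>
    obtain ⟨hc, C, hC⟩ := h
    exact ⟨hc.congr fun t ht => hfg t ht, C, fun t ht => hfg t ht ▸ hC t ht⟩
  | succ k =>
    obtain ⟨⟨C, hC⟩, f', hf', hd⟩ := h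
    exact ⟨⟨C, fun t ht => hfg t ht ▸ hC t ht⟩, f', hf', fun t ht =>
      (hd t ht).congr (fun s hs => hfg s hs) (hfg t ht)⟩

theorem Sym.add {k ℓ : ℕ} {f g : ℝ → ℂ} (hf : Sym k ℓ f) (hg : Sym k ℓ g) :
    Sym k ℓ (fun t => f t + g t) := by
  have key : ∃ C : ℝ, ∀ t : ℝ, 0 ≤ t → ‖f t + g t‖ ≤ C * (1 / (1 + t)) ^ ℓ := by
    obtain ⟨C, -, hC⟩ := hf.bound
    obtain ⟨D, -, hD⟩ := hg.bound
    refine ⟨C + D, fun t ht => (norm_add_le _ _).trans ?_⟩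
    rw [add_mul]
    exact add_le_add (hC t ht) (hD t ht)
  induction k generalizing ℓ f g with
  | zero => exact ⟨hf.1.add hg.1, key⟩
  | succ k ih =>
    obtain ⟨_, f', hf', hdf⟩ := hf
    obtain ⟨_, g', hg', hdg⟩ := hg
    refine ⟨key, _, ih hf' hg' ?_, fun t ht => (hdf t ht).add (hdg t ht)⟩
    obtain ⟨C, -, hC⟩ := hf'.bound
    obtain ⟨D, -, hD⟩ := hg'.bound
    refine ⟨C + D, fun t ht => (norm_add_le _ _).trans ?_⟩
    rw [add_mul]
    exact add_le_add (hC t ht) (hD t ht)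

theorem Sym.zero (k ℓ : ℕ) : Sym k ℓ (fun _ => 0) := by
  induction k generalizing ℓ with
  | zero => exact ⟨continuousOn_const, 0, by simp⟩
  | succ k ih => exact ⟨⟨0, by simp⟩, _, ih _, fun t _ => hasDerivWithinAt_const _ _ _⟩

theorem Sym.const (k : ℕ) (c : ℂ) : Sym k 0 (fun _ => c) := by
  cases k with
  | zero => exact ⟨continuousOn_const, ‖c‖, by simp⟩
  | succ k => exact ⟨⟨‖c‖, by simp⟩, _, Sym.zero k 1, fun t _ => hasDerivWithinAt_const _ _ _⟩

theorem Sym.mul {k ℓ m : ℕ} {f g : ℝ → ℂ} (hf : Sym k ℓ f) (hg : Sym k m g) :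
    Sym k (ℓ + m) (fun t => f t * g t) := by
  have key : ∀ {f g : ℝ → ℂ}, Sym k ℓ f → Sym k m g →
      ∃ C : ℝ, ∀ t : ℝ, 0 ≤ t → ‖f t * g t‖ ≤ C * (1 / (1 + t)) ^ (ℓ + m) := by
    intro f g hf hg
    obtain ⟨C, hC0, hC⟩ := hf.bound
    obtain ⟨D, hD0, hD⟩ := hg.bound
    refine ⟨C * D, fun t ht => ?_⟩
    rw [norm_mul, pow_add, mul_mul_mul_comm]
    exact mul_le_mul (hC t ht) (hD t ht) (norm_nonneg _) (by positivity)
  induction k generalizing ℓ m f g with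
  | zero => exact ⟨hf.1.mul hg.1, key hf hg⟩
  | succ k ih =>
    obtain ⟨hbf, f', hf', hdf⟩ := hf
    obtain ⟨hbg, g', hg', hdg⟩ := hg
    have hf : Sym (k + 1) ℓ f := ⟨hbf, f', hf', hdf⟩
    have hg : Sym (k + 1) m g := ⟨hbg, g', hg', hdg⟩
    refine ⟨key hf hg, _, ?_, fun t ht => (hdf t ht).mul (hdg t ht)⟩
    have aux : ∀ {ℓ m : ℕ} {f g : ℝ → ℂ}, Sym k ℓ f → Sym k m g →
        ∃ C : ℝ, ∀ t : ℝ, 0 ≤ t → ‖f t * g t‖ ≤ C * (1 / (1 + t)) ^ (ℓ + m) := by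
      intro ℓ m f g hf hg
      obtain ⟨C, hC0, hC⟩ := hf.bound
      obtain ⟨D, hD0, hD⟩ := hg.bound
      refine ⟨C * D, fun t ht => ?_⟩
      rw [norm_mul, pow_add, mul_mul_mul_comm]
      exact mul_le_mul (hC t ht) (hD t ht) (norm_nonneg _) (by positivity)
    have h1 := ih hf' hg.of_succ (fun h h' => aux h h')
    have h2 := ih hf.of_succ hg' (fun h h' => aux h h')
    rw [show ℓ + 1 + m = ℓ + m + 1 by ring] at h1
    rw [← add_assoc] at h2
    exact h1.add h2

theorem Sym.const_mul {k ℓ : ℕ} {f : ℝ → ℂ} (c : ℂ) (hf : Sym k ℓ f) :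
    Sym k ℓ (fun t => c * f t) := by
  simpa using (Sym.const k c).mul hf

theorem Sym.neg {k ℓ : ℕ} {f : ℝ → ℂ} (hf : Sym k ℓ f) : Sym k ℓ (fun t => -f t) := by
  simpa using hf.const_mul (-1)

theorem Sym.sub {k ℓ : ℕ} {f g : ℝ → ℂ} (hf : Sym k ℓ f) (hg : Sym k ℓ g) :
    Sym k ℓ (fun t => f t - g t) := by
  simpa [sub_eq_add_neg] using hf.add hg.neg

theorem Sym.sum {ι : Type*} {k ℓ : ℕ} (s : Finset ι) {f : ι → ℝ → ℂ}
    (hf : ∀ i ∈ s, Sym k ℓ (f i)) : Sym k ℓ (fun t => ∑ i ∈ s, f i t) := by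
  classical
  induction s using Finset.induction_on with
  | empty => simpa using Sym.zero k ℓ
  | insert a s ha ih =>
    simp only [Finset.sum_insert ha]
    exact (hf a (Finset.mem_insert_self a s)).add
      (ih fun i hi => hf i (Finset.mem_insert_of_mem hi))

theorem Sym.prod {ι : Type*} {k : ℕ} (s : Finset ι) {f : ι → ℝ → ℂ}
    (hf : ∀ i ∈ s, Sym k 0 (f i)) : Sym k 0 (fun t => ∏ i ∈ s, f i t) := by
  classical
  induction s using Finset.induction_on with
  | empty => simpa using Sym.const k 1
  | insert a s ha ih =>
    simp only [Finset.prod_insert ha]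
    exact (hf a (Finset.mem_insert_self a s)).mul
      (ih fun i hi => hf i (Finset.mem_insert_of_mem hi))

theorem Sym.pow {k : ℕ} {f : ℝ → ℂ} (hf : Sym k 0 f) (j : ℕ) : Sym k 0 (fun t => f t ^ j) := by
  induction j with
  | zero => simpa using Sym.const k 1
  | succ j ih => simpa [pow_succ] using ih.mul hf

/-- The derivative `-f' (f⁻¹)²` involves `f⁻¹` with one derivative fewer, so the claim follows by
induction on the number of derivatives. -/
theorem Sym.inv {k : ℕ} {f : ℝ → ℂ} (hf : Sym k 0 f) {c : ℝ} (hc : 0 < c)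
    (h : ∀ t, 0 ≤ t → c ≤ ‖f t‖) : Sym k 0 (fun t => (f t)⁻¹) := by
  have hne : ∀ t, 0 ≤ t → f t ≠ 0 := fun t ht => norm_pos_iff.1 (hc.trans_le (h t ht))
  have hb : ∃ C : ℝ, ∀ t : ℝ, 0 ≤ t → ‖(f t)⁻¹‖ ≤ C * (1 / (1 + t)) ^ 0 := by
    refine ⟨c⁻¹, fun t ht => ?_⟩
    rw [norm_inv, pow_zero, mul_one]
    exact inv_anti₀ hc (h t ht)
  induction k with
  | zero => exact ⟨hf.1.inv₀ hne, hb⟩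
  | succ k ih =>
    obtain ⟨_, g, hg, hd⟩ := id hf
    refine ⟨hb, _, ?_, fun t ht => (hd t ht).fun_inv (hne t ht)⟩
    have h1 := (hg.neg).mul ((ih hf.of_succ).pow 2)
    refine h1.congr fun t _ => ?_
    rw [div_eq_mul_inv, inv_pow]

theorem Sym.conj {k ℓ : ℕ} {f : ℝ → ℂ} (hf : Sym k ℓ f) :
    Sym k ℓ (fun t => (starRingEnd ℂ) (f t)) := by
  induction k generalizing ℓ f with
  | zero =>
    obtain ⟨h, C, hC⟩ := hf
    exact ⟨continuous_conj.comp_continuousOn h, C, by simpa using hC⟩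
  | succ k ih =>
    obtain ⟨⟨C, hC⟩, g, hg, hd⟩ := hf
    refine ⟨⟨C, by simpa using hC⟩, _, ih hg, fun t ht => ?_⟩
    exact (conjCLE.toContinuousLinearMap.hasFDerivAt.comp_hasDerivWithinAt t (hd t ht))

/-- This is the bootstrapping step: a function that solves a differential equation gains one
derivative from the right-hand side. It is used for the eigenvalues and for the diagonaliser. -/
theorem Sym.of_deriv {k ℓ : ℕ} {f g : ℝ → ℂ} (hf : Sym 0 ℓ f) (hg : Sym k (ℓ + 1) g)
    (h : ∀ t, 0 ≤ t → HasDerivWithinAt f (g t) (Ici 0) t) : Sym (k + 1) ℓ f :=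
  ⟨hf.2, g, hg, h⟩

theorem SymbolClass.derivWithin {ℓ : ℕ} {f : ℝ → ℂ} (h : SymbolClass ℓ f) :
    SymbolClass (ℓ + 1) (derivWithin f (Ici 0)) := by
  refine ⟨((contDiffOn_infty_iff_derivWithin (uniqueDiffOn_Ici 0)).1 h.1).2, fun k => ?_⟩
  obtain ⟨C, hC⟩ := h.2 (k + 1)
  refine ⟨C, fun t ht => ?_⟩
  have := hC t ht
  rw [iteratedDerivWithin_succ'] at this
  rwa [show ℓ + 1 + k = ℓ + (k + 1) by ring]

theorem SymbolClass.hasDerivWithinAt {ℓ : ℕ} {f : ℝ → ℂ} (h : SymbolClass ℓ f) {t : ℝ}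
    (ht : 0 ≤ t) : HasDerivWithinAt f (_root_.derivWithin f (Ici 0) t) (Ici 0) t :=
  ((h.1.differentiableOn (by simp)) t ht).hasDerivWithinAt

theorem SymbolClass.sym {ℓ : ℕ} {f : ℝ → ℂ} (h : SymbolClass ℓ f) (k : ℕ) : Sym k ℓ f := by
  induction k generalizing ℓ f with
  | zero =>
    obtain ⟨C, hC⟩ := h.2 0
    exact ⟨h.1.continuousOn, C, by simpa using hC⟩
  | succ k ih =>
    obtain ⟨C, hC⟩ := h.2 0
    exact ⟨⟨C, by simpa using hC⟩, _, ih h.derivWithin, fun t ht => h.hasDerivWithinAt ht⟩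

theorem Sym.contDiffOn {k ℓ : ℕ} {f : ℝ → ℂ} (h : Sym k ℓ f) :
    ContDiffOn ℝ k f (Ici 0) ∧
      ∃ C : ℝ, ∀ t : ℝ, 0 ≤ t → ‖iteratedDerivWithin k f (Ici 0) t‖ ≤ C * (1 / (1 + t)) ^ (ℓ + k)
    := by
  induction k generalizing ℓ f with
  | zero =>
    obtain ⟨hc, C, hC⟩ := h
    exact ⟨by simpa using hc, C, by simpa using hC⟩
  | succ k ih =>
    obtain ⟨_, g, hg, hd⟩ := h
    obtain ⟨hg1, C, hC⟩ := ih hg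
    have heq : EqOn (_root_.derivWithin f (Ici 0)) g (Ici 0) := fun t ht =>
      (hd t ht).derivWithin (uniqueDiffOn_Ici 0 t ht)
    refine ⟨?_, C, fun t ht => ?_⟩
    · rw [show ((k + 1 : ℕ) : WithTop ℕ∞) = (k : WithTop ℕ∞) + 1 by norm_cast,
        contDiffOn_succ_iff_derivWithin (uniqueDiffOn_Ici 0)]
      exact ⟨fun t ht => (hd t ht).differentiableWithinAt, by simp, hg1.congr heq⟩
    · rw [iteratedDerivWithin_succ', iteratedDerivWithin_congr heq ht,
        show ℓ + (k + 1) = ℓ + 1 + k by ring]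
      exact hC t ht

/-- Membership can thus be checked one derivative at a time. This matters for functions known only
through a differential equation they satisfy. -/
theorem symbolClass_iff {ℓ : ℕ} {f : ℝ → ℂ} : SymbolClass ℓ f ↔ ∀ k, Sym k ℓ f :=
  ⟨fun h k => h.sym k, fun h => ⟨contDiffOn_infty.2 fun k => (h k).contDiffOn.1, fun k =>
    (h k).contDiffOn.2⟩⟩

theorem SymbolClass.bound {ℓ : ℕ} {f : ℝ → ℂ} (h : SymbolClass ℓ f) :
    ∃ C : ℝ, 0 ≤ C ∧ ∀ t : ℝ, 0 ≤ t → ‖f t‖ ≤ C * (1 / (1 + t)) ^ ℓ := (h.sym 0).bound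

theorem SymbolClass.sub {ℓ : ℕ} {f g : ℝ → ℂ} (hf : SymbolClass ℓ f) (hg : SymbolClass ℓ g) :
    SymbolClass ℓ (fun t => f t - g t) := symbolClass_iff.2 fun k => (hf.sym k).sub (hg.sym k)

theorem SymbolClass.mul {ℓ m : ℕ} {f g : ℝ → ℂ} (hf : SymbolClass ℓ f) (hg : SymbolClass m g) :
    SymbolClass (ℓ + m) (fun t => f t * g t) :=
  symbolClass_iff.2 fun k => (hf.sym k).mul (hg.sym k)

theorem SymbolClass.const (c : ℂ) : SymbolClass 0 (fun _ => c) :=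
  symbolClass_iff.2 fun k => Sym.const k c

theorem SymbolClass.zero (ℓ : ℕ) : SymbolClass ℓ (fun _ => 0) :=
  symbolClass_iff.2 fun k => Sym.zero k ℓ

theorem SymbolClass.const_mul {ℓ : ℕ} {f : ℝ → ℂ} (c : ℂ) (hf : SymbolClass ℓ f) :
    SymbolClass ℓ (fun t => c * f t) := symbolClass_iff.2 fun k => (hf.sym k).const_mul c

theorem SymbolClass.sum {ι : Type*} {ℓ : ℕ} (s : Finset ι) {f : ι → ℝ → ℂ}
    (hf : ∀ i ∈ s, SymbolClass ℓ (f i)) : SymbolClass ℓ (fun t => ∑ i ∈ s, f i t) :=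
  symbolClass_iff.2 fun k => Sym.sum s fun i hi => (hf i hi).sym k

theorem SymbolClass.inv {f : ℝ → ℂ} (hf : SymbolClass 0 f) {c : ℝ} (hc : 0 < c)
    (h : ∀ t, 0 ≤ t → c ≤ ‖f t‖) : SymbolClass 0 (fun t => (f t)⁻¹) :=
  symbolClass_iff.2 fun k => (hf.sym k).inv hc h

/-- Polynomial symbols of order at least `m`: sums of terms `a(t) ξ^κ` with `a ∈ 𝒯{l - |κ|}`,
`l ≥ m`. -/
inductive PolySym {n : ℕ} : ℕ → (ℝ → Space n → ℂ) → Prop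
  | coeff {m : ℕ} {a : ℝ → ℂ} : SymbolClass m a → PolySym m (fun t _ => a t)
  | mulCoord {m : ℕ} {f : ℝ → Space n → ℂ} (k : Fin n) :
      PolySym m f → PolySym (m + 1) (fun t ξ => (ξ k : ℂ) * f t ξ)
  | add {m : ℕ} {f g : ℝ → Space n → ℂ} :
      PolySym m f → PolySym m g → PolySym m (fun t ξ => f t ξ + g t ξ)
  | weaken {m : ℕ} {f : ℝ → Space n → ℂ} : PolySym (m + 1) f → PolySym m f
  | congr {m : ℕ} {f g : ℝ → Space n → ℂ} :
      PolySym m f → (∀ t, 0 ≤ t → ∀ ξ, g t ξ = f t ξ) → PolySym m g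

variable {n : ℕ}

theorem PolySym.coeff_mul {m l : ℕ} {a : ℝ → ℂ} {f : ℝ → Space n → ℂ} (hf : PolySym m f)
    (ha : SymbolClass l a) : PolySym (l + m) (fun t ξ => a t * f t ξ) := by
  induction hf with
  | weaken _ ih => exact ih.weaken
  | coeff hb => exact .coeff (ha.mul hb)
  | mulCoord k _ ih => exact (ih.mulCoord k).congr fun t _ ξ => by ring
  | add _ _ ih1 ih2 => exact (ih1.add ih2).congr fun t _ ξ => by ring
  | congr _ h ih => exact ih.congr fun t ht ξ => by rw [h t ht]

theorem PolySym.mul {m l : ℕ} {f g : ℝ → Space n → ℂ} (hf : PolySym m f) (hg : PolySym l g) :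
    PolySym (m + l) (fun t ξ => f t ξ * g t ξ) := by
  induction hf with
  | @weaken m f _ ih =>
    rw [show m + 1 + l = m + l + 1 by ring] at ih
    exact ih.weaken
  | coeff ha => exact hg.coeff_mul ha
  | @mulCoord m f k _ ih =>
    have := (ih.mulCoord k).congr (g := fun t ξ => (ξ k : ℂ) * f t ξ * g t ξ)
      fun t _ ξ => by ring
    rwa [show m + 1 + l = m + l + 1 by ring]
  | add _ _ ih1 ih2 => exact (ih1.add ih2).congr fun t _ ξ => by ring
  | congr _ h ih => exact ih.congr fun t ht ξ => by rw [h t ht]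

theorem PolySym.const_mul {m : ℕ} {f : ℝ → Space n → ℂ} (hf : PolySym m f) (c : ℂ) :
    PolySym m (fun t ξ => c * f t ξ) := by
  simpa using hf.coeff_mul (SymbolClass.const c)

theorem PolySym.neg {m : ℕ} {f : ℝ → Space n → ℂ} (hf : PolySym m f) :
    PolySym m (fun t ξ => -f t ξ) := by
  simpa using hf.const_mul (-1)

theorem PolySym.sub {m : ℕ} {f g : ℝ → Space n → ℂ} (hf : PolySym m f) (hg : PolySym m g) :
    PolySym m (fun t ξ => f t ξ - g t ξ) := by
  simpa [sub_eq_add_neg] using hf.add hg.neg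

theorem PolySym.zero (m : ℕ) : PolySym m (fun _ (_ : Space n) => 0) :=
  .coeff (SymbolClass.zero m)

theorem PolySym.sum {ι : Type*} {m : ℕ} (s : Finset ι) {f : ι → ℝ → Space n → ℂ}
    (hf : ∀ i ∈ s, PolySym m (f i)) : PolySym m (fun t ξ => ∑ i ∈ s, f i t ξ) := by
  classical
  induction s using Finset.induction_on with
  | empty => simpa using PolySym.zero m
  | insert a s ha ih =>
    simp only [Finset.sum_insert ha]
    exact (hf a (Finset.mem_insert_self a s)).add
      (ih fun i hi => hf i (Finset.mem_insert_of_mem hi))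

/-- Differentiation in `t` acts on the coefficients only and gains a factor `(1+t)⁻¹` there; this is
why `D_t` raises the order by one in the hierarchy. -/
theorem PolySym.exists_deriv {m : ℕ} {f : ℝ → Space n → ℂ} (hf : PolySym m f) :
    ∃ g, PolySym (m + 1) g ∧
      ∀ t, 0 ≤ t → ∀ ξ, HasDerivWithinAt (fun τ => f τ ξ) (g t ξ) (Ici 0) t := by
  induction hf with
  | weaken _ ih =>
    obtain ⟨g, hg, h⟩ := ih
    exact ⟨g, hg.weaken, h⟩
  | coeff ha => exact ⟨_, .coeff ha.derivWithin, fun t ht ξ => ha.hasDerivWithinAt ht⟩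
  | mulCoord k _ ih =>
    obtain ⟨g, hg, h⟩ := ih
    exact ⟨_, hg.mulCoord k, fun t ht ξ => (h t ht ξ).const_mul _⟩
  | add _ _ ih1 ih2 =>
    obtain ⟨g, hg, h⟩ := ih1
    obtain ⟨g', hg', h'⟩ := ih2
    exact ⟨_, hg.add hg', fun t ht ξ => (h t ht ξ).add (h' t ht ξ)⟩
  | congr _ h ih =>
    obtain ⟨g, hg, h'⟩ := ih
    exact ⟨g, hg, fun t ht ξ => (h' t ht ξ).congr (fun s hs => h s hs ξ) (h t ht ξ)⟩

theorem norm_coord_le (ξ : Space n) (k : Fin n) : ‖(ξ k : ℂ)‖ ≤ ‖ξ‖ := by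
  rw [Complex.norm_real]
  exact PiLp.norm_apply_le ξ k

/-- Each factor `ξ k` and each power of `(1+t)⁻¹` is bounded by `(1+t)⁻¹ + ‖ξ‖`. For `‖ξ‖ ≤ 1` this
quantity is at most `2`, so weakening the order costs a factor `2`; this is the only use of the
restriction on `ξ`. -/
theorem PolySym.bound {m : ℕ} {f : ℝ → Space n → ℂ} (hf : PolySym m f) :
    ∃ C : ℝ, 0 ≤ C ∧ ∀ t, 0 ≤ t → ∀ ξ, ‖ξ‖ ≤ 1 →
      ‖f t ξ‖ ≤ C * (1 / (1 + t) + ‖ξ‖) ^ m := by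
  induction hf with
  | @weaken m f _ ih =>
    obtain ⟨C, h0, hC⟩ := ih
    refine ⟨C * 2, by positivity, fun t ht ξ hξ => (hC t ht ξ hξ).trans ?_⟩
    have h1 : (0 : ℝ) < 1 / (1 + t) := by positivity
    have h2 : 1 / (1 + t) ≤ 1 := by rw [div_le_one (by positivity)]; linarith
    rw [pow_succ, mul_assoc, mul_comm 2]
    exact mul_le_mul_of_nonneg_left (mul_le_mul_of_nonneg_left (by linarith) (by positivity)) h0
  | coeff ha =>
    obtain ⟨C, h0, hC⟩ := ha.bound
    refine ⟨C, h0, fun t ht ξ _ => (hC t ht).trans ?_⟩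
    have : (0 : ℝ) < 1 + t := by linarith
    gcongr
    exact le_add_of_nonneg_right (norm_nonneg _)
  | mulCoord k _ ih =>
    obtain ⟨C, h0, hC⟩ := ih
    refine ⟨C, h0, fun t ht ξ hξ => ?_⟩
    have : (0 : ℝ) < 1 / (1 + t) := by positivity
    rw [norm_mul, pow_succ, mul_comm, ← mul_assoc]
    have h1 : ‖(ξ k : ℂ)‖ ≤ 1 / (1 + t) + ‖ξ‖ := by linarith [norm_coord_le ξ k]
    exact mul_le_mul (hC t ht ξ hξ) h1 (norm_nonneg _) (by positivity)
  | add _ _ ih1 ih2 =>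
    obtain ⟨C, h0, hC⟩ := ih1
    obtain ⟨D, h0', hD⟩ := ih2
    refine ⟨C + D, by positivity, fun t ht ξ hξ => (norm_add_le _ _).trans ?_⟩
    rw [add_mul]
    exact add_le_add (hC t ht ξ hξ) (hD t ht ξ hξ)
  | congr _ h ih =>
    obtain ⟨C, h0, hC⟩ := ih
    exact ⟨C, h0, fun t ht ξ hξ => h t ht ξ ▸ hC t ht ξ hξ⟩

/-- A polynomial minus its constant term carries a factor `ξ k`, which replaces one power of
`(1+t)⁻¹ + ‖ξ‖`. For `m = 0` the truncated exponent is `0`, and the bound is then just `C ‖ξ‖`. -/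
theorem PolySym.bound_sub {m : ℕ} {f : ℝ → Space n → ℂ} (hf : PolySym m f) :
    ∃ C : ℝ, 0 ≤ C ∧ ∀ t, 0 ≤ t → ∀ ξ, ‖ξ‖ ≤ 1 →
      ‖f t ξ - f t 0‖ ≤ C * ‖ξ‖ * (1 / (1 + t) + ‖ξ‖) ^ (m - 1) := by
  induction hf with
  | @weaken m f _ ih =>
    obtain ⟨C, h0, hC⟩ := ih
    refine ⟨C * 2, by positivity, fun t ht ξ hξ => (hC t ht ξ hξ).trans ?_⟩
    have h1 : (0 : ℝ) < 1 / (1 + t) := by positivity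
    have h2 : 1 / (1 + t) ≤ 1 := by rw [div_le_one (by positivity)]; linarith
    cases m with
    | zero =>
      simp only [zero_add, tsub_self, zero_tsub, pow_zero, mul_one]
      nlinarith [mul_nonneg h0 (norm_nonneg ξ)]
    | succ m =>
      simp only [Nat.add_sub_cancel]
      have h3 : C * 2 * ‖ξ‖ * (1 / (1 + t) + ‖ξ‖) ^ m =
        C * ‖ξ‖ * ((1 / (1 + t) + ‖ξ‖) ^ m * 2) := by ring
      rw [pow_succ, h3]
      exact mul_le_mul_of_nonneg_left (mul_le_mul_of_nonneg_left (by linarith) (by positivity))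
        (by positivity)
  | coeff ha => exact ⟨0, le_rfl, fun t ht ξ _ => by simp⟩
  | mulCoord k hf _ =>
    obtain ⟨C, h0, hC⟩ := hf.bound
    refine ⟨C, h0, fun t ht ξ hξ => ?_⟩
    simp only [PiLp.zero_apply, ofReal_zero, zero_mul, sub_zero, Nat.add_sub_cancel]
    rw [norm_mul, mul_comm C, mul_assoc]
    exact mul_le_mul (norm_coord_le ξ k) (hC t ht ξ hξ) (norm_nonneg _) (norm_nonneg _)
  | add _ _ ih1 ih2 =>
    obtain ⟨C, h0, hC⟩ := ih1
    obtain ⟨D, h0', hD⟩ := ih2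
    refine ⟨C + D, by positivity, fun t ht ξ hξ => ?_⟩
    rw [add_sub_add_comm, add_mul, add_mul]
    exact (norm_add_le _ _).trans (add_le_add (hC t ht ξ hξ) (hD t ht ξ hξ))
  | congr _ h ih =>
    obtain ⟨C, h0, hC⟩ := ih
    exact ⟨C, h0, fun t ht ξ hξ => by rw [h t ht, h t ht]; exact hC t ht ξ hξ⟩

theorem PolySym.continuous {m : ℕ} {f : ℝ → Space n → ℂ} (hf : PolySym m f) {t : ℝ}
    (ht : 0 ≤ t) : Continuous (f t) := by
  induction hf with
  | weaken _ ih => exact ih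
  | coeff ha => exact continuous_const
  | mulCoord k _ ih => exact (by fun_prop : Continuous fun ξ : Space n => (ξ k : ℂ)).mul ih
  | add _ _ ih1 ih2 => exact ih1.add ih2
  | congr _ h ih => rwa [show _ = _ from funext (h t ht)]

theorem PolySym.continuousOn {m : ℕ} {f : ℝ → Space n → ℂ} (hf : PolySym m f) (ξ : Space n) :
    ContinuousOn (fun t => f t ξ) (Ici 0) := by
  obtain ⟨g, -, hg⟩ := hf.exists_deriv
  exact fun t ht => (hg t ht ξ).continuousWithinAt

end Symbols

/-! ### Regularity of the eigenvalues and spectral projections of `B` -/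

section Spectral

variable {d : ℕ}

theorem Sym.det {k : ℕ} {X : ℝ → Mat d} (hX : ∀ i j, Sym k 0 (fun t => X t i j)) :
    Sym k 0 (fun t => (X t).det) := by
  simp only [Matrix.det_apply, Units.smul_def, zsmul_eq_mul]
  exact Sym.sum _ fun σ _ => (Sym.prod _ fun i _ => hX _ _).const_mul _

theorem Sym.adjugate {k : ℕ} {X : ℝ → Mat d} (hX : ∀ i j, Sym k 0 (fun t => X t i j))
    (i j : Fin d) : Sym k 0 (fun t => (X t).adjugate i j) := by
  simp only [Matrix.adjugate_apply]
  refine Sym.det fun a b => ?_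
  by_cases h : a = j
  · subst h
    simpa using Sym.const k _
  · simpa [Matrix.updateRow_ne h] using hX a b

theorem Sym.matMul {k ℓ m : ℕ} {X Y : ℝ → Mat d} (hX : ∀ i j, Sym k ℓ (fun t => X t i j))
    (hY : ∀ i j, Sym k m (fun t => Y t i j)) (i j : Fin d) :
    Sym k (ℓ + m) (fun t => (X t * Y t) i j) := by
  simp only [Matrix.mul_apply]
  exact Sym.sum _ fun a _ => (hX i a).mul (hY a j)

theorem MatSymbolClass.mul {ℓ m : ℕ} {X Y : ℝ → Mat d} (hX : MatSymbolClass ℓ X)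
    (hY : MatSymbolClass m Y) : MatSymbolClass (ℓ + m) (fun t => X t * Y t) := fun i j =>
  symbolClass_iff.2 fun k => Sym.matMul (fun i j => (hX i j).sym k) (fun i j => (hY i j).sym k) i j

/-- The spectral projection of `X` for the eigenvalue `μ i`, if `μ` lists the eigenvalues. -/
def eigProj (μ : Fin d → ℂ) (X : Mat d) (i : Fin d) : Mat d :=
  (∏ j ∈ Finset.univ.erase i, (μ i - μ j))⁻¹ • (Matrix.diagonal (fun _ => μ i) - X).adjugate

section Algebra

variable {μ : Fin d → ℂ} {X V : Mat d}

theorem diagonal_sub_conj (hV : IsUnit V) (h : X * V = V * Matrix.diagonal μ) (x : ℂ) :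
    Matrix.diagonal (fun _ => x) - X = V * Matrix.diagonal (fun j => x - μ j) * V⁻¹ := by
  have hdet := (Matrix.isUnit_iff_isUnit_det _).1 hV
  have h1 : X = V * Matrix.diagonal μ * V⁻¹ := by
    rw [← h, Matrix.mul_assoc, Matrix.mul_nonsing_inv _ hdet, mul_one]
  have h2 : (Matrix.diagonal fun _ : Fin d => x) = V * Matrix.diagonal (fun _ => x) * V⁻¹ := by
    rw [← Matrix.smul_one_eq_diagonal, Matrix.mul_smul, mul_one, Matrix.smul_mul,
      Matrix.mul_nonsing_inv _ hdet]
  conv_lhs => rw [h1, h2, ← Matrix.sub_mul, ← Matrix.mul_sub, Matrix.diagonal_sub]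

theorem det_diagonal_sub (hV : IsUnit V) (h : X * V = V * Matrix.diagonal μ) (x : ℂ) :
    (Matrix.diagonal (fun _ => x) - X).det = ∏ j, (x - μ j) := by
  rw [diagonal_sub_conj hV h, Matrix.det_conj hV, Matrix.det_diagonal]

/-- Conjugation commutes with the adjugate, and the adjugate of `diag(μ i - μ j)` has a single
non-zero entry, at `i`, which the normalising product cancels. The adjugate form needs no choice of
eigenvectors, so the regularity of the projection in `t` can be read off from that of `B` and of the
eigenvalues. -/
theorem eigProj_eq (hV : IsUnit V) (h : X * V = V * Matrix.diagonal μ) (hμ : Function.Injective μ)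
    (i : Fin d) : eigProj μ X i = V * Matrix.diagonal (Pi.single i 1) * V⁻¹ := by
  have hdet := (Matrix.isUnit_iff_isUnit_det _).1 hV
  have hadj : ∀ D : Mat d, (V * D * V⁻¹).adjugate = V * D.adjugate * V⁻¹ := by
    intro D
    have h1 : V.adjugate = V.det • V⁻¹ := by
      rw [Matrix.inv_def, smul_smul, Ring.mul_inverse_cancel _ hdet, one_smul]
    have h2 : (V⁻¹).adjugate = V⁻¹.det • V := by
      have h3 : V⁻¹.det • (V⁻¹)⁻¹ = (V⁻¹).adjugate := by
        rw [Matrix.inv_def V⁻¹, smul_smul,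
          Ring.mul_inverse_cancel _ (Matrix.isUnit_nonsing_inv_det _ hdet), one_smul]
      rw [← h3, Matrix.nonsing_inv_nonsing_inv _ hdet]
    rw [Matrix.adjugate_mul_distrib, Matrix.adjugate_mul_distrib, h1, h2]
    simp only [Matrix.smul_mul, Matrix.mul_smul, smul_smul, ← Matrix.det_mul,
      Matrix.mul_nonsing_inv _ hdet, Matrix.det_one, one_smul,
      Matrix.mul_assoc]
  rw [eigProj, diagonal_sub_conj hV h, hadj, Matrix.adjugate_diagonal, ← Matrix.smul_mul,
    ← Matrix.mul_smul, ← Matrix.diagonal_smul]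
  congr 3
  ext j
  by_cases hj : j = i
  · subst hj
    simp only [Pi.smul_apply, Pi.single_eq_same, smul_eq_mul]
    refine inv_mul_cancel₀ (Finset.prod_ne_zero_iff.2 fun a ha => sub_ne_zero.2 ?_)
    exact fun hh => (Finset.mem_erase.1 ha).1 (hμ hh).symm
  · simp only [Pi.smul_apply, Pi.single_eq_of_ne hj, smul_eq_mul]
    rw [Finset.prod_eq_zero (Finset.mem_erase.2 ⟨fun h => hj h.symm, Finset.mem_univ i⟩)
      (sub_self _), mul_zero]

theorem conj_mul_conj (hV : IsUnit V) (D D' : Mat d) :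
    V * D * V⁻¹ * (V * D' * V⁻¹) = V * (D * D') * V⁻¹ := by
  have hdet := (Matrix.isUnit_iff_isUnit_det _).1 hV
  calc V * D * V⁻¹ * (V * D' * V⁻¹) = V * D * (V⁻¹ * V) * D' * V⁻¹ := by noncomm_ring
    _ = _ := by rw [Matrix.nonsing_inv_mul _ hdet]; noncomm_ring

theorem eigProj_mul_self (hV : IsUnit V) (h : X * V = V * Matrix.diagonal μ)
    (hμ : Function.Injective μ) (i : Fin d) :
    eigProj μ X i * eigProj μ X i = eigProj μ X i := by
  rw [eigProj_eq hV h hμ, conj_mul_conj hV, Matrix.diagonal_mul_diagonal]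
  congr 3
  ext j
  by_cases hj : j = i <;> simp [hj]

theorem eigProj_mul_of_ne (hV : IsUnit V) (h : X * V = V * Matrix.diagonal μ)
    (hμ : Function.Injective μ) {i j : Fin d} (hij : i ≠ j) :
    eigProj μ X i * eigProj μ X j = 0 := by
  rw [eigProj_eq hV h hμ, eigProj_eq hV h hμ, conj_mul_conj hV, Matrix.diagonal_mul_diagonal]
  have : (fun a => (Pi.single i 1 : Fin d → ℂ) a * (Pi.single j 1 : Fin d → ℂ) a) = 0 := by
    ext a
    by_cases ha : a = i
    · subst ha; simp [hij]
    · simp [ha]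
  rw [this]
  simp

theorem sum_eigProj (hV : IsUnit V) (h : X * V = V * Matrix.diagonal μ) (hμ : Function.Injective μ) :
    ∑ i, eigProj μ X i = 1 := by
  have hdet := (Matrix.isUnit_iff_isUnit_det _).1 hV
  simp only [eigProj_eq hV h hμ]
  rw [← Finset.sum_mul, ← Finset.mul_sum]
  have : ∑ i : Fin d, (Matrix.diagonal (Pi.single i 1) : Mat d) = 1 := by
    ext a b
    rw [Matrix.sum_apply]
    by_cases hab : a = b
    · subst hab; simp [Pi.single_apply]
    · simp [hab]
  rw [this, mul_one, Matrix.mul_nonsing_inv _ hdet]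

theorem eq_conj (hV : IsUnit V) (h : X * V = V * Matrix.diagonal μ) : X = V * Matrix.diagonal μ * V⁻¹ := by
  rw [← h, Matrix.mul_assoc, Matrix.mul_nonsing_inv _ ((Matrix.isUnit_iff_isUnit_det _).1 hV),
    mul_one]

theorem mul_eigProj (hV : IsUnit V) (h : X * V = V * Matrix.diagonal μ) (hμ : Function.Injective μ)
    (i : Fin d) : X * eigProj μ X i = μ i • eigProj μ X i := by
  rw [eigProj_eq hV h hμ]
  conv_lhs => rw [eq_conj hV h]
  rw [conj_mul_conj hV, Matrix.diagonal_mul_diagonal, ← Matrix.smul_mul, ← Matrix.mul_smul,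
    ← Matrix.diagonal_smul]
  congr 3
  ext j
  by_cases hj : j = i <;> simp [hj]

theorem eigProj_mul (hV : IsUnit V) (h : X * V = V * Matrix.diagonal μ) (hμ : Function.Injective μ)
    (i : Fin d) : eigProj μ X i * X = μ i • eigProj μ X i := by
  rw [eigProj_eq hV h hμ]
  conv_lhs => rw [eq_conj hV h]
  rw [conj_mul_conj hV, Matrix.diagonal_mul_diagonal, ← Matrix.smul_mul, ← Matrix.mul_smul,
    ← Matrix.diagonal_smul]
  congr 3
  ext j
  by_cases hj : j = i <;> simp [hj]

theorem trace_eigProj (hV : IsUnit V) (h : X * V = V * Matrix.diagonal μ) (hμ : Function.Injective μ)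
    (i : Fin d) : (eigProj μ X i).trace = 1 := by
  rw [eigProj_eq hV h hμ, Matrix.trace_conj hV]
  simp [Matrix.trace_diagonal]

theorem eigProj_conjTranspose {μ : Fin d → ℝ} (hX : X.IsHermitian) (i : Fin d) :
    (eigProj (fun j => (μ j : ℂ)) X i)ᴴ = eigProj (fun j => (μ j : ℂ)) X i := by
  rw [eigProj, Matrix.conjTranspose_smul, Matrix.adjugate_conjTranspose,
    Matrix.conjTranspose_sub, hX.eq]
  congr 2
  · simp
  · rw [Matrix.diagonal_conjTranspose]
    congr 2
    ext j
    simp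

/-- Eigenvectors of a Hermitian matrix with distinct eigenvalues are orthogonal. -/
theorem conjTranspose_mul_self_eq_diagonal {μ : Fin d → ℝ} (hX : X.IsHermitian)
    (h : X * V = V * Matrix.diagonal (fun i => (μ i : ℂ))) (hμ : Function.Injective μ) :
    Vᴴ * V = Matrix.diagonal fun i => (Vᴴ * V) i i := by
  ext i j
  by_cases hij : i = j
  · subst hij; simp
  rw [Matrix.diagonal_apply_ne _ hij]
  have h1 : Vᴴ * X * V = Vᴴ * V * Matrix.diagonal (fun i => (μ i : ℂ)) := by
    rw [Matrix.mul_assoc, h, Matrix.mul_assoc]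
  have h2 : Vᴴ * X * V = Matrix.diagonal (fun i => (μ i : ℂ)) * (Vᴴ * V) := by
    have := congrArg Matrix.conjTranspose h1
    rw [Matrix.conjTranspose_mul, Matrix.conjTranspose_mul, hX.eq, Matrix.conjTranspose_mul,
      Matrix.conjTranspose_mul, Matrix.conjTranspose_conjTranspose,
      Matrix.diagonal_conjTranspose] at this
    rw [Matrix.mul_assoc, this]
    congr 2
    ext j
    simp
  have h3 := congrFun (congrFun (h1.symm.trans h2) i) j
  rw [Matrix.mul_diagonal, Matrix.diagonal_mul] at h3
  have h4 : (Vᴴ * V) i j * ((μ j : ℂ) - μ i) = 0 := by linear_combination h3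
  refine (mul_eq_zero.1 h4).resolve_right (sub_ne_zero.2 fun hh => hij ?_)
  exact (hμ (by exact_mod_cast hh)).symm

theorem conjTranspose_mul_self_diag (V : Mat d) (i : Fin d) :
    (Vᴴ * V) i i = ((∑ j, ‖V j i‖ ^ 2 : ℝ) : ℂ) := by
  rw [Matrix.mul_apply]
  push_cast
  refine Finset.sum_congr rfl fun j _ => ?_
  rw [Matrix.conjTranspose_apply, ← Complex.conj_mul']
  rfl

theorem sum_norm_sq_col_pos (hV : IsUnit V) (i : Fin d) : 0 < ∑ j, ‖V j i‖ ^ 2 := by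
  have hdet := (Matrix.isUnit_iff_isUnit_det _).1 hV
  by_contra hcon
  have h0 : ∑ j, ‖V j i‖ ^ 2 = 0 :=
    le_antisymm (not_lt.1 hcon) (Finset.sum_nonneg fun j _ => by positivity)
  have h1 : ∀ j, V j i = 0 := fun j => by
    simpa using (Finset.sum_eq_zero_iff_of_nonneg (fun j _ => by positivity)).1 h0 j
      (Finset.mem_univ j)
  rw [Matrix.det_eq_zero_of_column_eq_zero i h1] at hdet
  simp at hdet

end Algebra

variable [NeZero d] {B : ℝ → Mat d} {δ : Fin d → ℝ → ℝ}

theorem CondB2.injective (h : CondB2 B δ) {t : ℝ} (ht : 0 ≤ t) :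
    Function.Injective fun i => (δ i t : ℂ) := fun _ _ hij =>
  (h.1 t ht).2.1.injective (Complex.ofReal_injective hij)

theorem CondB2.exists_eigenbasis (h : CondB2 B δ) {t : ℝ} (ht : 0 ≤ t) :
    ∃ V : Mat d, IsUnit V ∧ B t * V = V * Matrix.diagonal fun i => (δ i t : ℂ) := by
  have hv := fun i => ((h.1 t ht).2.2 i).exists_hasEigenvector
  choose v hv using hv
  have hli := Module.End.eigenvectors_linearIndependent' _ _ (h.injective ht) v hv
  refine ⟨(Matrix.of v)ᵀ, Matrix.linearIndependent_cols_iff_isUnit.1 hli, ?_⟩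
  ext i j
  have := congrFun (hv j).apply_eq_smul i
  rw [Matrix.mul_diagonal]
  simpa [Matrix.toLin'_apply, Matrix.mul_apply, Matrix.mulVec, dotProduct, mul_comm] using this

theorem CondB2.nonneg (h : CondB2 B δ) {t : ℝ} (ht : 0 ≤ t) (i : Fin d) : 0 ≤ δ i t := by
  rw [← (h.1 t ht).1]
  exact (h.1 t ht).2.1.monotone (Fin.zero_le _)

/-- The eigenvalues are non-negative, so each is at most the trace of `B`, which is bounded. -/
theorem CondB2.bounded (hB : MatSymbolClass 0 B) (h : CondB2 B δ) :
    ∃ C : ℝ, 0 ≤ C ∧ ∀ t, 0 ≤ t → ∀ i, δ i t ≤ C := by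
  have htr : SymbolClass 0 (fun t => ∑ i, B t i i) := SymbolClass.sum _ fun i _ => hB i i
  obtain ⟨C, hC0, hC⟩ := htr.bound
  refine ⟨C, hC0, fun t ht i => ?_⟩
  obtain ⟨V, hV, hBV⟩ := h.exists_eigenbasis ht
  have h1 : (∑ i, B t i i : ℂ) = ((∑ i, δ i t : ℝ) : ℂ) := by
    have : (B t).trace = ∑ i, (δ i t : ℂ) := by
      rw [eq_conj hV hBV, Matrix.trace_conj hV, Matrix.trace_diagonal]
    rw [Matrix.trace] at this
    push_cast
    exact this
  have h2 := hC t ht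
  rw [h1, Complex.norm_real, pow_zero, mul_one] at h2
  calc δ i t ≤ ∑ i, δ i t :=
        Finset.single_le_sum (f := fun i => δ i t) (fun j _ => h.nonneg ht j) (Finset.mem_univ i)
    _ ≤ C := (le_abs_self _).trans h2

/-- If no eigenvalue of `B t` lay within `η` of `δ j t₀`, then `|det(δ j t₀ - B t)| ≥ η ^ d`, which
contradicts the continuity of the determinant near `t₀`. With gaps of at least `2η` at `t₀`, the
matching of eigenvalues is strictly increasing, and therefore trivial. -/
theorem CondB2.continuousOn (hB : MatSymbolClass 0 B) (h : CondB2 B δ) (i : Fin d) :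
    ContinuousOn (δ i) (Ici 0) := by
  intro t₀ ht₀
  have ht₀' : (0 : ℝ) ≤ t₀ := ht₀
  rw [ContinuousWithinAt, Metric.tendsto_nhds]
  intro ε hε
  obtain ⟨η, hη, hηε, hgap⟩ : ∃ η : ℝ, 0 < η ∧ η ≤ ε ∧
      ∀ j j' : Fin d, j < j' → δ j t₀ + 2 * η ≤ δ j' t₀ := by
    have hfin : ∀ p : Fin d × Fin d, ∀ᶠ η in 𝓝[>] (0 : ℝ),
        p.1 < p.2 → δ p.1 t₀ + 2 * η ≤ δ p.2 t₀ := by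
      intro p
      by_cases hp : p.1 < p.2
      · have hlt : δ p.1 t₀ < δ p.2 t₀ := (h.1 t₀ ht₀').2.1 hp
        filter_upwards [Ioo_mem_nhdsGT (show (0 : ℝ) < (δ p.2 t₀ - δ p.1 t₀) / 2 by linarith)]
          with η hη _
        linarith [hη.2]
      · exact Eventually.of_forall fun η hh => absurd hh hp
    obtain ⟨η, h1, h2⟩ := ((eventually_all.2 hfin).and (Ioo_mem_nhdsGT hε)).exists
    exact ⟨η, h2.1, h2.2.le, fun j j' hjj => h1 (j, j') hjj⟩
  have hev : ∀ j : Fin d, ∀ᶠ t in 𝓝[Ici 0] t₀, ∃ i : Fin d, |δ j t₀ - δ i t| < η := by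
    intro j
    have hsym : Sym 0 0 (fun t => (Matrix.diagonal (fun _ => (δ j t₀ : ℂ)) - B t).det) := by
      refine Sym.det fun a b => ?_
      simp only [Matrix.sub_apply]
      exact (Sym.const 0 _).sub ((hB a b).sym 0)
    have hc := hsym.continuousOn t₀ ht₀
    have h0 : (Matrix.diagonal (fun _ => (δ j t₀ : ℂ)) - B t₀).det = 0 := by
      obtain ⟨V, hV, hBV⟩ := h.exists_eigenbasis ht₀'
      rw [det_diagonal_sub hV hBV]
      exact Finset.prod_eq_zero (Finset.mem_univ j) (sub_self _)
    rw [ContinuousWithinAt, h0] at hc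
    have h2 := (Metric.tendsto_nhds.1 hc) (η ^ d) (by positivity)
    filter_upwards [h2, self_mem_nhdsWithin] with t h3 h4
    by_contra hcon
    push Not at hcon
    obtain ⟨V, hV, hBV⟩ := h.exists_eigenbasis h4
    rw [det_diagonal_sub hV hBV, dist_zero_right, norm_prod] at h3
    refine absurd h3 (not_lt.2 ?_)
    calc η ^ d = ∏ _i : Fin d, η := by simp
      _ ≤ _ := Finset.prod_le_prod (fun _ _ => hη.le) fun i _ => by
        rw [← Complex.ofReal_sub, Complex.norm_real]
        exact hcon i
  filter_upwards [eventually_all.2 hev, self_mem_nhdsWithin] with t h1 h2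
  choose σ hσ using h1
  -- A strictly increasing self-map of `Fin d` is the identity, so the eigenvalue found near `δ j
  -- t₀` carries the same index.
  have hmono : StrictMono σ := by
    intro j j' hjj
    have h3 := abs_lt.1 (hσ j)
    have h4 := abs_lt.1 (hσ j')
    have h5 := hgap j j' hjj
    refine (h.1 t h2).2.1.lt_iff_lt.1 ?_
    show δ (σ j) t < δ (σ j') t
    linarith
  have hid : σ = id :=
    (StrictMono.range_inj hmono strictMono_id).1 (by
      rw [(Finite.injective_iff_surjective.1 hmono.injective).range_eq, range_id])
  have := hσ i
  rw [hid, abs_sub_comm] at this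
  exact this.trans_le hηε

/-- The liminf condition handles large times. On the remaining compact interval the gaps are
continuous and positive, hence bounded below. -/
theorem CondB2.separated (hB : MatSymbolClass 0 B) (h : CondB2 B δ) :
    ∃ σ : ℝ, 0 < σ ∧ ∀ t, 0 ≤ t → ∀ i j, i ≠ j → σ ≤ |δ i t - δ j t| := by
  have key : ∀ p : Fin d × Fin d, ∃ σ : ℝ, 0 < σ ∧ ∀ t, 0 ≤ t → p.1 ≠ p.2 →
      σ ≤ |δ p.1 t - δ p.2 t| := by
    rintro ⟨i, j⟩
    by_cases hij : i = j
    · exact ⟨1, one_pos, fun t _ hh => absurd hij hh⟩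
    have hl := h.2 i j hij
    obtain ⟨T, hT⟩ := eventually_atTop.1 (eventually_lt_of_lt_liminf (half_lt_self hl)
      (isBoundedUnder_of ⟨0, fun t => abs_nonneg _⟩))
    have hc : ContinuousOn (fun t => |δ i t - δ j t|) (Icc 0 (max T 0)) :=
      (((h.continuousOn hB i).sub (h.continuousOn hB j)).abs).mono Icc_subset_Ici_self
    obtain ⟨s, hs, hmin⟩ := isCompact_Icc.exists_isMinOn
      (nonempty_Icc.2 (le_max_right T 0)) hc
    refine ⟨min (liminf (fun t => |δ i t - δ j t|) atTop / 2) |δ i s - δ j s|,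
      lt_min (half_pos hl) (abs_pos.2 (sub_ne_zero.2
        fun hh => hij ((h.1 s hs.1).2.1.injective hh))), fun t ht _ => ?_⟩
    rcases le_total t (max T 0) with h1 | h1
    · exact (min_le_right _ _).trans (hmin ⟨ht, h1⟩)
    · exact (min_le_left _ _).trans (hT t ((le_max_left _ _).trans h1)).le
  choose σ hσ using key
  obtain ⟨p₀, hp₀⟩ := Finite.exists_min σ
  exact ⟨σ p₀, (hσ p₀).1, fun t ht i j hij => (hp₀ (i, j)).trans ((hσ (i, j)).2 t ht hij)⟩

/-- The projections have exactly as many controlled derivatives as the eigenvalues are already known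
to have, since their entries are polynomial in `B` and `δ` divided by products of uniformly
bounded-below gaps. This drives the induction in `CondB2.symbolClass`. -/
theorem CondB2.sym_eigProj {k : ℕ} (hB : MatSymbolClass 0 B) (h : CondB2 B δ)
    (hδ : ∀ i, Sym k 0 (fun t => (δ i t : ℂ))) (i a b : Fin d) :
    Sym k 0 (fun t => eigProj (fun j => (δ j t : ℂ)) (B t) i a b) := by
  obtain ⟨σ, hσ, hsep⟩ := h.separated hB
  simp only [eigProj, Matrix.smul_apply, smul_eq_mul]
  refine Sym.mul (ℓ := 0) (m := 0) (Sym.inv (c := σ ^ (Finset.univ.erase i).card)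
    (Sym.prod _ fun j _ => (hδ i).sub (hδ j)) (by positivity) ?_) ?_
  · intro t ht
    rw [norm_prod, ← Finset.prod_const]
    refine Finset.prod_le_prod (fun _ _ => hσ.le) fun j hj => ?_
    rw [← Complex.ofReal_sub, Complex.norm_real]
    exact hsep t ht i j (Finset.ne_of_mem_erase hj).symm
  · refine Sym.adjugate (fun c e => ?_) a b
    simp only [Matrix.sub_apply]
    refine Sym.sub ?_ ((hB c e).sym k)
    by_cases hce : c = e
    · subst hce; simpa using hδ i
    · simpa [Matrix.diagonal_apply_ne _ hce] using Sym.zero k 0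

/-- A product rule that asks only for continuity of the second factor, because the first vanishes at
the point. It breaks a circularity: the projections are only known to be continuous when the
eigenvalues are differentiated. -/
theorem hasDerivWithinAt_mul_of_eq_zero {u v : ℝ → ℂ} {u' : ℂ} {s : Set ℝ} {x : ℝ}
    (hu : HasDerivWithinAt u u' s x) (h0 : u x = 0) (hv : ContinuousWithinAt v s x) :
    HasDerivWithinAt (fun t => u t * v t) (u' * v x) s x := by
  rw [hasDerivWithinAt_iff_tendsto_slope] at hu ⊢
  refine (hu.mul (hv.mono_left (nhdsWithin_mono _ sdiff_subset))).congr fun t => ?_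
  simp only [slope_def_module, h0, zero_mul, sub_zero]
  rw [smul_mul_assoc]

/-- First-order perturbation theory through the exact identity `(δᵢ(t) - δᵢ(t₀)) tr(P(t₀)P(t)) =
tr((B(t) - B(t₀)) P(t)P(t₀))`, which follows by letting each `B` act on its own eigenprojection. The
trace on the left is `1` at `t₀`, hence non-zero nearby. -/
theorem CondB2.hasDerivWithinAt (hB : MatSymbolClass 0 B) (h : CondB2 B δ) (i : Fin d) {t₀ : ℝ}
    (ht₀ : 0 ≤ t₀) : HasDerivWithinAt (fun t => (δ i t : ℂ))
      (∑ a, ∑ b, derivWithin (fun τ => B τ a b) (Ici 0) t₀ *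
        eigProj (fun j => (δ j t₀ : ℂ)) (B t₀) i b a) (Ici 0) t₀ := by
  set P : ℝ → Mat d := fun t => eigProj (fun j => (δ j t : ℂ)) (B t) i with hP
  have hδc : ∀ i, Sym 0 0 (fun t => (δ i t : ℂ)) := by
    obtain ⟨C, _, hC⟩ := h.bounded hB
    intro i
    refine ⟨continuous_ofReal.comp_continuousOn (h.continuousOn hB i), C, fun t ht => ?_⟩
    rw [Complex.norm_real, pow_zero, mul_one, Real.norm_eq_abs, abs_of_nonneg (h.nonneg ht i)]
    exact hC t ht i
  have hPc : ∀ a b, ContinuousWithinAt (fun t => P t a b) (Ici 0) t₀ := fun a b =>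
    (h.sym_eigProj hB hδc i a b).continuousOn t₀ ht₀
  have hden : ContinuousWithinAt (fun t => (P t₀ * P t).trace) (Ici 0) t₀ := by
    simp only [Matrix.trace, Matrix.diag, Matrix.mul_apply]
    exact tendsto_finsetSum _ fun a _ => tendsto_finsetSum _ fun b _ =>
      (tendsto_const_nhds).mul (hPc b a)
  obtain ⟨V, hV, hBV⟩ := h.exists_eigenbasis ht₀
  have hinj := h.injective ht₀
  have hPP : P t₀ * P t₀ = P t₀ := eigProj_mul_self hV hBV hinj i
  have hden1 : (P t₀ * P t₀).trace = 1 := by rw [hPP]; exact trace_eigProj hV hBV hinj i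
  have hne : ∀ᶠ t in 𝓝[Ici 0] t₀, (P t₀ * P t).trace ≠ 0 :=
    hden.eventually_ne (by simp [hden1])
  have hmain : HasDerivWithinAt (fun t => ∑ a, ∑ b, (B t a b - B t₀ a b) *
      ((P t * P t₀) b a * ((P t₀ * P t).trace)⁻¹))
      (∑ a, ∑ b, derivWithin (fun τ => B τ a b) (Ici 0) t₀ *
        ((P t₀ * P t₀) b a * ((P t₀ * P t₀).trace)⁻¹)) (Ici 0) t₀ := by
    refine HasDerivWithinAt.fun_sum fun a _ => HasDerivWithinAt.fun_sum fun b _ => ?_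
    refine hasDerivWithinAt_mul_of_eq_zero (((hB a b).hasDerivWithinAt ht₀).sub_const _)
      (sub_self _) ?_
    refine ContinuousWithinAt.mul ?_ (hden.inv₀ (by simp [hden1]))
    simp only [Matrix.mul_apply]
    exact tendsto_finsetSum _ fun c _ => (hPc b c).mul tendsto_const_nhds
  rw [hden1, hPP] at hmain
  simp only [inv_one, mul_one] at hmain
  have heq : ∀ t, 0 ≤ t → (P t₀ * P t).trace ≠ 0 →
      (δ i t : ℂ) = ∑ a, ∑ b, (B t a b - B t₀ a b) *
        ((P t * P t₀) b a * ((P t₀ * P t).trace)⁻¹) + (δ i t₀ : ℂ) := by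
    intro t ht hne
    obtain ⟨V', hV', hBV'⟩ := h.exists_eigenbasis ht
    have h1 : B t * P t = (δ i t : ℂ) • P t := mul_eigProj hV' hBV' (h.injective ht) i
    have h2 : P t₀ * B t₀ = (δ i t₀ : ℂ) • P t₀ := eigProj_mul hV hBV hinj i
    have h3 : ∑ a, ∑ b, (B t a b - B t₀ a b) * ((P t * P t₀) b a * ((P t₀ * P t).trace)⁻¹) =
        ((B t - B t₀) * (P t * P t₀)).trace * ((P t₀ * P t).trace)⁻¹ := by
      simp only [Matrix.trace, Matrix.diag]
      rw [Finset.sum_mul]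
      refine Finset.sum_congr rfl fun a _ => ?_
      rw [Matrix.mul_apply, Finset.sum_mul]
      exact Finset.sum_congr rfl fun b _ => by rw [Matrix.sub_apply]; ring
    have h4 : ((B t - B t₀) * (P t * P t₀)).trace =
        ((δ i t : ℂ) - δ i t₀) * (P t₀ * P t).trace := by
      rw [← Matrix.mul_assoc, Matrix.trace_mul_comm, Matrix.sub_mul, Matrix.mul_sub, h1,
        ← Matrix.mul_assoc, h2, Matrix.mul_smul, Matrix.smul_mul, ← sub_smul,
        Matrix.trace_smul, smul_eq_mul]
    rw [h3, h4, mul_assoc, mul_inv_cancel₀ hne]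
    ring
  refine (hmain.add_const (δ i t₀ : ℂ)).congr_of_eventuallyEq ?_
    (heq t₀ ht₀ (by rw [hden1]; exact one_ne_zero))
  filter_upwards [hne, self_mem_nhdsWithin] with t h1 h2
  exact heq t h2 h1

/-- Bootstrapping on `δᵢ' = tr(B' Pᵢ)`: the factor `B'` is of order one, and `Pᵢ` is as regular as
`δ`. -/
theorem CondB2.symbolClass (hB : MatSymbolClass 0 B) (h : CondB2 B δ) (i : Fin d) :
    SymbolClass 0 (fun t => (δ i t : ℂ)) := by
  have key : ∀ k i, Sym k 0 (fun t => (δ i t : ℂ)) := by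
    intro k
    have h0 : ∀ i, Sym 0 0 (fun t => (δ i t : ℂ)) := by
      obtain ⟨C, _, hC⟩ := h.bounded hB
      intro i
      refine ⟨continuous_ofReal.comp_continuousOn (h.continuousOn hB i), C, fun t ht => ?_⟩
      rw [Complex.norm_real, pow_zero, mul_one, Real.norm_eq_abs, abs_of_nonneg (h.nonneg ht i)]
      exact hC t ht i
    induction k with
    | zero => exact h0
    | succ k ih =>
      intro i
      refine Sym.of_deriv (h0 i) ?_ fun t ht => h.hasDerivWithinAt hB i ht
      exact Sym.sum _ fun a _ => Sym.sum _ fun b _ =>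
        ((hB a b).derivWithin.sym k).mul (h.sym_eigProj hB ih i b a)
  exact symbolClass_iff.2 fun k => key k i

end Spectral

/-! ### Existence of a diagonaliser by Kato's parallel transport -/

section Kato
open scoped Matrix.Norms.L2Operator

variable {d : ℕ}

theorem hasDerivWithinAt_conjTranspose {X : ℝ → Mat d} {X' : Mat d} {s : Set ℝ} {t : ℝ}
    (h : HasDerivWithinAt X X' s t) : HasDerivWithinAt (fun τ => (X τ)ᴴ) X'ᴴ s t := by
  refine hasDerivWithinAt_matrix.2 fun i j => ?_
  exact conjCLE.toContinuousLinearMap.hasFDerivAt.comp_hasDerivWithinAt t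
    (hasDerivWithinAt_matrix.1 h j i)

theorem MatSymbolClass.hasDerivWithinAt {ℓ : ℕ} {X : ℝ → Mat d} (hX : MatSymbolClass ℓ X) {t : ℝ}
    (ht : 0 ≤ t) : HasDerivWithinAt X
      (Matrix.of fun i j => derivWithin (fun τ => X τ i j) (Ici 0) t) (Ici 0) t :=
  hasDerivWithinAt_matrix.2 fun i j => (hX i j).hasDerivWithinAt ht

theorem MatSymbolClass.continuousOn {ℓ : ℕ} {X : ℝ → Mat d} (hX : MatSymbolClass ℓ X) :
    ContinuousOn X (Ici 0) := fun _ ht => (hX.hasDerivWithinAt ht).continuousWithinAt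

theorem eq_of_hasDerivWithinAt_zero {X : ℝ → Mat d}
    (h : ∀ t, 0 ≤ t → HasDerivWithinAt X 0 (Ici 0) t) : ∀ t, 0 ≤ t → X t = X 0 := by
  refine linear_solution_unique (G := fun _ => 0) (Ψ := fun _ => X 0) continuousOn_const rfl
    (fun t ht => by simpa using h t ht) fun t _ => by
      simpa using hasDerivWithinAt_const t (Ici (0 : ℝ)) (X 0)

/-- A Hermitian matrix with distinct eigenvalues has a unitary eigenbasis. -/
theorem exists_unitary_eigenbasis {X V : Mat d} {μ : Fin d → ℝ} (hX : X.IsHermitian)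
    (hV : IsUnit V) (h : X * V = V * Matrix.diagonal (fun i => (μ i : ℂ)))
    (hμ : Function.Injective μ) :
    ∃ U : Mat d, Uᴴ * U = 1 ∧ X * U = U * Matrix.diagonal (fun i => (μ i : ℂ)) := by
  set g : Fin d → ℝ := fun i => ∑ j, ‖V j i‖ ^ 2 with hg
  have hg0 : ∀ i, 0 < g i := sum_norm_sq_col_pos hV
  have hVV : Vᴴ * V = Matrix.diagonal fun i => (g i : ℂ) := by
    rw [conjTranspose_mul_self_eq_diagonal hX h hμ]
    congr 1
    ext i
    exact conjTranspose_mul_self_diag V i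
  refine ⟨V * Matrix.diagonal fun i => (((Real.sqrt (g i))⁻¹ : ℝ) : ℂ), ?_, ?_⟩
  · rw [Matrix.conjTranspose_mul, Matrix.diagonal_conjTranspose, Matrix.mul_assoc,
      ← Matrix.mul_assoc Vᴴ, hVV, Matrix.diagonal_mul_diagonal, Matrix.diagonal_mul_diagonal,
      ← Matrix.diagonal_one]
    congr 1
    ext i
    have h1 := Real.mul_self_sqrt (hg0 i).le
    have h2 := (Real.sqrt_pos.2 (hg0 i)).ne'
    simp only [Pi.star_apply, RCLike.star_def, Complex.conj_ofReal]
    norm_cast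
    field_simp
    nlinarith
  · rw [← Matrix.mul_assoc, h, Matrix.mul_assoc, Matrix.diagonal_mul_diagonal, Matrix.mul_assoc,
      Matrix.diagonal_mul_diagonal]
    simp only [mul_comm]

theorem norm_entry_le_one {U : Mat d} (hU : Uᴴ * U = 1) (i j : Fin d) : ‖U i j‖ ≤ 1 :=
  entry_norm_bound_of_unitary (Matrix.mem_unitaryGroup_iff'.2 hU) i j

/-- The generator of Kato's parallel transport is commutator-compatible with the projections. -/
theorem kato_commutator {P P' : Fin d → Mat d} (hne : ∀ i j, i ≠ j → P i * P j = 0)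
    (hself : ∀ i, P i * P i = P i) (hsum : ∑ i, P i = 1)
    (hd : ∀ k i, P' k * P i + P k * P' i = if k = i then P' i else 0) (i : Fin d) :
    (∑ k, P' k * P k) * P i = P' i + P i * ∑ k, P' k * P k := by
  have h1 : (∑ k, P' k * P k) * P i = P' i * P i := by
    rw [Finset.sum_mul, Finset.sum_eq_single i]
    · rw [mul_assoc, hself]
    · intro k _ hk
      rw [mul_assoc, hne k i hk, mul_zero]
    · simp
  have h2 : P i * ∑ k, P' k * P k = ∑ k, ((if i = k then P' k else 0) * P k - P' i * P k) := by
    rw [Finset.mul_sum]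
    refine Finset.sum_congr rfl fun k _ => ?_
    rw [← hd i k, add_mul, mul_assoc (P' i), hself, mul_assoc]
    abel
  rw [h1, h2, Finset.sum_sub_distrib, ← Finset.mul_sum, hsum, Finset.sum_eq_single i]
  · simp
  · intro k _ hk
    simp [Ne.symm hk]
  · simp

variable [NeZero d] {B : ℝ → Mat d} {δ : Fin d → ℝ → ℝ}

/-- Eigenvectors are transported rather than chosen anew at each time: `M` solves `M' = H M` with `H
= ∑ Pᵢ' Pᵢ`, starting from a unitary eigenbasis at `t = 0`. The flow intertwines the projections and
is unitary, so the columns stay normalised eigenvectors and `M⁻¹ = Mᴴ`. -/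
theorem exists_isDiagonaliser (hB : MatSymbolClass 0 B) (hH : ∀ t, 0 ≤ t → (B t).IsHermitian)
    (h : CondB2 B δ) : ∃ M : ℝ → Mat d, IsDiagonaliser B δ M := by
  set P : Fin d → ℝ → Mat d := fun i t => eigProj (fun j => (δ j t : ℂ)) (B t) i with hP
  have hPs : ∀ i, MatSymbolClass 0 (P i) := fun i a b => symbolClass_iff.2 fun k =>
    h.sym_eigProj hB (fun i => (h.symbolClass hB i).sym k) i a b
  set P' : Fin d → ℝ → Mat d := fun i t =>
    Matrix.of fun a b => derivWithin (fun τ => P i τ a b) (Ici 0) t with hP'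
  have hPd : ∀ i t, 0 ≤ t → HasDerivWithinAt (P i) (P' i t) (Ici 0) t := fun i t ht =>
    (hPs i).hasDerivWithinAt ht
  have hP's : ∀ i, MatSymbolClass 1 (P' i) := fun i a b => (hPs i a b).derivWithin
  have hun : ∀ t, 0 ≤ t → UniqueDiffWithinAt ℝ (Ici (0 : ℝ)) t := fun t ht =>
    uniqueDiffOn_Ici 0 t ht
  have hne : ∀ t, 0 ≤ t → ∀ i j, i ≠ j → P i t * P j t = 0 := fun t ht i j hij => by
    obtain ⟨V, hV, hBV⟩ := h.exists_eigenbasis ht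
    exact eigProj_mul_of_ne hV hBV (h.injective ht) hij
  have hself : ∀ t, 0 ≤ t → ∀ i, P i t * P i t = P i t := fun t ht i => by
    obtain ⟨V, hV, hBV⟩ := h.exists_eigenbasis ht
    exact eigProj_mul_self hV hBV (h.injective ht) i
  have hsum : ∀ t, 0 ≤ t → ∑ i, P i t = 1 := fun t ht => by
    obtain ⟨V, hV, hBV⟩ := h.exists_eigenbasis ht
    exact sum_eigProj hV hBV (h.injective ht)
  have hPH : ∀ t, 0 ≤ t → ∀ i, (P i t)ᴴ = P i t := fun t ht i =>
    eigProj_conjTranspose (hH t ht) i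
  have hd : ∀ t, 0 ≤ t → ∀ k i,
      P' k t * P i t + P k t * P' i t = if k = i then P' i t else 0 := by
    intro t ht k i
    have h1 := (hPd k t ht).mul (hPd i t ht)
    by_cases hki : k = i
    · subst hki
      rw [if_pos rfl]
      exact (hun t ht).eq_deriv _ (h1.congr (fun s hs => (hself s hs k).symm) (hself t ht k).symm)
        (hPd k t ht)
    · rw [if_neg hki]
      exact (hun t ht).eq_deriv _ (h1.congr (fun s hs => (hne s hs k i hki).symm)
        (hne t ht k i hki).symm) (hasDerivWithinAt_const t _ (0 : Mat d))
  have hP'H : ∀ t, 0 ≤ t → ∀ i, (P' i t)ᴴ = P' i t := fun t ht i =>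
    (hun t ht).eq_deriv _ ((hasDerivWithinAt_conjTranspose (hPd i t ht)).congr (fun s hs => (hPH s hs i).symm)
      (hPH t ht i).symm) (hPd i t ht)
  -- Differentiating `Pᵢ² = Pᵢ` and `∑ Pᵢ = 1` shows that this generator is skew-Hermitian, which
  -- makes the transport unitary.
  set H : ℝ → Mat d := fun t => ∑ i, P' i t * P i t with hHdef
  have hHs : MatSymbolClass 1 H := fun a b => by
    simp only [hHdef, Matrix.sum_apply]
    exact SymbolClass.sum _ fun i _ => (hP's i).mul (hPs i) a b
  have hskew : ∀ t, 0 ≤ t → (H t)ᴴ + H t = 0 := by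
    intro t ht
    have h1 : HasDerivWithinAt (fun τ => ∑ i, P i τ) (∑ i, P' i t) (Ici 0) t :=
      HasDerivWithinAt.fun_sum fun i _ => hPd i t ht
    have h2 : ∑ i, P' i t = 0 := (hun t ht).eq_deriv _ (h1.congr (fun s hs => (hsum s hs).symm)
      (hsum t ht).symm) (hasDerivWithinAt_const t _ (1 : Mat d))
    rw [hHdef, Matrix.conjTranspose_sum, ← Finset.sum_add_distrib, ← h2]
    refine Finset.sum_congr rfl fun i _ => ?_
    rw [Matrix.conjTranspose_mul, hPH t ht, hP'H t ht, add_comm, hd t ht, if_pos rfl]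
  obtain ⟨V₀, hV₀, hBV₀⟩ := h.exists_eigenbasis le_rfl
  obtain ⟨U, hU, hBU⟩ := exists_unitary_eigenbasis (hH 0 le_rfl) hV₀ hBV₀
    (h.1 0 le_rfl).2.1.injective
  obtain ⟨M, hM0, hM⟩ := exists_isFundamentalSolution hHs.continuousOn U
  have hunit : ∀ t, 0 ≤ t → (M t)ᴴ * M t = 1 := by
    intro t ht
    rw [eq_of_hasDerivWithinAt_zero (X := fun t => (M t)ᴴ * M t) (fun s hs => ?_) t ht, hM0, hU]
    have := (hasDerivWithinAt_conjTranspose (hM s hs)).mul (hM s hs)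
    have h0 : (H s * M s)ᴴ * M s + (M s)ᴴ * (H s * M s) = 0 := by
      rw [Matrix.conjTranspose_mul, Matrix.mul_assoc, ← Matrix.mul_add, ← Matrix.add_mul,
        hskew s hs, Matrix.zero_mul, Matrix.mul_zero]
    rw [h0] at this
    exact this
  have hUu : IsUnit U := by
    rw [Matrix.isUnit_iff_isUnit_det]
    exact Matrix.isUnit_det_of_left_inverse hU
  have hUi : U⁻¹ * U = 1 := Matrix.nonsing_inv_mul _ ((Matrix.isUnit_iff_isUnit_det _).1 hUu)
  -- The identity says that column `i` of `M` lies in the range of `Pᵢ`. By `kato_commutator` both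
  -- sides solve the same linear equation with the same data.
  have hMP : ∀ t, 0 ≤ t → ∑ i, P i t * M t * Matrix.diagonal (Pi.single i 1) = M t := by
    refine linear_solution_unique hHs.continuousOn ?_ (fun t ht => ?_) hM
    · simp only [hM0]
      have : ∀ i, P i 0 * U = U * Matrix.diagonal (Pi.single i 1) := fun i => by
        rw [hP]
        simp only
        rw [eigProj_eq hUu hBU (h.injective le_rfl), Matrix.mul_assoc, hUi, mul_one]
      simp only [this, Matrix.mul_assoc, Matrix.diagonal_mul_diagonal]
      rw [← Finset.mul_sum]
      conv_rhs => rw [← mul_one U]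
      congr 1
      ext a b
      rw [Matrix.sum_apply]
      by_cases hab : a = b
      · subst hab; simp [Pi.single_apply]
      · simp [hab]
    · have h1 : HasDerivWithinAt
          (fun τ => ∑ i, P i τ * M τ * Matrix.diagonal (Pi.single i 1))
          (∑ i, (P' i t * M t + P i t * (H t * M t)) * Matrix.diagonal (Pi.single i 1))
          (Ici 0) t :=
        HasDerivWithinAt.fun_sum fun i _ =>
          ((hPd i t ht).mul (hM t ht)).mul_const (Matrix.diagonal (Pi.single i 1))
      convert h1 using 1
      rw [Finset.mul_sum]
      refine Finset.sum_congr rfl fun i _ => ?_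
      have := kato_commutator (hne t ht) (hself t ht) (hsum t ht) (hd t ht) i
      rw [← Matrix.mul_assoc, ← Matrix.mul_assoc, ← Matrix.mul_assoc, ← Matrix.add_mul]
      congr 2
  have hBM : ∀ t, 0 ≤ t → B t * M t = M t * Matrix.diagonal fun i => (δ i t : ℂ) := by
    intro t ht
    obtain ⟨V, hV, hBV⟩ := h.exists_eigenbasis ht
    conv_lhs => rw [← hMP t ht]
    conv_rhs => rw [← hMP t ht]
    rw [Finset.mul_sum, Finset.sum_mul]
    refine Finset.sum_congr rfl fun i _ => ?_
    rw [← Matrix.mul_assoc, ← Matrix.mul_assoc]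
    have : B t * P i t = (δ i t : ℂ) • P i t := mul_eigProj hV hBV (h.injective ht) i
    rw [this, Matrix.mul_assoc (P i t * M t), Matrix.diagonal_mul_diagonal,
      Matrix.smul_mul, Matrix.smul_mul, ← Matrix.mul_smul, ← Matrix.diagonal_smul]
    congr 2
    ext j
    by_cases hj : j = i <;> simp [hj]
  -- Entries of a unitary matrix are bounded by `1`; all further derivatives come from `M' = H M`,
  -- where `H` has order one.
  have hMs : MatSymbolClass 0 M := by
    intro a b
    refine symbolClass_iff.2 fun k => ?_
    induction k generalizing a b with
    | zero =>
      refine ⟨fun t ht => (hasDerivWithinAt_matrix.1 (hM t ht) a b).continuousWithinAt, 1,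
        fun t ht => ?_⟩
      simpa using norm_entry_le_one (hunit t ht) a b
    | succ k ih =>
      refine Sym.of_deriv ?_ (?_ : Sym k (0 + 1) fun t => (H t * M t) a b)
        fun t ht => hasDerivWithinAt_matrix.1 (hM t ht) a b
      · refine ⟨fun t ht => (hasDerivWithinAt_matrix.1 (hM t ht) a b).continuousWithinAt, 1,
          fun t ht => ?_⟩
        simpa using norm_entry_le_one (hunit t ht) a b
      · exact Sym.matMul (ℓ := 1) (m := 0) (fun i j => (hHs i j).sym k) ih a b
  have hinv : ∀ t, 0 ≤ t → (M t)⁻¹ = (M t)ᴴ := fun t ht =>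
    Matrix.inv_eq_left_inv (hunit t ht)
  refine ⟨M, hMs, fun a b => symbolClass_iff.2 fun k => ?_, fun t ht => ⟨?_, ?_⟩⟩
  · exact ((hMs b a).sym k).conj.congr fun t ht =>
      congrFun (congrFun (hinv t ht) a) b
  · rw [Matrix.isUnit_iff_isUnit_det]
    exact Matrix.isUnit_det_of_left_inverse (hunit t ht)
  · rw [hinv t ht, Matrix.mul_assoc, hBM t ht, ← Matrix.mul_assoc, hunit t ht, one_mul]

end Kato

/-! ### The diagonalisation hierarchy and its orders -/

section Hierarchy

variable {n d : ℕ}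

/-- Matrix valued polynomial symbols. -/
def PolyMat (m : ℕ) (X : ℝ → Space n → Mat d) : Prop :=
  ∀ i j, PolySym m (fun t ξ => X t ξ i j)

theorem PolyMat.mul {m l : ℕ} {X Y : ℝ → Space n → Mat d} (hX : PolyMat m X)
    (hY : PolyMat l Y) : PolyMat (m + l) (fun t ξ => X t ξ * Y t ξ) := fun i j => by
  simp only [Matrix.mul_apply]
  exact PolySym.sum _ fun a _ => (hX i a).mul (hY a j)

theorem PolyMat.add {m : ℕ} {X Y : ℝ → Space n → Mat d} (hX : PolyMat m X)
    (hY : PolyMat m Y) : PolyMat m (fun t ξ => X t ξ + Y t ξ) := fun i j => (hX i j).add (hY i j)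

theorem PolyMat.sub {m : ℕ} {X Y : ℝ → Space n → Mat d} (hX : PolyMat m X)
    (hY : PolyMat m Y) : PolyMat m (fun t ξ => X t ξ - Y t ξ) := fun i j => (hX i j).sub (hY i j)

theorem PolyMat.neg {m : ℕ} {X : ℝ → Space n → Mat d} (hX : PolyMat m X) :
    PolyMat m (fun t ξ => -X t ξ) := fun i j => (hX i j).neg

theorem PolyMat.weaken {m : ℕ} {X : ℝ → Space n → Mat d} (hX : PolyMat (m + 1) X) :
    PolyMat m X := fun i j => (hX i j).weaken

theorem PolyMat.weaken_to {m l : ℕ} {X : ℝ → Space n → Mat d} (hX : PolyMat m X) (h : l ≤ m) :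
    PolyMat l X := by
  induction m, h using Nat.le_induction with
  | base => exact hX
  | succ m _ ih => exact ih hX.weaken

theorem PolyMat.congr {m : ℕ} {X Y : ℝ → Space n → Mat d} (hX : PolyMat m X)
    (h : ∀ t, 0 ≤ t → ∀ ξ, Y t ξ = X t ξ) : PolyMat m Y := fun i j =>
  (hX i j).congr fun t ht ξ => by rw [h t ht ξ]

theorem PolyMat.diagonal_diag {m : ℕ} {X : ℝ → Space n → Mat d} (hX : PolyMat m X) :
    PolyMat m (fun t ξ => Matrix.diagonal (X t ξ).diag) := fun i j => by
  by_cases hij : i = j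
  · subst hij; simpa using hX i i
  · simpa [hij] using PolySym.zero m

theorem MatSymbolClass.polyMat {m : ℕ} {X : ℝ → Mat d} (hX : MatSymbolClass m X) :
    PolyMat m (fun t (_ : Space n) => X t) := fun i j => .coeff (hX i j)

theorem PolySym.dt {m : ℕ} {f : ℝ → Space n → ℂ} (hf : PolySym m f) :
    PolySym (m + 1) (fun t ξ => -I * derivWithin (fun τ => f τ ξ) (Ici 0) t) := by
  obtain ⟨g, hg, h⟩ := hf.exists_deriv
  refine (hg.const_mul (-I)).congr fun t ht ξ => ?_
  rw [(h t ht ξ).derivWithin (uniqueDiffOn_Ici 0 t ht)]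

theorem PolyMat.dt {m : ℕ} {X : ℝ → Space n → Mat d} (hX : PolyMat m X) :
    PolyMat (m + 1) (fun t ξ => Dt (fun τ => X τ ξ) t) := fun i j => (hX i j).dt

theorem PolySym.differentiableWithinAt {m : ℕ} {f : ℝ → Space n → ℂ} (hf : PolySym m f) {t : ℝ}
    (ht : 0 ≤ t) (ξ : Space n) : DifferentiableWithinAt ℝ (fun τ => f τ ξ) (Ici 0) t := by
  obtain ⟨g, _, h⟩ := hf.exists_deriv
  exact (h t ht ξ).differentiableWithinAt

theorem symbolA_apply (A : Fin n → ℝ → Mat d) (t : ℝ) (ξ : Space n) (i j : Fin d) :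
    symbolA A t ξ i j = ∑ k, (ξ k : ℂ) * A k t i j := by
  simp [symbolA, Matrix.sum_apply]

variable {A : Fin n → ℝ → Mat d} {B : ℝ → Mat d} {δ : Fin d → ℝ → ℝ} {M : ℝ → Mat d}

theorem polyMat_R1 (hA : ∀ k, MatSymbolClass 0 (A k)) (hM : IsDiagonaliser B δ M) :
    PolyMat 1 (R1 A M) := by
  have h1 : PolyMat 1 (symbolA A) := fun i j => by
    simp only [symbolA_apply]
    exact PolySym.sum _ fun k _ => (PolySym.coeff (hA k i j)).mulCoord k
  have h2 : PolyMat 1 fun t ξ => (M t)⁻¹ * symbolA A t ξ * M t := by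
    simpa using (hM.2.1.polyMat.mul h1).mul hM.1.polyMat
  have h3 : PolyMat 1 fun t (_ : Space n) => Dt (fun τ => (M τ)⁻¹) t * M t := by
    simpa using (PolyMat.dt (n := n) hM.2.1.polyMat).mul hM.1.polyMat
  exact h2.add h3

theorem commutator_solveCommutator {t : ℝ} (hinj : Function.Injective fun i => (δ i t : ℂ))
    (X : Mat d) : calD δ t * solveCommutator δ t X - solveCommutator δ t X * calD δ t =
      X - Matrix.diagonal X.diag := by
  ext i j
  rw [calD, Matrix.sub_apply, Matrix.diagonal_mul, Matrix.mul_diagonal, Matrix.sub_apply]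
  by_cases hij : i = j
  · subst hij
    simp [solveCommutator]
  · have h1 : (δ i t : ℂ) - δ j t ≠ 0 := sub_ne_zero.2 fun h => hij (hinj h)
    rw [Matrix.diagonal_apply_ne _ hij]
    simp only [solveCommutator, Matrix.of_apply, if_neg hij]
    field_simp
    ring

/-- Dividing by the eigenvalue differences does not change the order, because these differences are
symbols of order zero bounded away from zero. -/
theorem polyMat_solveCommutator [NeZero d] (hB : MatSymbolClass 0 B) (hB2 : CondB2 B δ) {m : ℕ}
    {X : ℝ → Space n → Mat d} (hX : PolyMat m X) :
    PolyMat m (fun t ξ => solveCommutator δ t (X t ξ)) := fun i j => by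
  simp only [solveCommutator, Matrix.of_apply]
  by_cases hij : i = j
  · simpa [hij] using PolySym.zero m
  simp only [if_neg hij]
  obtain ⟨σ, hσ, hsep⟩ := hB2.separated hB
  have h1 : SymbolClass 0 fun t => (I * ((δ i t : ℂ) - δ j t))⁻¹ := by
    refine SymbolClass.inv (((hB2.symbolClass hB i).sub (hB2.symbolClass hB j)).const_mul I) hσ
      fun t ht => ?_
    rw [norm_mul, Complex.norm_I, one_mul, ← Complex.ofReal_sub, Complex.norm_real]
    exact hsep t ht i j hij
  refine (by simpa using (hX i j).coeff_mul h1 : PolySym m _).congr fun t _ ξ => ?_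
  rw [div_eq_inv_mul]
  simp

/-- The error term of the diagonalisation hierarchy. -/
def errB (A : Fin n → ℝ → Mat d) (δ : Fin d → ℝ → ℝ) (M : ℝ → Mat d) (K : ℕ) (t : ℝ)
    (ξ : Space n) : Mat d :=
  hierarchyError A δ M (hierarchy A δ M ξ K).1 (hierarchy A δ M ξ K).2 t ξ

theorem matN_zero (t : ℝ) (ξ : Space n) : matN A δ M 0 t ξ = 1 := rfl

theorem matF_zero (t : ℝ) (ξ : Space n) : matF A δ M 0 t ξ = 0 := rfl

theorem matN_succ (K : ℕ) (t : ℝ) (ξ : Space n) : matN A δ M (K + 1) t ξ =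
    matN A δ M K t ξ + solveCommutator δ t (errB A δ M K t ξ) := rfl

theorem matF_succ (K : ℕ) (t : ℝ) (ξ : Space n) : matF A δ M (K + 1) t ξ =
    matF A δ M K t ξ - Matrix.diagonal (errB A δ M K t ξ).diag := rfl

theorem errB_eq (K : ℕ) (t : ℝ) (ξ : Space n) : errB A δ M K t ξ =
    Dt (fun τ => matN A δ M K τ ξ) t -
      (calD δ t * matN A δ M K t ξ - matN A δ M K t ξ * calD δ t) -
      R1 A M t ξ * matN A δ M K t ξ + matN A δ M K t ξ * matF A δ M K t ξ := rfl

theorem errB_zero (t : ℝ) (ξ : Space n) : errB A δ M 0 t ξ = -R1 A M t ξ := by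
  have h : Dt (fun τ => matN A δ M 0 τ ξ) t = 0 := by
    ext i j
    simp [Dt, matN_zero]
  rw [errB_eq, h, matN_zero, matF_zero]
  simp

/-- The choice of the two corrections cancels the old error: the commutator with `𝒟` removes its
off-diagonal part and the change of `F` its diagonal part. Each surviving term carries an extra
small factor, namely `D_t`, `R₁`, `F` or `N - 1`. -/
theorem errB_succ [NeZero d] (hB2 : CondB2 B δ) (K : ℕ) {t : ℝ} (ht : 0 ≤ t) (ξ : Space n)
    (hN : ∀ i j, DifferentiableWithinAt ℝ (fun τ => matN A δ M K τ ξ i j) (Ici 0) t)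
    (hS : ∀ i j, DifferentiableWithinAt ℝ
      (fun τ => solveCommutator δ τ (errB A δ M K τ ξ) i j) (Ici 0) t) :
    errB A δ M (K + 1) t ξ =
      Dt (fun τ => solveCommutator δ τ (errB A δ M K τ ξ)) t -
      R1 A M t ξ * solveCommutator δ t (errB A δ M K t ξ) +
      solveCommutator δ t (errB A δ M K t ξ) * matF A δ M (K + 1) t ξ -
      (matN A δ M K t ξ - 1) * Matrix.diagonal (errB A δ M K t ξ).diag := by
  have h1 : Dt (fun τ => matN A δ M (K + 1) τ ξ) t = Dt (fun τ => matN A δ M K τ ξ) t +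
      Dt (fun τ => solveCommutator δ τ (errB A δ M K τ ξ)) t := by
    ext i j
    simp only [Dt, Matrix.of_apply, Matrix.add_apply, matN_succ]
    rw [derivWithin_fun_add (hN i j) (hS i j)]
    ring
  have h2 := commutator_solveCommutator (hB2.injective ht) (errB A δ M K t ξ)
  have h3 := errB_eq (A := A) (δ := δ) (M := M) K t ξ
  rw [errB_eq (K + 1), h1, matN_succ, matF_succ]
  set S := solveCommutator δ t (errB A δ M K t ξ)
  set N := matN A δ M K t ξ
  set D := Matrix.diagonal (errB A δ M K t ξ).diag
  have h4 : calD δ t * S = errB A δ M K t ξ - D + S * calD δ t := by rw [← h2]; abel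
  have h5 : Dt (fun τ => matN A δ M K τ ξ) t = errB A δ M K t ξ +
      (calD δ t * N - N * calD δ t) + R1 A M t ξ * N - N * matF A δ M K t ξ := by
    rw [h3]; abel
  rw [h5, Matrix.mul_add (calD δ t), h4]
  noncomm_ring

theorem polyMat_one : PolyMat 0 (fun _ (_ : Space n) => (1 : Mat d)) := fun _ _ =>
  .coeff (SymbolClass.const _)

/-- Every term of `errB_succ` is a quantity of the order of the previous error times a factor of
order one, or its time derivative, so each stage gains one order. For `K = 2` the error is of order
three, which is integrable in time at `ξ = 0`. -/
theorem polyMat_hierarchy [NeZero d] (hA : ∀ k, MatSymbolClass 0 (A k)) (hB : MatSymbolClass 0 B)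
    (hB2 : CondB2 B δ) (hM : IsDiagonaliser B δ M) (K : ℕ) :
    PolyMat 1 (fun t ξ => matN A δ M K t ξ - 1) ∧ PolyMat 1 (matF A δ M K) ∧
      PolyMat (K + 1) (errB A δ M K) := by
  induction K with
  | zero =>
    refine ⟨fun i j => by simpa [matN_zero] using PolySym.zero 1,
      fun i j => by simpa [matF_zero] using PolySym.zero 1, ?_⟩
    exact (polyMat_R1 hA hM).neg.congr fun t _ ξ => errB_zero t ξ
  | succ K ih =>
    obtain ⟨hN, hF, hE⟩ := ih
    have hS := polyMat_solveCommutator hB hB2 hE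
    have hD := hE.diagonal_diag
    have hF' : PolyMat 1 (matF A δ M (K + 1)) := hF.sub (hD.weaken_to (by omega))
    have hN0 : PolyMat 0 (matN A δ M K) :=
      (hN.weaken.add polyMat_one).congr fun t _ ξ => by simp
    refine ⟨?_, hF', ?_⟩
    · refine (hN.add (hS.weaken_to (l := 1) (by omega))).congr fun t _ ξ => ?_
      rw [matN_succ]
      abel
    · refine PolyMat.congr ?_ fun t ht ξ => errB_succ hB2 K ht ξ
        (fun i j => (hN0 i j).differentiableWithinAt ht ξ)
        (fun i j => (hS i j).differentiableWithinAt ht ξ)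
      refine ((hS.dt.sub ?_).add (hS.mul hF')).sub ?_
      · rw [add_comm]
        exact (polyMat_R1 hA hM).mul hS
      · rw [add_comm]
        exact hN.mul hD

/-- The corner entry of `F₂` in terms of `R₁`. -/
theorem cornerF_two [NeZero d] (hA : ∀ k, MatSymbolClass 0 (A k)) (hB : MatSymbolClass 0 B)
    (hB2 : CondB2 B δ) (hM : IsDiagonaliser B δ M) {t : ℝ} (ht : 0 ≤ t) (ξ : Space n) :
    cornerF A δ M 2 t ξ = R1 A M t ξ 0 0 +
      I * ∑ j, (if j = 0 then 0 else (δ j t : ℂ)⁻¹) * (R1 A M t ξ 0 j * R1 A M t ξ j 0) := by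
  obtain ⟨hN, hF, hE⟩ := polyMat_hierarchy hA hB hB2 hM 0
  have hS := polyMat_solveCommutator hB hB2 hE
  have h1 := errB_succ (A := A) (M := M) hB2 0 ht ξ
    (fun i j => differentiableWithinAt_const ((1 : Mat d) i j))
    (fun i j => (hS i j).differentiableWithinAt ht ξ)
  -- The first correction has zero diagonal and `F₁` is diagonal, so neither the time derivative nor
  -- the product with `F₁` reaches the corner entry. Only the second-order perturbation term is
  -- left.
  have h2 : Dt (fun τ => solveCommutator δ τ (errB A δ M 0 τ ξ)) t 0 0 = 0 := by
    simp [Dt, solveCommutator]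
  have h3 : (solveCommutator δ t (errB A δ M 0 t ξ) * matF A δ M 1 t ξ) 0 0 = 0 := by
    rw [matF_succ, matF_zero, zero_sub, Matrix.mul_neg, Matrix.neg_apply, Matrix.mul_diagonal]
    simp [solveCommutator]
  have h0 : errB A δ M 1 t ξ 0 0 =
      -(R1 A M t ξ * solveCommutator δ t (errB A δ M 0 t ξ)) 0 0 := by
    have := congrFun (congrFun h1 0) 0
    rw [matN_zero, sub_self, zero_mul, sub_zero, Matrix.add_apply, Matrix.sub_apply, h2, h3,
      zero_sub, add_zero] at this
    exact this
  have h4 : cornerF A δ M 2 t ξ = -errB A δ M 0 t ξ 0 0 - errB A δ M 1 t ξ 0 0 := by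
    simp [cornerF, matF_succ, matF_zero]
  rw [h4, h0, errB_zero, Matrix.mul_apply, Matrix.neg_apply, neg_neg, sub_neg_eq_add,
    Finset.mul_sum]
  congr 1
  refine Finset.sum_congr rfl fun j _ => ?_
  simp only [solveCommutator, Matrix.of_apply]
  by_cases hj : j = 0
  · simp [hj]
  · have hδ : (δ j t : ℂ) ≠ 0 := by
      have := (hB2.1 t ht).2.1.injective.ne hj
      rw [(hB2.1 t ht).1] at this
      exact_mod_cast this
    rw [if_neg hj, if_neg hj, (hB2.1 t ht).1, Matrix.neg_apply, ofReal_zero, sub_zero]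
    field_simp
    linear_combination -(R1 A M t ξ 0 j * R1 A M t ξ j 0) * I_sq

end Hierarchy

/-! ### The Kalman condition makes the effective diffusion elliptic -/

section Parabolicity
open scoped Matrix.Norms.L2Operator

variable {n d : ℕ}

/-- The action of matrices on the Euclidean space `ℂᵈ`. -/
abbrev act (X : Mat d) : EuclideanSpace ℂ (Fin d) →L[ℂ] EuclideanSpace ℂ (Fin d) :=
  Matrix.toEuclideanCLM (n := Fin d) (𝕜 := ℂ) X

theorem act_apply (X : Mat d) (v : EuclideanSpace ℂ (Fin d)) (i : Fin d) :
    act X v i = ∑ j, X i j * v j := rfl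

theorem act_mul (X Y : Mat d) (v : EuclideanSpace ℂ (Fin d)) : act (X * Y) v = act X (act Y v) := by
  rw [act, map_mul]
  rfl

theorem act_one (v : EuclideanSpace ℂ (Fin d)) : act (1 : Mat d) v = v := by
  rw [act, map_one]
  rfl

theorem act_add (X Y : Mat d) (v : EuclideanSpace ℂ (Fin d)) :
    act (X + Y) v = act X v + act Y v := by
  rw [act, map_add]
  rfl

theorem act_sub (X Y : Mat d) (v : EuclideanSpace ℂ (Fin d)) :
    act (X - Y) v = act X v - act Y v := by
  rw [act, map_sub]
  rfl

theorem act_smul (c : ℂ) (X : Mat d) (v : EuclideanSpace ℂ (Fin d)) :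
    act (c • X) v = c • act X v := by
  rw [act, map_smul]
  rfl

theorem norm_act_le (X : Mat d) (v : EuclideanSpace ℂ (Fin d)) : ‖act X v‖ ≤ ‖X‖ * ‖v‖ :=
  (act X).le_opNorm v

theorem inner_act_left (X : Mat d) (v w : EuclideanSpace ℂ (Fin d)) :
    inner ℂ (act X v) w = inner ℂ v (act Xᴴ w) := by
  have : act Xᴴ = ContinuousLinearMap.adjoint (act X) := map_star (Matrix.toEuclideanCLM) X
  rw [this, ContinuousLinearMap.adjoint_inner_right]

theorem norm_entry_le (X : Mat d) (i j : Fin d) : ‖X i j‖ ≤ ‖X‖ := by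
  have h1 := norm_act_le X (EuclideanSpace.single j 1)
  have h2 := PiLp.norm_apply_le (act X (EuclideanSpace.single j 1)) i
  rw [act_apply] at h2
  simp at h1 h2
  exact h2.trans h1

theorem norm_le_sum_entries (d : ℕ) : ∃ K : ℝ, 0 ≤ K ∧ ∀ (X : Mat d) (b : ℝ),
    (∀ i j, ‖X i j‖ ≤ b) → ‖X‖ ≤ K * b := by
  refine ⟨∑ i : Fin d, ∑ j : Fin d, ‖(Matrix.single i j (1 : ℂ) : Mat d)‖, by positivity,
    fun X b hX => ?_⟩
  conv_lhs => rw [Matrix.matrix_eq_sum_single X]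
  rw [Finset.sum_mul]
  refine (norm_sum_le _ _).trans (Finset.sum_le_sum fun i _ => ?_)
  rw [Finset.sum_mul]
  refine (norm_sum_le _ _).trans (Finset.sum_le_sum fun j _ => ?_)
  have : (Matrix.single i j (X i j) : Mat d) = X i j • Matrix.single i j (1 : ℂ) := by
    rw [Matrix.smul_single, smul_eq_mul, mul_one]
  rw [this, norm_smul, mul_comm]
  exact mul_le_mul_of_nonneg_left (hX i j) (norm_nonneg _)

theorem exists_common_bound {ι : Type*} [Finite ι] {p : ι → ℝ → Prop}
    (hmono : ∀ i a b, a ≤ b → p i a → p i b) (h : ∀ i, ∃ C, p i C) :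
    ∃ C, 0 ≤ C ∧ ∀ i, p i C := by
  choose C hC using h
  obtain ⟨K, hK⟩ := (Set.finite_range C).bddAbove
  exact ⟨max K 0, le_max_right _ _, fun i =>
    hmono i _ _ ((hK (mem_range_self i)).trans (le_max_left _ _)) (hC i)⟩

theorem MatSymbolClass.norm_bound {ℓ : ℕ} {X : ℝ → Mat d} (hX : MatSymbolClass ℓ X) :
    ∃ C : ℝ, 0 ≤ C ∧ ∀ t, 0 ≤ t → ‖X t‖ ≤ C * (1 / (1 + t)) ^ ℓ := by
  obtain ⟨C, hC0, hC⟩ := exists_common_bound (ι := Fin d × Fin d)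
    (p := fun p C => ∀ t : ℝ, 0 ≤ t → ‖X t p.1 p.2‖ ≤ C * (1 / (1 + t)) ^ ℓ)
    (fun i a b hab h t ht => (h t ht).trans (by gcongr))
    fun p => by
      obtain ⟨C, -, hC⟩ := (hX p.1 p.2).bound
      exact ⟨C, hC⟩
  obtain ⟨K, hK0, hK⟩ := norm_le_sum_entries d
  refine ⟨K * C, by positivity, fun t ht => ?_⟩
  rw [mul_assoc]
  exact hK _ _ fun i j => hC (i, j) t ht

theorem symbolA_bound {A : Fin n → ℝ → Mat d} (hA : ∀ k, MatSymbolClass 0 (A k)) :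
    ∃ C : ℝ, 0 ≤ C ∧ ∀ t, 0 ≤ t → ∀ ξ, ‖symbolA A t ξ‖ ≤ C * ‖ξ‖ := by
  obtain ⟨C, hC0, hC⟩ := exists_common_bound (ι := Fin n)
    (p := fun k C => ∀ t : ℝ, 0 ≤ t → ‖A k t‖ ≤ C)
    (fun i a b hab h t ht => (h t ht).trans hab)
    fun k => by
      obtain ⟨C, -, hC⟩ := (hA k).norm_bound
      exact ⟨C, by simpa using hC⟩
  refine ⟨n * C, by positivity, fun t ht ξ => ?_⟩
  calc ‖symbolA A t ξ‖ ≤ ∑ k, ‖(ξ k : ℂ) • A k t‖ := norm_sum_le _ _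
    _ ≤ ∑ _k : Fin n, ‖ξ‖ * C := Finset.sum_le_sum fun k _ => by
        rw [norm_smul]
        exact mul_le_mul (norm_coord_le ξ k) (hC k t ht) (norm_nonneg _) (norm_nonneg _)
    _ = n * C * ‖ξ‖ := by
        rw [Finset.sum_const, Finset.card_univ, Fintype.card_fin, nsmul_eq_mul]
        ring

theorem symbolA_isHermitian {A : Fin n → ℝ → Mat d} {B : ℝ → Mat d} (hB1 : CondB1 A B) {t : ℝ}
    (ht : 0 ≤ t) (ξ : Space n) : (symbolA A t ξ).IsHermitian := by
  rw [Matrix.IsHermitian, symbolA, Matrix.conjTranspose_sum]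
  refine Finset.sum_congr rfl fun k _ => ?_
  rw [Matrix.conjTranspose_smul, ((hB1 t ht).1 k).eq]
  simp

variable {A : Fin n → ℝ → Mat d} {B : ℝ → Mat d} {δ : Fin d → ℝ → ℝ} {M : ℝ → Mat d}

theorem IsDiagonaliser.mul_eq (hM : IsDiagonaliser B δ M) {t : ℝ} (ht : 0 ≤ t) :
    B t * M t = M t * Matrix.diagonal fun i => (δ i t : ℂ) := by
  rw [← (hM.2.2 t ht).2, Matrix.mul_assoc, ← Matrix.mul_assoc (M t), Matrix.mul_nonsing_inv,
    one_mul]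
  exact (Matrix.isUnit_iff_isUnit_det _).1 (hM.2.2 t ht).1

theorem IsDiagonaliser.mul_inv (hM : IsDiagonaliser B δ M) {t : ℝ} (ht : 0 ≤ t) :
    M t * (M t)⁻¹ = 1 :=
  Matrix.mul_nonsing_inv _ ((Matrix.isUnit_iff_isUnit_det _).1 (hM.2.2 t ht).1)

theorem IsDiagonaliser.inv_mul (hM : IsDiagonaliser B δ M) {t : ℝ} (ht : 0 ≤ t) :
    (M t)⁻¹ * M t = 1 :=
  Matrix.nonsing_inv_mul _ ((Matrix.isUnit_iff_isUnit_det _).1 (hM.2.2 t ht).1)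

/-- The squared norms of the columns of `M`. -/
def colSq (M : ℝ → Mat d) (i : Fin d) (t : ℝ) : ℝ := ∑ j, ‖M t j i‖ ^ 2

theorem IsDiagonaliser.colSq_pos (hM : IsDiagonaliser B δ M) {t : ℝ} (ht : 0 ≤ t) (i : Fin d) :
    0 < colSq M i t := sum_norm_sq_col_pos (hM.2.2 t ht).1 i

/-- The transformed symbol `M⁻¹ A(t, ξ) M`. -/
def conjA (A : Fin n → ℝ → Mat d) (M : ℝ → Mat d) (t : ℝ) (ξ : Space n) : Mat d :=
  (M t)⁻¹ * symbolA A t ξ * M t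

theorem conjA_bound (hA : ∀ k, MatSymbolClass 0 (A k)) (hM : IsDiagonaliser B δ M) :
    ∃ C : ℝ, 0 ≤ C ∧ ∀ t, 0 ≤ t → ∀ ξ : Space n, ‖conjA A M t ξ‖ ≤ C * ‖ξ‖ := by
  obtain ⟨a, ha0, ha⟩ := symbolA_bound hA
  obtain ⟨m, hm0, hm⟩ := hM.1.norm_bound
  obtain ⟨m', hm'0, hm'⟩ := hM.2.1.norm_bound
  refine ⟨m' * a * m, by positivity, fun t ht ξ => ?_⟩
  have h1 := ha t ht ξ
  have h2 := hm t ht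
  have h3 := hm' t ht
  rw [pow_zero, mul_one] at h2 h3
  calc ‖conjA A M t ξ‖ ≤ ‖(M t)⁻¹‖ * ‖symbolA A t ξ‖ * ‖M t‖ :=
        (norm_mul_le _ _).trans (mul_le_mul_of_nonneg_right (norm_mul_le _ _) (norm_nonneg _))
    _ ≤ m' * (a * ‖ξ‖) * m := by gcongr
    _ = _ := by ring

/-- Quantitative form of: if `B x = 0` and `A x ≈ λ x`, then all `B Aʲ x` are small. -/
theorem norm_act_pow_le {X Y : Mat d} {x : EuclideanSpace ℂ (Fin d)} {z : ℂ} {a b : ℝ}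
    (hX : ‖X‖ ≤ a) (hY : ‖Y‖ ≤ b) (hz : ‖z‖ ≤ a) (hYx : act Y x = 0) (j : ℕ) :
    ‖act (Y * X ^ j) x‖ ≤ b * (j * a ^ (j - 1)) * ‖act X x - z • x‖ := by
  have ha : 0 ≤ a := (norm_nonneg _).trans hX
  have key : ∀ j : ℕ, ‖act (X ^ j) x - z ^ j • x‖ ≤ (j * a ^ (j - 1)) * ‖act X x - z • x‖ := by
    intro j
    induction j with
    | zero => simp
    | succ j ih =>
      have h1 : act (X ^ (j + 1)) x - z ^ (j + 1) • x =
          act X (act (X ^ j) x - z ^ j • x) + z ^ j • (act X x - z • x) := by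
        rw [pow_succ', act_mul, map_sub, map_smul, smul_sub, smul_smul, ← pow_succ]
        abel
      rw [h1]
      refine (norm_add_le _ _).trans ?_
      have h2 : ‖act X (act (X ^ j) x - z ^ j • x)‖ ≤
          a * ((j * a ^ (j - 1)) * ‖act X x - z • x‖) :=
        (norm_act_le _ _).trans (mul_le_mul hX ih (norm_nonneg _) ha)
      have h3 : ‖z ^ j • (act X x - z • x)‖ ≤ a ^ j * ‖act X x - z • x‖ := by
        rw [norm_smul, norm_pow]
        gcongr
      have h4 : a * ((j * a ^ (j - 1)) * ‖act X x - z • x‖) =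
          j * a ^ j * ‖act X x - z • x‖ := by
        cases j with
        | zero => simp
        | succ j => rw [Nat.add_sub_cancel, pow_succ]; ring
      rw [Nat.add_sub_cancel]
      push_cast
      linarith
  have h5 : act (Y * X ^ j) x = act Y (act (X ^ j) x - z ^ j • x) := by
    rw [act_mul, map_sub, map_smul, hYx, smul_zero, sub_zero]
  rw [h5, mul_assoc]
  exact (norm_act_le _ _).trans (mul_le_mul hY (key j) (norm_nonneg _)
    ((norm_nonneg _).trans hY))

theorem conjA_smul (s : ℝ) (t : ℝ) (ξ : Space n) :
    conjA A M t (s • ξ) = (s : ℂ) • conjA A M t ξ := by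
  have : symbolA A t (s • ξ) = (s : ℂ) • symbolA A t ξ := by
    rw [symbolA, symbolA, Finset.smul_sum]
    refine Finset.sum_congr rfl fun k _ => ?_
    rw [smul_smul]
    simp
  rw [conjA, this, conjA, Matrix.mul_smul, Matrix.smul_mul]

variable [NeZero d]

theorem IsDiagonaliser.gram (hM : IsDiagonaliser B δ M) (hB1 : CondB1 A B) (hB2 : CondB2 B δ)
    {t : ℝ} (ht : 0 ≤ t) : (M t)ᴴ * M t = Matrix.diagonal fun i => (colSq M i t : ℂ) := by
  rw [conjTranspose_mul_self_eq_diagonal (hB1 t ht).2.isHermitian (hM.mul_eq ht)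
    (hB2.1 t ht).2.1.injective]
  congr 1
  ext i
  exact conjTranspose_mul_self_diag (M t) i

/-- By orthogonality of the eigenvectors `Mᴴ M` is diagonal with entries `colSq`. So `diag(colSq)
M⁻¹ A M = Mᴴ A M`, which is Hermitian. The weights are needed because the columns of an arbitrary
diagonaliser are not normalised. -/
theorem colSq_mul_conjA (hM : IsDiagonaliser B δ M) (hB1 : CondB1 A B) (hB2 : CondB2 B δ)
    {t : ℝ} (ht : 0 ≤ t) (ξ : Space n) (i j : Fin d) :
    (colSq M i t : ℂ) * conjA A M t ξ i j =
      (starRingEnd ℂ) ((colSq M j t : ℂ) * conjA A M t ξ j i) := by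
  have h1 : Matrix.diagonal (fun i => (colSq M i t : ℂ)) * conjA A M t ξ =
      (M t)ᴴ * symbolA A t ξ * M t := by
    rw [← hM.gram hB1 hB2 ht, conjA, ← Matrix.mul_assoc, ← Matrix.mul_assoc,
      Matrix.mul_assoc _ (M t), hM.mul_inv ht, mul_one]
  have h2 : ((M t)ᴴ * symbolA A t ξ * M t)ᴴ = (M t)ᴴ * symbolA A t ξ * M t := by
    rw [Matrix.conjTranspose_mul, Matrix.conjTranspose_mul, (symbolA_isHermitian hB1 ht ξ).eq,
      Matrix.conjTranspose_conjTranspose, Matrix.mul_assoc]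
  rw [← h1] at h2
  have h3 := congrFun (congrFun h2 i) j
  rw [Matrix.conjTranspose_apply, Matrix.diagonal_mul, Matrix.diagonal_mul] at h3
  exact h3.symm

theorem conjA_zero_zero_im (hM : IsDiagonaliser B δ M) (hB1 : CondB1 A B) (hB2 : CondB2 B δ)
    {t : ℝ} (ht : 0 ≤ t) (ξ : Space n) : (conjA A M t ξ 0 0).im = 0 := by
  have h := (Complex.conj_eq_iff_im.1 (colSq_mul_conjA hM hB1 hB2 ht ξ 0 0).symm)
  rw [Complex.im_ofReal_mul] at h
  exact (mul_eq_zero.1 h).resolve_left (hM.colSq_pos ht 0).ne'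

/-- The weighted symmetry turns the product of opposite entries into a positive multiple of a
squared modulus. This is the source of the sign in the diffusion matrix. -/
theorem conjA_mul_conjA (hM : IsDiagonaliser B δ M) (hB1 : CondB1 A B) (hB2 : CondB2 B δ)
    {t : ℝ} (ht : 0 ≤ t) (ξ : Space n) (j : Fin d) :
    conjA A M t ξ 0 j * conjA A M t ξ j 0 =
      ((colSq M j t / colSq M 0 t * ‖conjA A M t ξ j 0‖ ^ 2 : ℝ) : ℂ) := by
  have h := colSq_mul_conjA hM hB1 hB2 ht ξ 0 j
  have h0 : (colSq M 0 t : ℂ) ≠ 0 := by exact_mod_cast (hM.colSq_pos ht 0).ne'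
  rw [map_mul, Complex.conj_ofReal] at h
  push_cast
  rw [← Complex.conj_mul']
  field_simp
  linear_combination conjA A M t ξ j 0 * h

theorem norm_sq_act_M (hM : IsDiagonaliser B δ M) (hB1 : CondB1 A B) (hB2 : CondB2 B δ)
    {t : ℝ} (ht : 0 ≤ t) (v : EuclideanSpace ℂ (Fin d)) :
    ‖act (M t) v‖ ^ 2 = ∑ i, colSq M i t * ‖v i‖ ^ 2 := by
  have h1 : (inner ℂ (act (M t) v) (act (M t) v) : ℂ) = ((‖act (M t) v‖ ^ 2 : ℝ) : ℂ) := by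
    rw [inner_self_eq_norm_sq_to_K]
    norm_cast
  have h2 : (inner ℂ (act (M t) v) (act (M t) v) : ℂ) =
      ((∑ i, colSq M i t * ‖v i‖ ^ 2 : ℝ) : ℂ) := by
    rw [inner_act_left, ← act_mul, hM.gram hB1 hB2 ht, PiLp.inner_apply]
    push_cast
    refine Finset.sum_congr rfl fun i _ => ?_
    rw [act_apply, Finset.sum_eq_single i, Matrix.diagonal_apply_eq]
    · rw [RCLike.inner_apply, mul_assoc, Complex.mul_conj']
    · intro j _ hj
      rw [Matrix.diagonal_apply_ne _ hj.symm, zero_mul]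
    · simp
  exact_mod_cast h1.symm.trans h2

theorem act_M_single_sq (hM : IsDiagonaliser B δ M) (hB1 : CondB1 A B) (hB2 : CondB2 B δ)
    {t : ℝ} (ht : 0 ≤ t) (i : Fin d) :
    ‖act (M t) (EuclideanSpace.single i 1)‖ ^ 2 = colSq M i t := by
  rw [norm_sq_act_M hM hB1 hB2 ht, Finset.sum_eq_single i]
  · simp
  · intro j _ hj; simp [hj]
  · simp

/-- `1 / δⱼ` for `j ≠ 0`. -/
def invδ (δ : Fin d → ℝ → ℝ) (j : Fin d) (t : ℝ) : ℝ := if j = 0 then 0 else (δ j t)⁻¹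

/-- The vector `x = M e₁` spans the kernel of `B`. If the coupling from the leading mode to the
others were small, `x` would nearly be an eigenvector of `A`, and then all `B Aʲ x` would be small,
against the lower Kalman bound. `norm_act_pow_le` makes this quantitative. -/
theorem exists_parabolicity_unit (hA : ∀ k, MatSymbolClass 0 (A k))
    (hB : MatSymbolClass 0 B)
    (hB1 : CondB1 A B) (hB2 : CondB2 B δ) (hB3 : CondB3 A B) (hM : IsDiagonaliser B δ M) :
    ∃ κ : ℝ, 0 < κ ∧ ∃ T : ℝ, 0 ≤ T ∧ ∀ t, T ≤ t → ∀ ξ : Space n, ‖ξ‖ = 1 →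
      κ ≤ ∑ j, invδ δ j t * (conjA A M t ξ 0 j * conjA A M t ξ j 0).re := by
  obtain ⟨c, hc, T, hT, h3⟩ := hB3 (fun _ => 1) fun _ => one_pos
  obtain ⟨a, ha0, ha⟩ := symbolA_bound hA
  obtain ⟨a', ha'0, ha'⟩ := conjA_bound hA hM
  obtain ⟨b, hb0, hb⟩ := hB.norm_bound
  obtain ⟨D, hD0, hD⟩ := hB2.bounded hB
  set a₁ := max a a'
  set K : ℝ := ∑ j : Fin d, (b * ((j : ℕ) * a₁ ^ ((j : ℕ) - 1))) ^ 2 with hK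
  have hKnn : 0 ≤ K := Finset.sum_nonneg fun _ _ => sq_nonneg _
  -- Here `c` is the Kalman constant, `K` bounds `∑ ‖B Aʲ x‖²` by the squared defect `‖r‖²`, and `D`
  -- bounds the eigenvalues from above, so that `1/δⱼ ≥ 1/(D + 1)`.
  refine ⟨1 / (c * (K + 1) * (D + 1)), by positivity, T, hT, fun t ht ξ hξ => ?_⟩
  have ht0 : 0 ≤ t := hT.trans ht
  set x := act (M t) (EuclideanSpace.single 0 1) with hx
  set z := conjA A M t ξ 0 0 with hz
  set r := act (symbolA A t ξ) x - z • x with hr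
  have hg0 : 0 < colSq M 0 t := hM.colSq_pos ht0 0
  have hxn : ‖x‖ ^ 2 = colSq M 0 t := act_M_single_sq hM hB1 hB2 ht0 0
  have hBx : act (B t) x = 0 := by
    rw [hx, ← act_mul, hM.mul_eq ht0, act_mul]
    have : act (Matrix.diagonal fun i => (δ i t : ℂ)) (EuclideanSpace.single 0 1) = 0 := by
      ext i
      rw [act_apply]
      by_cases hi : i = 0
      · subst hi; simp [(hB2.1 t ht0).1]
      · simp [Matrix.diagonal_apply_ne _ hi]
    rw [this, map_zero]
  -- In the basis `M` the defect is the first column of `M⁻¹ A M` without its corner entry, so its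
  -- norm is a weighted version of the sum that has to be bounded below.
  have hr2 : ‖r‖ ^ 2 = ∑ j, if j = 0 then 0 else colSq M j t * ‖conjA A M t ξ j 0‖ ^ 2 := by
    have h1 : act (symbolA A t ξ) x =
        act (M t) (act (conjA A M t ξ) (EuclideanSpace.single 0 1)) := by
      rw [hx, ← act_mul, ← act_mul, conjA, ← Matrix.mul_assoc, ← Matrix.mul_assoc,
        hM.mul_inv ht0, one_mul]
    rw [hr, h1, hx, ← map_smul, ← map_sub, norm_sq_act_M hM hB1 hB2 ht0]
    refine Finset.sum_congr rfl fun j _ => ?_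
    rw [PiLp.sub_apply, act_apply, Finset.sum_eq_single 0]
    · by_cases hj : j = 0
      · subst hj; simp [hz]
      · simp [hj]
    · intro i _ hi; simp [hi]
    · simp
  have h4 := (h3 t ht ξ hξ x).1
  have h5 : ∑ j : Fin d, (1 : ℝ) *
      ‖Matrix.toEuclideanLin (B t * symbolA A t ξ ^ (j : ℕ)) x‖ ^ 2 ≤ K * ‖r‖ ^ 2 := by
    rw [hK, Finset.sum_mul]
    refine Finset.sum_le_sum fun j _ => ?_
    rw [one_mul, ← mul_pow]
    refine pow_le_pow_left₀ (norm_nonneg _) ?_ 2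
    refine norm_act_pow_le (z := z) (a := a₁) ?_ ?_ ?_ hBx j
    · refine (ha t ht0 ξ).trans ?_
      rw [hξ, mul_one]
      exact le_max_left _ _
    · simpa using hb t ht0
    · refine (norm_entry_le _ _ _).trans ((ha' t ht0 ξ).trans ?_)
      rw [hξ, mul_one]
      exact le_max_right _ _
  have h6 : 1 / c * colSq M 0 t ≤ (K + 1) * ‖r‖ ^ 2 := by
    rw [← hxn]
    nlinarith [sq_nonneg ‖r‖]
  have h7 : ‖r‖ ^ 2 / colSq M 0 t * (1 / (D + 1)) ≤
      ∑ j, invδ δ j t * (conjA A M t ξ 0 j * conjA A M t ξ j 0).re := by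
    rw [hr2, Finset.sum_div, Finset.sum_mul]
    refine Finset.sum_le_sum fun j _ => ?_
    rw [conjA_mul_conjA hM hB1 hB2 ht0, Complex.ofReal_re, invδ]
    by_cases hj : j = 0
    · simp [hj]
    · rw [if_neg hj, if_neg hj]
      have hδ : 0 < δ j t := by
        rw [← (hB2.1 t ht0).1]
        exact (hB2.1 t ht0).2.1 (lt_of_le_of_ne (Fin.zero_le _) (Ne.symm hj))
      have h8 : 1 / (D + 1) ≤ (δ j t)⁻¹ := by
        rw [one_div]
        exact inv_anti₀ hδ (by linarith [hD t ht0 j])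
      have h9 : 0 ≤ colSq M j t / colSq M 0 t * ‖conjA A M t ξ j 0‖ ^ 2 :=
        mul_nonneg (div_nonneg (hM.colSq_pos ht0 j).le hg0.le) (sq_nonneg _)
      have h10 := mul_le_mul_of_nonneg_left h8 h9
      calc _ = colSq M j t / colSq M 0 t * ‖conjA A M t ξ j 0‖ ^ 2 * (1 / (D + 1)) := by ring
        _ ≤ _ := h10
        _ = _ := by ring
  refine le_trans ?_ h7
  have h11 : 1 / (c * (K + 1)) ≤ ‖r‖ ^ 2 / colSq M 0 t := by
    rw [le_div_iff₀ hg0, div_mul_eq_mul_div, div_le_iff₀ (by positivity), one_mul]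
    rw [div_mul_eq_mul_div, div_le_iff₀ hc, one_mul] at h6
    linarith
  calc 1 / (c * (K + 1) * (D + 1)) = 1 / (c * (K + 1)) * (1 / (D + 1)) := by
        rw [one_div_mul_one_div]
    _ ≤ _ := mul_le_mul_of_nonneg_right h11 (by positivity)

theorem exists_parabolicity (hA : ∀ k, MatSymbolClass 0 (A k))
    (hB : MatSymbolClass 0 B)
    (hB1 : CondB1 A B) (hB2 : CondB2 B δ) (hB3 : CondB3 A B) (hM : IsDiagonaliser B δ M) :
    ∃ κ : ℝ, 0 < κ ∧ ∃ T : ℝ, 0 ≤ T ∧ ∀ t, T ≤ t → ∀ ξ : Space n,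
      κ * ‖ξ‖ ^ 2 ≤ ∑ j, invδ δ j t * (conjA A M t ξ 0 j * conjA A M t ξ j 0).re := by
  obtain ⟨κ, hκ, T, hT, h⟩ := exists_parabolicity_unit hA hB hB1 hB2 hB3 hM
  refine ⟨κ, hκ, T, hT, fun t ht ξ => ?_⟩
  by_cases hξ : ξ = 0
  · have : conjA A M t (0 : Space n) = 0 := by
      simpa using conjA_smul (A := A) (M := M) 0 t (0 : Space n)
    simp [hξ, this]
  have hpos : 0 < ‖ξ‖ := norm_pos_iff.2 hξ
  have h1 := h t ht (‖ξ‖⁻¹ • ξ) (by rw [norm_smul, norm_inv, norm_norm, inv_mul_cancel₀ hpos.ne'])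
  have h2 : conjA A M t ξ = (‖ξ‖ : ℂ) • conjA A M t (‖ξ‖⁻¹ • ξ) := by
    rw [← conjA_smul, smul_smul, mul_inv_cancel₀ hpos.ne', one_smul]
  rw [h2]
  set X := conjA A M t (‖ξ‖⁻¹ • ξ)
  have h3 : ∀ j, (((‖ξ‖ : ℂ) • X) 0 j * ((‖ξ‖ : ℂ) • X) j 0).re = ‖ξ‖ ^ 2 * (X 0 j * X j 0).re := by
    intro j
    rw [Matrix.smul_apply, Matrix.smul_apply, smul_eq_mul, smul_eq_mul, mul_mul_mul_comm, ← sq,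
      ← Complex.ofReal_pow, Complex.re_ofReal_mul]
  simp only [h3]
  calc κ * ‖ξ‖ ^ 2 ≤ (∑ j, invδ δ j t * (X 0 j * X j 0).re) * ‖ξ‖ ^ 2 :=
        mul_le_mul_of_nonneg_right h1 (sq_nonneg _)
    _ = _ := by
        rw [Finset.sum_mul]
        exact Finset.sum_congr rfl fun j _ => by ring

end Parabolicity

/-! ### Coefficients of the parabolic problem and the Gaussian bound on `Ξ₂` -/

section Coefficients
open scoped Matrix.Norms.L2Operator

variable {n d : ℕ}

/-- The coefficient matrices `M⁻¹ Aₖ M`. -/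
def conjAk (A : Fin n → ℝ → Mat d) (M : ℝ → Mat d) (k : Fin n) (t : ℝ) : Mat d :=
  (M t)⁻¹ * A k t * M t

/-- The matrix `(D_t M⁻¹) M`. -/
def dtM (M : ℝ → Mat d) (t : ℝ) : Mat d := Dt (fun τ => (M τ)⁻¹) t * M t

variable {A : Fin n → ℝ → Mat d} {B : ℝ → Mat d} {δ : Fin d → ℝ → ℝ} {M : ℝ → Mat d}

theorem conjA_apply (t : ℝ) (ξ : Space n) (i j : Fin d) :
    conjA A M t ξ i j = ∑ k, (ξ k : ℂ) * conjAk A M k t i j := by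
  have : conjA A M t ξ = ∑ k, (ξ k : ℂ) • conjAk A M k t := by
    rw [conjA, symbolA, Finset.mul_sum, Finset.sum_mul]
    refine Finset.sum_congr rfl fun k _ => ?_
    rw [Matrix.mul_smul, Matrix.smul_mul, conjAk]
  rw [this, Matrix.sum_apply]
  rfl

theorem matSymbolClass_dtM (hM : IsDiagonaliser B δ M) : MatSymbolClass 1 (dtM M) := by
  have h : MatSymbolClass 1 (Dt fun τ => (M τ)⁻¹) := fun i j =>
    ((hM.2.1 i j).derivWithin).const_mul (-I)
  exact h.mul hM.1

variable [NeZero d]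

/-- The non-symmetrised second order coefficients. -/
def preα (A : Fin n → ℝ → Mat d) (δ : Fin d → ℝ → ℝ) (M : ℝ → Mat d) (t : ℝ) (k l : Fin n) : ℂ :=
  ∑ j, (invδ δ j t : ℂ) * (conjAk A M k t 0 j * conjAk A M l t j 0)

/-- The second order coefficients of the parabolic problem. -/
def coefα (A : Fin n → ℝ → Mat d) (δ : Fin d → ℝ → ℝ) (M : ℝ → Mat d) (t : ℝ) :
    Matrix (Fin n) (Fin n) ℂ :=
  Matrix.of fun k l => (preα A δ M t k l + preα A δ M t l k) / 2

/-- The first order coefficients of the parabolic problem. -/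
def coefβ (A : Fin n → ℝ → Mat d) (δ : Fin d → ℝ → ℝ) (M : ℝ → Mat d) (t : ℝ) (k : Fin n) : ℂ :=
  conjAk A M k t 0 0 + I * ∑ j, (invδ δ j t : ℂ) *
    (conjAk A M k t 0 j * dtM M t j 0 + dtM M t 0 j * conjAk A M k t j 0)

/-- The zeroth order coefficient of the parabolic problem. -/
def coefγ (δ : Fin d → ℝ → ℝ) (M : ℝ → Mat d) (t : ℝ) : ℂ :=
  dtM M t 0 0 + I * ∑ j, (invδ δ j t : ℂ) * (dtM M t 0 j * dtM M t j 0)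

theorem coefα_isSymm (t : ℝ) : (coefα A δ M t).IsSymm := by
  ext k l
  simp only [coefα, Matrix.transpose_apply, Matrix.of_apply, add_comm]

theorem sum_coefα (t : ℝ) (ξ : Space n) :
    ∑ k, ∑ l, coefα A δ M t k l * (ξ k : ℂ) * (ξ l : ℂ) =
      ∑ j, (invδ δ j t : ℂ) * (conjA A M t ξ 0 j * conjA A M t ξ j 0) := by
  have h1 : ∑ k, ∑ l, preα A δ M t k l * (ξ k : ℂ) * (ξ l : ℂ) =
      ∑ j, (invδ δ j t : ℂ) * (conjA A M t ξ 0 j * conjA A M t ξ j 0) := by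
    simp only [preα, conjA_apply, Finset.mul_sum, Finset.sum_mul]
    calc _ = ∑ k, ∑ j, ∑ l, (invδ δ j t : ℂ) *
          (conjAk A M k t 0 j * conjAk A M l t j 0) * (ξ k : ℂ) * (ξ l : ℂ) :=
          Finset.sum_congr rfl fun k _ => Finset.sum_comm
      _ = _ := by
          rw [Finset.sum_comm]
          refine Finset.sum_congr rfl fun j _ => ?_
          rw [Finset.sum_comm]
          exact Finset.sum_congr rfl fun k _ => Finset.sum_congr rfl fun l _ => by ring
  have h2 : ∑ k, ∑ l, preα A δ M t l k * (ξ k : ℂ) * (ξ l : ℂ) =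
      ∑ k, ∑ l, preα A δ M t k l * (ξ k : ℂ) * (ξ l : ℂ) := by
    rw [Finset.sum_comm]
    refine Finset.sum_congr rfl fun j _ => Finset.sum_congr rfl fun k _ => by ring
  calc _ = ∑ k, ∑ l, (preα A δ M t k l * (ξ k : ℂ) * (ξ l : ℂ) / 2 +
        preα A δ M t l k * (ξ k : ℂ) * (ξ l : ℂ) / 2) :=
        Finset.sum_congr rfl fun k _ => Finset.sum_congr rfl fun l _ => by
          simp only [coefα, Matrix.of_apply]; ring
    _ = _ := by
        simp only [Finset.sum_add_distrib, ← Finset.sum_div]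
        rw [h2, h1]
        ring

theorem sum_coefβ (t : ℝ) (ξ : Space n) : ∑ k, coefβ A δ M t k * (ξ k : ℂ) =
    conjA A M t ξ 0 0 + I * ∑ j, (invδ δ j t : ℂ) *
      (conjA A M t ξ 0 j * dtM M t j 0 + dtM M t 0 j * conjA A M t ξ j 0) := by
  simp only [coefβ, conjA_apply, add_mul, Finset.sum_add_distrib]
  congr 1
  · exact Finset.sum_congr rfl fun k _ => by ring
  · simp only [Finset.sum_mul, Finset.mul_sum]
    rw [Finset.sum_comm]
    refine Finset.sum_congr rfl fun j _ => ?_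
    rw [← Finset.sum_add_distrib, Finset.mul_sum, Finset.mul_sum]
    exact Finset.sum_congr rfl fun k _ => by ring

theorem R1_eq (t : ℝ) (ξ : Space n) : R1 A M t ξ = conjA A M t ξ + dtM M t := rfl

theorem cornerF_eq (hA : ∀ k, MatSymbolClass 0 (A k)) (hB : MatSymbolClass 0 B)
    (hB2 : CondB2 B δ) (hM : IsDiagonaliser B δ M) {t : ℝ} (ht : 0 ≤ t) (ξ : Space n) :
    cornerF A δ M 2 t ξ = I * ∑ k, ∑ l, coefα A δ M t k l * (ξ k : ℂ) * (ξ l : ℂ) +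
      ∑ k, coefβ A δ M t k * (ξ k : ℂ) + coefγ δ M t := by
  have h : ∀ j, (if j = 0 then (0 : ℂ) else (δ j t : ℂ)⁻¹) = (invδ δ j t : ℂ) := by
    intro j
    rw [invδ]
    split_ifs <;> simp
  rw [cornerF_two hA hB hB2 hM ht, sum_coefα, sum_coefβ, coefγ]
  simp only [h, R1_eq, Matrix.add_apply]
  have h2 : ∑ j, (invδ δ j t : ℂ) * ((conjA A M t ξ 0 j + dtM M t 0 j) *
      (conjA A M t ξ j 0 + dtM M t j 0)) =
      ∑ j, (invδ δ j t : ℂ) * (conjA A M t ξ 0 j * conjA A M t ξ j 0) +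
      ∑ j, (invδ δ j t : ℂ) *
        (conjA A M t ξ 0 j * dtM M t j 0 + dtM M t 0 j * conjA A M t ξ j 0) +
      ∑ j, (invδ δ j t : ℂ) * (dtM M t 0 j * dtM M t j 0) := by
    rw [← Finset.sum_add_distrib, ← Finset.sum_add_distrib]
    exact Finset.sum_congr rfl fun j _ => by ring
  rw [h2]
  ring

theorem re_sum_coefα (t : ℝ) (ξ : Space n) :
    (∑ k, ∑ l, coefα A δ M t k l * (ξ k : ℂ) * (ξ l : ℂ)).re =
      ∑ j, invδ δ j t * (conjA A M t ξ 0 j * conjA A M t ξ j 0).re := by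
  rw [sum_coefα, Complex.re_sum]
  exact Finset.sum_congr rfl fun j _ => Complex.re_ofReal_mul _ _

theorem invδ_bound (hB : MatSymbolClass 0 B) (hB2 : CondB2 B δ) :
    ∃ C : ℝ, 0 ≤ C ∧ ∀ t, 0 ≤ t → ∀ j, ‖(invδ δ j t : ℂ)‖ ≤ C := by
  obtain ⟨σ, hσ, hsep⟩ := hB2.separated hB
  refine ⟨σ⁻¹, by positivity, fun t ht j => ?_⟩
  rw [Complex.norm_real, invδ]
  split_ifs with hj
  · simpa using hσ.le
  · have := hsep t ht j 0 hj
    rw [(hB2.1 t ht).1, sub_zero] at this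
    rw [norm_inv]
    exact inv_anti₀ hσ this

theorem hasDerivWithinAt_colSq (hM : MatSymbolClass 0 M) {t : ℝ} (ht : 0 ≤ t) :
    HasDerivWithinAt (colSq M 0)
      (2 * (∑ j, (starRingEnd ℂ) (M t j 0) * derivWithin (fun τ => M τ j 0) (Ici 0) t).re)
      (Ici 0) t := by
  have h := HasDerivWithinAt.fun_sum (u := Finset.univ) fun (j : Fin d) _ =>
    hasDerivWithinAt_norm_sq ((hM j 0).hasDerivWithinAt ht)
  refine h.congr_deriv ?_
  rw [Complex.re_sum, Finset.mul_sum]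
  refine Finset.sum_congr rfl fun j _ => ?_
  rw [RCLike.inner_apply, mul_comm (derivWithin _ _ _)]

/-- The imaginary part of this corner entry is half the logarithmic derivative of `‖M e₁‖²`. Its
symbol order only gives a bound `O((1+t)⁻¹)`, which could integrate to a power of `t`; being an
exact derivative it contributes just a bounded factor to `Ξ₂`. -/
theorem dtM_zero_zero_im (hM : IsDiagonaliser B δ M) (hB1 : CondB1 A B) (hB2 : CondB2 B δ)
    {t : ℝ} (ht : 0 ≤ t) : colSq M 0 t * (dtM M t 0 0).im =
      (∑ j, (starRingEnd ℂ) (M t j 0) * derivWithin (fun τ => M τ j 0) (Ici 0) t).re := by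
  set M' : Mat d := Matrix.of fun i j => derivWithin (fun τ => M τ i j) (Ici 0) t with hM'
  set J' : Mat d := Matrix.of fun i j => derivWithin (fun τ => (M τ)⁻¹ i j) (Ici 0) t with hJ'
  have h1 : HasDerivWithinAt M M' (Ici 0) t := hM.1.hasDerivWithinAt ht
  have h2 : HasDerivWithinAt (fun τ => (M τ)⁻¹) J' (Ici 0) t := hM.2.1.hasDerivWithinAt ht
  have h3 : J' * M t + (M t)⁻¹ * M' = 0 :=
    (uniqueDiffOn_Ici (0 : ℝ) t ht).eq_deriv _ ((h2.mul h1).congr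
      (fun s hs => (hM.inv_mul hs).symm) (hM.inv_mul ht).symm)
      (hasDerivWithinAt_const t _ (1 : Mat d))
  have h4 : dtM M t = I • ((M t)⁻¹ * M') := by
    have : Dt (fun τ => (M τ)⁻¹) t = (-I) • J' := by
      ext i j
      simp [Dt, hJ']
    rw [dtM, this, Matrix.smul_mul, neg_smul, ← smul_neg, eq_neg_of_add_eq_zero_left h3, neg_neg]
  have h5 : (M t)ᴴ = Matrix.diagonal (fun i => (colSq M i t : ℂ)) * (M t)⁻¹ := by
    rw [← hM.gram hB1 hB2 ht, Matrix.mul_assoc, hM.mul_inv ht, mul_one]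
  have h6 : (colSq M 0 t : ℂ) * dtM M t 0 0 = I * ((M t)ᴴ * M') 0 0 := by
    rw [h4, h5, Matrix.mul_assoc, Matrix.diagonal_mul, Matrix.smul_apply, smul_eq_mul]
    ring
  have h7 := congrArg Complex.im h6
  rw [Complex.im_ofReal_mul, Complex.I_mul_im, Matrix.mul_apply] at h7
  exact h7

theorem norm_sum_invδ_mul_le {t C a b : ℝ} {X Y : Mat d}
    (hC : ∀ j, ‖(invδ δ j t : ℂ)‖ ≤ C) (hX : ‖X‖ ≤ a) (hY : ‖Y‖ ≤ b) :
    ‖∑ j, (invδ δ j t : ℂ) * (X 0 j * Y j 0)‖ ≤ d * (C * (a * b)) := by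
  calc _ ≤ ∑ _j : Fin d, C * (a * b) := by
        refine (norm_sum_le _ _).trans (Finset.sum_le_sum fun j _ => ?_)
        rw [norm_mul, norm_mul]
        have h1 := (norm_entry_le X 0 j).trans hX
        have h2 := (norm_entry_le Y j 0).trans hY
        exact mul_le_mul (hC j) (mul_le_mul h1 h2 (norm_nonneg _) ((norm_nonneg _).trans h1))
          (by positivity) ((norm_nonneg _).trans (hC j))
    _ = _ := by rw [Finset.sum_const, Finset.card_univ, Fintype.card_fin, nsmul_eq_mul]

/-- The modulus of `Ξ₂` is governed by `Im f₁`. Its quadratic part is elliptic, the linear part `M⁻¹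
A M` contributes a real corner entry, and what remains is either a cross term of size `‖ξ‖/(1+t)`, a
term of size `(1+t)⁻²`, or the logarithmic derivative kept explicitly. -/
theorem exists_im_cornerF_lower (hA : ∀ k, MatSymbolClass 0 (A k)) (hB : MatSymbolClass 0 B)
    (hB1 : CondB1 A B) (hB2 : CondB2 B δ) (hB3 : CondB3 A B) (hM : IsDiagonaliser B δ M) :
    ∃ κ : ℝ, 0 < κ ∧ ∃ C : ℝ, 0 ≤ C ∧ ∃ T : ℝ, 0 ≤ T ∧ ∀ t, T ≤ t → ∀ ξ : Space n,
      κ * ‖ξ‖ ^ 2 - C * (1 / (1 + t)) ^ 2 +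
        (∑ j, (starRingEnd ℂ) (M t j 0) * derivWithin (fun τ => M τ j 0) (Ici 0) t).re /
          colSq M 0 t ≤ (cornerF A δ M 2 t ξ).im := by
  obtain ⟨κ, hκ, T, hT, h⟩ := exists_parabolicity hA hB hB1 hB2 hB3 hM
  obtain ⟨D, hD0, hD⟩ := invδ_bound hB hB2
  obtain ⟨a, ha0, ha⟩ := conjA_bound hA hM
  obtain ⟨b, hb0, hb⟩ := (matSymbolClass_dtM hM).norm_bound
  set E : ℝ := 2 * (d * (D * (a * b))) with hE
  have hE0 : 0 ≤ E := by positivity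
  refine ⟨κ / 2, by positivity, E ^ 2 / (2 * κ) + d * (D * (b * b)), by positivity, T, hT,
    fun t ht ξ => ?_⟩
  have ht0 : 0 ≤ t := hT.trans ht
  set τ : ℝ := 1 / (1 + t) with hτ
  have hτ0 : 0 ≤ τ := by positivity
  have hb' := hb t ht0
  rw [pow_one] at hb'
  have h1 : (∑ j, (starRingEnd ℂ) (M t j 0) * derivWithin (fun τ => M τ j 0) (Ici 0) t).re /
      colSq M 0 t = (dtM M t 0 0).im := by
    rw [← dtM_zero_zero_im hM hB1 hB2 ht0, mul_div_cancel_left₀ _ (hM.colSq_pos ht0 0).ne']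
  have h2 : (cornerF A δ M 2 t ξ).im =
      ∑ j, invδ δ j t * (conjA A M t ξ 0 j * conjA A M t ξ j 0).re +
      (∑ j, (invδ δ j t : ℂ) *
        (conjA A M t ξ 0 j * dtM M t j 0 + dtM M t 0 j * conjA A M t ξ j 0)).re +
      ((dtM M t 0 0).im + (∑ j, (invδ δ j t : ℂ) * (dtM M t 0 j * dtM M t j 0)).re) := by
    rw [cornerF_eq hA hB hB2 hM ht0, Complex.add_im, Complex.add_im, Complex.I_mul_im,
      re_sum_coefα, sum_coefβ, Complex.add_im, Complex.I_mul_im, coefγ, Complex.add_im,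
      Complex.I_mul_im, conjA_zero_zero_im hM hB1 hB2 ht0, zero_add]
  have h3 : -(E * (‖ξ‖ * τ)) ≤ (∑ j, (invδ δ j t : ℂ) *
      (conjA A M t ξ 0 j * dtM M t j 0 + dtM M t 0 j * conjA A M t ξ j 0)).re := by
    have e1 := norm_sum_invδ_mul_le (hD t ht0) (ha t ht0 ξ) hb'
    have e2 := norm_sum_invδ_mul_le (hD t ht0) hb' (ha t ht0 ξ)
    simp only [mul_add, Finset.sum_add_distrib]
    rw [Complex.add_re]
    have e3 := (abs_le.1 ((Complex.abs_re_le_norm _).trans e1)).1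
    have e4 := (abs_le.1 ((Complex.abs_re_le_norm _).trans e2)).1
    rw [hE]
    nlinarith
  have h4 : -(d * (D * (b * b)) * τ ^ 2) ≤
      (∑ j, (invδ δ j t : ℂ) * (dtM M t 0 j * dtM M t j 0)).re := by
    have e1 := norm_sum_invδ_mul_le (hD t ht0) hb' hb'
    have e3 := (abs_le.1 ((Complex.abs_re_le_norm _).trans e1)).1
    nlinarith
  have h5 := h t ht ξ
  -- Young's inequality spends half of the ellipticity on the cross terms and leaves a term that is
  -- integrable in time.
  have h6 : E * (‖ξ‖ * τ) ≤ κ / 2 * ‖ξ‖ ^ 2 + E ^ 2 / (2 * κ) * τ ^ 2 := by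
    have : κ / 2 * ‖ξ‖ ^ 2 + E ^ 2 / (2 * κ) * τ ^ 2 - E * (‖ξ‖ * τ) =
        (κ * ‖ξ‖ - E * τ) ^ 2 / (2 * κ) := by field_simp; ring
    have h7 : 0 ≤ (κ * ‖ξ‖ - E * τ) ^ 2 / (2 * κ) := by positivity
    linarith
  rw [h1, h2]
  linarith

theorem colSq_bounds (hM : IsDiagonaliser B δ M) (hB1 : CondB1 A B) (hB2 : CondB2 B δ) :
    ∃ c C : ℝ, 0 < c ∧ 0 < C ∧ ∀ t, 0 ≤ t → c ≤ colSq M 0 t ∧ colSq M 0 t ≤ C := by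
  obtain ⟨m, hm0, hm⟩ := hM.1.norm_bound
  obtain ⟨m', hm'0, hm'⟩ := hM.2.1.norm_bound
  refine ⟨((m' + 1) ^ 2)⁻¹, (m + 1) ^ 2, by positivity, by positivity, fun t ht => ?_⟩
  have hx := act_M_single_sq hM hB1 hB2 ht 0
  set x := act (M t) (EuclideanSpace.single 0 1) with hxdef
  have h1 : ‖x‖ ≤ m := by
    simpa using (norm_act_le (M t) (EuclideanSpace.single 0 1)).trans
      (mul_le_mul_of_nonneg_right (hm t ht) (norm_nonneg _))
  have h2 : 1 ≤ m' * ‖x‖ := by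
    have h3 : act (M t)⁻¹ x = EuclideanSpace.single 0 1 := by
      rw [hxdef, ← act_mul, hM.inv_mul ht, act_one]
    have h4 := norm_act_le (M t)⁻¹ x
    rw [h3] at h4
    have h5 := hm' t ht
    rw [pow_zero, mul_one] at h5
    simpa using h4.trans (mul_le_mul_of_nonneg_right h5 (norm_nonneg _))
  rw [← hx]
  constructor
  · rw [inv_le_iff_one_le_mul₀ (by positivity), ← mul_pow]
    refine one_le_pow₀ ?_
    nlinarith [norm_nonneg x]
  · nlinarith [norm_nonneg x]

theorem continuousOn_cornerF (hA : ∀ k, MatSymbolClass 0 (A k)) (hB : MatSymbolClass 0 B)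
    (hB2 : CondB2 B δ) (hM : IsDiagonaliser B δ M) (ξ : Space n) :
    ContinuousOn (fun t => cornerF A δ M 2 t ξ) (Ici 0) :=
  ((polyMat_hierarchy hA hB hB2 hM 2).2.1 0 0).continuousOn ξ

theorem hasDerivAt_Xi (hA : ∀ k, MatSymbolClass 0 (A k)) (hB : MatSymbolClass 0 B)
    (hB2 : CondB2 B δ) (hM : IsDiagonaliser B δ M) (ξ : Space n) {t₀ t : ℝ} (ht₀ : 0 < t₀)
    (ht : t₀ ≤ t) : HasDerivAt (fun τ => Xi A δ M 2 τ t₀ ξ)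
      (I * cornerF A δ M 2 t ξ * Xi A δ M 2 t t₀ ξ) t := by
  have hc := continuousOn_cornerF hA hB hB2 hM ξ
  have hc' : ContinuousOn (fun t => cornerF A δ M 2 t ξ) (Ioi 0) := hc.mono Ioi_subset_Ici_self
  have h1 : HasDerivAt (fun τ => ∫ θ in t₀..τ, cornerF A δ M 2 θ ξ) (cornerF A δ M 2 t ξ) t := by
    refine intervalIntegral.integral_hasDerivAt_right ?_ ?_ ?_
    · refine (hc.mono fun s hs => ?_).intervalIntegrable
      rw [uIcc_of_le ht] at hs
      exact ht₀.le.trans hs.1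
    · exact hc'.stronglyMeasurableAtFilter isOpen_Ioi t (ht₀.trans_le ht)
    · exact hc'.continuousAt (Ioi_mem_nhds (ht₀.trans_le ht))
  have h2 := (h1.const_mul I).cexp
  rw [mul_comm] at h2
  exact h2

theorem Xi_self (t₀ : ℝ) (ξ : Space n) : Xi A δ M 2 t₀ t₀ ξ = 1 := by simp [Xi]

/-- The lower bound on `Im f₁` is integrated. The term `(1+t)⁻²` is integrable, and the logarithmic
derivative integrates to `log (colSq M 0)`, which is bounded because `M` and `M⁻¹` are. The
prefactor is therefore independent of `ξ` and `t₀`. -/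
theorem exists_norm_Xi_le (hA : ∀ k, MatSymbolClass 0 (A k)) (hB : MatSymbolClass 0 B)
    (hB1 : CondB1 A B) (hB2 : CondB2 B δ) (hB3 : CondB3 A B) (hM : IsDiagonaliser B δ M) :
    ∃ κ : ℝ, 0 < κ ∧ ∃ C : ℝ, 0 < C ∧ ∃ T : ℝ, 0 < T ∧ ∀ t₀, T ≤ t₀ → ∀ t, t₀ ≤ t →
      ∀ ξ : Space n, ‖Xi A δ M 2 t t₀ ξ‖ ≤ C * Real.exp (-(κ * ‖ξ‖ ^ 2 * (t - t₀))) := by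
  obtain ⟨κ, hκ, C, hC0, T, hT, h⟩ := exists_im_cornerF_lower hA hB hB1 hB2 hB3 hM
  obtain ⟨g₀, g₁, hg₀, hg₁, hg⟩ := colSq_bounds hM hB1 hB2
  refine ⟨κ, hκ, Real.sqrt (Real.exp (2 * C) * (g₁ / g₀)), by positivity, T + 1, by positivity,
    fun t₀ ht₀ t ht ξ => ?_⟩
  have ht₀' : 0 < t₀ := by linarith
  set p : ℝ → ℝ := fun t => (∑ j, (starRingEnd ℂ) (M t j 0) *
    derivWithin (fun τ => M τ j 0) (Ici 0) t).re with hp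
  set u : ℝ → ℂ := fun t => Xi A δ M 2 t t₀ ξ with hu
  -- A primitive of the upper bound for the logarithmic derivative of `‖Ξ₂‖²`; the middle term has
  -- derivative `2C (1+s)⁻²`.
  set α : ℝ → ℝ := fun s => -(2 * κ * ‖ξ‖ ^ 2 * s) - 2 * C * (1 + s)⁻¹ - Real.log (colSq M 0 s)
    with hα
  have hαd : ∀ s, t₀ ≤ s → HasDerivWithinAt α (-(2 * κ * ‖ξ‖ ^ 2) + 2 * C * (1 / (1 + s)) ^ 2
      - 2 * p s / colSq M 0 s) (Ici t₀) s := by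
    intro s hs
    have hs0 : 0 ≤ s := ht₀'.le.trans hs
    have e1 : HasDerivWithinAt (colSq M 0) (2 * p s) (Ici t₀) s :=
      (hasDerivWithinAt_colSq hM.1 hs0).mono (Ici_subset_Ici.2 ht₀'.le)
    have e2 := e1.log (hM.colSq_pos hs0 0).ne'
    have e3 : HasDerivWithinAt (fun s : ℝ => (1 + s)⁻¹) (-1 / (1 + s) ^ 2) (Ici t₀) s :=
      (((hasDerivAt_id s).const_add 1).fun_inv (by simp; linarith)).hasDerivWithinAt
    have e4 := ((((hasDerivWithinAt_id s (Ici t₀)).const_mul (2 * κ * ‖ξ‖ ^ 2)).neg).sub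
      (e3.const_mul (2 * C))).sub e2
    refine e4.congr_deriv ?_
    rw [one_div, inv_pow]
    ring
  have hu2 : ∀ s, t₀ ≤ s → HasDerivWithinAt (fun s => ‖u s‖ ^ 2)
      (-2 * (cornerF A δ M 2 s ξ).im * ‖u s‖ ^ 2) (Ici t₀) s := by
    intro s hs
    have e1 := hasDerivWithinAt_norm_sq
      (hasDerivAt_Xi hA hB hB2 hM ξ ht₀' hs).hasDerivWithinAt (s := Ici t₀)
    refine e1.congr_deriv ?_
    rw [RCLike.inner_apply]
    have e2 : I * cornerF A δ M 2 s ξ * Xi A δ M 2 s t₀ ξ *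
        (starRingEnd ℂ) (Xi A δ M 2 s t₀ ξ) =
        ((‖u s‖ ^ 2 : ℝ) : ℂ) * (I * cornerF A δ M 2 s ξ) := by
      rw [mul_assoc, Complex.mul_conj']
      push_cast
      ring
    rw [e2, Complex.re_ofReal_mul, Complex.I_mul_re]
    ring
  have key := le_of_deriv_le (b := fun _ => 0) (φ := fun s => Real.exp (α s - α t₀))
    (t₁ := t) (fun s hs _ => hu2 s hs) (fun s hs _ => hαd s hs)
    (fun s hs _ => ((hαd s hs).sub_const (α t₀)).exp) (fun s hs _ => ?_)
    (fun s hs _ => le_of_eq (by ring)) (by simp [hu, Xi_self]) t ht le_rfl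
  · have hle : α t - α t₀ ≤ 2 * C + (Real.log g₁ - Real.log g₀) +
        (-(κ * ‖ξ‖ ^ 2 * (t - t₀)) + -(κ * ‖ξ‖ ^ 2 * (t - t₀))) := by
      have e1 : 0 ≤ (1 + t)⁻¹ := inv_nonneg.2 (by linarith)
      have e2 : (1 + t₀)⁻¹ ≤ 1 := inv_le_one_of_one_le₀ (by linarith)
      have e3 := Real.log_le_log hg₀ (hg t (ht₀'.le.trans ht)).1
      have e4 := Real.log_le_log (hM.colSq_pos ht₀'.le 0) (hg t₀ ht₀'.le).2
      simp only [hα]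
      nlinarith [mul_nonneg hC0 e1, mul_le_mul_of_nonneg_left e2 hC0]
    refine le_of_sq_le_sq ?_ (by positivity)
    refine (key.trans (Real.exp_le_exp.2 hle)).trans_eq ?_
    rw [mul_pow, Real.sq_sqrt (by positivity), Real.exp_add, Real.exp_add, Real.exp_sub,
      Real.exp_log hg₁, Real.exp_log hg₀, Real.exp_add]
    ring
  · have e1 := h s (by linarith) ξ
    have e2 := sq_nonneg ‖u s‖
    have e3 : 2 * p s / colSq M 0 s = 2 * (p s / colSq M 0 s) := by ring
    rw [e3, add_zero]
    nlinarith

end Coefficients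

/-! ### Hypocoercive decay away from the zero frequency -/

section Lyapunov
open scoped Matrix.Norms.L2Operator

variable {n d : ℕ}

/-- The weights of the hypocoercive corrections. -/
theorem exists_weights (m : ℕ) : ∀ η : ℝ, 0 < η → ∃ K : ℝ, 0 ≤ K ∧ ∃ w : ℕ → ℝ, (∀ j, 0 ≤ w j) ∧
    ∀ a : ℕ → ℝ, (∑ j ∈ Finset.range m, a (j + 1) ^ 2) - K * a 0 ^ 2 - η * a (m + 1) ^ 2 ≤
      ∑ j ∈ Finset.range m, w j * (a (j + 1) ^ 2 - a j * a (j + 2)) := by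
  induction m with
  | zero =>
    intro η hη
    refine ⟨0, le_rfl, fun _ => 0, fun _ => le_rfl, fun a => ?_⟩
    simp only [Finset.range_zero, Finset.sum_empty, zero_mul, sub_zero, zero_sub]
    exact neg_nonpos.2 (by positivity)
  | succ m ih =>
    intro η hη
    -- After multiplication by `1 + 1/η` the tail error of the shorter chain is exactly `a (m + 1) ^
    -- 2`. The new weight `2` pays for it and leaves one copy. The excess `1/η` on the old sum
    -- absorbs the `a m ^ 2` that Young's inequality produces from `a m * a (m + 2)`.
    obtain ⟨K, hK, w, hw, h⟩ := ih (1 + 1 / η)⁻¹ (by positivity)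
    refine ⟨(1 + 1 / η) * K + 1 / η, by positivity, fun j => if j < m then (1 + 1 / η) * w j else 2,
      fun j => ?_, fun a => ?_⟩
    · have := hw j
      dsimp only
      split_ifs <;> positivity
    have h1 : ∑ j ∈ Finset.range m, (if j < m then (1 + 1 / η) * w j else 2) *
        (a (j + 1) ^ 2 - a j * a (j + 2)) =
        (1 + 1 / η) * ∑ j ∈ Finset.range m, w j * (a (j + 1) ^ 2 - a j * a (j + 2)) := by
      rw [Finset.mul_sum]
      refine Finset.sum_congr rfl fun j hj => ?_
      rw [if_pos (Finset.mem_range.1 hj), mul_assoc]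
    simp only [Finset.sum_range_succ, h1, if_neg (lt_irrefl m)]
    have h2 := mul_le_mul_of_nonneg_left (h a) (show 0 ≤ 1 + 1 / η by positivity)
    have h3 : a m ^ 2 ≤ a 0 ^ 2 + ∑ j ∈ Finset.range m, a (j + 1) ^ 2 := by
      rw [add_comm, ← Finset.sum_range_succ' (fun j => a j ^ 2)]
      exact Finset.single_le_sum (f := fun j => a j ^ 2) (fun j _ => sq_nonneg (a j))
        (Finset.self_mem_range_succ m)
    have h4 := mul_le_mul_of_nonneg_left h3 (show 0 ≤ 1 / η by positivity)
    have h5 : 2 * (a m * a (m + 2)) ≤ 1 / η * a m ^ 2 + η * a (m + 2) ^ 2 := by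
      have : 1 / η * a m ^ 2 + η * a (m + 2) ^ 2 - 2 * (a m * a (m + 2)) =
        (a m - η * a (m + 2)) ^ 2 / η := by field_simp; ring
      have h6 : 0 ≤ (a m - η * a (m + 2)) ^ 2 / η := by positivity
      linarith
    have h6 : (1 + 1 / η) * ((1 + 1 / η)⁻¹ * a (m + 1) ^ 2) = a (m + 1) ^ 2 := by
      rw [← mul_assoc, mul_inv_cancel₀ (by positivity), one_mul]
    rw [mul_sub, mul_sub, h6] at h2
    rw [show m + 1 + 1 = m + 2 from rfl]
    linarith

open scoped MatrixOrder in
-- Writing `X = Y* Y` gives `‖X v‖² ≤ ‖Y‖² ‖Y v‖²`. It converts the dissipation `⟨v, B v⟩` into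
-- control of `‖B v‖²`, the first link of the hypocoercive chain.
theorem norm_act_sq_le_of_posSemidef {X : Mat d} (hX : X.PosSemidef)
    (v : EuclideanSpace ℂ (Fin d)) : ‖act X v‖ ^ 2 ≤ ‖X‖ * (inner ℂ v (act X v)).re := by
  obtain ⟨Y, rfl⟩ := CStarAlgebra.nonneg_iff_eq_star_mul_self.1 (Matrix.nonneg_iff_posSemidef.2 hX)
  have h1 : ‖star Y * Y‖ = ‖Y‖ * ‖Y‖ := CStarRing.norm_star_mul_self
  have h2 : (inner ℂ v (act (star Y * Y) v)).re = ‖act Y v‖ ^ 2 := by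
    rw [act_mul, Matrix.star_eq_conjTranspose, ← inner_act_left, inner_self_eq_norm_sq_to_K]
    norm_cast
  have h3 := norm_act_le (star Y) (act Y v)
  rw [norm_star, ← act_mul] at h3
  rw [h1, h2]
  nlinarith [norm_nonneg (act (star Y * Y) v), norm_nonneg Y, norm_nonneg (act Y v)]

variable {A : Fin n → ℝ → Mat d} {B : ℝ → Mat d}

theorem inner_act_self_im {X : Mat d} (hX : X.IsHermitian) (v : EuclideanSpace ℂ (Fin d)) :
    (inner ℂ v (act X v)).im = 0 := by
  have h := inner_act_left X v v
  rw [hX.eq, ← inner_conj_symm] at h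
  exact Complex.conj_eq_iff_im.1 h

/-- The Hermitian part `A` only rotates, so the energy is dissipated by `B` alone. -/
theorem re_inner_system_eq (hB1 : CondB1 A B) {t : ℝ} (ht : 0 ≤ t) (ξ : Space n)
    (v : EuclideanSpace ℂ (Fin d)) :
    (inner ℂ v (I • act (symbolA A t ξ + I • B t) v)).re = -(inner ℂ v (act (B t) v)).re := by
  rw [act_add, act_smul, smul_add, smul_smul, I_mul_I, neg_one_smul, inner_add_right,
    inner_smul_right, inner_neg_right, Complex.add_re, Complex.I_mul_re,
    inner_act_self_im (symbolA_isHermitian hB1 ht ξ), neg_zero, zero_add, Complex.neg_re]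

theorem inner_act_nonneg (hB1 : CondB1 A B) {t : ℝ} (ht : 0 ≤ t) (v : EuclideanSpace ℂ (Fin d)) :
    0 ≤ (inner ℂ v (act (B t) v)).re := by
  have h := norm_act_sq_le_of_posSemidef (hB1 t ht).2 v
  by_contra! hc
  have h1 : ‖B t‖ = 0 := by
    by_contra hne
    have := (norm_nonneg (B t)).lt_of_ne' hne
    nlinarith [sq_nonneg ‖act (B t) v‖]
  rw [norm_eq_zero.1 h1] at hc
  simp at hc

theorem exists_hasDerivWithinAt_symbolA (hA : ∀ k, MatSymbolClass 0 (A k)) :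
    ∃ C : ℝ, 0 ≤ C ∧ ∀ t, 0 ≤ t → ∀ e : Space n, ∃ X' : Mat d,
      HasDerivWithinAt (fun τ => symbolA A τ e) X' (Ici 0) t ∧
      ‖X'‖ ≤ C * (1 / (1 + t)) * ‖e‖ := by
  obtain ⟨C, hC0, hC⟩ := exists_common_bound (ι := Fin n)
    (p := fun k C => ∀ t : ℝ, 0 ≤ t → ‖(Matrix.of fun i j =>
      derivWithin (fun τ => A k τ i j) (Ici 0) t : Mat d)‖ ≤ C * (1 / (1 + t)))
    (fun i a b hab h t ht => (h t ht).trans (by gcongr))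
    fun k => by
      have h1 : MatSymbolClass 1 (fun t => (Matrix.of fun i j =>
        derivWithin (fun τ => A k τ i j) (Ici 0) t : Mat d)) := fun i j => (hA k i j).derivWithin
      obtain ⟨C, -, hC⟩ := h1.norm_bound
      exact ⟨C, fun t ht => by simpa using hC t ht⟩
  refine ⟨n * C, by positivity, fun t ht e => ⟨∑ k, (e k : ℂ) • Matrix.of fun i j =>
    derivWithin (fun τ => A k τ i j) (Ici 0) t, ?_, ?_⟩⟩
  · exact HasDerivWithinAt.fun_sum fun k _ => ((hA k).hasDerivWithinAt ht).fun_const_smul (e k : ℂ)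
  · refine (norm_sum_le _ _).trans ((Finset.sum_le_sum fun k _ => ?_).trans_eq
      (by rw [Finset.sum_const, Finset.card_univ, Fintype.card_fin, nsmul_eq_mul, mul_assoc,
        mul_assoc] : _ = n * C * (1 / (1 + t)) * ‖e‖))
    rw [norm_smul, Complex.norm_real, mul_comm]
    have h := norm_coord_le e k
    rw [Complex.norm_real] at h
    refine (mul_le_mul (hC k t ht) h (norm_nonneg _) (by positivity)).trans_eq ?_
    ring

theorem exists_deriv_mul_symbolA_pow (hA : ∀ k, MatSymbolClass 0 (A k)) (hB : MatSymbolClass 0 B)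
    (j : ℕ) : ∃ C : ℝ, 0 ≤ C ∧ ∀ t, 0 ≤ t → ∀ e : Space n, ‖e‖ = 1 →
      ‖B t * symbolA A t e ^ j‖ ≤ C ∧ ∃ X' : Mat d,
        HasDerivWithinAt (fun τ => B τ * symbolA A τ e ^ j) X' (Ici 0) t ∧
        ‖X'‖ ≤ C * (1 / (1 + t)) := by
  induction j with
  | zero =>
    obtain ⟨b, hb0, hb⟩ := hB.norm_bound
    have h1 : MatSymbolClass 1 (fun t => (Matrix.of fun i j =>
        derivWithin (fun τ => B τ i j) (Ici 0) t : Mat d)) := fun i j => (hB i j).derivWithin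
    obtain ⟨b', hb'0, hb'⟩ := h1.norm_bound
    refine ⟨b + b', by positivity, fun t ht e he => ⟨?_, Matrix.of fun i j =>
      derivWithin (fun τ => B τ i j) (Ici 0) t, ?_, ?_⟩⟩
    · have := hb t ht
      simp only [pow_zero, mul_one] at this ⊢
      linarith
    · simpa only [pow_zero, mul_one] using hB.hasDerivWithinAt ht
    · refine (hb' t ht).trans ?_
      rw [pow_one]
      gcongr
      linarith
  | succ j ih =>
    obtain ⟨C, hC0, hC⟩ := ih
    obtain ⟨a, ha0, ha⟩ := symbolA_bound hA
    obtain ⟨a', ha'0, ha'⟩ := exists_hasDerivWithinAt_symbolA hA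
    refine ⟨C * a + C * a', by positivity, fun t ht e he => ?_⟩
    obtain ⟨h1, X', h2, h3⟩ := hC t ht e he
    obtain ⟨Y', h4, h5⟩ := ha' t ht e
    have h6 := ha t ht e
    rw [he, mul_one] at h5 h6
    have hτ : 0 ≤ 1 / (1 + t) := by positivity
    refine ⟨?_, X' * symbolA A t e + B t * symbolA A t e ^ j * Y', ?_, ?_⟩
    · rw [pow_succ, ← Matrix.mul_assoc]
      refine (norm_mul_le_of_le h1 h6).trans ?_
      nlinarith [mul_nonneg hC0 ha'0]
    · simp only [pow_succ, ← Matrix.mul_assoc]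
      exact h2.mul h4
    · refine (norm_add_le_of_le (norm_mul_le_of_le h3 h6) (norm_mul_le_of_le h1 h5)).trans_eq ?_
      ring

variable {V : Type*} [NormedAddCommGroup V] [InnerProductSpace ℂ V]

theorem hasDerivWithinAt_im_inner {f g : ℝ → V} {f' g' : V} {s : Set ℝ} {t : ℝ}
    (hf : HasDerivWithinAt f f' s t) (hg : HasDerivWithinAt g g' s t) :
    HasDerivWithinAt (fun τ => (inner ℂ (f τ) (g τ)).im)
      ((inner ℂ (f t) g').im + (inner ℂ f' (g t)).im) s t := by
  have h := Complex.imCLM.hasFDerivAt.comp_hasDerivWithinAt t (HasDerivWithinAt.inner ℂ hf hg)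
  exact h

/-- Hypocoercive decay for a chain `y₀, …, y_{m+1}` of linear observables of `x`. -/
theorem exists_hypocoercive_decay (m : ℕ) {b c C c₀ T : ℝ} (hb : 0 < b) (hc : 0 < c) (hC : 0 < C)
    (hc₀ : 0 < c₀) (hT : 0 ≤ T) : ∃ l : ℝ, 0 < l ∧ ∃ T₁ : ℝ, T ≤ T₁ ∧
    ∀ (r : ℝ), c₀ ≤ r → ∀ (x x' : ℝ → V) (y e : ℕ → ℝ → V),
      (∀ t, T ≤ t → HasDerivWithinAt x (x' t) (Ici T) t) →
      (∀ t, T ≤ t → (inner ℂ (x t) (x' t)).re ≤ -(b * ‖y 0 t‖ ^ 2)) →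
      (∀ j t, T ≤ t → HasDerivWithinAt (y j) ((I * r) • y (j + 1) t + e j t) (Ici T) t) →
      (∀ j t, j ≤ m → T ≤ t → ‖e j t‖ ≤ C * (1 / (1 + t) * ‖x t‖ + ‖y 0 t‖)) →
      (∀ j t, j ≤ m + 1 → T ≤ t → ‖y j t‖ ≤ C * ‖x t‖) →
      (∀ t, T ≤ t → ‖x t‖ ^ 2 ≤ c * ∑ j ∈ Finset.range (m + 1), ‖y j t‖ ^ 2) →
      ∀ t, T₁ ≤ t → ‖x t‖ ^ 2 ≤ 3 * ‖x T₁‖ ^ 2 * Real.exp (-l * (t - T₁)) := by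
  -- With this `η` the uncontrolled last link satisfies `η ‖y (m+1)‖² ≤ ‖x‖² / (2c)`, half of what
  -- coercivity provides.
  obtain ⟨K, hK, w, hw, hwt⟩ := exists_weights m (1 / (2 * c * C ^ 2)) (by positivity)
  set D : ℝ := 2 * (∑ j ∈ Finset.range m, w j) * C ^ 2 with hD
  have hw0 : 0 ≤ ∑ j ∈ Finset.range m, w j := Finset.sum_nonneg fun j _ => hw j
  have hD0 : 0 ≤ D := by positivity
  set D' : ℝ := D / c₀ with hD'
  have hD'0 : 0 ≤ D' := by positivity
  -- The first bound lets the genuine dissipation `2b ‖y 0‖²` absorb all error terms in `y 0`. The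
  -- second makes the corrected energy lie between half and three halves of `‖x‖²`, whence the
  -- factor `3` in the conclusion.
  set ε : ℝ := min (2 * b / (K + 1 + 2 * c * D' ^ 2)) (1 / (2 * D' + 1)) with hε
  have hε0 : 0 < ε := lt_min (by positivity) (by positivity)
  have hε1 : ε * (K + 1 + 2 * c * D' ^ 2) ≤ 2 * b :=
    (le_div_iff₀ (by positivity)).1 (min_le_left _ _)
  have hε2 : ε * D' ≤ 1 / 2 := by
    have := (le_div_iff₀ (by positivity)).1 (min_le_right (2 * b / (K + 1 + 2 * c * D' ^ 2))
      (1 / (2 * D' + 1)))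
    rw [← hε] at this
    linarith
  -- From time `8cD'` on, the errors caused by the time dependence of the coefficients are at most a
  -- small fraction of the coercive term.
  refine ⟨ε / (6 * c), by positivity, max T (8 * c * D'), le_max_left _ _,
    fun r hr x x' y e hx hxx hy he hyC hcoer => ?_⟩
  have hr0 : 0 < r := hc₀.trans_le hr
  have hεr : ε / r * D ≤ ε * D' := by
    rw [hD', ← mul_div_assoc, div_mul_eq_mul_div]
    gcongr
  set T₁ := max T (8 * c * D') with hT₁
  have hTT : T ≤ T₁ := le_max_left _ _
  -- Differentiating `Im ⟨yⱼ, yⱼ₊₁⟩` yields `-r ‖yⱼ₊₁‖²` plus at most `r ‖yⱼ‖ ‖yⱼ₊₂‖` and errors.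
  -- The correction is later multiplied by `ε / r`, so the gain does not depend on `r`, while the
  -- errors stay bounded since `r ≥ c₀`.
  set S : ℝ → ℝ := fun t => ∑ j ∈ Finset.range m, w j * (inner ℂ (y j t) (y (j + 1) t)).im with hS
  set S' : ℝ → ℝ := fun t => ∑ j ∈ Finset.range m, w j *
    ((inner ℂ (y j t) ((I * r) • y (j + 1 + 1) t + e (j + 1) t)).im +
      (inner ℂ ((I * r) • y (j + 1) t + e j t) (y (j + 1) t)).im) with hS'
  have hSd : ∀ t, T ≤ t → HasDerivWithinAt S (S' t) (Ici T) t := fun t ht =>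
    HasDerivWithinAt.fun_sum fun j _ =>
      (hasDerivWithinAt_im_inner (hy j t ht) (hy (j + 1) t ht)).const_mul (w j)
  have hSb : ∀ t, T ≤ t → |S t| ≤ D / 2 * ‖x t‖ ^ 2 := by
    intro t ht
    have : D / 2 * ‖x t‖ ^ 2 = ∑ j ∈ Finset.range m, w j * ((C * ‖x t‖) * (C * ‖x t‖)) := by
      rw [← Finset.sum_mul, hD]; ring
    rw [this]
    refine (Finset.abs_sum_le_sum_abs _ _).trans (Finset.sum_le_sum fun j hj => ?_)
    have hj' := Finset.mem_range.1 hj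
    rw [abs_mul, abs_of_nonneg (hw j)]
    refine mul_le_mul_of_nonneg_left ?_ (hw j)
    exact ((Complex.abs_im_le_norm _).trans (norm_inner_le_norm _ _)).trans
      (mul_le_mul (hyC j t (by omega) ht) (hyC (j + 1) t (by omega) ht) (norm_nonneg _)
        (by positivity))
  have hS'b : ∀ t, T ≤ t → S' t ≤ -r * (‖x t‖ ^ 2 / (2 * c) - (K + 1) * ‖y 0 t‖ ^ 2) +
      D * (1 / (1 + t) * ‖x t‖ ^ 2 + ‖y 0 t‖ * ‖x t‖) := by
    intro t ht
    set R : ℝ := C * (1 / (1 + t) * ‖x t‖ + ‖y 0 t‖) with hR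
    have hR0 : 0 ≤ R := (norm_nonneg _).trans (he 0 t (Nat.zero_le _) ht)
    have h1 : S' t ≤ ∑ j ∈ Finset.range m, (-r * (w j * (‖y (j + 1) t‖ ^ 2 - ‖y j t‖ *
        ‖y (j + 2) t‖)) + w j * (2 * (C * ‖x t‖ * R))) := by
      refine Finset.sum_le_sum fun j hj => ?_
      have hj' := Finset.mem_range.1 hj
      have e1 : (inner ℂ (y j t) ((I * r) • y (j + 1 + 1) t + e (j + 1) t)).im ≤
          r * (‖y j t‖ * ‖y (j + 2) t‖) + C * ‖x t‖ * R := by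
        rw [inner_add_right, inner_smul_right, Complex.add_im, mul_assoc, Complex.I_mul_im,
          Complex.re_ofReal_mul]
        refine add_le_add (mul_le_mul_of_nonneg_left ((Complex.re_le_norm _).trans
          (norm_inner_le_norm _ _)) hr0.le) ?_
        exact ((Complex.abs_im_le_norm _).trans (norm_inner_le_norm _ _)).trans' (le_abs_self _)
          |>.trans (mul_le_mul (hyC j t (by omega) ht) (he (j + 1) t (by omega) ht)
            (norm_nonneg _) (by positivity))
      have e2 : (inner ℂ ((I * r) • y (j + 1) t + e j t) (y (j + 1) t)).im ≤
          -r * ‖y (j + 1) t‖ ^ 2 + C * ‖x t‖ * R := by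
        rw [inner_add_left, inner_smul_left, inner_self_eq_norm_sq_to_K, Complex.add_im]
        refine add_le_add (le_of_eq ?_) ?_
        · have : (starRingEnd ℂ) (I * r) * ((‖y (j + 1) t‖ : ℝ) : ℂ) ^ 2 =
              ((-r * ‖y (j + 1) t‖ ^ 2 : ℝ) : ℂ) * I := by
            rw [map_mul, Complex.conj_I, Complex.conj_ofReal]
            push_cast
            ring
          refine (congrArg Complex.im this).trans ?_
          rw [Complex.im_ofReal_mul, Complex.I_im, mul_one]
        · rw [mul_comm]
          exact ((Complex.abs_im_le_norm _).trans (norm_inner_le_norm _ _)).trans' (le_abs_self _)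
            |>.trans (mul_le_mul (he j t (by omega) ht) (hyC (j + 1) t (by omega) ht)
              (norm_nonneg _) hR0)
      have := mul_le_mul_of_nonneg_left (add_le_add e1 e2) (hw j)
      refine this.trans_eq ?_
      ring
    have h2 := hwt fun j => ‖y j t‖
    have h3 := hcoer t ht
    rw [Finset.sum_range_succ'] at h3
    have h4 : 1 / (2 * c * C ^ 2) * ‖y (m + 1) t‖ ^ 2 ≤ ‖x t‖ ^ 2 / (2 * c) := by
      have e1 := pow_le_pow_left₀ (norm_nonneg _) (hyC (m + 1) t le_rfl ht) 2
      refine (mul_le_mul_of_nonneg_left e1 (by positivity)).trans_eq ?_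
      field_simp
    have h5 : ‖x t‖ ^ 2 / c - ‖y 0 t‖ ^ 2 ≤ ∑ j ∈ Finset.range m, ‖y (j + 1) t‖ ^ 2 := by
      rw [sub_le_iff_le_add, div_le_iff₀ hc]
      linarith
    have h6 : ‖x t‖ ^ 2 / (2 * c) - (K + 1) * ‖y 0 t‖ ^ 2 ≤
        ∑ j ∈ Finset.range m, w j * (‖y (j + 1) t‖ ^ 2 - ‖y j t‖ * ‖y (j + 2) t‖) := by
      have e1 : ‖x t‖ ^ 2 / c = 2 * (‖x t‖ ^ 2 / (2 * c)) := by field_simp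
      linarith
    rw [Finset.sum_add_distrib, ← Finset.mul_sum, ← Finset.sum_mul] at h1
    have h7 := mul_le_mul_of_nonneg_left h6 hr0.le
    refine h1.trans ?_
    have e2 : (∑ j ∈ Finset.range m, w j) * (2 * (C * ‖x t‖ * R)) =
        D * (1 / (1 + t) * ‖x t‖ ^ 2 + ‖y 0 t‖ * ‖x t‖) := by
      rw [hD, hR]; ring
    rw [e2]
    linarith
  set L : ℝ → ℝ := fun t => ‖x t‖ ^ 2 + ε / r * S t with hL
  have hLb : ∀ t, T ≤ t → |ε / r * S t| ≤ 1 / 2 * ‖x t‖ ^ 2 := by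
    intro t ht
    rw [abs_mul, abs_of_pos (by positivity)]
    have e1 := mul_le_mul_of_nonneg_left (hSb t ht) (show 0 ≤ ε / r by positivity)
    have e2 := mul_le_mul_of_nonneg_right (hεr.trans hε2) (sq_nonneg ‖x t‖)
    nlinarith [sq_nonneg ‖x t‖]
  have hLd : ∀ t, T₁ ≤ t → HasDerivWithinAt L
      (2 * (inner ℂ (x t) (x' t)).re + ε / r * S' t) (Ici T₁) t := fun t ht =>
    ((hasDerivWithinAt_norm_sq (hx t (hTT.trans ht))).add
      ((hSd t (hTT.trans ht)).const_mul (ε / r))).mono (Ici_subset_Ici.2 hTT)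
  have hdecay : ∀ t, T₁ ≤ t → 2 * (inner ℂ (x t) (x' t)).re + ε / r * S' t ≤
      -(ε / (6 * c)) * L t + 0 := by
    intro t ht
    have htT := hTT.trans ht
    have ht0 : 0 ≤ t := hT.trans htT
    have e1 := hxx t htT
    have e2 := mul_le_mul_of_nonneg_left (hS'b t htT) (show 0 ≤ ε / r by positivity)
    have e3 : ε / r * (-r * (‖x t‖ ^ 2 / (2 * c) - (K + 1) * ‖y 0 t‖ ^ 2) +
        D * (1 / (1 + t) * ‖x t‖ ^ 2 + ‖y 0 t‖ * ‖x t‖)) =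
        -ε * (‖x t‖ ^ 2 / (2 * c) - (K + 1) * ‖y 0 t‖ ^ 2) +
        ε / r * D * (1 / (1 + t) * ‖x t‖ ^ 2 + ‖y 0 t‖ * ‖x t‖) := by field_simp
    have e4 : ε / r * D * (1 / (1 + t) * ‖x t‖ ^ 2 + ‖y 0 t‖ * ‖x t‖) ≤
        ε * D' * (1 / (1 + t) * ‖x t‖ ^ 2 + ‖y 0 t‖ * ‖x t‖) :=
      mul_le_mul_of_nonneg_right hεr (by positivity)
    have e5 : D' * (1 / (1 + t)) ≤ 1 / (8 * c) := by
      have : 8 * c * D' ≤ t := (le_max_right _ _).trans ht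
      rw [mul_one_div, div_le_div_iff₀ (by positivity) (by positivity)]
      linarith
    have e6 : D' * (‖y 0 t‖ * ‖x t‖) ≤ 1 / (8 * c) * ‖x t‖ ^ 2 + 2 * c * D' ^ 2 * ‖y 0 t‖ ^ 2 := by
      have : 1 / (8 * c) * ‖x t‖ ^ 2 + 2 * c * D' ^ 2 * ‖y 0 t‖ ^ 2 - D' * (‖y 0 t‖ * ‖x t‖) =
        (‖x t‖ - 4 * c * D' * ‖y 0 t‖) ^ 2 / (8 * c) := by field_simp; ring
      have : 0 ≤ (‖x t‖ - 4 * c * D' * ‖y 0 t‖) ^ 2 / (8 * c) := by positivity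
      linarith
    have e7 : ε * D' * (1 / (1 + t) * ‖x t‖ ^ 2 + ‖y 0 t‖ * ‖x t‖) ≤
        ε * (1 / (4 * c) * ‖x t‖ ^ 2 + 2 * c * D' ^ 2 * ‖y 0 t‖ ^ 2) := by
      have f1 := mul_le_mul_of_nonneg_right e5 (sq_nonneg ‖x t‖)
      have f2 : 1 / (4 * c) * ‖x t‖ ^ 2 = 2 * (1 / (8 * c) * ‖x t‖ ^ 2) := by field_simp; ring
      rw [mul_assoc, mul_add]
      refine mul_le_mul_of_nonneg_left ?_ hε0.le
      linarith
    have e8 := mul_le_mul_of_nonneg_right hε1 (sq_nonneg ‖y 0 t‖)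
    have e9 := (abs_le.1 (hLb t htT)).2
    have e10 : ε / (6 * c) * L t ≤ ε / (6 * c) * (3 / 2 * ‖x t‖ ^ 2) :=
      mul_le_mul_of_nonneg_left (by simp only [hL]; linarith) (by positivity)
    have e11 : ε / (6 * c) * (3 / 2 * ‖x t‖ ^ 2) = ε * (1 / (4 * c) * ‖x t‖ ^ 2) := by
      field_simp; ring
    have e12 : ε * (‖x t‖ ^ 2 / (2 * c)) = 2 * (ε * (1 / (4 * c) * ‖x t‖ ^ 2)) := by
      field_simp; ring
    rw [e3] at e2
    linarith
  intro t ht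
  have key := le_of_deriv_le (f := L) (α := fun s => -(ε / (6 * c)) * s) (b := fun _ => 0)
    (a := fun _ => -(ε / (6 * c))) (φ := fun s => L T₁ * Real.exp (-(ε / (6 * c)) * (s - T₁)))
    (φ' := fun s => L T₁ * (Real.exp (-(ε / (6 * c)) * (s - T₁)) * (-(ε / (6 * c)) * 1)))
    (t₁ := t) (fun s hs _ => hLd s hs)
    (fun s hs _ => by simpa using (hasDerivWithinAt_id s (Ici T₁)).const_mul (-(ε / (6 * c))))
    (fun s hs _ => ((((hasDerivWithinAt_id s (Ici T₁)).sub_const T₁).const_mul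
      (-(ε / (6 * c)))).exp).const_mul (L T₁))
    (fun s hs _ => hdecay s hs) (fun s hs _ => le_of_eq (by ring)) (by simp) t ht le_rfl
  have f1 := (abs_le.1 (hLb t (hTT.trans ht))).1
  have f2 := (abs_le.1 (hLb T₁ hTT)).2
  have f3 := Real.exp_pos (-(ε / (6 * c)) * (t - T₁))
  have f4 : L T₁ * Real.exp (-(ε / (6 * c)) * (t - T₁)) ≤
      3 / 2 * ‖x T₁‖ ^ 2 * Real.exp (-(ε / (6 * c)) * (t - T₁)) :=
    mul_le_mul_of_nonneg_right (by simp only [hL]; linarith) f3.le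
  simp only [hL] at key f4
  linarith

theorem hasDerivWithinAt_act {X : ℝ → Mat d} {X' : Mat d} {x : ℝ → EuclideanSpace ℂ (Fin d)}
    {x' : EuclideanSpace ℂ (Fin d)} {s : Set ℝ} {t : ℝ} (hX : HasDerivWithinAt X X' s t)
    (hx : HasDerivWithinAt x x' s t) :
    HasDerivWithinAt (fun τ => act (X τ) (x τ)) (act X' (x t) + act (X t) x') s t := by
  have hx' : ∀ j, HasDerivWithinAt (fun τ => x τ j) (x' j) s t := fun j =>
    (PiLp.proj (𝕜 := ℝ) 2 (fun _ : Fin d => ℂ) j).hasFDerivAt.comp_hasDerivWithinAt t hx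
  have h : HasDerivWithinAt (fun τ i => ∑ j, X τ i j * x τ j)
      (fun i => ∑ j, (X' i j * x t j + X t i j * x' j)) s t :=
    hasDerivWithinAt_pi.2 fun i => HasDerivWithinAt.fun_sum fun j _ =>
      (hasDerivWithinAt_matrix.1 hX i j).mul (hx' j)
  have h2 := (PiLp.continuousLinearEquiv 2 ℝ (fun _ : Fin d => ℂ)).symm.hasFDerivAt
    |>.comp_hasDerivWithinAt t h
  refine h2.congr_deriv ?_
  ext i
  simp only [Finset.sum_add_distrib]
  rfl

theorem norm_le_of_system (hB1 : CondB1 A B) {ξ : Space n} {x : ℝ → EuclideanSpace ℂ (Fin d)}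
    (hx : ∀ t, 0 ≤ t → HasDerivWithinAt x (I • act (symbolA A t ξ + I • B t) (x t)) (Ici 0) t)
    {t : ℝ} (ht : 0 ≤ t) : ‖x t‖ ≤ ‖x 0‖ :=
  norm_le_of_re_inner_deriv_le (a := fun _ => 0) (b := fun _ => 0) (α := fun _ => 0)
    (φ := fun _ => ‖x 0‖) (φ' := fun _ => 0) (t₁ := t) (fun s hs _ => hx s hs)
    (fun s _ _ => hasDerivWithinAt_const s _ _) (fun s _ _ => hasDerivWithinAt_const s _ _)
    (fun s hs _ => by
      rw [re_inner_system_eq hB1 hs]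
      have := inner_act_nonneg hB1 hs (x s)
      linarith) (fun s _ _ => by simp) (fun s _ _ => norm_nonneg _) le_rfl t ht le_rfl

theorem symbolA_smul (A : Fin n → ℝ → Mat d) (s t : ℝ) (ξ : Space n) :
    symbolA A t (s • ξ) = (s : ℂ) • symbolA A t ξ := by
  rw [symbolA, symbolA, Finset.smul_sum]
  refine Finset.sum_congr rfl fun k _ => ?_
  rw [smul_smul]
  simp

/-- Exponential decay of the solutions away from the zero frequency. -/
theorem exists_norm_le_exp [NeZero d] (hA : ∀ k, MatSymbolClass 0 (A k)) (hB : MatSymbolClass 0 B)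
    (hB1 : CondB1 A B) (hB3 : CondB3 A B) {c₀ : ℝ} (hc₀ : 0 < c₀) :
    ∃ l : ℝ, 0 < l ∧ ∃ C : ℝ, 0 < C ∧ ∀ ξ : Space n, c₀ ≤ ‖ξ‖ →
      ∀ x : ℝ → EuclideanSpace ℂ (Fin d),
      (∀ t, 0 ≤ t → HasDerivWithinAt x (I • act (symbolA A t ξ + I • B t) (x t)) (Ici 0) t) →
      ∀ t, 0 ≤ t → ‖x t‖ ≤ C * Real.exp (-(l * t)) * ‖x 0‖ := by
  obtain ⟨m, hm⟩ : ∃ m, d = m + 1 := ⟨d - 1, (Nat.succ_pred_eq_of_ne_zero (NeZero.ne d)).symm⟩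
  obtain ⟨b, hb0, hb⟩ := hB.norm_bound
  simp only [pow_zero, mul_one] at hb
  choose C hC0 hC using exists_deriv_mul_symbolA_pow (A := A) hA hB
  choose! hCb X' hX' hX'b using hC
  obtain ⟨c, hc, T, hT, hcoer⟩ := hB3 (fun _ => 1) (fun _ => one_pos)
  set C₁ : ℝ := ∑ j ∈ Finset.range (m + 2), C j + 1 with hC₁
  have hC₁0 : 0 < C₁ := by
    have : 0 ≤ ∑ j ∈ Finset.range (m + 2), C j := Finset.sum_nonneg fun j _ => hC0 j
    positivity
  have hCC : ∀ j ≤ m + 1, C j ≤ C₁ := fun j hj =>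
    (Finset.single_le_sum (f := C) (fun j _ => hC0 j) (Finset.mem_range.2 (by omega))).trans
      (le_add_of_nonneg_right zero_le_one)
  obtain ⟨l, hl, T₁, hTT, key⟩ := exists_hypocoercive_decay (V := EuclideanSpace ℂ (Fin d)) m
    (b := 1 / (b + 1)) (c := c) (C := C₁) (c₀ := c₀) (T := T) (by positivity) hc hC₁0 hc₀ hT
  have hT₁ := hT.trans hTT
  refine ⟨l / 2, by positivity, 2 * Real.exp (l / 2 * T₁), by positivity, fun ξ hξ x hx => ?_⟩
  have hr0 : 0 < ‖ξ‖ := hc₀.trans_le hξ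
  set u : Space n := ‖ξ‖⁻¹ • ξ with hu
  have hu1 : ‖u‖ = 1 := by rw [hu, norm_smul, norm_inv, norm_norm, inv_mul_cancel₀ hr0.ne']
  have hξu : ξ = ‖ξ‖ • u := by rw [hu, smul_smul, mul_inv_cancel₀ hr0.ne', one_smul]
  have hAu : ∀ t, symbolA A t ξ = (‖ξ‖ : ℂ) • symbolA A t u := fun t => by
    conv_lhs => rw [hξu, symbolA_smul]
  -- The chain is `yⱼ = B A(u)ʲ x` with `u = ξ/‖ξ‖`. Its error consists of the time derivative of `B
  -- A(u)ʲ`, of size `(1+t)⁻¹`, and of `-B A(u)ʲ B x`, which is controlled by `y₀ = B x`. With `d =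
  -- m + 1`, the first `m + 1` links are precisely the terms of the Kalman condition.
  have hdec := key ‖ξ‖ hξ x (fun t => I • act (symbolA A t ξ + I • B t) (x t))
    (fun j t => act (B t * symbolA A t u ^ j) (x t))
    (fun j t => act (X' j t u) (x t) - act (B t * symbolA A t u ^ j) (act (B t) (x t)))
    (fun t ht => (hx t (hT.trans ht)).mono (Ici_subset_Ici.2 hT))
    (fun t ht => by
      have ht0 := hT.trans ht
      rw [re_inner_system_eq hB1 ht0, pow_zero, mul_one]
      have h1 := norm_act_sq_le_of_posSemidef (hB1 t ht0).2 (x t)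
      have h2 := inner_act_nonneg hB1 ht0 (x t)
      have h3 := hb t ht0
      rw [neg_le_neg_iff, one_div_mul_eq_div, div_le_iff₀ (by positivity)]
      nlinarith)
    (fun j t ht => by
      have ht0 := hT.trans ht
      refine ((hasDerivWithinAt_act (hX' j t ht0 u hu1) (hx t ht0)).mono
        (Ici_subset_Ici.2 hT)).congr_deriv ?_
      rw [hAu, act_add, act_smul, act_smul, smul_add, smul_smul, smul_smul, I_mul_I, map_add, map_smul,
        neg_one_smul, map_neg, ← act_mul, pow_succ, ← Matrix.mul_assoc]
      abel)
    (fun j t hj ht => by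
      have ht0 := hT.trans ht
      refine (norm_sub_le _ _).trans ?_
      rw [pow_zero, mul_one, mul_add]
      refine add_le_add ?_ ?_
      · refine (norm_act_le _ _).trans ?_
        rw [← mul_assoc]
        refine mul_le_mul_of_nonneg_right ((hX'b j t ht0 u hu1).trans ?_) (norm_nonneg _)
        exact mul_le_mul_of_nonneg_right (hCC j (by omega)) (by positivity)
      · exact (norm_act_le _ _).trans (mul_le_mul_of_nonneg_right
          ((hCb j t ht0 u hu1).trans (hCC j (by omega))) (norm_nonneg _)))
    (fun j t hj ht => (norm_act_le _ _).trans (mul_le_mul_of_nonneg_right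
      ((hCb j t (hT.trans ht) u hu1).trans (hCC j hj)) (norm_nonneg _)))
    (fun t ht => by
      have h := (hcoer t ht u hu1 (x t)).1
      simp only [one_mul] at h
      rw [one_div_mul_eq_div, div_le_iff₀ hc, mul_comm] at h
      refine h.trans_eq ?_
      rw [← hm, Finset.sum_range]
      rfl)
  have hexp : Real.exp (-(l / 2 * (T₁ + -T₁))) = 1 := by simp
  intro t ht
  rcases le_total T₁ t with h | h
  · have h1 := hdec t h
    have h2 := norm_le_of_system hB1 hx hT₁
    refine le_of_sq_le_sq (h1.trans ?_) (by positivity)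
    have h3 : Real.exp (-l * (t - T₁)) = (Real.exp (l / 2 * T₁) * Real.exp (-(l / 2 * t))) ^ 2 := by
      rw [← Real.exp_add, sq, ← Real.exp_add]
      congr 1
      ring
    have h4 := pow_le_pow_left₀ (norm_nonneg _) h2 2
    rw [h3]
    have h5 := sq_nonneg (Real.exp (l / 2 * T₁) * Real.exp (-(l / 2 * t)))
    have h6 := mul_le_mul_of_nonneg_right h4 h5
    nlinarith [mul_nonneg (sq_nonneg ‖x 0‖) h5]
  -- Before `T₁` contractivity suffices, since the prefactor `exp(l/2 · T₁)` compensates for the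
  -- exponential.
  · refine (norm_le_of_system hB1 hx ht).trans ?_
    refine le_mul_of_one_le_left (norm_nonneg _) ?_
    rw [mul_assoc, ← Real.exp_add]
    have : 1 ≤ Real.exp (l / 2 * T₁ + -(l / 2 * t)) := Real.one_le_exp (by nlinarith)
    linarith

end Lyapunov

/-! ### Explicit growth and decay estimates for scalar rates -/

section Comparison

variable {V : Type*} [NormedAddCommGroup V] [InnerProductSpace ℂ V]

theorem hasDerivWithinAt_inv_one_add {t : ℝ} (ht : 0 ≤ t) (s : Set ℝ) :
    HasDerivWithinAt (fun t : ℝ => (1 + t)⁻¹) (-((1 + t)⁻¹ ^ 2)) s t := by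
  have h := (((hasDerivAt_id t).const_add 1).fun_inv (by simp; linarith)).hasDerivWithinAt (s := s)
  refine h.congr_deriv ?_
  rw [inv_pow, id, neg_div, one_div]

theorem inv_one_add_le_one {t : ℝ} (ht : 0 ≤ t) : (1 + t)⁻¹ ≤ 1 :=
  inv_le_one_of_one_le₀ (by linarith)

theorem inv_one_add_pos {t : ℝ} (ht : 0 ≤ t) : 0 < (1 + t)⁻¹ := inv_pos.2 (by linarith)

/-- The rate splits into an integrable part, which costs a bounded factor `exp A`, and a constant
part `A ρ`, which costs exponential growth. In the application `ρ = ‖ξ‖³`, and the Gaussian bound on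
`Ξ₂` absorbs that growth. -/
theorem norm_le_of_re_inner_le_integrable {g g' : ℝ → V} {A ρ b t₀ : ℝ} (hA : 0 ≤ A) (hρ : 0 ≤ ρ)
    (hb : 0 ≤ b) (ht₀ : 0 ≤ t₀) (hg : ∀ t, t₀ ≤ t → HasDerivWithinAt g (g' t) (Ici t₀) t)
    (hle : ∀ t, t₀ ≤ t → (inner ℂ (g t) (g' t)).re ≤
      A * ((1 + t)⁻¹ ^ 3 + ρ) * ‖g t‖ ^ 2 + b * ‖g t‖) {t : ℝ} (ht : t₀ ≤ t) :
    ‖g t‖ ≤ (‖g t₀‖ + b * (t - t₀)) * (Real.exp A * Real.exp (A * ρ * (t - t₀))) := by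
  set α : ℝ → ℝ := fun t => A * (-((1 + t)⁻¹ ^ 2 / 2) + ρ * t) with hα
  have hαd : ∀ s, t₀ ≤ s → HasDerivWithinAt α (A * ((1 + s)⁻¹ ^ 3 + ρ)) (Ici t₀) s := by
    intro s hs
    have h := (((((hasDerivWithinAt_inv_one_add (ht₀.trans hs) (Ici t₀)).pow 2).div_const 2).neg).add
      ((hasDerivWithinAt_id s (Ici t₀)).const_mul ρ)).const_mul A
    refine h.congr_deriv ?_
    push_cast
    ring
  have hmono : ∀ s, t₀ ≤ s → 0 ≤ α s - α t₀ := by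
    intro s hs
    have h1 : (1 + s)⁻¹ ^ 2 ≤ (1 + t₀)⁻¹ ^ 2 :=
      pow_le_pow_left₀ (inv_one_add_pos (ht₀.trans hs)).le (by gcongr) 2
    have : α s - α t₀ = A * (((1 + t₀)⁻¹ ^ 2 - (1 + s)⁻¹ ^ 2) / 2 + ρ * (s - t₀)) := by
      simp only [hα]; ring
    rw [this]
    have h2 := mul_nonneg hρ (sub_nonneg.2 hs)
    exact mul_nonneg hA (by linarith)
  have key := norm_le_of_re_inner_deriv_le (b := fun _ => b) (t₁ := t)
    (φ := fun s => (‖g t₀‖ + b * (s - t₀)) * Real.exp (α s - α t₀))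
    (fun s hs _ => hg s hs) (fun s hs _ => hαd s hs)
    (fun s hs _ => ((((hasDerivWithinAt_id s (Ici t₀)).sub_const t₀).const_mul b).const_add
      (‖g t₀‖)).mul ((hαd s hs).sub_const (α t₀)).exp)
    (fun s hs _ => hle s hs) (fun s hs _ => ?_)
    (fun s hs _ => by
      have := mul_nonneg hb (sub_nonneg.2 hs)
      positivity) (by simp) t ht le_rfl
  · refine key.trans (mul_le_mul_of_nonneg_left ?_ ?_)
    · rw [← Real.exp_add]
      refine Real.exp_le_exp.2 ?_
      have h1 := sq_nonneg (1 + t)⁻¹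
      have h2 : (1 + t₀)⁻¹ ^ 2 ≤ 1 := pow_le_one₀ (inv_one_add_pos ht₀).le (inv_one_add_le_one ht₀)
      have : α t - α t₀ = A * (((1 + t₀)⁻¹ ^ 2 - (1 + t)⁻¹ ^ 2) / 2) + A * ρ * (t - t₀) := by
        simp only [hα]; ring
      rw [this]
      have := mul_le_mul_of_nonneg_left (show ((1 + t₀)⁻¹ ^ 2 - (1 + t)⁻¹ ^ 2) / 2 ≤ 1 by linarith) hA
      linarith
    · have := mul_nonneg hb (sub_nonneg.2 ht)
      positivity
  · have h1 := Real.one_le_exp (hmono s hs)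
    simp only [id, mul_one]
    nlinarith [mul_le_mul_of_nonneg_left h1 hb]

/-- The term `(1+t)⁻²` has total integral at most `1`, the constant one contributes linearly in
time, and the common increasing exponential is pulled out at its largest value. -/
theorem norm_le_of_norm_deriv_le_exp {g g' : ℝ → V} {b₁ b₂ l t₀ : ℝ} (hb₁ : 0 ≤ b₁) (hb₂ : 0 ≤ b₂)
    (hl : 0 ≤ l) (ht₀ : 0 ≤ t₀) (hg : ∀ t, t₀ ≤ t → HasDerivWithinAt g (g' t) (Ici t₀) t)
    (hle : ∀ t, t₀ ≤ t → ‖g' t‖ ≤ (b₁ * (1 + t)⁻¹ ^ 2 + b₂) * Real.exp (l * (t - t₀)))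
    (h0 : g t₀ = 0) {t : ℝ} (ht : t₀ ≤ t) :
    ‖g t‖ ≤ (b₁ + b₂ * (t - t₀)) * Real.exp (l * (t - t₀)) := by
  have hmono : ∀ s, t₀ ≤ s → 0 ≤ (1 + t₀)⁻¹ - (1 + s)⁻¹ := fun s hs => by
    have : (1 + s)⁻¹ ≤ (1 + t₀)⁻¹ := by gcongr
    linarith
  have hpos : ∀ s, t₀ ≤ s → 0 ≤ b₁ * ((1 + t₀)⁻¹ - (1 + s)⁻¹) + b₂ * (s - t₀) := fun s hs =>
    add_nonneg (mul_nonneg hb₁ (hmono s hs)) (mul_nonneg hb₂ (sub_nonneg.2 hs))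
  have key := norm_le_of_re_inner_deriv_le (a := fun _ => 0) (α := fun _ => 0) (t₁ := t)
    (b := fun t => (b₁ * (1 + t)⁻¹ ^ 2 + b₂) * Real.exp (l * (t - t₀)))
    (φ := fun s => (b₁ * ((1 + t₀)⁻¹ - (1 + s)⁻¹) + b₂ * (s - t₀)) * Real.exp (l * (s - t₀)))
    (fun s hs _ => hg s hs) (fun s _ _ => hasDerivWithinAt_const s _ _)
    (fun s hs _ => ((((hasDerivWithinAt_inv_one_add (ht₀.trans hs) (Ici t₀)).const_sub
      (1 + t₀)⁻¹).const_mul b₁).add (((hasDerivWithinAt_id s (Ici t₀)).sub_const t₀).const_mul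
      b₂)).mul (((hasDerivWithinAt_id s (Ici t₀)).sub_const t₀).const_mul l).exp)
    (fun s hs _ => ?_) (fun s hs _ => ?_)
    (fun s hs _ => mul_nonneg (hpos s hs) (Real.exp_pos _).le) (by simp [h0]) t ht le_rfl
  · refine key.trans (mul_le_mul_of_nonneg_right ?_ (Real.exp_pos _).le)
    have h1 := inv_one_add_le_one ht₀
    have h2 := inv_one_add_pos (ht₀.trans ht)
    have := mul_le_mul_of_nonneg_left (show (1 + t₀)⁻¹ - (1 + t)⁻¹ ≤ 1 by linarith) hb₁
    linarith
  · rw [zero_mul, zero_add]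
    refine (Complex.re_le_norm _).trans ((norm_inner_le_norm _ _).trans ?_)
    rw [mul_comm]
    exact mul_le_mul_of_nonneg_right (hle s hs) (norm_nonneg _)
  · have h1 := mul_nonneg (mul_nonneg (hpos s hs) (Real.exp_pos (l * (s - t₀))).le) hl
    simp only [id, mul_one, neg_neg, Pi.add_apply]
    linarith

/-- The right-hand side is a supersolution: half of the damping `κ` pays for the source, the other
half for the decrease of `(1+t)⁻¹`, which is slow because `(1+t)⁻¹ ≤ κ / 2` from `t₀` on. -/
theorem norm_le_of_re_inner_le_damped {g g' : ℝ → V} {κ b ρ l t₀ C : ℝ}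
    (hρ : 0 ≤ ρ) (hl : 0 ≤ l) (ht₀ : 0 ≤ t₀) (hC : 0 ≤ C) (hκ : (1 + t₀)⁻¹ ≤ κ / 2)
    (hbC : b ≤ C * (κ / 2)) (h0 : ‖g t₀‖ ≤ C * (1 + t₀)⁻¹)
    (hg : ∀ t, t₀ ≤ t → HasDerivWithinAt g (g' t) (Ici t₀) t)
    (hle : ∀ t, t₀ ≤ t → (inner ℂ (g t) (g' t)).re ≤ -κ * ‖g t‖ ^ 2 +
      b * ((1 + t)⁻¹ + ρ) * Real.exp (l * (t - t₀)) * ‖g t‖) {t : ℝ} (ht : t₀ ≤ t) :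
    ‖g t‖ ≤ C * ((1 + t)⁻¹ + ρ) * Real.exp (l * (t - t₀)) := by
  have hκ0 : 0 < κ := by have := inv_one_add_pos ht₀; linarith
  refine norm_le_of_re_inner_deriv_le (a := fun _ => -κ) (α := fun s => -κ * s) (t₁ := t)
    (b := fun t => b * ((1 + t)⁻¹ + ρ) * Real.exp (l * (t - t₀)))
    (φ := fun s => C * ((1 + s)⁻¹ + ρ) * Real.exp (l * (s - t₀)))
    (fun s hs _ => hg s hs)
    (fun s _ _ => by simpa using (hasDerivWithinAt_id s (Ici t₀)).const_mul (-κ))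
    (fun s hs _ => (((hasDerivWithinAt_inv_one_add (ht₀.trans hs) (Ici t₀)).add_const ρ).const_mul
      C).mul (((hasDerivWithinAt_id s (Ici t₀)).sub_const t₀).const_mul l).exp)
    (fun s hs _ => hle s hs) (fun s hs _ => ?_) (fun s hs _ => ?_) ?_ t ht le_rfl
  · have hs0 := inv_one_add_pos (ht₀.trans hs)
    have hsκ : (1 + s)⁻¹ ≤ κ / 2 := le_trans (by gcongr) hκ
    have hE := Real.exp_pos (l * (s - t₀))
    simp only [id, mul_one]
    have h1 : 0 ≤ C * ((1 + s)⁻¹ + ρ) * (Real.exp (l * (s - t₀)) * l) := by positivity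
    have h2 : -κ * (C * ((1 + s)⁻¹ + ρ)) + b * ((1 + s)⁻¹ + ρ) ≤ C * -((1 + s)⁻¹ ^ 2) := by
      have e1 := mul_le_mul_of_nonneg_right hbC (show 0 ≤ (1 + s)⁻¹ + ρ by positivity)
      have e2 := mul_le_mul_of_nonneg_left (mul_le_mul_of_nonneg_left hsκ hs0.le) hC
      have e3 : 0 ≤ C * (κ / 2) * ρ := by positivity
      nlinarith
    have h3 := mul_le_mul_of_nonneg_right h2 hE.le
    linarith
  · have hs0 := inv_one_add_pos (ht₀.trans hs)
    positivity
  · simp only [sub_self, mul_zero, Real.exp_zero, mul_one]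
    have := mul_nonneg hC hρ
    linarith

/-- The increments are bounded by the tail integral `b (1+t)⁻¹`, so the function is Cauchy; letting
the later time tend to infinity gives the rate. -/
theorem exists_tendsto_of_norm_deriv_le [CompleteSpace V] {g g' : ℝ → V} {b t₀ : ℝ} (hb : 0 ≤ b)
    (ht₀ : 0 ≤ t₀) (hg : ∀ t, t₀ ≤ t → HasDerivWithinAt g (g' t) (Ici t₀) t)
    (hle : ∀ t, t₀ ≤ t → ‖g' t‖ ≤ b * (1 + t)⁻¹ ^ 2) :
    ∃ L, Tendsto g atTop (𝓝 L) ∧ ∀ t, t₀ ≤ t → ‖g t - L‖ ≤ b * (1 + t)⁻¹ := by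
  have h1 : ∀ t s, t₀ ≤ t → t ≤ s → ‖g s - g t‖ ≤ b * (1 + t)⁻¹ := by
    intro t s ht hts
    have ht0 := ht₀.trans ht
    refine (norm_le_of_re_inner_deriv_le (g := fun s => g s - g t) (a := fun _ => 0)
      (α := fun _ => 0) (t₀ := t) (t₁ := s) (b := fun s => b * (1 + s)⁻¹ ^ 2)
      (φ := fun s => b * ((1 + t)⁻¹ - (1 + s)⁻¹))
      (fun s hs _ => ((hg s (ht.trans hs)).mono (Ici_subset_Ici.2 ht)).sub_const (g t))
      (fun s _ _ => hasDerivWithinAt_const s _ _)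
      (fun s hs _ => ((hasDerivWithinAt_inv_one_add (ht0.trans hs) (Ici t)).const_sub
        (1 + t)⁻¹).const_mul b) (fun s hs _ => ?_) (fun s hs _ => ?_) (fun s hs _ => ?_) (by simp)
      s hts le_rfl).trans ?_
    · rw [zero_mul, zero_add]
      refine (Complex.re_le_norm _).trans ((norm_inner_le_norm _ _).trans ?_)
      rw [mul_comm]
      exact mul_le_mul_of_nonneg_right (hle s (ht.trans hs)) (norm_nonneg _)
    · simp
    · have : (1 + s)⁻¹ ≤ (1 + t)⁻¹ := by gcongr
      exact mul_nonneg hb (by linarith)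
    · have := inv_one_add_pos (ht0.trans hts)
      exact mul_le_mul_of_nonneg_left (by linarith) hb
  have h2 : Tendsto (fun t : ℝ => b * (1 + t)⁻¹) atTop (𝓝 0) := by
    simpa using (tendsto_inv_atTop_zero.comp (tendsto_atTop_add_const_left atTop 1
      tendsto_id)).const_mul b
  have h3 : CauchySeq g := by
    refine Metric.cauchySeq_iff'.2 fun ε hε => ?_
    obtain ⟨N, hN, hN'⟩ := ((h2.eventually (gt_mem_nhds hε)).and (eventually_ge_atTop t₀)).exists
    exact ⟨N, fun s hs => by rw [dist_eq_norm]; exact (h1 N s hN' hs).trans_lt hN⟩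
  obtain ⟨L, hL⟩ := cauchySeq_tendsto_of_complete h3
  refine ⟨L, hL, fun t ht => ?_⟩
  rw [norm_sub_rev]
  exact le_of_tendsto ((hL.sub_const (g t)).norm)
    ((eventually_ge_atTop t).mono fun s hs => h1 t s ht hs)

end Comparison

/-! ### Perturbed diagonal systems with one undamped component -/

section DiagonalSystem
open scoped Matrix.Norms.L2Operator

variable {d : ℕ}

theorem hasDerivWithinAt_coord {x : ℝ → EuclideanSpace ℂ (Fin d)} {x' : EuclideanSpace ℂ (Fin d)}
    {s : Set ℝ} {t : ℝ} (hx : HasDerivWithinAt x x' s t) (j : Fin d) :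
    HasDerivWithinAt (fun τ => x τ j) (x' j) s t :=
  (PiLp.proj (𝕜 := ℝ) 2 (fun _ : Fin d => ℂ) j).hasFDerivAt.comp_hasDerivWithinAt t hx

theorem norm_le_sum_coord (v : EuclideanSpace ℂ (Fin d)) : ‖v‖ ≤ ∑ j, ‖v j‖ := by
  rw [EuclideanSpace.norm_eq]
  refine Real.sqrt_le_iff.2 ⟨Finset.sum_nonneg fun _ _ => norm_nonneg _, ?_⟩
  exact Finset.sum_sq_le_sq_sum_of_nonneg fun _ _ => norm_nonneg _

theorem act_diagonal (g : Fin d → ℂ) (v : EuclideanSpace ℂ (Fin d)) (j : Fin d) :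
    act (Matrix.diagonal g) v j = g j * v j := by
  rw [act_apply, Finset.sum_eq_single j (fun i _ hi => by
    rw [Matrix.diagonal_apply_ne _ hi.symm, zero_mul]) (by simp), Matrix.diagonal_apply_eq]

theorem re_conj_mul_I_mul (z g : ℂ) : (inner ℂ z (I * (g * z))).re = -g.im * ‖z‖ ^ 2 := by
  have : I * (g * z) * (starRingEnd ℂ) z = ((‖z‖ ^ 2 : ℝ) : ℂ) * (I * g) := by
    have h := Complex.mul_conj' z
    push_cast
    rw [← h]
    ring
  rw [RCLike.inner_apply, this, Complex.re_ofReal_mul, Complex.I_mul_re]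
  ring

theorem re_inner_diagonal_nonpos {g : Fin d → ℂ} (hg : ∀ j, 0 ≤ (g j).im)
    (v : EuclideanSpace ℂ (Fin d)) : (inner ℂ v (I • act (Matrix.diagonal g) v)).re ≤ 0 := by
  rw [PiLp.inner_apply, Complex.re_sum]
  refine Finset.sum_nonpos fun j _ => ?_
  rw [PiLp.smul_apply, act_diagonal, smul_eq_mul, re_conj_mul_I_mul]
  nlinarith [hg j, sq_nonneg ‖v j‖]

theorem norm_diagonal_le {g : Fin d → ℂ} {b : ℝ} (hb : 0 ≤ b) (hg : ∀ j, ‖g j‖ ≤ b) :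
    ‖(Matrix.diagonal g : Mat d)‖ ≤ b := by
  rw [Matrix.l2_opNorm_diagonal]
  exact (pi_norm_le_iff_of_nonneg hb).2 hg

theorem re_inner_act_le (X : Mat d) (v w : EuclideanSpace ℂ (Fin d)) :
    (inner ℂ v (I • act X w)).re ≤ ‖X‖ * ‖w‖ * ‖v‖ := by
  refine (Complex.re_le_norm _).trans ((norm_inner_le_norm _ _).trans ?_)
  rw [norm_smul, Complex.norm_I, one_mul, mul_comm]
  exact mul_le_mul_of_nonneg_right (norm_act_le X w) (norm_nonneg _)

variable {A ρ t₀ : ℝ} {g : Fin d → ℝ → ℂ} {R : ℝ → Mat d} {z : ℝ → EuclideanSpace ℂ (Fin d)}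

/-- Diagonal entries with non-negative imaginary part do not increase the norm, so only the
remainder matters. -/
theorem norm_le_of_diagonal_system (hA : 0 ≤ A) (hρ : 0 ≤ ρ) (ht₀ : 0 ≤ t₀)
    (hg : ∀ j t, t₀ ≤ t → 0 ≤ (g j t).im) (hR : ∀ t, t₀ ≤ t → ‖R t‖ ≤ A * ((1 + t)⁻¹ ^ 3 + ρ))
    (hz : ∀ t, t₀ ≤ t → HasDerivWithinAt z
      (I • act (Matrix.diagonal (fun j => g j t) + R t) (z t)) (Ici t₀) t)
    {t : ℝ} (ht : t₀ ≤ t) :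
    ‖z t‖ ≤ ‖z t₀‖ * (Real.exp A * Real.exp (A * ρ * (t - t₀))) := by
  have h := norm_le_of_re_inner_le_integrable hA hρ le_rfl ht₀ hz (fun s hs => ?_) ht
  · simpa using h
  · rw [act_add, smul_add, inner_add_right, Complex.add_re]
    have h1 := re_inner_diagonal_nonpos (fun j => hg j s hs) (z s)
    have h2 := re_inner_act_le (R s) (z s) (z s)
    have h3 := mul_le_mul_of_nonneg_right (hR s hs) (sq_nonneg ‖z s‖)
    nlinarith

theorem hasDerivWithinAt_zeroth_coord [NeZero d] (hg0 : ∀ t, t₀ ≤ t → g 0 t = 0)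
    (hz : ∀ t, t₀ ≤ t → HasDerivWithinAt z
      (I • act (Matrix.diagonal (fun j => g j t) + R t) (z t)) (Ici t₀) t)
    {t : ℝ} (ht : t₀ ≤ t) : HasDerivWithinAt (fun s => z s 0) (I * act (R t) (z t) 0) (Ici t₀) t := by
  refine (hasDerivWithinAt_coord (hz t ht) 0).congr_deriv ?_
  rw [PiLp.smul_apply, act_add, PiLp.add_apply, act_diagonal, hg0 t ht, zero_mul, zero_add,
    smul_eq_mul]

theorem norm_act_coord_le (X : Mat d) (v : EuclideanSpace ℂ (Fin d)) (j : Fin d) :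
    ‖act X v j‖ ≤ ‖X‖ * ‖v‖ := (PiLp.norm_apply_le _ j).trans (norm_act_le X v)

/-- The leading diagonal entry is zero, so the leading component changes only through the remainder,
which is integrable while the solution stays bounded. Applied at `ξ = 0`, this yields the limit
`W₂`. -/
theorem exists_tendsto_zeroth_coord [NeZero d] (hA : 0 ≤ A) (ht₀ : 0 ≤ t₀)
    (hg : ∀ j t, t₀ ≤ t → 0 ≤ (g j t).im) (hg0 : ∀ t, t₀ ≤ t → g 0 t = 0)
    (hR : ∀ t, t₀ ≤ t → ‖R t‖ ≤ A * (1 + t)⁻¹ ^ 3)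
    (hz : ∀ t, t₀ ≤ t → HasDerivWithinAt z
      (I • act (Matrix.diagonal (fun j => g j t) + R t) (z t)) (Ici t₀) t) :
    ∃ L, Tendsto (fun t => z t 0) atTop (𝓝 L) ∧
      ∀ t, t₀ ≤ t → ‖z t 0 - L‖ ≤ A * (‖z t₀‖ * Real.exp A) * (1 + t)⁻¹ := by
  refine exists_tendsto_of_norm_deriv_le (by positivity) ht₀
    (fun t ht => hasDerivWithinAt_zeroth_coord hg0 hz ht) fun t ht => ?_
  have h1 := norm_le_of_diagonal_system (ρ := 0) hA le_rfl ht₀ hg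
    (fun s hs => by simpa using hR s hs) hz ht
  rw [mul_zero, zero_mul, Real.exp_zero, mul_one] at h1
  have hτ := inv_one_add_pos (ht₀.trans ht)
  rw [norm_mul, Complex.norm_I, one_mul]
  refine (norm_act_coord_le _ _ _).trans ((mul_le_mul (hR t ht) h1 (norm_nonneg _)
    (by positivity)).trans ?_)
  have h2 : (1 + t)⁻¹ ^ 3 ≤ (1 + t)⁻¹ ^ 2 :=
    pow_le_pow_of_le_one hτ.le (inv_one_add_le_one (ht₀.trans ht)) (by norm_num)
  calc A * (1 + t)⁻¹ ^ 3 * (‖z t₀‖ * Real.exp A) =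
      A * (‖z t₀‖ * Real.exp A) * (1 + t)⁻¹ ^ 3 := by ring
    _ ≤ _ := mul_le_mul_of_nonneg_left h2 (by positivity)

/-- The leading component converges and the other ones decay, uniformly in the parameter `r`. -/
theorem exists_norm_sub_limit_le [NeZero d] {κ : ℝ} (hA : 0 ≤ A) (hκ : 0 < κ) (ht₀ : 0 ≤ t₀)
    (hκt : (1 + t₀)⁻¹ ≤ κ / 2) : ∃ C : ℝ, 0 ≤ C ∧
    ∀ (r : ℝ) (g g₀ : Fin d → ℝ → ℂ) (R R₀ : ℝ → Mat d) (z z₀ : ℝ → EuclideanSpace ℂ (Fin d))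
      (L : ℂ), 0 ≤ r → r ≤ 1 →
      (∀ t, t₀ ≤ t → g 0 t = 0) → (∀ t, t₀ ≤ t → g₀ 0 t = 0) →
      (∀ j t, t₀ ≤ t → j ≠ 0 → κ ≤ (g j t).im) → (∀ j t, t₀ ≤ t → 0 ≤ (g₀ j t).im) →
      (∀ t, t₀ ≤ t → ‖R t‖ ≤ A * ((1 + t)⁻¹ ^ 3 + r ^ 3)) →
      (∀ t, t₀ ≤ t → ‖R₀ t‖ ≤ A * (1 + t)⁻¹ ^ 3) →
      (∀ t, t₀ ≤ t → ‖R t - R₀ t‖ ≤ A * r * ((1 + t)⁻¹ ^ 2 + r ^ 2)) →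
      (∀ j t, t₀ ≤ t → ‖g j t - g₀ j t‖ ≤ A * r) →
      (∀ t, t₀ ≤ t → HasDerivWithinAt z
        (I • act (Matrix.diagonal (fun j => g j t) + R t) (z t)) (Ici t₀) t) →
      (∀ t, t₀ ≤ t → HasDerivWithinAt z₀
        (I • act (Matrix.diagonal (fun j => g₀ j t) + R₀ t) (z₀ t)) (Ici t₀) t) →
      z t₀ = z₀ t₀ → Tendsto (fun t => z₀ t 0) atTop (𝓝 L) → ∀ t, t₀ ≤ t →
      ‖z t - L • EuclideanSpace.single 0 1‖ ≤
        C * (r + r ^ 3 * (t - t₀) + (1 + t)⁻¹) * Real.exp (A * r ^ 3 * (t - t₀)) * ‖z t₀‖ := by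
  set a : ℝ := Real.exp A with ha
  have ha0 : 0 < a := Real.exp_pos A
  -- `K₁` collects the time-integrable contributions to the leading component, and `K₂` those
  -- growing like `r³ (t - t₀)`. In `K₃` the first summand covers the source and `1 + t₀` the
  -- initial value of a damped component.
  set K₁ : ℝ := 3 * A ^ 2 * a ^ 2 + A * a with hK₁
  set K₂ : ℝ := 3 * A * a with hK₂
  set K₃ : ℝ := 2 * (A * a) / κ + (1 + t₀) with hK₃
  have hK₁0 : 0 ≤ K₁ := by positivity
  have hK₂0 : 0 ≤ K₂ := by positivity
  have hK₃0 : 0 ≤ K₃ := by positivity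
  refine ⟨K₁ + K₂ + A * a + d * K₃, by positivity, ?_⟩
  intro r g g₀ R R₀ z z₀ L hr0 hr1 hg00 hg₀0 hgκ hg₀i hR hR₀ hRR hgg hz hz₀ hzz hL t ht
  have hgi : ∀ j t, t₀ ≤ t → 0 ≤ (g j t).im := fun j t ht => by
    by_cases hj : j = 0
    · rw [hj, hg00 t ht, Complex.zero_im]
    · exact hκ.le.trans (hgκ j t ht hj)
  set p : ℝ := ‖z t₀‖ with hp
  have hp0 : 0 ≤ p := norm_nonneg _
  set e : ℝ → ℝ := fun s => Real.exp (A * r ^ 3 * (s - t₀)) with he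
  have he1 : ∀ s, t₀ ≤ s → 1 ≤ e s := fun s hs =>
    Real.one_le_exp (mul_nonneg (by positivity) (sub_nonneg.2 hs))
  have hzb : ∀ s, t₀ ≤ s → ‖z s‖ ≤ p * (a * e s) := fun s hs =>
    norm_le_of_diagonal_system hA (by positivity) ht₀ hgi hR hz hs
  have hz₀b : ∀ s, t₀ ≤ s → ‖z₀ s‖ ≤ p * a := fun s hs => by
    have h1 := norm_le_of_diagonal_system (ρ := 0) hA le_rfl ht₀ hg₀i
      (fun s hs => by simpa using hR₀ s hs) hz₀ hs
    rwa [mul_zero, zero_mul, Real.exp_zero, mul_one, ← hzz] at h1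
  set v : ℝ → EuclideanSpace ℂ (Fin d) := fun s => z s - z₀ s with hv
  have hvd : ∀ s, t₀ ≤ s → HasDerivWithinAt v
      (I • act (Matrix.diagonal (fun j => g j s)) (v s) + I • act (R s) (v s) +
        I • act ((Matrix.diagonal (fun j => g j s - g₀ j s)) + (R s - R₀ s)) (z₀ s)) (Ici t₀) s := by
    intro s hs
    refine ((hz s hs).sub (hz₀ s hs)).congr_deriv ?_
    have : (Matrix.diagonal (fun j => g j s - g₀ j s) : Mat d) =
      Matrix.diagonal (fun j => g j s) - Matrix.diagonal (fun j => g₀ j s) :=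
      (Matrix.diagonal_sub _ _).symm
    rw [this]
    simp only [act_add, act_sub]
    simp only [hv, map_sub, smul_add, smul_sub]
    abel
  have hτ : ∀ s, t₀ ≤ s → 0 < (1 + s)⁻¹ := fun s hs => inv_one_add_pos (ht₀.trans hs)
  have hτ1 : ∀ s, t₀ ≤ s → (1 + s)⁻¹ ≤ 1 := fun s hs => inv_one_add_le_one (ht₀.trans hs)
  -- The difference of the two solutions starts at zero and is driven by a source of size `r`. This
  -- crude bound, linear in time, is enough where it meets the remainder: one factor of `(1+s)⁻³`
  -- cancels the growth and leaves the integrable `(1+s)⁻²`.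
  have hvb1 : ∀ s, t₀ ≤ s → ‖v s‖ ≤ 3 * A * r * p * a * (s - t₀) * (a * e s) := by
    intro s hs
    have h := norm_le_of_re_inner_le_integrable (ρ := r ^ 3) (b := 3 * A * r * p * a) hA
      (by positivity) (by positivity) ht₀ hvd (fun u hu => ?_) hs
    · rwa [show v t₀ = 0 from sub_eq_zero.2 hzz, norm_zero, zero_add] at h
    · rw [inner_add_right, inner_add_right, Complex.add_re, Complex.add_re]
      have h1 := re_inner_diagonal_nonpos (fun j => hgi j u hu) (v u)
      have h2 := re_inner_act_le (R u) (v u) (v u)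
      have h3 := mul_le_mul_of_nonneg_right (hR u hu) (sq_nonneg ‖v u‖)
      have h4 := re_inner_act_le
        ((Matrix.diagonal (fun j => g j u - g₀ j u)) + (R u - R₀ u)) (v u) (z₀ u)
      have h5 : ‖(Matrix.diagonal (fun j => g j u - g₀ j u)) + (R u - R₀ u)‖ ≤ 3 * A * r := by
        refine (norm_add_le_of_le (norm_diagonal_le (by positivity) fun j => hgg j u hu)
          (hRR u hu)).trans ?_
        have f1 : (1 + u)⁻¹ ^ 2 ≤ 1 := pow_le_one₀ (hτ u hu).le (hτ1 u hu)
        have f2 : r ^ 2 ≤ 1 := pow_le_one₀ hr0 hr1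
        have f3 : 0 ≤ A * r := by positivity
        nlinarith
      have h6 := mul_le_mul_of_nonneg_right (mul_le_mul h5 (hz₀b u hu) (norm_nonneg _)
        (by positivity)) (norm_nonneg (v u))
      nlinarith
  have hvb2 : ∀ s, t₀ ≤ s → ‖v s‖ ≤ 2 * p * a * e s := by
    intro s hs
    refine (norm_sub_le_of_le (hzb s hs) (hz₀b s hs)).trans ?_
    have := mul_le_mul_of_nonneg_left (he1 s hs) (mul_nonneg hp0 ha0.le)
    linarith
  -- Against the `(1+s)⁻³` part of the remainder the linear bound on `v` is used, against the `r³`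
  -- part the uniform one. Using only one of them would lose either the factor `r` or an extra power
  -- of `t`.
  have hv0 : ‖v t 0‖ ≤ (K₁ * r * p + K₂ * r ^ 3 * p * (t - t₀)) * e t := by
    refine norm_le_of_norm_deriv_le_exp (g := fun s => v s 0) (by positivity) (by positivity)
      (by positivity) ht₀
      (fun s hs => (hasDerivWithinAt_zeroth_coord hg00 hz hs).sub
        (hasDerivWithinAt_zeroth_coord hg₀0 hz₀ hs)) (fun s hs => ?_) ?_ ht
    · have h1 : I * act (R s) (z s) 0 - I * act (R₀ s) (z₀ s) 0 =
          I * (act (R s) (v s) 0 + act (R s - R₀ s) (z₀ s) 0) := by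
        rw [act_sub]
        simp only [hv, map_sub, PiLp.sub_apply]
        ring
      rw [h1, norm_mul, Complex.norm_I, one_mul]
      have hes := he1 s hs
      have h2 := (norm_act_coord_le (R s) (v s) 0).trans
        (mul_le_mul_of_nonneg_right (hR s hs) (norm_nonneg _))
      have h3 := (norm_act_coord_le (R s - R₀ s) (z₀ s) 0).trans
        (mul_le_mul (hRR s hs) (hz₀b s hs) (norm_nonneg _) (by have := hτ s hs; positivity))
      refine (norm_add_le_of_le h2 h3).trans ?_
      have h4 : A * (1 + s)⁻¹ ^ 3 * ‖v s‖ ≤ 3 * A ^ 2 * a ^ 2 * r * p * (1 + s)⁻¹ ^ 2 * e s := by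
        have f1 : (1 + s)⁻¹ * (s - t₀) ≤ 1 := by
          rw [inv_mul_le_iff₀ (by linarith)]
          linarith
        have f2 : 0 ≤ A * (1 + s)⁻¹ ^ 3 := by have := hτ s hs; positivity
        have f3 : 0 ≤ 3 * A ^ 2 * a ^ 2 * r * p * (1 + s)⁻¹ ^ 2 * e s := by positivity
        calc _ ≤ A * (1 + s)⁻¹ ^ 3 * (3 * A * r * p * a * (s - t₀) * (a * e s)) :=
              mul_le_mul_of_nonneg_left (hvb1 s hs) f2
          _ = 3 * A ^ 2 * a ^ 2 * r * p * (1 + s)⁻¹ ^ 2 * e s * ((1 + s)⁻¹ * (s - t₀)) := by ring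
          _ ≤ _ := mul_le_of_le_one_right f3 f1
      have h5 : A * r ^ 3 * ‖v s‖ ≤ A * r ^ 3 * (2 * p * a * e s) :=
        mul_le_mul_of_nonneg_left (hvb2 s hs) (by positivity)
      have h6 : A * r * ((1 + s)⁻¹ ^ 2 + r ^ 2) * (p * a) ≤
          A * r * ((1 + s)⁻¹ ^ 2 + r ^ 2) * (p * a) * e s :=
        le_mul_of_one_le_right (by positivity) hes
      calc _ ≤ _ := add_le_add ((by rw [mul_add, add_mul] : _ = _).le.trans (add_le_add h4 h5)) h6
        _ = _ := by rw [hK₁, hK₂]; simp only [he]; ring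
    · rw [show v t₀ = 0 from sub_eq_zero.2 hzz]
      rfl
  have hz₀L : ‖z₀ t 0 - L‖ ≤ A * (p * a) * (1 + t)⁻¹ := by
    obtain ⟨L', hL', h⟩ := exists_tendsto_zeroth_coord hA ht₀ hg₀i hg₀0 hR₀ hz₀
    rw [tendsto_nhds_unique hL hL', hp, hzz]
    exact h t ht
  -- The remaining components are damped at rate `κ` and fed only through the remainder, so they
  -- follow its size. No comparison with `ξ = 0` is needed for them.
  have hzj : ∀ j, j ≠ 0 → ‖z t j‖ ≤ K₃ * p * ((1 + t)⁻¹ + r ^ 3) * e t := by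
    intro j hj
    refine norm_le_of_re_inner_le_damped (g := fun s => z s j) (κ := κ) (b := A * (p * a))
      (by positivity) (by positivity) ht₀ (by positivity) hκt ?_ ?_
      (fun s hs => hasDerivWithinAt_coord (hz s hs) j) (fun s hs => ?_) ht
    · have : K₃ * p * (κ / 2) = A * (p * a) + (1 + t₀) * p * (κ / 2) := by
        rw [hK₃]; field_simp
      rw [this]
      exact le_add_of_nonneg_right (by positivity)
    · refine (PiLp.norm_apply_le _ j).trans ?_
      have : K₃ * p * (1 + t₀)⁻¹ = p + 2 * (A * a) / κ * p * (1 + t₀)⁻¹ := by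
        rw [hK₃, add_mul, add_mul, mul_right_comm (1 + t₀), mul_inv_cancel₀ (by positivity),
          one_mul, add_comm]
      rw [this]
      exact le_add_of_nonneg_right (by have := hτ t₀ le_rfl; positivity)
    · rw [PiLp.smul_apply, act_add, PiLp.add_apply, act_diagonal, smul_eq_mul, mul_add,
        inner_add_right, Complex.add_re, re_conj_mul_I_mul]
      have hs1 := hτ s hs
      have h1 : ((inner ℂ (z s j) (I * act (R s) (z s) j)) : ℂ).re ≤
          A * (p * a) * ((1 + s)⁻¹ + r ^ 3) * e s * ‖z s j‖ := by
        refine (Complex.re_le_norm _).trans ((norm_inner_le_norm _ _).trans ?_)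
        rw [norm_mul, Complex.norm_I, one_mul, mul_comm]
        refine mul_le_mul_of_nonneg_right ?_ (norm_nonneg _)
        refine (norm_act_coord_le _ _ _).trans ((mul_le_mul (hR s hs) (hzb s hs) (norm_nonneg _)
          (by positivity)).trans ?_)
        have f1 : (1 + s)⁻¹ ^ 3 ≤ (1 + s)⁻¹ := pow_le_of_le_one hs1.le (hτ1 s hs) (by norm_num)
        calc _ = A * (p * a) * ((1 + s)⁻¹ ^ 3 + r ^ 3) * e s := by ring
          _ ≤ _ := by gcongr
      have h2 := mul_le_mul_of_nonneg_right (hgκ j s hs hj) (sq_nonneg ‖z s j‖)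
      linarith
  set F : ℝ := (r + r ^ 3 * (t - t₀) + (1 + t)⁻¹) * e t * p with hF
  have ht' : 0 ≤ t - t₀ := sub_nonneg.2 ht
  have hes := he1 t ht
  have hts := hτ t ht
  have hr3 : r ^ 3 ≤ r := pow_le_of_le_one hr0 hr1 (by norm_num)
  have hr3t : 0 ≤ r ^ 3 * (t - t₀) := by positivity
  have hep : 0 ≤ e t * p := by positivity
  have c0 : ‖z t 0 - L‖ ≤ (K₁ + K₂ + A * a) * F := by
    have h1 : z t 0 - L = v t 0 + (z₀ t 0 - L) := by simp only [hv, PiLp.sub_apply]; ring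
    rw [h1]
    refine (norm_add_le_of_le hv0 hz₀L).trans ?_
    have e1 : (K₁ * r * p + K₂ * r ^ 3 * p * (t - t₀)) * e t ≤ (K₁ + K₂) * F := by
      have f1 : K₁ * (r * (e t * p)) ≤ K₁ * F := by
        refine mul_le_mul_of_nonneg_left ?_ hK₁0
        rw [hF, mul_assoc]
        exact mul_le_mul_of_nonneg_right (by linarith) hep
      have f2 : K₂ * (r ^ 3 * (t - t₀) * (e t * p)) ≤ K₂ * F := by
        refine mul_le_mul_of_nonneg_left ?_ hK₂0
        rw [hF, mul_assoc (r + _ + _)]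
        exact mul_le_mul_of_nonneg_right (by linarith) hep
      linarith
    have e2 : A * (p * a) * (1 + t)⁻¹ ≤ A * a * F := by
      have f1 : (1 + t)⁻¹ * p ≤ F := by
        rw [hF, mul_assoc]
        have f2 : (1 + t)⁻¹ * p ≤ (1 + t)⁻¹ * (e t * p) :=
          mul_le_mul_of_nonneg_left (le_mul_of_one_le_left hp0 hes) hts.le
        exact f2.trans (mul_le_mul_of_nonneg_right (by linarith) hep)
      have := mul_le_mul_of_nonneg_left f1 (mul_nonneg hA ha0.le)
      linarith
    linarith
  have cj : ∀ j, j ≠ 0 → ‖z t j‖ ≤ K₃ * F := by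
    intro j hj
    refine (hzj j hj).trans ?_
    calc _ = K₃ * (((1 + t)⁻¹ + r ^ 3) * (e t * p)) := by ring
      _ ≤ K₃ * ((r + r ^ 3 * (t - t₀) + (1 + t)⁻¹) * (e t * p)) :=
        mul_le_mul_of_nonneg_left (mul_le_mul_of_nonneg_right (by linarith) hep) hK₃0
      _ = _ := by rw [hF]; ring
  have hF0 : 0 ≤ F := by positivity
  refine (norm_le_sum_coord _).trans ?_
  rw [← Finset.add_sum_erase _ _ (Finset.mem_univ (0 : Fin d))]
  have s1 : ∑ j ∈ Finset.univ.erase (0 : Fin d),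
      ‖(z t - L • EuclideanSpace.single (0 : Fin d) (1 : ℂ)) j‖ ≤ d * (K₃ * F) := by
    refine (Finset.sum_le_card_nsmul _ _ (K₃ * F) fun j hj => ?_).trans ?_
    · have hj0 := Finset.ne_of_mem_erase hj
      simpa [hj0] using cj j hj0
    · rw [nsmul_eq_mul]
      refine mul_le_mul_of_nonneg_right ?_ (by positivity)
      exact_mod_cast (Finset.card_erase_le).trans (by simp)
  have s2 : ‖(z t - L • EuclideanSpace.single (0 : Fin d) (1 : ℂ)) 0‖ ≤
      (K₁ + K₂ + A * a) * F := by simpa using c0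
  calc _ ≤ (K₁ + K₂ + A * a) * F + d * (K₃ * F) := add_le_add s2 s1
    _ = _ := by rw [hF]; ring

end DiagonalSystem

/-! ### Conjugation to the reduced system and its estimates in the elliptic zone -/

section Reduction
open scoped Matrix.Norms.L2Operator

variable {n d : ℕ}

theorem PolyMat.norm_bound {m : ℕ} {X : ℝ → Space n → Mat d} (hX : PolyMat m X) :
    ∃ C : ℝ, 0 ≤ C ∧ ∀ t, 0 ≤ t → ∀ ξ, ‖ξ‖ ≤ 1 → ‖X t ξ‖ ≤ C * ((1 + t)⁻¹ + ‖ξ‖) ^ m := by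
  obtain ⟨C, hC0, hC⟩ := exists_common_bound (ι := Fin d × Fin d)
    (p := fun p C => ∀ t : ℝ, 0 ≤ t → ∀ ξ : Space n, ‖ξ‖ ≤ 1 →
      ‖X t ξ p.1 p.2‖ ≤ C * ((1 + t)⁻¹ + ‖ξ‖) ^ m)
    (fun i a b hab h t ht ξ hξ => (h t ht ξ hξ).trans
      (mul_le_mul_of_nonneg_right hab (by have := inv_one_add_pos ht; positivity)))
    fun p => by
      obtain ⟨C, -, hC⟩ := (hX p.1 p.2).bound
      exact ⟨C, by simpa only [one_div] using hC⟩
  obtain ⟨K, hK0, hK⟩ := norm_le_sum_entries d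
  refine ⟨K * C, by positivity, fun t ht ξ hξ => ?_⟩
  rw [mul_assoc]
  exact hK _ _ fun i j => hC (i, j) t ht ξ hξ

theorem PolyMat.norm_bound_sub {m : ℕ} {X : ℝ → Space n → Mat d} (hX : PolyMat m X) :
    ∃ C : ℝ, 0 ≤ C ∧ ∀ t, 0 ≤ t → ∀ ξ, ‖ξ‖ ≤ 1 →
      ‖X t ξ - X t 0‖ ≤ C * ‖ξ‖ * ((1 + t)⁻¹ + ‖ξ‖) ^ (m - 1) := by
  obtain ⟨C, hC0, hC⟩ := exists_common_bound (ι := Fin d × Fin d)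
    (p := fun p C => ∀ t : ℝ, 0 ≤ t → ∀ ξ : Space n, ‖ξ‖ ≤ 1 →
      ‖X t ξ p.1 p.2 - X t 0 p.1 p.2‖ ≤ C * ‖ξ‖ * ((1 + t)⁻¹ + ‖ξ‖) ^ (m - 1))
    (fun i a b hab h t ht ξ hξ => (h t ht ξ hξ).trans
      (mul_le_mul_of_nonneg_right (mul_le_mul_of_nonneg_right hab (norm_nonneg _))
        (by have := inv_one_add_pos ht; positivity)))
    fun p => by
      obtain ⟨C, -, hC⟩ := (hX p.1 p.2).bound_sub
      exact ⟨C, by simpa only [one_div] using hC⟩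
  obtain ⟨K, hK0, hK⟩ := norm_le_sum_entries d
  refine ⟨K * C, by positivity, fun t ht ξ hξ => ?_⟩
  rw [mul_assoc, mul_assoc, ← mul_assoc C]
  exact hK _ _ fun i j => hC (i, j) t ht ξ hξ

/-- Neumann series for invertibility; the bound on the inverse comes from `X⁻¹ = 1 - (X - 1) X⁻¹`.
-/
theorem isUnit_of_norm_sub_one_le {X : Mat d} (h : ‖X - 1‖ ≤ 1 / 2) :
    IsUnit X ∧ ‖X‖ ≤ 2 ∧ ‖X⁻¹‖ ≤ 2 := by
  have h1 : ‖(1 : Mat d)‖ ≤ 1 := by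
    rw [← Matrix.diagonal_one]
    exact norm_diagonal_le zero_le_one fun j => by simp
  have hu : IsUnit X := by
    have h2 : ‖1 - X‖ < 1 := by
      rw [norm_sub_rev]
      linarith
    have := (Units.oneSub (1 - X) h2).isUnit
    rwa [Units.val_oneSub, sub_sub_cancel] at this
  refine ⟨hu, ?_, ?_⟩
  · have := norm_add_le (X - 1) 1
    rw [sub_add_cancel] at this
    linarith
  · have h3 : X⁻¹ = 1 - (X - 1) * X⁻¹ := by
      rw [sub_mul, one_mul, Matrix.mul_nonsing_inv _ ((Matrix.isUnit_iff_isUnit_det _).1 hu)]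
      abel
    have h4 : ‖X⁻¹‖ ≤ 1 + 1 / 2 * ‖X⁻¹‖ := by
      conv_lhs => rw [h3]
      exact norm_sub_le_of_le h1 ((norm_mul_le _ _).trans
        (mul_le_mul_of_nonneg_right h (norm_nonneg _)))
    linarith

theorem hasDerivWithinAt_matrix_inv {X : ℝ → Mat d} {X' : Mat d} {s : Set ℝ} {t : ℝ}
    (hX : HasDerivWithinAt X X' s t) (hu : IsUnit (X t)) :
    HasDerivWithinAt (fun τ => (X τ)⁻¹) (-((X t)⁻¹ * X' * (X t)⁻¹)) s t := by
  obtain ⟨u, hu⟩ := hu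
  have h := hasFDerivAt_ringInverse (𝕜 := ℝ) u
  rw [hu] at h
  have h2 := h.comp_hasDerivWithinAt t hX
  have h3 : (Ring.inverse ∘ X) = fun τ => (X τ)⁻¹ := by
    ext1 τ
    rw [Matrix.nonsing_inv_eq_ringInverse]
    rfl
  rw [h3] at h2
  refine h2.congr_deriv ?_
  have h4 : (X t)⁻¹ = ((u⁻¹ : (Mat d)ˣ) : Mat d) := by
    rw [← hu, Matrix.coe_units_inv]
  rw [h4]
  rfl

variable {A : Fin n → ℝ → Mat d} {B : ℝ → Mat d} {δ : Fin d → ℝ → ℝ} {M : ℝ → Mat d}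

theorem matF_apply_ne (K : ℕ) (t : ℝ) (ξ : Space n) {i j : Fin d} (hij : i ≠ j) :
    matF A δ M K t ξ i j = 0 := by
  induction K with
  | zero => rfl
  | succ K ih => rw [matF_succ, Matrix.sub_apply, ih, Matrix.diagonal_apply_ne _ hij, sub_zero]

/-- The diagonalised system of order two. -/
def reducedG (A : Fin n → ℝ → Mat d) (δ : Fin d → ℝ → ℝ) (M : ℝ → Mat d) (t : ℝ)
    (ξ : Space n) : Mat d :=
  calD δ t + matF A δ M 2 t ξ + remainder A δ M 2 t ξ

/-- The diagonal rates relative to the leading one. -/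
def relRate [NeZero d] (A : Fin n → ℝ → Mat d) (δ : Fin d → ℝ → ℝ) (M : ℝ → Mat d) (ξ : Space n) (j : Fin d)
    (t : ℝ) : ℂ :=
  I * δ j t + (matF A δ M 2 t ξ j j - cornerF A δ M 2 t ξ)

/-- Splitting off the scalar `f₁` isolates what `Ξ₂` solves. After division by `Ξ₂` the rates are
relative to the leading one. -/
theorem reducedG_eq [NeZero d] (t : ℝ) (ξ : Space n) : reducedG A δ M t ξ =
    cornerF A δ M 2 t ξ • (1 : Mat d) + (Matrix.diagonal (fun j => relRate A δ M ξ j t) +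
      remainder A δ M 2 t ξ) := by
  rw [reducedG, ← add_assoc]
  congr 1
  ext i j
  by_cases hij : i = j
  · subst hij
    simp [calD, relRate]
    ring
  · simp [calD, relRate, hij, matF_apply_ne 2 t ξ hij]

theorem remainder_eq (t : ℝ) (ξ : Space n) :
    remainder A δ M 2 t ξ = -((matN A δ M 2 t ξ)⁻¹ * errB A δ M 2 t ξ) := rfl

theorem hasDerivWithinAt_matN [NeZero d] (hA : ∀ k, MatSymbolClass 0 (A k)) (hB : MatSymbolClass 0 B)
    (hB2 : CondB2 B δ) (hM : IsDiagonaliser B δ M) {t : ℝ} (ht : 0 ≤ t) (ξ : Space n) :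
    HasDerivWithinAt (fun τ => matN A δ M 2 τ ξ) (I • Dt (fun τ => matN A δ M 2 τ ξ) t)
      (Ici 0) t := by
  obtain ⟨hN, -, -⟩ := polyMat_hierarchy hA hB hB2 hM 2
  refine hasDerivWithinAt_matrix.2 fun i j => ?_
  have h1 := ((hN i j).differentiableWithinAt ht ξ).add_const ((1 : Mat d) i j)
  simp only [Matrix.sub_apply, sub_add_cancel] at h1
  refine h1.hasDerivWithinAt.congr_deriv ?_
  rw [Matrix.smul_apply, Dt, Matrix.of_apply, smul_eq_mul, ← mul_assoc, mul_neg, I_mul_I, neg_neg,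
    one_mul]

/-- The intertwining relation `(D_t - 𝒟 - R₁) N₂ = N₂ (D_t - 𝒟 - F₂ - R₃)`, combined with `M⁻¹ (iB)
= 𝒟 M⁻¹`, carried out on solutions. It is exact, because `R₃` is defined as the full error. -/
theorem hasDerivWithinAt_reduced [NeZero d] (hA : ∀ k, MatSymbolClass 0 (A k)) (hB : MatSymbolClass 0 B)
    (hB2 : CondB2 B δ) (hM : IsDiagonaliser B δ M) {ξ : Space n} {x : ℝ → EuclideanSpace ℂ (Fin d)}
    {t : ℝ} (ht : 0 ≤ t) (hu : IsUnit (matN A δ M 2 t ξ))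
    (hx : HasDerivWithinAt x (I • act (symbolA A t ξ + I • B t) (x t)) (Ici 0) t) :
    HasDerivWithinAt (fun τ => act ((matN A δ M 2 τ ξ)⁻¹ * (M τ)⁻¹) (x τ))
      (I • act (reducedG A δ M t ξ) (act ((matN A δ M 2 t ξ)⁻¹ * (M t)⁻¹) (x t))) (Ici 0) t := by
  set N := matN A δ M 2 t ξ with hN
  set N' := Dt (fun τ => matN A δ M 2 τ ξ) t with hN'
  set J' : Mat d := Dt (fun τ => (M τ)⁻¹) t with hJ'
  have h1 := hasDerivWithinAt_matrix_inv (hasDerivWithinAt_matN hA hB hB2 hM ht ξ) hu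
  have h2 : HasDerivWithinAt (fun τ => (M τ)⁻¹) (I • J') (Ici 0) t := by
    refine (hM.2.1.hasDerivWithinAt ht).congr_deriv ?_
    ext i j
    rw [Matrix.smul_apply, hJ', Dt, Matrix.of_apply, Matrix.of_apply, smul_eq_mul, ← mul_assoc,
      mul_neg, I_mul_I, neg_neg, one_mul]
  have h3 := hasDerivWithinAt_act (h1.mul h2) hx
  refine h3.congr_deriv ?_
  have hNi : N⁻¹ * N = 1 := Matrix.nonsing_inv_mul _ ((Matrix.isUnit_iff_isUnit_det _).1 hu)
  have hNi' : N * N⁻¹ = 1 := Matrix.mul_nonsing_inv _ ((Matrix.isUnit_iff_isUnit_det _).1 hu)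
  have hMi := hM.mul_inv ht
  have hMi' := hM.inv_mul ht
  have hBM : (M t)⁻¹ * (I • B t) = calD δ t * (M t)⁻¹ := by
    have e1 : (M t)⁻¹ * B t * M t = Matrix.diagonal fun i => (δ i t : ℂ) := (hM.2.2 t ht).2
    have e2 : calD δ t = I • Matrix.diagonal fun i => (δ i t : ℂ) := by
      rw [calD, ← Matrix.diagonal_smul]
      rfl
    rw [e2, ← e1, Matrix.mul_smul, Matrix.smul_mul, Matrix.mul_assoc _ (M t), hMi, mul_one]
  have herr : errB A δ M 2 t ξ = N' - (calD δ t * N - N * calD δ t) -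
      ((M t)⁻¹ * symbolA A t ξ * M t + J' * M t) * N + N * matF A δ M 2 t ξ := rfl
  have hG : reducedG A δ M t ξ * N⁻¹ = N⁻¹ * ((M t)⁻¹ * symbolA A t ξ * M t + J' * M t + calD δ t)
      - N⁻¹ * N' * N⁻¹ := by
    rw [reducedG, remainder_eq, ← hN, herr]
    have : (calD δ t + matF A δ M 2 t ξ + -(N⁻¹ * (N' - (calD δ t * N - N * calD δ t) -
        ((M t)⁻¹ * symbolA A t ξ * M t + J' * M t) * N + N * matF A δ M 2 t ξ))) =
        (1 - N⁻¹ * N) * (calD δ t + matF A δ M 2 t ξ) +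
        N⁻¹ * ((M t)⁻¹ * symbolA A t ξ * M t + J' * M t + calD δ t) * N - N⁻¹ * N' := by
      noncomm_ring
    rw [this, hNi, sub_self, zero_mul, zero_add, sub_mul, Matrix.mul_assoc _ N, hNi', mul_one]
  have hkey : reducedG A δ M t ξ * (N⁻¹ * (M t)⁻¹) =
      N⁻¹ * (M t)⁻¹ * (symbolA A t ξ + I • B t) + (N⁻¹ * J' - N⁻¹ * N' * N⁻¹ * (M t)⁻¹) := by
    rw [← Matrix.mul_assoc, hG, mul_add (N⁻¹ * (M t)⁻¹), Matrix.mul_assoc N⁻¹ (M t)⁻¹ (I • B t), hBM]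
    have : (N⁻¹ * ((M t)⁻¹ * symbolA A t ξ * M t + J' * M t + calD δ t) - N⁻¹ * N' * N⁻¹) *
        (M t)⁻¹ = N⁻¹ * (M t)⁻¹ * symbolA A t ξ * (M t * (M t)⁻¹) + N⁻¹ * J' * (M t * (M t)⁻¹) +
        N⁻¹ * (calD δ t * (M t)⁻¹) - N⁻¹ * N' * N⁻¹ * (M t)⁻¹ := by
      noncomm_ring
    rw [this, hMi, mul_one, mul_one]
    abel
  have hval : -(N⁻¹ * (I • N') * N⁻¹) * (M t)⁻¹ + N⁻¹ * (I • J') =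
      I • (N⁻¹ * J' - N⁻¹ * N' * N⁻¹ * (M t)⁻¹) := by
    simp only [Matrix.mul_smul, Matrix.smul_mul, Matrix.neg_mul, smul_sub]
    abel
  change act (-(N⁻¹ * (I • N') * N⁻¹) * (M t)⁻¹ + N⁻¹ * (I • J')) (x t) +
    act (N⁻¹ * (M t)⁻¹) (I • act (symbolA A t ξ + I • B t) (x t)) = _
  rw [hval, ← act_mul, hkey, act_smul, map_smul, ← act_mul, act_add (N⁻¹ * (M t)⁻¹ * _), smul_add,
    add_comm]

theorem continuousOn_reducedG [NeZero d] (hA : ∀ k, MatSymbolClass 0 (A k))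
    (hB : MatSymbolClass 0 B) (hB2 : CondB2 B δ) (hM : IsDiagonaliser B δ M) {ξ : Space n} {t₁ : ℝ}
    (ht₁ : 0 ≤ t₁) (hu : ∀ t, t₁ ≤ t → IsUnit (matN A δ M 2 t ξ)) :
    ContinuousOn (fun t => reducedG A δ M t ξ) (Ici t₁) := by
  obtain ⟨hN, hF, hE⟩ := polyMat_hierarchy hA hB hB2 hM 2
  have hsub : Ici t₁ ⊆ Ici (0 : ℝ) := Ici_subset_Ici.2 ht₁
  have hmat : ∀ {X : ℝ → Mat d}, (∀ i j, ContinuousOn (fun t => X t i j) (Ici t₁)) →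
      ContinuousOn X (Ici t₁) := fun h => continuousOn_pi.2 fun i => continuousOn_pi.2 fun j => h i j
  refine (ContinuousOn.add ?_ ?_).add ?_
  · refine hmat fun i j => ?_
    by_cases hij : i = j
    · subst hij
      simp only [calD, Matrix.diagonal_apply_eq]
      exact continuousOn_const.mul
        (Complex.continuous_ofReal.comp_continuousOn ((hB2.continuousOn hB i).mono hsub))
    · simp only [calD, Matrix.diagonal_apply_ne _ hij]
      exact continuousOn_const
  · exact hmat fun i j => ((hF i j).continuousOn ξ).mono hsub
  · refine ContinuousOn.neg (ContinuousOn.mul (fun t ht => ?_)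
      (hmat fun i j => ((hE i j).continuousOn ξ).mono hsub))
    exact ((hasDerivWithinAt_matrix_inv (hasDerivWithinAt_matN hA hB hB2 hM (hsub ht) ξ)
      (hu t ht)).continuousWithinAt).mono hsub

/-- The estimates of the reduced system in the elliptic zone `‖ξ‖ ≤ c`, `t ≥ 1 / c`. -/
theorem exists_reduced_bounds [NeZero d] (hA : ∀ k, MatSymbolClass 0 (A k))
    (hB : MatSymbolClass 0 B) (hB2 : CondB2 B δ) (hM : IsDiagonaliser B δ M) :
    ∃ κ : ℝ, 0 < κ ∧ ∃ a : ℝ, 0 ≤ a ∧ ∃ c₁ : ℝ, 0 < c₁ ∧ c₁ ≤ 1 ∧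
      ∀ t, 1 / c₁ ≤ t → ∀ ξ : Space n, ‖ξ‖ ≤ c₁ →
        (IsUnit (matN A δ M 2 t ξ) ∧ ‖matN A δ M 2 t ξ‖ ≤ 2 ∧ ‖(matN A δ M 2 t ξ)⁻¹‖ ≤ 2) ∧
        relRate A δ M ξ 0 t = 0 ∧
        (∀ j, j ≠ 0 → κ ≤ (relRate A δ M ξ j t).im) ∧
        (∀ j, ‖relRate A δ M ξ j t - relRate A δ M 0 j t‖ ≤ a * ‖ξ‖) ∧
        ‖remainder A δ M 2 t ξ‖ ≤ a * ((1 + t)⁻¹ ^ 3 + ‖ξ‖ ^ 3) ∧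
        ‖remainder A δ M 2 t ξ - remainder A δ M 2 t 0‖ ≤
          a * ‖ξ‖ * ((1 + t)⁻¹ ^ 2 + ‖ξ‖ ^ 2) := by
  obtain ⟨hN, hF, hE⟩ := polyMat_hierarchy hA hB hB2 hM 2
  obtain ⟨σ, hσ, hsep⟩ := hB2.separated hB
  obtain ⟨a₁, ha₁, hN1⟩ := hN.norm_bound
  obtain ⟨a₂, ha₂, hN2⟩ := hN.norm_bound_sub
  obtain ⟨a₃, ha₃, hF1⟩ := hF.norm_bound
  obtain ⟨a₄, ha₄, hF2⟩ := hF.norm_bound_sub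
  obtain ⟨a₅, ha₅, hE1⟩ := hE.norm_bound
  obtain ⟨a₆, ha₆, hE2⟩ := hE.norm_bound_sub
  simp only [pow_one, tsub_self, pow_zero, mul_one] at hN1 hN2 hF1 hF2
  norm_num at hE1 hE2
  -- In the zone both `(1+t)⁻¹` and `‖ξ‖` are at most `c₁`. The second entry makes `‖N₂ - 1‖ ≤ 1/2`.
  -- The third bounds the entries of `F₂` by `σ/4`, so that a spectral gap of `σ/2` survives in the
  -- relative rates.
  set c₁ : ℝ := min 1 (min (1 / (4 * (a₁ + 1))) (σ / (8 * (a₃ + 1)))) with hc₁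
  have hc0 : 0 < c₁ := lt_min one_pos (lt_min (by positivity) (by positivity))
  have hc1 : c₁ ≤ 1 := min_le_left _ _
  have hc2 : c₁ * (4 * (a₁ + 1)) ≤ 1 :=
    (le_div_iff₀ (by positivity)).1 ((min_le_right _ _).trans (min_le_left _ _))
  have hc3 : c₁ * (8 * (a₃ + 1)) ≤ σ :=
    (le_div_iff₀ (by positivity)).1 ((min_le_right _ _).trans (min_le_right _ _))
  refine ⟨σ / 2, by positivity, 2 * a₄ + 8 * a₅ + (4 * a₂ * a₅ * 4 + 4 * a₆), by positivity,
    c₁, hc0, hc1, fun t ht ξ hξ => ?_⟩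
  have ht0 : 0 ≤ t := (by positivity : (0 : ℝ) ≤ 1 / c₁).trans ht
  set τ : ℝ := (1 + t)⁻¹ with hτ
  have hτ0 : 0 < τ := inv_one_add_pos ht0
  have hτc : τ ≤ c₁ := by
    rw [hτ]
    refine inv_le_of_inv_le₀ hc0 ?_
    rw [one_div] at ht
    linarith
  have hξ1 : ‖ξ‖ ≤ 1 := hξ.trans hc1
  have h01 : ‖(0 : Space n)‖ ≤ 1 := by simp
  set r := ‖ξ‖ with hr
  have hr0 : 0 ≤ r := norm_nonneg _
  have hU : ∀ ζ : Space n, ‖ζ‖ ≤ c₁ → IsUnit (matN A δ M 2 t ζ) ∧ ‖matN A δ M 2 t ζ‖ ≤ 2 ∧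
      ‖(matN A δ M 2 t ζ)⁻¹‖ ≤ 2 := fun ζ hζ => by
    refine isUnit_of_norm_sub_one_le ((hN1 t ht0 ζ (hζ.trans hc1)).trans ?_)
    have := mul_le_mul_of_nonneg_left (add_le_add hτc hζ) ha₁
    linarith
  have h0c : ‖(0 : Space n)‖ ≤ c₁ := by simpa using hc0.le
  have hU0 := hU 0 h0c
  have hUξ := hU ξ hξ
  refine ⟨hUξ, ?_, fun j hj => ?_, fun j => ?_, ?_, ?_⟩
  · simp [relRate, cornerF, (hB2.1 t ht0).1]
  · have h1 : |(matF A δ M 2 t ξ j j).im| ≤ a₃ * (τ + r) :=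
      (Complex.abs_im_le_norm _).trans ((norm_entry_le _ j j).trans (hF1 t ht0 ξ hξ1))
    have h2 : |(cornerF A δ M 2 t ξ).im| ≤ a₃ * (τ + r) :=
      (Complex.abs_im_le_norm _).trans ((norm_entry_le _ 0 0).trans (hF1 t ht0 ξ hξ1))
    have h3 : σ ≤ δ j t := by
      have := hsep t ht0 j 0 hj
      rwa [(hB2.1 t ht0).1, sub_zero, abs_of_nonneg (hB2.nonneg ht0 j)] at this
    have h4 : a₃ * (τ + r) ≤ σ / 4 := by
      have := mul_le_mul_of_nonneg_left (add_le_add hτc hξ) ha₃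
      linarith
    have h5 : (relRate A δ M ξ j t).im =
        δ j t + ((matF A δ M 2 t ξ j j).im - (cornerF A δ M 2 t ξ).im) := by
      simp [relRate]
    rw [h5]
    have := (abs_le.1 h1).1
    have := (abs_le.1 h2).2
    linarith
  · have h1 := (norm_entry_le _ j j).trans (hF2 t ht0 ξ hξ1)
    have h2 := (norm_entry_le _ 0 0).trans (hF2 t ht0 ξ hξ1)
    have h3 : relRate A δ M ξ j t - relRate A δ M 0 j t =
        (matF A δ M 2 t ξ - matF A δ M 2 t 0) j j - (matF A δ M 2 t ξ - matF A δ M 2 t 0) 0 0 := by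
      simp only [relRate, cornerF, Matrix.sub_apply]
      ring
    rw [h3]
    refine (norm_sub_le_of_le h1 h2).trans ?_
    have : 0 ≤ (8 * a₅ + (4 * a₂ * a₅ * 4 + 4 * a₆)) * r := by positivity
    linarith
  · rw [remainder_eq, norm_neg]
    refine (norm_mul_le_of_le hUξ.2.2 (hE1 t ht0 ξ hξ1)).trans ?_
    have h1 : (τ + r) ^ 3 ≤ 4 * (τ ^ 3 + r ^ 3) := by
      nlinarith [mul_nonneg (add_nonneg hτ0.le hr0) (sq_nonneg (τ - r))]
    have h2 := mul_le_mul_of_nonneg_left h1 ha₅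
    have h3 : 0 ≤ (2 * a₄ + (4 * a₂ * a₅ * 4 + 4 * a₆)) * (τ ^ 3 + r ^ 3) := by positivity
    linarith
  · set N := matN A δ M 2 t ξ
    set N₀ := matN A δ M 2 t 0
    -- The resolvent identity `N₀⁻¹ - N⁻¹ = N⁻¹ (N - N₀) N₀⁻¹` exhibits a factor `‖ξ‖` in each of
    -- the two terms.
    have h1 : remainder A δ M 2 t ξ - remainder A δ M 2 t 0 =
        N⁻¹ * (N - N₀) * N₀⁻¹ * errB A δ M 2 t ξ -
          N₀⁻¹ * (errB A δ M 2 t ξ - errB A δ M 2 t 0) := by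
      have e1 : N⁻¹ * N = 1 :=
        Matrix.nonsing_inv_mul _ ((Matrix.isUnit_iff_isUnit_det _).1 hUξ.1)
      have e2 : N₀ * N₀⁻¹ = 1 :=
        Matrix.mul_nonsing_inv _ ((Matrix.isUnit_iff_isUnit_det _).1 hU0.1)
      rw [mul_sub N⁻¹, e1, sub_mul, one_mul, Matrix.mul_assoc N⁻¹, e2, mul_one, remainder_eq,
        remainder_eq]
      noncomm_ring
    rw [h1]
    have h2 : ‖N⁻¹ * (N - N₀) * N₀⁻¹ * errB A δ M 2 t ξ‖ ≤
        2 * (a₂ * r) * 2 * (a₅ * (τ + r) ^ 3) := by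
      refine norm_mul_le_of_le (norm_mul_le_of_le (norm_mul_le_of_le hUξ.2.2 ?_) hU0.2.2)
        (hE1 t ht0 ξ hξ1)
      have := hN2 t ht0 ξ hξ1
      rwa [sub_sub_sub_cancel_right] at this
    have h3 := norm_mul_le_of_le hU0.2.2 (hE2 t ht0 ξ hξ1)
    refine (norm_sub_le_of_le h2 h3).trans ?_
    have h4 : (τ + r) ^ 2 ≤ 2 * (τ ^ 2 + r ^ 2) := by nlinarith [sq_nonneg (τ - r)]
    have h5 : (τ + r) ^ 3 ≤ 2 * (2 * (τ ^ 2 + r ^ 2)) := by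
      rw [pow_succ, mul_comm]
      exact mul_le_mul (by linarith [hτc.trans hc1]) h4 (by positivity) (by norm_num)
    have h6 := mul_le_mul_of_nonneg_left h5 (show 0 ≤ 2 * (a₂ * r) * 2 * a₅ by positivity)
    have h7 := mul_le_mul_of_nonneg_left h4 (show 0 ≤ 2 * (a₆ * r) by positivity)
    have h8 : 0 ≤ (2 * a₄ + 8 * a₅) * r * (τ ^ 2 + r ^ 2) := by positivity
    linarith

end Reduction

/-! ### Asymptotics of the solutions near the zero frequency -/

section LowFrequency
open scoped Matrix.Norms.L2Operator

variable {n d : ℕ}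

theorem one_add_sq_mul_exp_le {κ q : ℝ} (hκ : 0 < κ) (hq : 0 ≤ q) :
    (1 + q) ^ 2 * Real.exp (-(κ / 2 * q)) ≤ (1 + 4 / κ) ^ 2 := by
  have h1 : 1 + q ≤ (1 + 4 / κ) * Real.exp (κ / 4 * q) := by
    have h2 := Real.add_one_le_exp (κ / 4 * q)
    have h3 : (1 + 4 / κ) * (κ / 4 * q + 1) = 1 + q + 4 / κ + κ / 4 * q := by field_simp; ring
    have h4 : 0 ≤ 4 / κ + κ / 4 * q := by positivity
    have h5 := mul_le_mul_of_nonneg_left h2 (show 0 ≤ 1 + 4 / κ by positivity)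
    linarith
  have h6 := pow_le_pow_left₀ (by positivity) h1 2
  have h7 : Real.exp (κ / 4 * q) ^ 2 * Real.exp (-(κ / 2 * q)) = 1 := by
    rw [sq, ← Real.exp_add, ← Real.exp_add]
    simp only [Real.exp_eq_one_iff]
    ring
  calc _ ≤ ((1 + 4 / κ) * Real.exp (κ / 4 * q)) ^ 2 * Real.exp (-(κ / 2 * q)) :=
        mul_le_mul_of_nonneg_right h6 (Real.exp_pos _).le
    _ = (1 + 4 / κ) ^ 2 * (Real.exp (κ / 4 * q) ^ 2 * Real.exp (-(κ / 2 * q))) := by ring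
    _ = _ := by rw [h7, mul_one]

/-- With `q = r² (t - t₀)` the first two terms are `r (1 + q)`, and `r √(1+t) ≤ (1 + t₀)(1 + q)`.
The Gaussian `exp(-κ q / 2)` bounds `(1 + q)²`. This is where the rate `(1+t)^{-1/2}` originates. -/
theorem parabolic_decay_le {κ r t t₀ : ℝ} (hκ : 0 < κ) (hr0 : 0 ≤ r) (hr1 : r ≤ 1) (ht₀ : 0 ≤ t₀)
    (ht : t₀ ≤ t) : (r + r ^ 3 * (t - t₀) + (1 + t)⁻¹) * Real.exp (-(κ / 2 * (r ^ 2 * (t - t₀)))) ≤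
      ((1 + t₀) * (1 + 4 / κ) ^ 2 + 1) * (√(1 + t))⁻¹ := by
  have ht0 := ht₀.trans ht
  set q : ℝ := r ^ 2 * (t - t₀) with hq
  have hq0 : 0 ≤ q := mul_nonneg (sq_nonneg _) (sub_nonneg.2 ht)
  set S := √(1 + t) with hS
  have hS0 : 0 < S := Real.sqrt_pos.2 (by linarith)
  have hSS : S ^ 2 = 1 + t := Real.sq_sqrt (by linarith)
  have hS1 : 1 ≤ S := Real.one_le_sqrt.2 (by linarith)
  have hE := Real.exp_pos (-(κ / 2 * q))
  have hE1 : Real.exp (-(κ / 2 * q)) ≤ 1 := Real.exp_le_one_iff.2 (by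
    have : 0 ≤ κ / 2 * q := by positivity
    linarith)
  rw [← div_eq_mul_inv, le_div_iff₀ hS0]
  have h1 : r * S ≤ (1 + t₀) * (1 + q) := by
    refine le_of_sq_le_sq ?_ (by positivity)
    rw [mul_pow, hSS]
    have e1 : r ^ 2 * (1 + t) = r ^ 2 * (1 + t₀) + q := by rw [hq]; ring
    have e2 : r ^ 2 ≤ 1 := pow_le_one₀ hr0 hr1
    have e3 : r ^ 2 * (1 + t₀) ≤ 1 + t₀ := mul_le_of_le_one_left (by linarith) e2
    have e4 : 1 + t₀ + q ≤ (1 + t₀) * (1 + q) := by nlinarith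
    have e5 : 1 ≤ (1 + t₀) * (1 + q) := by nlinarith
    nlinarith
  have h2 : (1 + t)⁻¹ * S ≤ 1 := by
    rw [← hSS, sq, mul_inv, mul_assoc, inv_mul_cancel₀ hS0.ne', mul_one]
    exact inv_le_one_of_one_le₀ hS1
  have h3 := one_add_sq_mul_exp_le hκ hq0
  calc _ = (r * S * (1 + q)) * Real.exp (-(κ / 2 * q)) +
        ((1 + t)⁻¹ * S) * Real.exp (-(κ / 2 * q)) := by rw [hq]; ring
    _ ≤ ((1 + t₀) * (1 + q) * (1 + q)) * Real.exp (-(κ / 2 * q)) + 1 * 1 := by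
        gcongr
    _ = (1 + t₀) * ((1 + q) ^ 2 * Real.exp (-(κ / 2 * q))) + 1 := by ring
    _ ≤ _ := by gcongr

variable {A : Fin n → ℝ → Mat d} {B : ℝ → Mat d} {δ : Fin d → ℝ → ℝ} {M : ℝ → Mat d}

theorem IsFundamentalSolution.hasDerivWithinAt_act {G Φ : ℝ → Mat d} {s t : ℝ}
    (h : IsFundamentalSolution G s Φ) (ht : s ≤ t) (v : EuclideanSpace ℂ (Fin d)) :
    HasDerivWithinAt (fun τ => act (Φ τ) v) (I • act (G t) (act (Φ t) v)) (Ici s) t := by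
  have h1 : HasDerivWithinAt Φ (I • (G t * Φ t)) (Ici s) t :=
    hasDerivWithinAt_matrix.2 fun i j => h.2 t ht i j
  refine (Diffusion.hasDerivWithinAt_act h1 (hasDerivWithinAt_const t _ v)).congr_deriv ?_
  rw [map_zero, add_zero, act_smul, act_mul]

variable [NeZero d]

theorem Xi_ne_zero (t t₀ : ℝ) (ξ : Space n) : Xi A δ M 2 t t₀ ξ ≠ 0 := Complex.exp_ne_zero _

/-- Division by `Ξ₂` cancels the scalar part of the reduced system, so the leading diagonal entry
becomes zero and the leading component can converge. -/
theorem hasDerivWithinAt_inv_Xi_smul (hA : ∀ k, MatSymbolClass 0 (A k)) (hB : MatSymbolClass 0 B)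
    (hB2 : CondB2 B δ) (hM : IsDiagonaliser B δ M) {ξ : Space n} {t₀ t : ℝ} (ht₀ : 0 < t₀)
    (ht : t₀ ≤ t) {y : ℝ → EuclideanSpace ℂ (Fin d)}
    (hy : HasDerivWithinAt y (I • act (reducedG A δ M t ξ) (y t)) (Ici t₀) t) :
    HasDerivWithinAt (fun s => (Xi A δ M 2 s t₀ ξ)⁻¹ • y s)
      (I • act (Matrix.diagonal (fun j => relRate A δ M ξ j t) + remainder A δ M 2 t ξ)
        ((Xi A δ M 2 t t₀ ξ)⁻¹ • y t)) (Ici t₀) t := by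
  have h0 := Xi_ne_zero (A := A) (δ := δ) (M := M) t t₀ ξ
  have h1 := ((hasDerivAt_Xi hA hB hB2 hM ξ ht₀ ht).fun_inv h0).hasDerivWithinAt (s := Ici t₀)
  refine (h1.smul hy).congr_deriv ?_
  have : -(I * cornerF A δ M 2 t ξ * Xi A δ M 2 t t₀ ξ) / Xi A δ M 2 t t₀ ξ ^ 2 =
      -((Xi A δ M 2 t t₀ ξ)⁻¹ * I * cornerF A δ M 2 t ξ) := by
    field_simp
  rw [reducedG_eq, act_add, act_smul, act_one, map_smul, this]
  module

theorem symbolK_eq (t : ℝ) (ξ : Space n) (z : ℂ) : symbolK A δ M t ξ z =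
    act (M t * matN A δ M 2 t ξ) (z • EuclideanSpace.single 0 1) := by
  rw [map_smul, symbolK]
  congr 1
  ext i
  rw [act_apply]
  simp

/-- The asymptotics of the fundamental solution in the elliptic zone. -/
theorem exists_low_frequency (hA : ∀ k, MatSymbolClass 0 (A k)) (hB : MatSymbolClass 0 B)
    (hB1 : CondB1 A B) (hB2 : CondB2 B δ) (hB3 : CondB3 A B) (hM : IsDiagonaliser B δ M) :
    ∃ c : ℝ, 0 < c ∧
      (∀ t, 1 / c ≤ t → ∀ ξ : Space n, ‖ξ‖ ≤ c →
        IsUnit (matN A δ M 2 t ξ) ∧ ‖(matN A δ M 2 t ξ)⁻¹‖ ≤ 2) ∧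
      (∃ K : ℝ, 0 ≤ K ∧ ∀ t, 1 / c ≤ t → ∀ ξ : Space n, ‖ξ‖ ≤ c → ∀ z,
        ‖symbolK A δ M t ξ z‖ ≤ K * ‖z‖) ∧
      (∃ κ : ℝ, 0 < κ ∧ ∃ K : ℝ, 0 < K ∧ ∀ t₀, 1 / c ≤ t₀ → ∀ t, t₀ ≤ t → ∀ ξ : Space n,
        ‖Xi A δ M 2 t t₀ ξ‖ ≤ K * Real.exp (-(κ * ‖ξ‖ ^ 2 * (t - t₀)))) ∧
      ∀ t₀, 1 / c ≤ t₀ → ∀ E₂ : ℝ → Mat d,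
        IsFundamentalSolution (fun t => reducedG A δ M t 0) t₀ E₂ →
        ∃ W : Fin d → ℂ,
          Tendsto (fun t => fun j => (Xi A δ M 2 t t₀ 0)⁻¹ * E₂ t 0 j) atTop (𝓝 W) ∧
          ∃ K : ℝ, 0 ≤ K ∧ ∀ ξ : Space n, ‖ξ‖ ≤ c → ∀ x : ℝ → EuclideanSpace ℂ (Fin d),
            (∀ t, 0 ≤ t →
              HasDerivWithinAt x (I • act (symbolA A t ξ + I • B t) (x t)) (Ici 0) t) →
            ∀ t, t₀ ≤ t → ‖x t - symbolK A δ M t ξ (Xi A δ M 2 t t₀ ξ *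
              (W ⬝ᵥ (((matN A δ M 2 t₀ ξ)⁻¹ * (M t₀)⁻¹) *ᵥ fun i => x t₀ i)))‖ ≤
              K * (√(1 + t))⁻¹ * ‖x 0‖ := by
  obtain ⟨κ, hκ, a, ha, c₁, hc₁0, hc₁1, hred⟩ := exists_reduced_bounds hA hB hB2 hM
  obtain ⟨k, hk, X, hX, T, hT, hXi⟩ := exists_norm_Xi_le hA hB hB1 hB2 hB3 hM
  obtain ⟨m, hm0, hm⟩ := hM.1.norm_bound
  obtain ⟨m', hm'0, hm'⟩ := hM.2.1.norm_bound
  simp only [pow_zero, mul_one] at hm hm'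
  -- In order, the entries ensure the reduced estimates, the Gaussian bound from time `1/c` on, the
  -- inequality `a r³ ≤ (k/2) r²` that absorbs the growth factor, and `(1+t₀)⁻¹ ≤ κ/2` for the
  -- damped components.
  set c : ℝ := min c₁ (min (1 / T) (min (k / (2 * (a + 1))) (κ / 2))) with hc
  have hc0 : 0 < c := lt_min hc₁0 (lt_min (by positivity) (lt_min (by positivity) (by positivity)))
  have hcc₁ : c ≤ c₁ := min_le_left _ _
  have hcT : T ≤ 1 / c := by
    rw [le_div_iff₀ hc0, mul_comm]
    exact (le_div_iff₀ hT).1 ((min_le_right _ _).trans (min_le_left _ _))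
  have hck : c * (2 * (a + 1)) ≤ k := (le_div_iff₀ (by positivity)).1
    ((min_le_right _ _).trans ((min_le_right _ _).trans (min_le_left _ _)))
  have hcκ : c ≤ κ / 2 :=
    (min_le_right _ _).trans ((min_le_right _ _).trans (min_le_right _ _))
  have hinv : 1 / c₁ ≤ 1 / c := one_div_le_one_div_of_le hc0 hcc₁
  have hcpos : 0 < 1 / c := by positivity
  have hMN : ∀ t, 1 / c ≤ t → ∀ ξ : Space n, ‖ξ‖ ≤ c → ‖M t * matN A δ M 2 t ξ‖ ≤ m * 2 :=
    fun t ht ξ hξ => norm_mul_le_of_le (hm t (hcpos.le.trans ht))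
      (hred t (hinv.trans ht) ξ (hξ.trans hcc₁)).1.2.1
  refine ⟨c, hc0, fun t ht ξ hξ => ?_, ⟨m * 2, by positivity, fun t ht ξ hξ z => ?_⟩,
    ⟨k, hk, X, hX, fun t₀ ht₀ t ht ξ => hXi t₀ (hcT.trans ht₀) t ht ξ⟩, fun t₀ ht₀ E₂ hE₂ => ?_⟩
  · have := (hred t (hinv.trans ht) ξ (hξ.trans hcc₁)).1
    exact ⟨this.1, this.2.2⟩
  · rw [symbolK_eq]
    refine (norm_act_le _ _).trans ?_
    rw [norm_smul, PiLp.norm_single, norm_one, mul_one]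
    exact mul_le_mul_of_nonneg_right (hMN t ht ξ hξ) (norm_nonneg _)
  have ht₀0 : 0 < t₀ := hcpos.trans_le ht₀
  have hR : ∀ t, t₀ ≤ t → ∀ ξ : Space n, ‖ξ‖ ≤ c → _ := fun t ht ξ hξ =>
    hred t (hinv.trans (ht₀.trans ht)) ξ (hξ.trans hcc₁)
  have h0c : ‖(0 : Space n)‖ ≤ c := by simpa using hc0.le
  set y₀ : EuclideanSpace ℂ (Fin d) → ℝ → EuclideanSpace ℂ (Fin d) := fun v s =>
    (Xi A δ M 2 s t₀ (0 : Space n))⁻¹ • act (E₂ s) v with hy₀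
  have hy₀d : ∀ v t, t₀ ≤ t → HasDerivWithinAt (y₀ v)
      (I • act (Matrix.diagonal (fun j => relRate A δ M (0 : Space n) j t) +
        remainder A δ M 2 t 0) (y₀ v t)) (Ici t₀) t := fun v t ht =>
    hasDerivWithinAt_inv_Xi_smul hA hB hB2 hM ht₀0 ht (hE₂.hasDerivWithinAt_act ht v)
  have him0 : ∀ j t, t₀ ≤ t → 0 ≤ (relRate A δ M (0 : Space n) j t).im := fun j t ht => by
    by_cases hj : j = 0
    · rw [hj, (hR t ht 0 h0c).2.1, Complex.zero_im]
    · exact hκ.le.trans ((hR t ht 0 h0c).2.2.1 j hj)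
  have hR0 : ∀ t, t₀ ≤ t → ‖remainder A δ M 2 t (0 : Space n)‖ ≤ a * (1 + t)⁻¹ ^ 3 :=
    fun t ht => by simpa using (hR t ht 0 h0c).2.2.2.2.1
  have hlim : ∀ j : Fin d, ∃ L, Tendsto (fun t => (Xi A δ M 2 t t₀ (0 : Space n))⁻¹ * E₂ t 0 j)
      atTop (𝓝 L) := by
    intro j
    obtain ⟨L, hL, -⟩ := exists_tendsto_zeroth_coord ha ht₀0.le him0
      (fun t ht => (hR t ht 0 h0c).2.1) hR0 (hy₀d (EuclideanSpace.single j 1))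
    refine ⟨L, hL.congr fun t => ?_⟩
    simp only [hy₀]
    rw [PiLp.smul_apply, act_apply, smul_eq_mul]
    simp
  choose W hW using hlim
  refine ⟨W, tendsto_pi_nhds.2 hW, ?_⟩
  -- The entries of `W` are the limits for the basis vectors; linearity gives the limit for
  -- arbitrary data.
  have hWv : ∀ v, Tendsto (fun t => y₀ v t 0) atTop (𝓝 (W ⬝ᵥ fun i => v i)) := by
    intro v
    refine (tendsto_finsetSum Finset.univ fun j _ => (hW j).mul_const (v j)).congr fun t => ?_
    simp only [hy₀]
    rw [PiLp.smul_apply, act_apply, smul_eq_mul, Finset.mul_sum]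
    simp only [mul_assoc]
  have hκt : (1 + t₀)⁻¹ ≤ κ / 2 := by
    refine le_trans (inv_le_of_inv_le₀ hc0 ?_) hcκ
    rw [one_div] at ht₀
    linarith
  obtain ⟨C, hC0, hC⟩ := exists_norm_sub_limit_le (d := d) ha hκ ht₀0.le hκt
  set Q : ℝ := (1 + t₀) * (1 + 4 / k) ^ 2 + 1 with hQ
  have hQ0 : 0 ≤ Q := by positivity
  refine ⟨m * 2 * (X * (C * Q * (2 * m'))), by positivity, fun ξ hξ x hx t ht => ?_⟩
  have hξ1 : ‖ξ‖ ≤ 1 := hξ.trans (hcc₁.trans hc₁1)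
  have ht0 : 0 ≤ t := ht₀0.le.trans ht
  set y : ℝ → EuclideanSpace ℂ (Fin d) := fun s =>
    act ((matN A δ M 2 s ξ)⁻¹ * (M s)⁻¹) (x s) with hy
  set z : ℝ → EuclideanSpace ℂ (Fin d) := fun s => (Xi A δ M 2 s t₀ ξ)⁻¹ • y s with hz
  have hzd : ∀ s, t₀ ≤ s → HasDerivWithinAt z
      (I • act (Matrix.diagonal (fun j => relRate A δ M ξ j s) + remainder A δ M 2 s ξ) (z s))
      (Ici t₀) s := fun s hs =>
    hasDerivWithinAt_inv_Xi_smul hA hB hB2 hM ht₀0 hs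
      ((hasDerivWithinAt_reduced hA hB hB2 hM (ht₀0.le.trans hs) (hR s hs ξ hξ).1.1
        (hx s (ht₀0.le.trans hs))).mono (Ici_subset_Ici.2 ht₀0.le))
  have hzt₀ : z t₀ = y t₀ := by simp only [hz, Xi_self, inv_one, one_smul]
  have hy₀t₀ : y₀ (y t₀) t₀ = y t₀ := by
    simp only [hy₀, Xi_self, inv_one, one_smul, hE₂.1]
    exact act_one _
  set L : ℂ := W ⬝ᵥ fun i => y t₀ i with hL
  -- The solution at frequency `ξ` is compared with the solution at frequency `0` that takes the
  -- same value `y t₀` at `t₀`. This explains why `W₂` is built at `ξ = 0` but acts on data carrying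
  -- `N₂⁻¹(t₀, ξ)`.
  have key := hC ‖ξ‖ (relRate A δ M ξ) (relRate A δ M 0) (fun s => remainder A δ M 2 s ξ)
    (fun s => remainder A δ M 2 s 0) z (y₀ (y t₀)) L (norm_nonneg _) hξ1
    (fun s hs => (hR s hs ξ hξ).2.1) (fun s hs => (hR s hs 0 h0c).2.1)
    (fun j s hs hj => (hR s hs ξ hξ).2.2.1 j hj) him0 (fun s hs => (hR s hs ξ hξ).2.2.2.2.1) hR0
    (fun s hs => (hR s hs ξ hξ).2.2.2.2.2) (fun j s hs => (hR s hs ξ hξ).2.2.2.1 j) hzd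
    (hy₀d (y t₀)) (hzt₀.trans hy₀t₀.symm) (hWv (y t₀)) t ht
  have hxt : x t = act (M t * matN A δ M 2 t ξ) (Xi A δ M 2 t t₀ ξ • z t) := by
    have e1 : M t * matN A δ M 2 t ξ * ((matN A δ M 2 t ξ)⁻¹ * (M t)⁻¹) = 1 := by
      rw [Matrix.mul_assoc, ← Matrix.mul_assoc (matN A δ M 2 t ξ), Matrix.mul_nonsing_inv _
        ((Matrix.isUnit_iff_isUnit_det _).1 (hR t ht ξ hξ).1.1), one_mul, hM.mul_inv ht0]
    simp only [hz, smul_smul, mul_inv_cancel₀ (Xi_ne_zero t t₀ ξ), one_smul, hy]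
    rw [← act_mul, e1, act_one]
  have hdata : W ⬝ᵥ (((matN A δ M 2 t₀ ξ)⁻¹ * (M t₀)⁻¹) *ᵥ fun i => x t₀ i) = L := rfl
  have hdiff : x t - symbolK A δ M t ξ (Xi A δ M 2 t t₀ ξ * L) =
      act (M t * matN A δ M 2 t ξ) (Xi A δ M 2 t t₀ ξ • (z t - L • EuclideanSpace.single 0 1)) := by
    rw [symbolK_eq, smul_sub, map_sub, ← hxt, smul_smul]
  rw [hdata, hdiff]
  have hy1 : ‖z t₀‖ ≤ 2 * m' * ‖x 0‖ := by
    rw [hzt₀]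
    refine (norm_act_le _ _).trans (mul_le_mul (norm_mul_le_of_le (hR t₀ le_rfl ξ hξ).1.2.2
      (hm' t₀ ht₀0.le)) (norm_le_of_system hB1 hx ht₀0.le) (norm_nonneg _) (by positivity))
  have hXt := hXi t₀ (hcT.trans ht₀) t ht ξ
  set r := ‖ξ‖ with hr
  have hr0 : 0 ≤ r := norm_nonneg _
  -- Half of the Gaussian decay of `Ξ₂` beats the growth `exp(a r³ (t - t₀))`, because `r ≤ c`; the
  -- other half is left for `parabolic_decay_le`.
  have hexp : Real.exp (-(k * r ^ 2 * (t - t₀))) * Real.exp (a * r ^ 3 * (t - t₀)) ≤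
      Real.exp (-(k / 2 * (r ^ 2 * (t - t₀)))) := by
    rw [← Real.exp_add]
    refine Real.exp_le_exp.2 ?_
    have e1 : a * r ≤ k / 2 := by
      have := mul_le_mul_of_nonneg_left hξ ha
      nlinarith
    have e2 := mul_le_mul_of_nonneg_right e1
      (mul_nonneg (sq_nonneg r) (sub_nonneg.2 ht))
    nlinarith
  have hdec := parabolic_decay_le hk hr0 hξ1 ht₀0.le ht
  have hfac : 0 ≤ r + r ^ 3 * (t - t₀) + (1 + t)⁻¹ := by
    have := sub_nonneg.2 ht
    have := inv_one_add_pos ht0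
    positivity
  refine (norm_act_le _ _).trans ?_
  rw [norm_smul]
  calc _ ≤ m * 2 * (X * Real.exp (-(k * r ^ 2 * (t - t₀))) *
        (C * (r + r ^ 3 * (t - t₀) + (1 + t)⁻¹) * Real.exp (a * r ^ 3 * (t - t₀)) *
          (2 * m' * ‖x 0‖))) := by
        refine mul_le_mul (hMN t (ht₀.trans ht) ξ hξ) (mul_le_mul hXt
          (key.trans (mul_le_mul_of_nonneg_left hy1 (by positivity))) (norm_nonneg _)
          (by positivity)) (by positivity) (by positivity)
    _ = m * 2 * (X * (C * ((r + r ^ 3 * (t - t₀) + (1 + t)⁻¹) *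
        (Real.exp (-(k * r ^ 2 * (t - t₀))) * Real.exp (a * r ^ 3 * (t - t₀)))) *
          (2 * m'))) * ‖x 0‖ := by ring
    _ ≤ m * 2 * (X * (C * (Q * (√(1 + t))⁻¹) * (2 * m'))) * ‖x 0‖ := by
        have hfin := (mul_le_mul_of_nonneg_left hexp hfac).trans hdec
        exact mul_le_mul_of_nonneg_right (mul_le_mul_of_nonneg_left (mul_le_mul_of_nonneg_left
          (mul_le_mul_of_nonneg_right (mul_le_mul_of_nonneg_left hfin hC0) (by positivity)) hX.le)
          (by positivity)) (norm_nonneg _)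
    _ = _ := by ring

end LowFrequency

/-! ### Uniqueness of weak solutions on the Fourier side -/

section WeakUniqueness

variable {n : ℕ}

theorem integral_mul_eq_inner (f g : L2 n ℂ) : ∫ x, f x * g x = inner ℂ (star g) f := by
  rw [L2.inner_def]
  refine integral_congr_ae ?_
  filter_upwards [Lp.coeFn_star g] with x hx
  rw [hx]
  simp [RCLike.inner_apply]

theorem norm_star_L2 (g : L2 n ℂ) : ‖star g‖ = ‖g‖ := by
  rw [Lp.norm_def, Lp.norm_def]
  congr 1
  refine eLpNorm_congr_norm_ae ?_
  filter_upwards [Lp.coeFn_star g] with x hx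
  rw [hx]
  simp

theorem continuous_star_L2 : Continuous (star : L2 n ℂ → L2 n ℂ) :=
  (Isometry.of_dist_eq fun g h => by
    rw [dist_eq_norm, dist_eq_norm, Lp.norm_def, Lp.norm_def]
    congr 1
    refine eLpNorm_congr_norm_ae ?_
    filter_upwards [Lp.coeFn_star g, Lp.coeFn_star h, Lp.coeFn_sub g h,
      Lp.coeFn_sub (star g) (star h)] with x h1 h2 h3 h4
    rw [h3, h4, Pi.sub_apply, Pi.sub_apply, h1, h2, Pi.star_apply, Pi.star_apply, ← star_sub,
      norm_star]).continuous

theorem norm_integral_mul_le (f g : L2 n ℂ) : ‖∫ x, f x * g x‖ ≤ ‖f‖ * ‖g‖ := by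
  rw [integral_mul_eq_inner]
  calc _ ≤ ‖star g‖ * ‖f‖ := norm_inner_le_norm _ _
    _ = _ := by rw [norm_star_L2, mul_comm]

theorem integrable_mul_L2 (f g : L2 n ℂ) : Integrable fun x => f x * g x := by
  refine (L2.integrable_inner (𝕜 := ℂ) (star g) f).congr ?_
  filter_upwards [Lp.coeFn_star g] with x hx
  rw [hx]
  simp [RCLike.inner_apply]

theorem integrable_mul_of_memLp {f g : Space n → ℂ} (hf : MemLp f 2 volume)
    (hg : MemLp g 2 volume) : Integrable fun x => f x * g x := by
  refine (integrable_mul_L2 (hf.toLp f) (hg.toLp g)).congr ?_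
  filter_upwards [hf.coeFn_toLp, hg.coeFn_toLp] with x h1 h2
  rw [h1, h2]

theorem memLp_schwartz (ψ : 𝓢(Space n, ℂ)) : MemLp ψ 2 (volume : Measure (Space n)) :=
  ψ.memLp 2 volume

theorem norm_integral_mul_mul_le {h : Space n → ℂ} (hh : AEStronglyMeasurable h volume)
    (u : L2 n ℂ) (ψ : 𝓢(Space n, ℂ)) {K : ℝ} (hK : ∀ᵐ ξ, ‖h ξ * u ξ‖ ≤ K * ‖u ξ‖) :
    ‖∫ ξ, h ξ * u ξ * ψ ξ‖ ≤ K * ‖u‖ * ‖(ψ.toLp 2 : L2 n ℂ)‖ := by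
  have hm : MemLp (fun ξ => h ξ * u ξ) 2 (volume : Measure (Space n)) :=
    (Lp.memLp u).of_le_mul (hh.mul (Lp.aestronglyMeasurable u)) hK
  have h1 : ∫ ξ, h ξ * u ξ * ψ ξ = ∫ ξ, (hm.toLp _ : L2 n ℂ) ξ * (ψ.toLp 2 : L2 n ℂ) ξ := by
    refine integral_congr_ae ?_
    filter_upwards [hm.coeFn_toLp, ψ.coeFn_toLp 2 volume] with x h1 h2
    rw [h1, h2]
  rw [h1]
  refine (norm_integral_mul_le _ _).trans ?_
  gcongr
  refine Lp.norm_le_mul_norm_of_ae_le_mul ?_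
  filter_upwards [hm.coeFn_toLp, hK] with x h1 h2
  rw [h1]
  exact h2

/-- Duality in `L²`: Schwartz functions are dense, and the complex conjugate of `f` is itself an
admissible limit of test functions. -/
theorem norm_le_of_forall_schwartz {f : L2 n ℂ} {b : ℝ} (hb : 0 ≤ b)
    (h : ∀ ψ : 𝓢(Space n, ℂ), ‖∫ ξ, f ξ * ψ ξ‖ ≤ b * ‖(ψ.toLp 2 : L2 n ℂ)‖) : ‖f‖ ≤ b := by
  have hd : DenseRange (SchwartzMap.toLpCLM ℝ ℂ 2 (volume : Measure (Space n))) :=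
    SchwartzMap.denseRange_toLpCLM ENNReal.ofNat_ne_top
  have key : ∀ g : L2 n ℂ, ‖inner ℂ (star g) f‖ ≤ b * ‖g‖ := by
    intro g
    refine hd.induction_on (p := fun g : L2 n ℂ => ‖inner ℂ (star g) f‖ ≤ b * ‖g‖) g ?_ ?_
    · refine isClosed_le ?_ (by fun_prop)
      exact (Continuous.inner continuous_star_L2 continuous_const).norm
    · intro ψ
      rw [← integral_mul_eq_inner]
      refine le_trans (le_of_eq ?_) (h ψ)
      congr 1
      refine integral_congr_ae ?_
      filter_upwards [ψ.coeFn_toLp 2 volume] with x h1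
      rw [SchwartzMap.toLpCLM_apply, h1]
  have h1 := key (star f)
  rw [star_star, norm_star_L2, inner_self_eq_norm_sq_to_K] at h1
  norm_cast at h1
  rw [abs_of_nonneg (by positivity), sq] at h1
  rcases (norm_nonneg f).eq_or_lt with h0 | h0
  · rw [← h0]; exact hb
  · exact le_of_mul_le_mul_right h1 h0

/-- Multiplying a Schwartz function by a smooth compactly supported function. -/
theorem exists_schwartz_mul (χ : Space n → ℂ) (h₁ : HasCompactSupport χ) (h₂ : ContDiff ℝ ∞ χ)
    (ψ : 𝓢(Space n, ℂ)) : ∃ η : 𝓢(Space n, ℂ), HasCompactSupport η ∧ ∀ ξ, η ξ = χ ξ * ψ ξ := by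
  have hg : Function.HasTemperateGrowth χ := (h₁.toSchwartzMap h₂).hasTemperateGrowth
  have he : ∀ ξ, (SchwartzMap.smulLeftCLM ℂ χ ψ) ξ = χ ξ * ψ ξ := fun ξ =>
    SchwartzMap.smulLeftCLM_apply_apply hg ψ ξ
  refine ⟨SchwartzMap.smulLeftCLM ℂ χ ψ, ?_, he⟩
  rw [show (⇑(SchwartzMap.smulLeftCLM ℂ χ ψ) : Space n → ℂ) = fun ξ => χ ξ * ψ ξ from funext he]
  exact h₁.mul_right

theorem exists_cutoff (R : ℝ) (hR : 0 < R) : ∃ χ : Space n → ℂ, HasCompactSupport χ ∧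
    ContDiff ℝ ∞ χ ∧ (∀ ξ, ‖χ ξ‖ ≤ 1) ∧ (∀ ξ, ‖ξ‖ ≤ R → χ ξ = 1) ∧
    ∀ ξ, R + 1 ≤ ‖ξ‖ → χ ξ = 0 := by
  let f : ContDiffBump (0 : Space n) := ⟨R, R + 1, hR, by linarith⟩
  refine ⟨fun ξ => (f ξ : ℂ), ?_, ?_, ?_, ?_, ?_⟩
  · exact f.hasCompactSupport.comp_left (g := fun x : ℝ => (x : ℂ)) (by simp)
  · exact Complex.ofRealCLM.contDiff.comp f.contDiff
  · intro ξ
    rw [Complex.norm_real, Real.norm_of_nonneg f.nonneg]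
    exact f.le_one
  · intro ξ h
    change (f ξ : ℂ) = 1
    rw [f.one_of_mem_closedBall (by simpa using h)]
    simp
  · intro ξ h
    change (f ξ : ℂ) = 0
    rw [f.zero_of_le_dist (by simpa using h)]
    simp

/-- The only bounded weak solution to `D' = G(t, ξ) D` with vanishing data is zero. -/
theorem eq_zero_of_weak_solution {ι : Type} [Fintype ι] {D : ι → ℝ → L2 n ℂ}
    {G : ℝ → Space n → Matrix ι ι ℂ} {s : ℝ}
    (hGc : ∀ t, s ≤ t → ∀ i j, Continuous fun ξ => G t ξ i j)
    (hGb : ∀ R T : ℝ, ∃ K : ℝ, ∀ t, s ≤ t → t ≤ T → ∀ ξ, ‖ξ‖ ≤ R → ∀ i j, ‖G t ξ i j‖ ≤ K)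
    (hDb : ∀ T : ℝ, ∃ K : ℝ, ∀ t, s ≤ t → t ≤ T → ∀ i, ‖D i t‖ ≤ K)
    (hD0 : ∀ i, D i s = 0)
    (hD : ∀ (i : ι) (ψ : 𝓢(Space n, ℂ)), HasCompactSupport ψ → ∀ t, s ≤ t →
      HasDerivWithinAt (fun τ => ∫ ξ, D i τ ξ * ψ ξ) (∫ ξ, (∑ j, G t ξ i j * D j t ξ) * ψ ξ)
        (Ici s) t) {t : ℝ} (ht : s ≤ t) (i : ι) : D i t = 0 := by
  -- The coefficients are bounded only for bounded frequencies. The equation is local in `ξ`, so a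
  -- cutoff reduces the claim to balls.
  suffices H : ∀ R : ℝ, 0 < R → ∀ᵐ ξ, ‖ξ‖ ≤ R → D i t ξ = 0 by
    refine (Lp.eq_zero_iff_ae_eq_zero).2 ?_
    have h1 : ∀ N : ℕ, ∀ᵐ ξ, ‖ξ‖ ≤ (N : ℝ) + 1 → D i t ξ = 0 := fun N => H _ (by positivity)
    filter_upwards [ae_all_iff.2 h1] with ξ hξ
    obtain ⟨N, hN⟩ := exists_nat_ge ‖ξ‖
    exact hξ N (by linarith)
  intro R hR
  obtain ⟨χ, hχ1, hχ2, hχ3, hχ4, hχ5⟩ := exists_cutoff (n := n) R hR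
  obtain ⟨K', hK'⟩ := hGb (R + 1) t
  obtain ⟨m', hm'⟩ := hDb t
  set K : ℝ := max K' 0 with hKdef
  set m : ℝ := max m' 0 with hmdef
  have hK0 : 0 ≤ K := le_max_right _ _
  have hm0 : 0 ≤ m := le_max_right _ _
  have hK : ∀ τ, s ≤ τ → τ ≤ t → ∀ ξ, ‖ξ‖ ≤ R + 1 → ∀ i j, ‖G τ ξ i j‖ ≤ K :=
    fun τ h1 h2 ξ h3 i j => (hK' τ h1 h2 ξ h3 i j).trans (le_max_left _ _)
  have hmem : ∀ j τ, MemLp (fun ξ => χ ξ * D j τ ξ) 2 (volume : Measure (Space n)) := by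
    intro j τ
    refine (Lp.memLp (D j τ)).of_le_mul (c := 1)
      (hχ2.continuous.aestronglyMeasurable.mul (Lp.aestronglyMeasurable _)) ?_
    filter_upwards with ξ
    rw [norm_mul]
    exact mul_le_mul_of_nonneg_right (hχ3 ξ) (norm_nonneg _)
  let u : ι → ℝ → L2 n ℂ := fun j τ => (hmem j τ).toLp _
  have hu : ∀ j τ, ∀ᵐ ξ, u j τ ξ = χ ξ * D j τ ξ := fun j τ => (hmem j τ).coeFn_toLp
  -- This exponent is twice the bound of the coefficient operator, so integrating the equation
  -- against the weight `e^{L(τ - s)}` halves the constant.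
  set L : ℝ := 2 * (Fintype.card ι * K) with hL
  have hGu : ∀ τ, s ≤ τ → τ ≤ t → ∀ i j, ∀ᵐ ξ, ‖G τ ξ i j * u j τ ξ‖ ≤ K * ‖u j τ ξ‖ := by
    intro τ h1 h2 i j
    filter_upwards [hu j τ] with ξ hξ
    rcases le_total ‖ξ‖ (R + 1) with h | h
    · rw [norm_mul]
      exact mul_le_mul_of_nonneg_right (hK τ h1 h2 ξ h i j) (norm_nonneg _)
    · rw [hξ, hχ5 ξ h]
      simp
  have hderiv : ∀ (i : ι) (ψ : 𝓢(Space n, ℂ)) (τ : ℝ), s ≤ τ → τ ≤ t →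
      HasDerivWithinAt (fun τ => ∫ ξ, u i τ ξ * ψ ξ) (∑ j, ∫ ξ, G τ ξ i j * u j τ ξ * ψ ξ)
        (Ici s) τ := by
    intro i ψ τ h1 h2
    obtain ⟨η, hη1, hη2⟩ := exists_schwartz_mul χ hχ1 hχ2 ψ
    have e1 : (fun τ => ∫ ξ, u i τ ξ * ψ ξ) = fun τ => ∫ ξ, D i τ ξ * η ξ := by
      funext τ
      refine integral_congr_ae ?_
      filter_upwards [hu i τ] with ξ hξ
      rw [hξ, hη2]
      ring
    rw [e1]
    refine (hD i η hη1 τ h1).congr_deriv ?_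
    rw [← integral_finsetSum]
    · refine integral_congr_ae ?_
      filter_upwards [ae_all_iff.2 fun j => hu j τ] with ξ hξ
      rw [hη2, Finset.sum_mul]
      refine Finset.sum_congr rfl fun j _ => ?_
      rw [hξ j]
      ring
    · intro j _
      refine integrable_mul_of_memLp ?_ (memLp_schwartz ψ)
      exact (Lp.memLp (u j τ)).of_le_mul
        ((hGc τ h1 i j).aestronglyMeasurable.mul (Lp.aestronglyMeasurable _)) (hGu τ h1 h2 i j)
  -- Only pairings with test functions are known to be differentiable, not the norm. Each round
  -- inserts the current norm bound into the weak equation, integrates for every test function, and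
  -- recovers by duality a norm bound that is half as large.
  have claim : ∀ k : ℕ, ∀ τ, s ≤ τ → τ ≤ t → ∀ i,
      ‖u i τ‖ ≤ m * (1 / 2) ^ k * Real.exp (L * (τ - s)) := by
    intro k
    induction k with
    | zero =>
      intro τ h1 h2 i
      have hL0 : 0 ≤ L := by positivity
      have h3 : ‖u i τ‖ ≤ 1 * ‖D i τ‖ := by
        refine Lp.norm_le_mul_norm_of_ae_le_mul ?_
        filter_upwards [hu i τ] with ξ hξ
        rw [hξ, norm_mul]
        exact mul_le_mul_of_nonneg_right (hχ3 ξ) (norm_nonneg _)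
      have h4 : ‖D i τ‖ ≤ m := (hm' τ h1 h2 i).trans (le_max_left _ _)
      have h5 : 1 ≤ Real.exp (L * (τ - s)) :=
        Real.one_le_exp (mul_nonneg hL0 (by linarith))
      rw [pow_zero, mul_one]
      nlinarith
    | succ k ih =>
      intro τ h1 h2 i
      refine norm_le_of_forall_schwartz (by positivity) fun ψ => ?_
      set p : ℝ := ‖(ψ.toLp 2 : L2 n ℂ)‖ with hp
      have hexp : ∀ r : ℝ, HasDerivWithinAt
          (fun r => m * (1 / 2) ^ (k + 1) * Real.exp (L * (r - s)) * p)
          (m * (1 / 2) ^ (k + 1) * (Real.exp (L * (r - s)) * L) * p) (Ici s) r := by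
        intro r
        have h6 : HasDerivAt (fun r : ℝ => L * (r - s)) L r := by
          simpa using ((hasDerivAt_id r).sub_const s).const_mul L
        exact ((h6.exp.const_mul _).mul_const p).hasDerivWithinAt
      refine norm_le_of_re_inner_deriv_le (t₀ := s) (t₁ := t) (a := fun _ => 0)
        (b := fun r => Fintype.card ι * (K * (m * (1 / 2) ^ k * Real.exp (L * (r - s))) * p))
        (fun r h3 h4 => hderiv i ψ r h3 h4)
        (fun r _ _ => hasDerivWithinAt_const r _ (0 : ℝ)) (fun r _ _ => hexp r) ?_ ?_ ?_ ?_ τ h1 h2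
      · intro r h3 h4
        rw [zero_mul, zero_add]
        refine (Complex.re_le_norm _).trans ((norm_inner_le_norm _ _).trans ?_)
        rw [mul_comm]
        refine mul_le_mul_of_nonneg_right ((norm_sum_le _ _).trans ?_) (norm_nonneg _)
        refine (Finset.sum_le_card_nsmul _ _
          (K * (m * (1 / 2) ^ k * Real.exp (L * (r - s))) * p) fun j _ => ?_).trans ?_
        · refine (norm_integral_mul_mul_le (hGc r h3 i j).aestronglyMeasurable (u j r) ψ
            (hGu r h3 h4 i j)).trans ?_
          gcongr
          exact ih r h3 h4 j
        · rw [nsmul_eq_mul, Finset.card_univ]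
      · intro r _ _
        refine le_of_eq ?_
        rw [hL]
        ring
      · intro r _ _
        positivity
      · have : ∫ ξ, u i s ξ * ψ ξ = 0 := by
          rw [← integral_zero (Space n) ℂ]
          refine integral_congr_ae ?_
          have h0 : ∀ᵐ ξ, D i s ξ = 0 := (Lp.eq_zero_iff_ae_eq_zero).1 (hD0 i)
          filter_upwards [hu i s, h0] with ξ hξ h0
          rw [hξ, h0]
          simp
        rw [this, norm_zero]
        positivity
  have hz : ‖u i t‖ ≤ 0 := by
    have h1 : Tendsto (fun k : ℕ => m * (1 / 2 : ℝ) ^ k * Real.exp (L * (t - s))) atTop (𝓝 0) := by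
      have := ((tendsto_pow_atTop_nhds_zero_of_lt_one (r := (1 / 2 : ℝ)) (by norm_num)
        (by norm_num)).const_mul m).mul_const (Real.exp (L * (t - s)))
      simpa using this
    exact ge_of_tendsto' h1 fun k => claim k t ht le_rfl i
  have hz' : u i t = 0 := norm_le_zero_iff.1 hz
  have h0 : ∀ᵐ ξ, u i t ξ = 0 := (Lp.eq_zero_iff_ae_eq_zero).1 hz'
  filter_upwards [h0, hu i t] with ξ h1 h2 h3
  rw [h1, hχ4 ξ h3, one_mul] at h2
  exact h2.symm

end WeakUniqueness

/-! ### Weak solutions are given by the fundamental matrix -/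

section Representation

variable {n : ℕ}

/-- Differentiation under the integral sign for one-sided derivatives. -/
theorem hasDerivWithinAt_integral {g g' : ℝ → Space n → ℂ} {bound : Space n → ℝ} {s t T : ℝ}
    (ht : s ≤ t) (hT : t < T) (hi : ∀ τ, s ≤ τ → Integrable (g τ))
    (hd : ∀ᵐ ξ, ∀ τ, s ≤ τ → HasDerivWithinAt (fun τ => g τ ξ) (g' τ ξ) (Ici s) τ)
    (hb : ∀ᵐ ξ, ∀ τ, s ≤ τ → τ ≤ T → ‖g' τ ξ‖ ≤ bound ξ) (hbi : Integrable bound) :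
    HasDerivWithinAt (fun τ => ∫ ξ, g τ ξ) (∫ ξ, g' t ξ) (Ici s) t := by
  rw [hasDerivWithinAt_iff_tendsto_slope]
  have hev : ∀ᶠ τ in 𝓝[Ici s \ {t}] t, s ≤ τ ∧ τ ≠ t ∧ τ ≤ T := by
    have h1 : ∀ᶠ τ in 𝓝[Ici s \ {t}] t, τ ∈ Ici s \ {t} := self_mem_nhdsWithin
    have h2 : ∀ᶠ τ in 𝓝[Ici s \ {t}] t, τ < T :=
      nhdsWithin_le_nhds (gt_mem_nhds hT)
    filter_upwards [h1, h2] with τ h1 h2 using ⟨h1.1, h1.2, h2.le⟩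
  have key : Tendsto (fun τ => ∫ ξ, slope (fun τ => g τ ξ) t τ) (𝓝[Ici s \ {t}] t)
      (𝓝 (∫ ξ, g' t ξ)) := by
    refine tendsto_integral_filter_of_dominated_convergence bound ?_ ?_ hbi ?_
    · filter_upwards [hev] with τ hτ
      simp only [slope_def_module]
      exact (((hi τ hτ.1).sub (hi t ht)).smul ((τ - t)⁻¹)).aestronglyMeasurable
    · filter_upwards [hev] with τ hτ
      filter_upwards [hd, hb] with ξ hd hb
      have h1 : ‖g τ ξ - g t ξ‖ ≤ bound ξ * ‖τ - t‖ :=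
        Convex.norm_image_sub_le_of_norm_hasDerivWithin_le (f := fun τ => g τ ξ)
          (f' := fun τ => g' τ ξ) (s := Icc s T)
          (fun r hr => (hd r hr.1).mono Icc_subset_Ici_self) (fun r hr => hb r hr.1 hr.2)
          (convex_Icc _ _) ⟨ht, hT.le⟩ ⟨hτ.1, hτ.2.2⟩
      have h2 : 0 < ‖τ - t‖ := norm_pos_iff.2 (sub_ne_zero.2 hτ.2.1)
      rw [slope_def_module, norm_smul, norm_inv, inv_mul_le_iff₀ h2, mul_comm]
      exact h1
    · filter_upwards [hd] with ξ hd
      exact hasDerivWithinAt_iff_tendsto_slope.1 (hd t ht)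
  refine key.congr' ?_
  filter_upwards [hev] with τ hτ
  simp only [slope_def_module]
  rw [integral_smul, integral_sub (hi τ hτ.1) (hi t ht)]

/-- A bounded weak solution to `V' = G(t, ξ) V` is given by the fundamental matrix. -/
theorem weak_solution_eq {ι : Type} [Fintype ι] [DecidableEq ι] {V : ι → ℝ → L2 n ℂ}
    {G Φ : ℝ → Space n → Matrix ι ι ℂ} {s : ℝ}
    (hGc : ∀ t, s ≤ t → ∀ i j, Continuous fun ξ => G t ξ i j)
    (hGb : ∀ R T : ℝ, ∃ K : ℝ, ∀ t, s ≤ t → t ≤ T → ∀ ξ, ‖ξ‖ ≤ R → ∀ i j, ‖G t ξ i j‖ ≤ K)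
    (hVb : ∀ T : ℝ, ∃ K : ℝ, ∀ t, s ≤ t → t ≤ T → ∀ i, ‖V i t‖ ≤ K)
    (hV : ∀ (i : ι) (ψ : 𝓢(Space n, ℂ)), HasCompactSupport ψ → ∀ t, s ≤ t →
      HasDerivWithinAt (fun τ => ∫ ξ, V i τ ξ * ψ ξ) (∫ ξ, (∑ j, G t ξ i j * V j t ξ) * ψ ξ)
        (Ici s) t)
    (hΦs : ∀ ξ, Φ s ξ = 1)
    (hΦ : ∀ ξ t, s ≤ t → ∀ i j,
      HasDerivWithinAt (fun τ => Φ τ ξ i j) ((G t ξ * Φ t ξ) i j) (Ici s) t)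
    (hΦb : ∀ T : ℝ, ∃ K : ℝ, ∀ t, s ≤ t → t ≤ T → ∀ ξ i j, ‖Φ t ξ i j‖ ≤ K)
    (hΦc : ∀ t, s ≤ t → ∀ i j, Continuous fun ξ => Φ t ξ i j) {t : ℝ} (ht : s ≤ t) (i : ι) :
    V i t =ᵐ[volume] fun ξ => ∑ j, Φ t ξ i j * V j s ξ := by
  have hcoef : ∀ (c : Space n → ℂ), Continuous c → ∀ K : ℝ, (∀ ξ, ‖c ξ‖ ≤ K) → ∀ f : L2 n ℂ,
      MemLp (fun ξ => c ξ * f ξ) 2 (volume : Measure (Space n)) := by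
    intro c hc K hK f
    refine (Lp.memLp f).of_le_mul (c := K)
      (hc.aestronglyMeasurable.mul (Lp.aestronglyMeasurable _)) ?_
    filter_upwards with ξ
    rw [norm_mul]
    exact mul_le_mul_of_nonneg_right (hK ξ) (norm_nonneg _)
  have hmem : ∀ i τ, s ≤ τ →
      MemLp (fun ξ => ∑ j, Φ τ ξ i j * V j s ξ) 2 (volume : Measure (Space n)) := by
    intro i τ hτ
    obtain ⟨K, hK⟩ := hΦb τ
    exact memLp_finsetSum _ fun j _ =>
      hcoef _ (hΦc τ hτ i j) K (fun ξ => hK τ hτ le_rfl ξ i j) _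
  classical
  -- The default value before `s` plays no role, as the weak equation is only used on `[s, ∞)`.
  let P : ι → ℝ → L2 n ℂ := fun i τ => if h : s ≤ τ then (hmem i τ h).toLp _ else 0
  have hP : ∀ i τ, s ≤ τ → P i τ =ᵐ[volume] fun ξ => ∑ j, Φ τ ξ i j * V j s ξ := by
    intro i τ hτ
    simp only [P, dif_pos hτ]
    exact (hmem i τ hτ).coeFn_toLp
  have hsub : ∀ i τ, ∀ᵐ ξ, (V i τ - P i τ) ξ = V i τ ξ - P i τ ξ := fun i τ =>
    Lp.coeFn_sub _ _
  -- The candidate is a weak solution by differentiation under the integral sign. The dominating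
  -- function exists because the test functions have compact support and the coefficients are
  -- bounded for bounded frequencies. Uniqueness then gives equality.
  have key : V i t - P i t = 0 := by
    refine eq_zero_of_weak_solution (D := fun i τ => V i τ - P i τ) hGc hGb ?_ ?_ ?_ ht i
    · intro T
      obtain ⟨K, hK⟩ := hVb T
      obtain ⟨K', hK'⟩ := hΦb T
      refine ⟨K + ∑ j, K' * ‖V j s‖, fun τ h1 h2 i => (norm_sub_le _ _).trans ?_⟩
      refine add_le_add (hK τ h1 h2 i) ?_
      have hj : ∀ j, MemLp (fun ξ => Φ τ ξ i j * V j s ξ) 2 (volume : Measure (Space n)) :=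
        fun j => hcoef _ (hΦc τ h1 i j) K' (fun ξ => hK' τ h1 h2 ξ i j) _
      have e : P i τ = ∑ j, (hj j).toLp _ := by
        refine Lp.ext ?_
        filter_upwards [hP i τ h1, Lp.coeFn_finsetSum Finset.univ (fun j => (hj j).toLp _),
          ae_all_iff.2 fun j => (hj j).coeFn_toLp] with ξ h3 h4 h5
        rw [h3, h4, Finset.sum_apply]
        exact Finset.sum_congr rfl fun j _ => (h5 j).symm
      rw [e]
      refine (norm_sum_le _ _).trans (Finset.sum_le_sum fun j _ => ?_)
      refine Lp.norm_le_mul_norm_of_ae_le_mul ?_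
      filter_upwards [(hj j).coeFn_toLp] with ξ h3
      rw [h3, norm_mul]
      exact mul_le_mul_of_nonneg_right (hK' τ h1 h2 ξ i j) (norm_nonneg _)
    · intro i
      rw [sub_eq_zero]
      refine Lp.ext ?_
      filter_upwards [hP i s le_rfl] with ξ h1
      rw [h1, hΦs]
      simp [Matrix.one_apply]
    · intro i ψ hψ r hr
      have hPint : ∀ τ, s ≤ τ →
          Integrable fun ξ => (∑ j, Φ τ ξ i j * V j s ξ) * ψ ξ := fun τ hτ =>
        integrable_mul_of_memLp (hmem i τ hτ) (memLp_schwartz ψ)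
      obtain ⟨R, hR⟩ := hψ.isBounded.subset_closedBall (0 : Space n)
      have hR' : ∀ ξ, R < ‖ξ‖ → ψ ξ = 0 := by
        intro ξ hξ
        by_contra h
        have := hR (subset_tsupport _ h)
        rw [mem_closedBall_zero_iff] at this
        linarith
      obtain ⟨K₁, hK₁⟩ := hGb R (r + 1)
      obtain ⟨K₂, hK₂⟩ := hΦb (r + 1)
      have hder : HasDerivWithinAt (fun τ => ∫ ξ, (∑ j, Φ τ ξ i j * V j s ξ) * ψ ξ)
          (∫ ξ, (∑ j, (G r ξ * Φ r ξ) i j * V j s ξ) * ψ ξ) (Ici s) r := by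
        refine hasDerivWithinAt_integral
          (g' := fun τ ξ => (∑ j, (G τ ξ * Φ τ ξ) i j * V j s ξ) * ψ ξ)
          (bound := fun ξ => ∑ j, (Fintype.card ι * (K₁ * K₂)) * ‖V j s ξ * ψ ξ‖)
          hr (by linarith : r < r + 1) hPint ?_ ?_ ?_
        · filter_upwards with ξ τ hτ
          exact (HasDerivWithinAt.fun_sum fun j _ =>
            (hΦ ξ τ hτ i j).mul_const _).mul_const _
        · filter_upwards with ξ τ h1 h2
          rw [Finset.sum_mul]
          refine (norm_sum_le _ _).trans (Finset.sum_le_sum fun j _ => ?_)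
          rw [mul_assoc, norm_mul]
          rcases lt_or_ge R ‖ξ‖ with h | h
          · rw [hR' ξ h]
            simp
          · refine mul_le_mul_of_nonneg_right ?_ (norm_nonneg _)
            rw [Matrix.mul_apply]
            refine (norm_sum_le _ _).trans ?_
            refine (Finset.sum_le_card_nsmul _ _ (K₁ * K₂) fun k _ => ?_).trans ?_
            · rw [norm_mul]
              exact mul_le_mul (hK₁ τ h1 h2 ξ h i k) (hK₂ τ h1 h2 ξ k j) (norm_nonneg _)
                ((norm_nonneg _).trans (hK₁ τ h1 h2 ξ h i k))
            · rw [nsmul_eq_mul, Finset.card_univ]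
        · exact integrable_finsetSum _ fun j _ =>
            ((integrable_mul_of_memLp (Lp.memLp (V j s)) (memLp_schwartz ψ)).norm.const_mul _)
      have h3 := (hV i ψ hψ r hr).sub hder
      refine (h3.congr_of_mem (f₁ := fun τ => ∫ ξ, (V i τ - P i τ) ξ * ψ ξ) ?_ hr).congr_deriv ?_
      · intro τ hτ
        rw [Pi.sub_apply, ← integral_sub
          (integrable_mul_of_memLp (Lp.memLp (V i τ)) (memLp_schwartz ψ)) (hPint τ hτ)]
        refine integral_congr_ae ?_
        filter_upwards [hsub i τ, hP i τ hτ] with ξ h4 h5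
        rw [h4, h5]
        ring
      · have hGint : ∀ f : ι → L2 n ℂ, Integrable fun ξ => (∑ j, G r ξ i j * f j ξ) * ψ ξ := by
          intro f
          simp only [Finset.sum_mul]
          refine integrable_finsetSum _ fun j _ => ?_
          refine ((integrable_mul_of_memLp (Lp.memLp (f j)) (memLp_schwartz ψ)).norm.const_mul
            K₁).mono' ?_ ?_
          · exact ((hGc r hr i j).aestronglyMeasurable.mul (Lp.aestronglyMeasurable _)).mul
              ψ.continuous.aestronglyMeasurable
          · filter_upwards with ξ
            rw [mul_assoc, norm_mul]
            rcases lt_or_ge R ‖ξ‖ with h | h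
            · rw [hR' ξ h]
              simp
            · exact mul_le_mul_of_nonneg_right (hK₁ r hr (by linarith) ξ h i j) (norm_nonneg _)
        have e : ∫ ξ, (∑ j, (G r ξ * Φ r ξ) i j * V j s ξ) * ψ ξ =
            ∫ ξ, (∑ j, G r ξ i j * P j r ξ) * ψ ξ := by
          refine integral_congr_ae ?_
          filter_upwards [ae_all_iff.2 fun j => hP j r hr] with ξ h4
          congr 1
          simp only [h4, Matrix.mul_apply, Finset.sum_mul, Finset.mul_sum]
          rw [Finset.sum_comm]
          exact Finset.sum_congr rfl fun j _ => Finset.sum_congr rfl fun k _ => by ring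
        rw [e, ← integral_sub (hGint fun j => V j r) (hGint fun j => P j r)]
        refine integral_congr_ae ?_
        filter_upwards [ae_all_iff.2 fun j => hsub j r] with ξ h4
        simp only [h4, mul_sub, Finset.sum_sub_distrib, sub_mul]
  rw [sub_eq_zero.1 key]
  exact hP i t ht

end Representation

/-! ### Fundamental solutions and their dependence on the frequency -/

section FundamentalSolutions
open scoped Matrix.Norms.L2Operator

variable {n d : ℕ} {A : Fin n → ℝ → Mat d} {B : ℝ → Mat d} {δ : Fin d → ℝ → ℝ} {M : ℝ → Mat d}

theorem PolySym.bound_of_norm_le {m : ℕ} {f : ℝ → Space n → ℂ} (hf : PolySym m f) (R : ℝ) :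
    ∃ K : ℝ, ∀ t, 0 ≤ t → ∀ ξ, ‖ξ‖ ≤ R → ‖f t ξ‖ ≤ K := by
  induction hf with
  | weaken _ ih => exact ih
  | coeff ha =>
    obtain ⟨C, h0, hC⟩ := ha.bound
    refine ⟨C, fun t ht ξ _ => (hC t ht).trans ?_⟩
    have h1 : (0 : ℝ) < 1 / (1 + t) := by positivity
    have h2 : 1 / (1 + t) ≤ 1 := by rw [div_le_one (by positivity)]; linarith
    exact mul_le_of_le_one_right h0 (pow_le_one₀ h1.le h2)
  | mulCoord k _ ih =>
    obtain ⟨K, hK⟩ := ih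
    refine ⟨R * K, fun t ht ξ hξ => ?_⟩
    rw [norm_mul]
    exact mul_le_mul ((norm_coord_le ξ k).trans hξ) (hK t ht ξ hξ) (norm_nonneg _)
      ((norm_nonneg _).trans hξ)
  | add _ _ ih1 ih2 =>
    obtain ⟨K, hK⟩ := ih1
    obtain ⟨K', hK'⟩ := ih2
    exact ⟨K + K', fun t ht ξ hξ =>
      (norm_add_le _ _).trans (add_le_add (hK t ht ξ hξ) (hK' t ht ξ hξ))⟩
  | congr _ h ih =>
    obtain ⟨K, hK⟩ := ih
    exact ⟨K, fun t ht ξ hξ => by rw [h t ht]; exact hK t ht ξ hξ⟩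

/-- Polynomial dependence on `ξ` commutes with integration in time, so only the coefficients are
integrated. It yields the continuity of `Ξ₂` in `ξ`. -/
theorem PolySym.continuous_integral {m : ℕ} {f : ℝ → Space n → ℂ} (hf : PolySym m f) {s t : ℝ}
    (hs : 0 ≤ s) (ht : s ≤ t) : Continuous fun ξ => ∫ θ in s..t, f θ ξ := by
  have hsub : uIcc s t ⊆ Ici 0 := by
    rw [uIcc_of_le ht]
    exact fun x hx => hs.trans hx.1
  induction hf with
  | weaken _ ih => exact ih
  | coeff ha => exact continuous_const
  | mulCoord k _ ih =>
    simp only [intervalIntegral.integral_const_mul]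
    exact (by fun_prop : Continuous fun ξ : Space n => (ξ k : ℂ)).mul ih
  | add hf hg ih1 ih2 =>
    refine (ih1.add ih2).congr fun ξ => ?_
    exact (intervalIntegral.integral_add ((hf.continuousOn ξ).mono hsub).intervalIntegrable
      ((hg.continuousOn ξ).mono hsub).intervalIntegrable).symm
  | congr _ h ih =>
    refine ih.congr fun ξ => ?_
    exact intervalIntegral.integral_congr fun θ hθ => (h θ (hsub hθ) ξ).symm

theorem polySym_system (hA : ∀ k, MatSymbolClass 0 (A k)) (hB : MatSymbolClass 0 B)
    (i j : Fin d) : PolySym 0 fun t (ξ : Space n) => (symbolA A t ξ + I • B t) i j := by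
  refine (PolySym.add (PolySym.weaken (PolySym.sum Finset.univ fun k _ =>
    PolySym.mulCoord k (.coeff (hA k i j)))) (PolySym.coeff ((hB i j).const_mul I))).congr ?_
  intro t _ ξ
  rw [Matrix.add_apply, symbolA_apply]
  rfl

theorem polySym_cornerF [NeZero d] (hA : ∀ k, MatSymbolClass 0 (A k)) (hB : MatSymbolClass 0 B)
    (hB2 : CondB2 B δ) (hM : IsDiagonaliser B δ M) : PolySym 1 (cornerF A δ M 2) :=
  (polyMat_hierarchy hA hB hB2 hM 2).2.1 0 0

theorem continuous_Xi [NeZero d] (hA : ∀ k, MatSymbolClass 0 (A k)) (hB : MatSymbolClass 0 B)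
    (hB2 : CondB2 B δ) (hM : IsDiagonaliser B δ M) {s t : ℝ} (hs : 0 ≤ s) (ht : s ≤ t) :
    Continuous (Xi A δ M 2 t s) :=
  Complex.continuous_exp.comp
    (continuous_const.mul ((polySym_cornerF hA hB hB2 hM).continuous_integral hs ht))

theorem exists_system_fundamentalSolution (hA : ∀ k, MatSymbolClass 0 (A k))
    (hB : MatSymbolClass 0 B) (ξ : Space n) :
    ∃ Φ, IsFundamentalSolution (fun t => symbolA A t ξ + I • B t) 0 Φ := by
  have hc : ContinuousOn (fun t => I • (symbolA A t ξ + I • B t)) (Ici 0) := by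
    refine ContinuousOn.const_smul ?_ I
    refine continuousOn_pi.2 fun i => continuousOn_pi.2 fun j => ?_
    exact (polySym_system hA hB i j).continuousOn ξ
  obtain ⟨Φ, h1, h2⟩ := exists_isFundamentalSolution hc 1
  refine ⟨Φ, h1, fun t ht i j => ?_⟩
  refine (hasDerivWithinAt_matrix.1 (h2 t ht) i j).congr_deriv ?_
  rw [smul_mul_assoc]
  rfl

theorem exists_reduced_fundamentalSolution [NeZero d] (hA : ∀ k, MatSymbolClass 0 (A k))
    (hB : MatSymbolClass 0 B) (hB2 : CondB2 B δ) (hM : IsDiagonaliser B δ M) {ξ : Space n} {t₁ : ℝ}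
    (ht₁ : 0 ≤ t₁) (hu : ∀ t, t₁ ≤ t → IsUnit (matN A δ M 2 t ξ)) :
    ∃ Φ, IsFundamentalSolution (fun t => reducedG A δ M t ξ) t₁ Φ := by
  have hc : ContinuousOn (fun t => I • reducedG A δ M t ξ) (Ici t₁) :=
    (continuousOn_reducedG hA hB hB2 hM ht₁ hu).const_smul I
  obtain ⟨Φ, h1, h2⟩ := exists_isFundamentalSolution hc 1
  refine ⟨Φ, h1, fun t ht i j => ?_⟩
  refine (hasDerivWithinAt_matrix.1 (h2 t ht) i j).congr_deriv ?_
  rw [smul_mul_assoc]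
  rfl

theorem IsFundamentalSolution.act_self {G Φ : ℝ → Mat d} {s : ℝ}
    (h : IsFundamentalSolution G s Φ) (v : EuclideanSpace ℂ (Fin d)) : act (Φ s) v = v := by
  rw [h.1, act_one]

theorem norm_act_fundamentalSolution_le (hB1 : CondB1 A B) {ξ : Space n} {Φ : ℝ → Mat d}
    (h : IsFundamentalSolution (fun t => symbolA A t ξ + I • B t) 0 Φ) {t : ℝ} (ht : 0 ≤ t)
    (v : EuclideanSpace ℂ (Fin d)) : ‖act (Φ t) v‖ ≤ ‖v‖ := by
  refine (norm_le_of_system hB1 (x := fun t => act (Φ t) v)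
    (fun t ht => h.hasDerivWithinAt_act ht v) ht).trans ?_
  rw [h.act_self]

theorem symbolA_sub (A : Fin n → ℝ → Mat d) (t : ℝ) (ξ ζ : Space n) :
    symbolA A t ξ - symbolA A t ζ = symbolA A t (ξ - ζ) := by
  rw [symbolA, symbolA, symbolA, ← Finset.sum_sub_distrib]
  refine Finset.sum_congr rfl fun k _ => ?_
  rw [← sub_smul]
  simp

/-- The fundamental solutions depend continuously on the frequency. -/
theorem continuous_act_fundamentalSolution (hA : ∀ k, MatSymbolClass 0 (A k)) (hB1 : CondB1 A B)
    {E : Space n → ℝ → Mat d}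
    (hE : ∀ ξ, IsFundamentalSolution (fun t => symbolA A t ξ + I • B t) 0 (E ξ)) {t : ℝ}
    (ht : 0 ≤ t) (v : EuclideanSpace ℂ (Fin d)) : Continuous fun ξ => act (E ξ t) v := by
  obtain ⟨C, h0, hC⟩ := symbolA_bound hA
  -- The difference solves the dissipative equation at `ξ` with source `A(t, ξ - ζ)` applied to a
  -- bounded solution, so it grows at most linearly in time.
  have hlip : ∀ ξ ζ, ‖act (E ξ t) v - act (E ζ t) v‖ ≤ C * ‖v‖ * t * ‖ξ - ζ‖ := by
    intro ξ ζ
    have hd : ∀ r, 0 ≤ r → r ≤ t → HasDerivWithinAt (fun r => act (E ξ r) v - act (E ζ r) v)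
        (I • act (symbolA A r ξ + I • B r) (act (E ξ r) v) -
          I • act (symbolA A r ζ + I • B r) (act (E ζ r) v)) (Ici 0) r := fun r hr _ =>
      ((hE ξ).hasDerivWithinAt_act hr v).sub ((hE ζ).hasDerivWithinAt_act hr v)
    have hφ : ∀ r, HasDerivWithinAt (fun r : ℝ => C * ‖ξ - ζ‖ * ‖v‖ * r)
        (C * ‖ξ - ζ‖ * ‖v‖) (Ici 0) r := fun r => by
      simpa using ((hasDerivAt_id r).const_mul (C * ‖ξ - ζ‖ * ‖v‖)).hasDerivWithinAt
    refine (norm_le_of_re_inner_deriv_le (t₁ := t) (a := fun _ => 0)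
      (b := fun _ => C * ‖ξ - ζ‖ * ‖v‖) hd
      (fun r _ _ => hasDerivWithinAt_const r _ (0 : ℝ)) (fun r _ _ => hφ r) ?_
      (fun r _ _ => by simp) (fun r hr _ => by positivity) ?_ t ht le_rfl).trans
        (le_of_eq (by ring))
    · intro r hr _
      have e : I • act (symbolA A r ξ + I • B r) (act (E ξ r) v) -
          I • act (symbolA A r ζ + I • B r) (act (E ζ r) v) =
          I • act (symbolA A r ξ + I • B r) (act (E ξ r) v - act (E ζ r) v) +
          I • act (symbolA A r (ξ - ζ)) (act (E ζ r) v) := by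
        rw [← symbolA_sub, act_sub, map_sub, act_add, act_add, act_add]
        module
      rw [e, inner_add_right, Complex.add_re, re_inner_system_eq hB1 hr, zero_mul, zero_add]
      have h1 := inner_act_nonneg hB1 hr (act (E ξ r) v - act (E ζ r) v)
      have h2 : (inner ℂ (act (E ξ r) v - act (E ζ r) v)
          (I • act (symbolA A r (ξ - ζ)) (act (E ζ r) v))).re ≤
          ‖act (E ξ r) v - act (E ζ r) v‖ * (C * ‖ξ - ζ‖ * ‖v‖) := by
        refine (Complex.re_le_norm _).trans ((norm_inner_le_norm _ _).trans ?_)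
        refine mul_le_mul_of_nonneg_left ?_ (norm_nonneg _)
        rw [norm_smul, Complex.norm_I, one_mul]
        exact (norm_act_le _ _).trans (mul_le_mul (hC r hr _)
          (norm_act_fundamentalSolution_le hB1 (hE ζ) hr v) (norm_nonneg _) (by positivity))
      linarith
    · simp [(hE ξ).act_self, (hE ζ).act_self]
  refine (LipschitzWith.of_dist_le_mul (K := ⟨C * ‖v‖ * t, by positivity⟩) fun ξ ζ => ?_).continuous
  rw [dist_eq_norm, dist_eq_norm]
  exact hlip ξ ζ

theorem act_single (X : Mat d) (i j : Fin d) : act X (EuclideanSpace.single j 1) i = X i j := by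
  rw [act_apply]
  simp

theorem continuous_fundamentalSolution_apply (hA : ∀ k, MatSymbolClass 0 (A k)) (hB1 : CondB1 A B)
    {E : Space n → ℝ → Mat d}
    (hE : ∀ ξ, IsFundamentalSolution (fun t => symbolA A t ξ + I • B t) 0 (E ξ)) {t : ℝ}
    (ht : 0 ≤ t) (i j : Fin d) : Continuous fun ξ => E ξ t i j := by
  have h := continuous_act_fundamentalSolution hA hB1 hE ht (EuclideanSpace.single j 1)
  refine ((EuclideanSpace.proj (𝕜 := ℂ) i).continuous.comp h).congr fun ξ => ?_
  exact act_single _ i j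

theorem norm_fundamentalSolution_apply_le (hB1 : CondB1 A B) {ξ : Space n} {Φ : ℝ → Mat d}
    (h : IsFundamentalSolution (fun t => symbolA A t ξ + I • B t) 0 Φ) {t : ℝ} (ht : 0 ≤ t)
    (i j : Fin d) : ‖Φ t i j‖ ≤ 1 := by
  rw [← act_single (Φ t) i j]
  refine (PiLp.norm_apply_le _ i).trans
    ((norm_act_fundamentalSolution_le hB1 h ht _).trans ?_)
  simp

end FundamentalSolutions

/-! ### Fourier transform of the two evolution problems -/

section Fourier

variable {n d : ℕ} {A : Fin n → ℝ → Mat d} {B : ℝ → Mat d} {δ : Fin d → ℝ → ℝ} {M : ℝ → Mat d}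

/-- The `L²` Fourier transform agrees with that of tempered distributions, which is defined by
moving it onto the test function. A functional `ℓ` extracts scalar components. -/
theorem integral_fourier_mul {F : Type} [NormedAddCommGroup F] [InnerProductSpace ℂ F]
    [CompleteSpace F] (ℓ : F →L[ℂ] ℂ) (f : L2 n F) (ψ : 𝓢(Space n, ℂ)) :
    ∫ ξ, ℓ ((𝓕 f : L2 n F) ξ) * ψ ξ = ∫ x, ℓ (f x) * (𝓕 ψ) x := by
  have hint : ∀ (g : L2 n F) (η : 𝓢(Space n, ℂ)), Integrable fun x => η x • g x := fun g η =>
    memLp_one_iff_integrable.1 ((Lp.memLp g).smul (memLp_schwartz η))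
  have hpair : ∀ (g : L2 n F) (η : 𝓢(Space n, ℂ)),
      ∫ x, ℓ (g x) * η x = ℓ (∫ x, η x • g x) := by
    intro g η
    rw [← ℓ.integral_comp_comm (hint g η)]
    refine integral_congr_ae (Eventually.of_forall fun x => ?_)
    simp [mul_comm]
  rw [hpair, hpair]
  congr 1
  rw [← Lp.toTemperedDistribution_apply, ← Lp.toTemperedDistribution_apply,
    ← Lp.fourier_toTemperedDistribution_eq]
  rfl

/-- A derivative of the Fourier transform is the Fourier transform of a product. -/
theorem exists_lineDeriv_fourier (ψ : 𝓢(Space n, ℂ)) (k : Fin n) :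
    ∃ η : 𝓢(Space n, ℂ), ∂_{(EuclideanSpace.single k 1 : Space n)} (𝓕 ψ) = 𝓕 η ∧
      ∀ ξ, η ξ = -(2 * Real.pi * I) * (ξ k : ℂ) * ψ ξ := by
  refine ⟨_, SchwartzMap.lineDerivOp_fourier_eq ψ _, fun ξ => ?_⟩
  have hg : Function.HasTemperateGrowth
      fun x : Space n => inner ℝ x (EuclideanSpace.single k 1 : Space n) := by fun_prop
  rw [_root_.smul_apply, SchwartzMap.smulLeftCLM_apply_apply hg]
  simp [EuclideanSpace.inner_single_right, mul_assoc]

/-- The `i`-th component of a vector valued `L²` function. -/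
def component (i : Fin d) (f : L2 n (EuclideanSpace ℂ (Fin d))) : L2 n ℂ :=
  (EuclideanSpace.proj i : EuclideanSpace ℂ (Fin d) →L[ℂ] ℂ).compLp f

theorem coeFn_component (i : Fin d) (f : L2 n (EuclideanSpace ℂ (Fin d))) :
    ∀ᵐ ξ, component i f ξ = f ξ i :=
  ContinuousLinearMap.coeFn_compLp _ f

theorem norm_component_le (i : Fin d) (f : L2 n (EuclideanSpace ℂ (Fin d))) :
    ‖component i f‖ ≤ ‖f‖ := by
  rw [← one_mul ‖f‖]
  refine Lp.norm_le_mul_norm_of_ae_le_mul ?_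
  filter_upwards [coeFn_component i f] with ξ h
  rw [h, one_mul]
  exact PiLp.norm_apply_le _ i

theorem integral_component_fourier (i : Fin d) (f : L2 n (EuclideanSpace ℂ (Fin d)))
    (ψ : 𝓢(Space n, ℂ)) :
    ∫ ξ, component i (𝓕 f) ξ * ψ ξ = ∫ x, f x i * (𝓕 ψ) x := by
  refine (integral_congr_ae ?_).trans
    (integral_fourier_mul (EuclideanSpace.proj i : EuclideanSpace ℂ (Fin d) →L[ℂ] ℂ) f ψ)
  filter_upwards [coeFn_component i (𝓕 f)] with ξ h
  rw [h]
  rfl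

theorem exists_norm_le_of_continuousOn {V : Type} [NormedAddCommGroup V] {u : ℝ → V} {s : ℝ}
    (hu : ContinuousOn u (Ici s)) (T : ℝ) : ∃ K : ℝ, ∀ t, s ≤ t → t ≤ T → ‖u t‖ ≤ K := by
  obtain ⟨K, hK⟩ := (isCompact_Icc (a := s) (b := T)).exists_bound_of_continuousOn
    (hu.mono Icc_subset_Ici_self)
  exact ⟨K, fun t h1 h2 => hK t ⟨h1, h2⟩⟩

theorem integral_mul_of_eq_mul {f : L2 n ℂ} {η ψ : 𝓢(Space n, ℂ)} {p : Space n → ℂ} {a : ℂ}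
    (h : ∀ ξ, η ξ = p ξ * ψ ξ) :
    Integrable (fun ξ => a * p ξ * f ξ * ψ ξ) ∧
      a * ∫ ξ, f ξ * η ξ = ∫ ξ, a * p ξ * f ξ * ψ ξ := by
  have e : (fun ξ => a * p ξ * f ξ * ψ ξ) = fun ξ => a * (f ξ * η ξ) := by
    funext ξ
    rw [h]
    ring
  rw [e, integral_const_mul]
  exact ⟨(integrable_mul_of_memLp (Lp.memLp f) (memLp_schwartz η)).const_mul a, rfl⟩

theorem neg_integral_sub_integral {f g : Space n → ℂ} (hf : Integrable f) (hg : Integrable g) :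
    -(∫ ξ, f ξ) - ∫ ξ, g ξ = ∫ ξ, (-f ξ - g ξ) := by
  rw [← integral_neg]
  exact (integral_sub hf.neg hg).symm

theorem integral_sub_integral_add {f g h : Space n → ℂ} (hf : Integrable f) (hg : Integrable g)
    (hh : Integrable h) : (∫ ξ, f ξ) - (∫ ξ, g ξ) + ∫ ξ, h ξ = ∫ ξ, (f ξ - g ξ + h ξ) := by
  rw [← integral_sub hf hg]
  exact (integral_add (hf.sub hg) hh).symm

/-- Testing the weak equation with `𝓕 ψ` turns each derivative of the test function into
multiplication by `-2πi ξ k` on `ψ`, so the system becomes an ordinary differential equation with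
parameter `2πξ`. -/
theorem fourier_system_weak {U₀ : L2 n (EuclideanSpace ℂ (Fin d))}
    {U : ℝ → L2 n (EuclideanSpace ℂ (Fin d))} (hU : IsSystemSolution A B U₀ U) (i : Fin d)
    (ψ : 𝓢(Space n, ℂ)) {t : ℝ} (ht : 0 ≤ t) :
    HasDerivWithinAt (fun τ => ∫ ξ, component i (𝓕 (U τ)) ξ * ψ ξ)
      (∫ ξ, (∑ j, (I • (symbolA A t ((2 * Real.pi) • ξ) + I • B t)) i j *
        component j (𝓕 (U t)) ξ) * ψ ξ) (Ici 0) t := by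
  simp only [integral_component_fourier]
  refine (hU.2.2 i (𝓕 ψ) t ht).congr_deriv ?_
  choose η hη1 hη2 using exists_lineDeriv_fourier ψ
  simp only [hη1, ← integral_component_fourier]
  have h1 := fun k j => integral_mul_of_eq_mul (f := component j (𝓕 (U t))) (a := A k t i j)
    (hη2 k)
  have h2 := fun j => integral_mul_of_eq_mul (f := component j (𝓕 (U t))) (a := B t i j)
    (p := fun _ => 1) (ψ := ψ) (η := ψ) (fun ξ => by simp)
  simp only [(h1 _ _).2, (h2 _).2]
  have e1 : ∀ k, ∑ j, ∫ ξ, A k t i j * (-(2 * Real.pi * I) * (ξ k : ℂ)) *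
      component j (𝓕 (U t)) ξ * ψ ξ = ∫ ξ, ∑ j, A k t i j * (-(2 * Real.pi * I) * (ξ k : ℂ)) *
      component j (𝓕 (U t)) ξ * ψ ξ := fun k =>
    (integral_finsetSum _ fun j _ => (h1 k j).1).symm
  simp only [e1]
  have i1 := integrable_finsetSum Finset.univ fun k _ =>
    integrable_finsetSum Finset.univ fun j _ => (h1 k j).1
  have i2 := integrable_finsetSum Finset.univ fun j _ => (h2 j).1
  rw [← integral_finsetSum _ fun k _ => integrable_finsetSum _ fun j _ => (h1 k j).1,
    ← integral_finsetSum _ fun j _ => (h2 j).1, neg_integral_sub_integral i1 i2]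
  refine integral_congr_ae (Eventually.of_forall fun ξ => ?_)
  simp only
  rw [Finset.sum_comm, ← Finset.sum_neg_distrib, ← Finset.sum_sub_distrib, Finset.sum_mul]
  refine Finset.sum_congr rfl fun j _ => ?_
  rw [Matrix.smul_apply, Matrix.add_apply, Matrix.smul_apply, symbolA_apply, smul_eq_mul,
    smul_eq_mul, mul_add, ← mul_assoc I I, Complex.I_mul_I, ← Finset.sum_neg_distrib,
    Finset.mul_sum, add_mul, add_mul, Finset.sum_mul, Finset.sum_mul, sub_eq_add_neg]
  congr 1
  · refine Finset.sum_congr rfl fun k _ => ?_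
    simp only [PiLp.smul_apply, smul_eq_mul]
    push_cast
    ring
  · ring

/-- The Fourier transform of the solution to the system. -/
theorem fourier_system_eq (hA : ∀ k, MatSymbolClass 0 (A k)) (hB : MatSymbolClass 0 B)
    (hB1 : CondB1 A B) {E : Space n → ℝ → Mat d}
    (hE : ∀ ξ, IsFundamentalSolution (fun t => symbolA A t ξ + I • B t) 0 (E ξ))
    {U₀ : L2 n (EuclideanSpace ℂ (Fin d))} {U : ℝ → L2 n (EuclideanSpace ℂ (Fin d))}
    (hU : IsSystemSolution A B U₀ U) {t : ℝ} (ht : 0 ≤ t) :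
    ∀ᵐ ξ, (𝓕 (U t) : L2 n (EuclideanSpace ℂ (Fin d))) ξ =
      act (E ((2 * Real.pi) • ξ) t) ((𝓕 U₀ : L2 n (EuclideanSpace ℂ (Fin d))) ξ) := by
  have hsc : Continuous fun ξ : Space n => (2 * Real.pi) • ξ := continuous_const_smul _
  have key : ∀ i, ∀ᵐ ξ, component i (𝓕 (U t)) ξ =
      ∑ j, E ((2 * Real.pi) • ξ) t i j * component j (𝓕 (U 0)) ξ := by
    intro i
    refine weak_solution_eq (V := fun i t => component i (𝓕 (U t)))
      (G := fun t ξ => I • (symbolA A t ((2 * Real.pi) • ξ) + I • B t))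
      (Φ := fun t ξ => E ((2 * Real.pi) • ξ) t) (s := 0) ?_ ?_ ?_
      (fun i ψ _ t ht => fourier_system_weak hU i ψ ht) ?_ ?_ ?_ ?_ ht i
    · intro t ht i j
      exact ((((polySym_system hA hB i j).continuous ht).comp hsc).const_mul I)
    · intro R T
      have h := fun p : Fin d × Fin d =>
        (polySym_system (n := n) hA hB p.1 p.2).bound_of_norm_le (2 * Real.pi * R)
      obtain ⟨K, -, hK⟩ := exists_common_bound
        (p := fun (p : Fin d × Fin d) K => ∀ t, 0 ≤ t → ∀ ξ : Space n, ‖ξ‖ ≤ 2 * Real.pi * R →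
          ‖(symbolA A t ξ + I • B t) p.1 p.2‖ ≤ K)
        (fun p a b hab h t ht ξ hξ => (h t ht ξ hξ).trans hab) h
      refine ⟨K, fun t h1 _ ξ hξ i j => ?_⟩
      rw [Matrix.smul_apply, norm_smul, Complex.norm_I, one_mul]
      refine hK (i, j) t h1 _ ?_
      rw [norm_smul, Real.norm_of_nonneg (by positivity)]
      gcongr
    · intro T
      obtain ⟨K, hK⟩ := exists_norm_le_of_continuousOn hU.1 T
      refine ⟨K, fun t h1 h2 i => (norm_component_le _ _).trans ?_⟩
      rw [Lp.norm_fourier_eq]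
      exact hK t h1 h2
    · exact fun ξ => (hE _).1
    · intro ξ t ht i j
      refine ((hE _).2 t ht i j).congr_deriv ?_
      rw [smul_mul_assoc]
      rfl
    · exact fun T => ⟨1, fun t h1 _ ξ i j => norm_fundamentalSolution_apply_le hB1 (hE _) h1 i j⟩
    · exact fun t ht i j => (continuous_fundamentalSolution_apply hA hB1 hE ht i j).comp hsc
  rw [hU.2.1] at key
  filter_upwards [ae_all_iff.2 key, ae_all_iff.2 fun i => coeFn_component i (𝓕 (U t)),
    ae_all_iff.2 fun i => coeFn_component i (𝓕 U₀)] with ξ h1 h2 h3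
  ext i
  rw [act_apply, ← h2, h1]
  exact Finset.sum_congr rfl fun j _ => by rw [h3]

theorem fourier_parabolic_weak {α : ℝ → Matrix (Fin n) (Fin n) ℂ} {β : ℝ → Fin n → ℂ}
    {γ : ℝ → ℂ} {t₀ : ℝ} {w₀ : L2 n ℂ} {w : ℝ → L2 n ℂ} (hw : IsParabolicSolution α β γ t₀ w₀ w)
    (ψ : 𝓢(Space n, ℂ)) {t : ℝ} (ht : t₀ ≤ t) :
    HasDerivWithinAt (fun τ => ∫ ξ, (𝓕 (w τ) : L2 n ℂ) ξ * ψ ξ)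
      (∫ ξ, (I * (I * ∑ i, ∑ j, α t i j * (((2 * Real.pi) • ξ) i : ℂ) *
          (((2 * Real.pi) • ξ) j : ℂ) + ∑ i, β t i * (((2 * Real.pi) • ξ) i : ℂ) + γ t)) *
        (𝓕 (w t) : L2 n ℂ) ξ * ψ ξ) (Ici t₀) t := by
  have hpair : ∀ (f : L2 n ℂ) (η : 𝓢(Space n, ℂ)),
      ∫ x, f x * (𝓕 η) x = ∫ ξ, (𝓕 f : L2 n ℂ) ξ * η ξ := fun f η =>
    (integral_fourier_mul (ContinuousLinearMap.id ℂ ℂ) f η).symm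
  simp only [← hpair _ ψ]
  refine (hw.2.2 (𝓕 ψ) t ht).congr_deriv ?_
  choose η hη1 hη2 using exists_lineDeriv_fourier ψ
  have h := fun j => exists_lineDeriv_fourier (η j)
  choose η' hη1' hη2' using h
  simp only [hη1, hη1', hpair]
  have h1 := fun i j => integral_mul_of_eq_mul (f := 𝓕 (w t)) (a := α t i j) (ψ := ψ)
    (η := η' j i) (p := fun ξ => (-(2 * Real.pi * I) * (ξ i : ℂ)) *
      (-(2 * Real.pi * I) * (ξ j : ℂ))) (fun ξ => by rw [hη2', hη2]; ring)
  have h2 := fun i => integral_mul_of_eq_mul (f := 𝓕 (w t)) (a := β t i) (hη2 i)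
  have h3 := integral_mul_of_eq_mul (f := 𝓕 (w t)) (a := I * γ t)
    (p := fun _ => 1) (ψ := ψ) (η := ψ) (fun ξ => by simp)
  simp only [(h1 _ _).2, (h2 _).2, h3.2]
  have e1 : ∀ i, ∑ j, ∫ ξ : Space n, α t i j * ((-(2 * Real.pi * I) * (ξ i : ℂ)) *
      (-(2 * Real.pi * I) * (ξ j : ℂ))) * (𝓕 (w t) : L2 n ℂ) ξ * ψ ξ =
      ∫ ξ : Space n, ∑ j, α t i j * ((-(2 * Real.pi * I) * (ξ i : ℂ)) *
      (-(2 * Real.pi * I) * (ξ j : ℂ))) * (𝓕 (w t) : L2 n ℂ) ξ * ψ ξ := fun i =>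
    (integral_finsetSum _ fun j _ => (h1 i j).1).symm
  simp only [e1]
  have i1 := integrable_finsetSum Finset.univ fun i _ =>
    integrable_finsetSum Finset.univ fun j _ => (h1 i j).1
  have i2 := integrable_finsetSum Finset.univ fun i _ => (h2 i).1
  rw [← integral_finsetSum _ fun i _ => integrable_finsetSum _ fun j _ => (h1 i j).1,
    ← integral_finsetSum _ fun i _ => (h2 i).1, integral_sub_integral_add i1 i2 h3.1]
  refine integral_congr_ae (Eventually.of_forall fun ξ => ?_)
  simp only [PiLp.smul_apply, smul_eq_mul]
  rw [mul_add, mul_add, ← mul_assoc I I, Complex.I_mul_I, add_mul, add_mul, add_mul, add_mul,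
    sub_eq_add_neg]
  congr 1
  · congr 1
    · rw [neg_one_mul, ← Finset.sum_neg_distrib, Finset.sum_mul, Finset.sum_mul]
      refine Finset.sum_congr rfl fun i _ => ?_
      rw [← Finset.sum_neg_distrib, Finset.sum_mul, Finset.sum_mul]
      refine Finset.sum_congr rfl fun j _ => ?_
      push_cast
      linear_combination (4 * Real.pi ^ 2 * α t i j * (ξ i : ℂ) * (ξ j : ℂ) *
        (𝓕 (w t) : L2 n ℂ) ξ * ψ ξ) * Complex.I_mul_I
    · rw [← Finset.sum_neg_distrib, Finset.mul_sum, Finset.sum_mul, Finset.sum_mul]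
      refine Finset.sum_congr rfl fun i _ => ?_
      push_cast
      ring
  · ring

/-- The Fourier transform of the solution to the parabolic problem. -/
theorem fourier_parabolic_eq [NeZero d] (hA : ∀ k, MatSymbolClass 0 (A k))
    (hB : MatSymbolClass 0 B) (hB2 : CondB2 B δ) (hM : IsDiagonaliser B δ M) {t₀ K : ℝ}
    (ht₀ : 0 < t₀) (hK : ∀ t, t₀ ≤ t → ∀ ξ, ‖Xi A δ M 2 t t₀ ξ‖ ≤ K) {w₀ : L2 n ℂ}
    {w : ℝ → L2 n ℂ}
    (hw : IsParabolicSolution (coefα A δ M) (coefβ A δ M) (coefγ δ M) t₀ w₀ w) {t : ℝ}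
    (ht : t₀ ≤ t) :
    ∀ᵐ ξ, (𝓕 (w t) : L2 n ℂ) ξ =
      Xi A δ M 2 t t₀ ((2 * Real.pi) • ξ) * (𝓕 w₀ : L2 n ℂ) ξ := by
  have hsc : Continuous fun ξ : Space n => (2 * Real.pi) • ξ := continuous_const_smul _
  -- The scalar problem is the case of `1 × 1` matrices, with coefficient `i f₁` and fundamental
  -- solution `Ξ₂`.
  have key := weak_solution_eq (ι := Fin 1) (V := fun _ t => 𝓕 (w t))
    (G := fun t ξ => Matrix.of fun _ _ => I * cornerF A δ M 2 t ((2 * Real.pi) • ξ))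
    (Φ := fun t ξ => Matrix.of fun _ _ => Xi A δ M 2 t t₀ ((2 * Real.pi) • ξ)) (s := t₀)
    ?_ ?_ ?_ ?_ ?_ ?_ ?_ ?_ ht 0
  · filter_upwards [key] with ξ h
    rw [h, hw.2.1]
    simp
  · intro t ht i j
    exact (((polySym_cornerF hA hB hB2 hM).continuous (ht₀.le.trans ht)).comp hsc).const_mul I
  · intro R T
    obtain ⟨K, hK⟩ := (polySym_cornerF hA hB hB2 hM).bound_of_norm_le (2 * Real.pi * R)
    refine ⟨K, fun t h1 _ ξ hξ i j => ?_⟩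
    rw [Matrix.of_apply, norm_mul, Complex.norm_I, one_mul]
    refine hK t (ht₀.le.trans h1) _ ?_
    rw [norm_smul, Real.norm_of_nonneg (by positivity)]
    gcongr
  · intro T
    obtain ⟨K, hK⟩ := exists_norm_le_of_continuousOn hw.1 T
    refine ⟨K, fun t h1 h2 i => ?_⟩
    rw [Lp.norm_fourier_eq]
    exact hK t h1 h2
  · intro i ψ _ t ht
    refine (fourier_parabolic_weak hw ψ ht).congr_deriv ?_
    refine integral_congr_ae (Eventually.of_forall fun ξ => ?_)
    simp only [Matrix.of_apply, Finset.univ_unique, Finset.sum_singleton,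
      cornerF_eq hA hB hB2 hM (ht₀.le.trans ht)]
  · intro ξ
    ext i j
    rw [Subsingleton.elim i j]
    simp [Xi_self]
  · intro ξ t ht i j
    refine (hasDerivAt_Xi hA hB hB2 hM _ ht₀ ht).hasDerivWithinAt.congr_deriv ?_
    simp [Matrix.mul_apply]
  · exact fun T => ⟨K, fun t h1 _ ξ i j => hK t h1 _⟩
  · exact fun t ht i j => (continuous_Xi hA hB hB2 hM ht₀.le ht).comp hsc

end Fourier

/-! ### Fourier multipliers and the estimate for the symbols -/

section Multipliers
open scoped Matrix.Norms.L2Operator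

variable {n d : ℕ} {A : Fin n → ℝ → Mat d} {B : ℝ → Mat d} {δ : Fin d → ℝ → ℝ} {M : ℝ → Mat d}

theorem fourier_sub_L2 {F : Type} [NormedAddCommGroup F] [InnerProductSpace ℂ F]
    [CompleteSpace F] (f g : L2 n F) : 𝓕 (f - g) = (𝓕 f : L2 n F) - 𝓕 g :=
  map_sub (Lp.fourierTransformₗᵢ (Space n) F) f g

theorem fourier_fourierMultiplier {F G : Type} [NormedAddCommGroup F] [InnerProductSpace ℂ F]
    [CompleteSpace F] [NormedAddCommGroup G] [InnerProductSpace ℂ G] [CompleteSpace G]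
    {m : Space n → F → G} {f : L2 n F} (h : MultiplierDefined m f) :
    ∀ᵐ ξ, (𝓕 (fourierMultiplier m f) : L2 n G) ξ = m ((2 * Real.pi) • ξ) ((𝓕 f : L2 n F) ξ) := by
  rw [fourierMultiplier, dif_pos h, FourierTransform.fourier_fourierInv_eq]
  exact h.coeFn_toLp

theorem norm_dotProduct_mulVec_le (W : Fin d → ℂ) (X : Mat d) (z : EuclideanSpace ℂ (Fin d)) :
    ‖W ⬝ᵥ (X *ᵥ fun i => z i)‖ ≤ (∑ i, ‖W i‖) * ‖X‖ * ‖z‖ := by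
  rw [dotProduct, mul_assoc, Finset.sum_mul]
  refine (norm_sum_le _ _).trans (Finset.sum_le_sum fun i _ => ?_)
  rw [norm_mul]
  refine mul_le_mul_of_nonneg_left (le_trans ?_ (norm_act_le X z)) (norm_nonneg _)
  refine le_trans (le_of_eq ?_) (PiLp.norm_apply_le (act X z) i)
  rw [act_apply]
  rfl

theorem symbolData_eq (t₀ : ℝ) (W : Fin d → ℂ) (E : Space n → Mat d) (χ : Space n → ℂ)
    (ξ : Space n) (v : EuclideanSpace ℂ (Fin d)) :
    symbolData A δ M t₀ W E χ ξ v = χ ξ * (W ⬝ᵥ (((matN A δ M 2 t₀ ξ)⁻¹ * (M t₀)⁻¹) *ᵥ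
      fun i => act (E ξ) v i)) := by
  have e : (fun i => act (E ξ) v i) = E ξ *ᵥ fun i => v i := by
    funext i
    rw [act_apply]
    rfl
  rw [symbolData, e, Matrix.mulVec_mulVec, Matrix.mulVec_smul, dotProduct_smul, smul_eq_mul]

theorem symbolData_eq_sum (t₀ : ℝ) (W : Fin d → ℂ) (E : Space n → Mat d) (χ : Space n → ℂ)
    (ξ : Space n) (v : EuclideanSpace ℂ (Fin d)) :
    symbolData A δ M t₀ W E χ ξ v =
      ∑ j, χ ξ * (W ᵥ* ((matN A δ M 2 t₀ ξ)⁻¹ * (M t₀)⁻¹ * E ξ)) j * v j := by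
  rw [symbolData, Matrix.mulVec_smul, dotProduct_smul, Matrix.dotProduct_mulVec, smul_eq_mul, dotProduct,
    Finset.mul_sum]
  exact Finset.sum_congr rfl fun j _ => by ring

/-- Cramer's formula with the convention `0⁻¹ = 0` is measurable everywhere. It is needed because
`N₂` is known to be invertible only for small frequencies. -/
theorem measurable_inv_apply {X : Space n → Mat d} (hX : ∀ i j, Continuous fun ξ => X ξ i j)
    (i j : Fin d) : Measurable fun ξ => (X ξ)⁻¹ i j := by
  have hc : Continuous X := continuous_pi fun i => continuous_pi fun j => hX i j
  have e : (fun ξ => (X ξ)⁻¹ i j) = fun ξ => ((X ξ).det)⁻¹ * (X ξ).adjugate i j := by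
    funext ξ
    rw [Matrix.inv_def, Ring.inverse_eq_inv']
    rfl
  rw [e]
  exact hc.matrix_det.measurable.inv.mul (hc.matrix_adjugate.matrix_elem i j).measurable

theorem continuous_matN_apply [NeZero d] (hA : ∀ k, MatSymbolClass 0 (A k))
    (hB : MatSymbolClass 0 B) (hB2 : CondB2 B δ) (hM : IsDiagonaliser B δ M) {t : ℝ} (ht : 0 ≤ t)
    (i j : Fin d) : Continuous fun ξ => matN A δ M 2 t ξ i j := by
  have h := ((polyMat_hierarchy hA hB hB2 hM 2).1 i j).continuous ht
  refine (h.add (continuous_const (y := (1 : Mat d) i j))).congr fun ξ => ?_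
  exact sub_add_cancel (matN A δ M 2 t ξ i j) ((1 : Mat d) i j)

theorem aestronglyMeasurable_symbolData [NeZero d] (hA : ∀ k, MatSymbolClass 0 (A k))
    (hB : MatSymbolClass 0 B) (hB2 : CondB2 B δ) (hM : IsDiagonaliser B δ M) {t₀ : ℝ}
    (ht₀ : 0 ≤ t₀) (W : Fin d → ℂ) {E : Space n → Mat d}
    (hE : ∀ i j, Continuous fun ξ => E ξ i j) {χ : Space n → ℂ} (hχ : Continuous χ)
    (f : L2 n (EuclideanSpace ℂ (Fin d))) :
    AEStronglyMeasurable
      (fun ξ : Space n => symbolData A δ M t₀ W E χ ((2 * Real.pi) • ξ) (f ξ)) volume := by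
  have hsc : Measurable fun ξ : Space n => (2 * Real.pi) • ξ :=
    (continuous_const_smul (2 * Real.pi)).measurable
  have hN := measurable_inv_apply (continuous_matN_apply hA hB hB2 hM ht₀)
  simp only [symbolData_eq_sum]
  refine Finset.aestronglyMeasurable_fun_sum _ fun j _ => AEStronglyMeasurable.mul ?_ ?_
  · refine Measurable.aestronglyMeasurable ?_
    have h : Measurable fun ξ =>
        χ ξ * (W ᵥ* ((matN A δ M 2 t₀ ξ)⁻¹ * (M t₀)⁻¹ * E ξ)) j := by
      simp only [Matrix.vecMul, dotProduct, Matrix.mul_apply]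
      refine hχ.measurable.mul (Finset.measurable_fun_sum _ fun i _ => Measurable.const_mul ?_ _)
      refine Finset.measurable_fun_sum _ fun k _ => Measurable.mul ?_ (hE k j).measurable
      exact Finset.measurable_fun_sum _ fun l _ => (hN i l).mul_const _
    exact h.comp hsc
  · exact (EuclideanSpace.proj (𝕜 := ℂ) j).continuous.comp_aestronglyMeasurable
      (Lp.aestronglyMeasurable f)

theorem aestronglyMeasurable_symbolK [NeZero d] (hA : ∀ k, MatSymbolClass 0 (A k))
    (hB : MatSymbolClass 0 B) (hB2 : CondB2 B δ) (hM : IsDiagonaliser B δ M) {t : ℝ} (ht : 0 ≤ t)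
    (f : L2 n ℂ) :
    AEStronglyMeasurable
      (fun ξ : Space n => symbolK A δ M t ((2 * Real.pi) • ξ) (f ξ)) volume := by
  have hsc : Continuous fun ξ : Space n => (2 * Real.pi) • ξ := continuous_const_smul _
  refine (Lp.aestronglyMeasurable f).smul (Continuous.aestronglyMeasurable ?_)
  refine (PiLp.continuous_toLp 2 _).comp (continuous_pi fun i => ?_)
  simp only [Matrix.mul_apply]
  exact continuous_finsetSum _ fun j _ =>
    ((continuous_matN_apply hA hB hB2 hM ht j 0).comp hsc).const_mul _

theorem exists_exp_le_inv_sqrt {l : ℝ} (hl : 0 < l) :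
    ∃ C : ℝ, 0 ≤ C ∧ ∀ t : ℝ, 0 ≤ t → Real.exp (-(l * t)) ≤ C * (√(1 + t))⁻¹ := by
  refine ⟨1 + l⁻¹, by positivity, fun t ht => ?_⟩
  have h1 : 0 < √(1 + t) := Real.sqrt_pos.2 (by linarith)
  rw [← div_eq_mul_inv, le_div_iff₀ h1, Real.exp_neg, inv_mul_le_iff₀ (Real.exp_pos _)]
  have h2 : √(1 + t) ≤ 1 + t := by
    rw [Real.sqrt_le_left (by linarith)]
    nlinarith
  have h3 : 1 + l * t ≤ Real.exp (l * t) := by linarith [Real.add_one_le_exp (l * t)]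
  have h4 : 1 + t ≤ (1 + l * t) * (1 + l⁻¹) := by
    have : (1 + l * t) * (1 + l⁻¹) = 1 + l * t + l⁻¹ + t * (l * l⁻¹) := by ring
    rw [this, mul_inv_cancel₀ hl.ne']
    nlinarith [inv_pos.2 hl, mul_nonneg hl.le ht]
  exact h2.trans (h4.trans (mul_le_mul_of_nonneg_right h3 (by positivity)))

/-- The difference of the symbols of the two solution operators. -/
theorem exists_symbol_estimate [NeZero d] (hA : ∀ k, MatSymbolClass 0 (A k))
    (hB : MatSymbolClass 0 B) (hB1 : CondB1 A B) (hB3 : CondB3 A B)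
    {E : Space n → ℝ → Mat d} {W : Fin d → ℂ} {χ : Space n → ℂ} {c t₀ κ K₀ K₁ K₂ S : ℝ}
    (hE : ∀ ξ, IsFundamentalSolution (fun t => symbolA A t ξ + I • B t) 0 (E ξ)) (ht₀ : 0 ≤ t₀)
    (hκ : 0 < κ) (hK₁ : 0 < K₁)
    (hΞ : ∀ t, t₀ ≤ t → ∀ ξ, ‖Xi A δ M 2 t t₀ ξ‖ ≤ K₁ * Real.exp (-(κ * ‖ξ‖ ^ 2 * (t - t₀))))
    (hK₀ : 0 ≤ K₀)
    (hK : ∀ t, t₀ ≤ t → ∀ ξ, ‖ξ‖ ≤ c → ∀ z, ‖symbolK A δ M t ξ z‖ ≤ K₀ * ‖z‖)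
    (hK₂ : 0 ≤ K₂)
    (hlow : ∀ ξ, ‖ξ‖ ≤ c → ∀ x : ℝ → EuclideanSpace ℂ (Fin d),
      (∀ t, 0 ≤ t → HasDerivWithinAt x (I • act (symbolA A t ξ + I • B t) (x t)) (Ici 0) t) →
      ∀ t, t₀ ≤ t → ‖x t - symbolK A δ M t ξ (Xi A δ M 2 t t₀ ξ *
        (W ⬝ᵥ (((matN A δ M 2 t₀ ξ)⁻¹ * (M t₀)⁻¹) *ᵥ fun i => x t₀ i)))‖ ≤
          K₂ * (√(1 + t))⁻¹ * ‖x 0‖)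
    (hχ1 : χ =ᶠ[𝓝 0] fun _ => 1) (hχ2 : ∀ ξ, χ ξ ≠ 0 → ‖ξ‖ ≤ c) (hS0 : 0 ≤ S)
    (hS : ∀ ξ v, ‖symbolData A δ M t₀ W (fun ξ => E ξ t₀) χ ξ v‖ ≤ S * ‖v‖) :
    ∃ C : ℝ, 0 ≤ C ∧ ∀ t, t₀ ≤ t → ∀ ξ v,
      ‖act (E ξ t) v - symbolK A δ M t ξ
        (Xi A δ M 2 t t₀ ξ * symbolData A δ M t₀ W (fun ξ => E ξ t₀) χ ξ v)‖ ≤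
        C * (√(1 + t))⁻¹ * ‖v‖ := by
  -- The radius on which `χ = 1` separates the zones. Inside, the data symbol is the uncut one and
  -- the low-frequency asymptotics apply. Outside, both the solution and its approximation decay
  -- exponentially and are estimated separately.
  obtain ⟨ρ, hρ, hχρ⟩ := Metric.eventually_nhds_iff_ball.1 hχ1
  obtain ⟨l, hl, C₁, hC₁, hexp⟩ := exists_norm_le_exp hA hB hB1 hB3 hρ
  obtain ⟨C₂, hC₂, he₂⟩ := exists_exp_le_inv_sqrt hl
  obtain ⟨C₃, hC₃, he₃⟩ := exists_exp_le_inv_sqrt (l := κ * ρ ^ 2) (by positivity)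
  refine ⟨K₂ + (C₁ * C₂ + K₀ * (K₁ * (Real.exp (κ * ρ ^ 2 * t₀) * C₃) * S)), by positivity,
    fun t ht ξ v => ?_⟩
  have ht' : 0 ≤ t := ht₀.trans ht
  have hx : ∀ t, 0 ≤ t → HasDerivWithinAt (fun t => act (E ξ t) v)
      (I • act (symbolA A t ξ + I • B t) (act (E ξ t) v)) (Ici 0) t := fun t ht =>
    (hE ξ).hasDerivWithinAt_act ht v
  have hx0 : act (E ξ 0) v = v := (hE ξ).act_self v
  have hsq : 0 ≤ (√(1 + t))⁻¹ := by positivity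
  rcases lt_or_ge ‖ξ‖ ρ with h | h
  · have h1 : χ ξ = 1 := hχρ ξ (by simpa using h)
    have h2 : ‖ξ‖ ≤ c := hχ2 ξ (by rw [h1]; exact one_ne_zero)
    have h3 := hlow ξ h2 _ hx t ht
    rw [hx0] at h3
    rw [symbolData_eq, h1, one_mul]
    refine h3.trans ?_
    gcongr
    exact le_add_of_nonneg_right (by positivity)
  · have h1 : ‖act (E ξ t) v‖ ≤ C₁ * (C₂ * (√(1 + t))⁻¹) * ‖v‖ := by
      have := hexp ξ h _ hx t ht'
      rw [hx0] at this
      refine this.trans ?_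
      gcongr
      exact he₂ t ht'
    have h2 : ‖symbolK A δ M t ξ
        (Xi A δ M 2 t t₀ ξ * symbolData A δ M t₀ W (fun ξ => E ξ t₀) χ ξ v)‖ ≤
        K₀ * (K₁ * (Real.exp (κ * ρ ^ 2 * t₀) * (C₃ * (√(1 + t))⁻¹)) * (S * ‖v‖)) := by
      by_cases h0 : χ ξ = 0
      · rw [symbolData_eq, h0, zero_mul, mul_zero, symbolK, zero_smul, norm_zero]
        positivity
      · refine (hK t ht ξ (hχ2 ξ h0) _).trans (mul_le_mul_of_nonneg_left ?_ hK₀)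
        rw [norm_mul]
        refine mul_le_mul ?_ (hS ξ v) (norm_nonneg _) (by positivity)
        refine (hΞ t ht ξ).trans (mul_le_mul_of_nonneg_left ?_ hK₁.le)
        have h3 : -(κ * ‖ξ‖ ^ 2 * (t - t₀)) ≤ κ * ρ ^ 2 * t₀ + -(κ * ρ ^ 2 * t) := by
          have : κ * ρ ^ 2 * (t - t₀) ≤ κ * ‖ξ‖ ^ 2 * (t - t₀) := by
            have : 0 ≤ t - t₀ := by linarith
            gcongr
          linarith
        refine (Real.exp_le_exp.2 h3).trans ?_
        rw [Real.exp_add]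
        exact mul_le_mul_of_nonneg_left (he₃ t ht') (Real.exp_pos _).le
    refine (norm_sub_le _ _).trans ((add_le_add h1 h2).trans ?_)
    have h3 : 0 ≤ K₂ * (√(1 + t))⁻¹ * ‖v‖ := by positivity
    calc _ = (C₁ * C₂ + K₀ * (K₁ * (Real.exp (κ * ρ ^ 2 * t₀) * C₃) * S)) * (√(1 + t))⁻¹ *
          ‖v‖ := by ring
      _ ≤ _ := by rw [add_mul K₂, add_mul (K₂ * _)]; linarith

/-- Where `χ ≠ 0` the inverse of `N₂` is bounded by `2`, and `E` is contractive. Where `χ = 0` the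
symbol vanishes, whatever the value of the inverse. -/
theorem exists_norm_symbolData_le {E : Space n → ℝ → Mat d} (hB1 : CondB1 A B) (W : Fin d → ℂ)
    {χ : Space n → ℂ} {c t₀ : ℝ}
    (hE : ∀ ξ, IsFundamentalSolution (fun t => symbolA A t ξ + I • B t) 0 (E ξ)) (ht₀ : 0 ≤ t₀)
    (hN : ∀ ξ, ‖ξ‖ ≤ c → ‖(matN A δ M 2 t₀ ξ)⁻¹‖ ≤ 2) (hχ : Continuous χ)
    (hχs : HasCompactSupport χ) (hχ2 : ∀ ξ, χ ξ ≠ 0 → ‖ξ‖ ≤ c) :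
    ∃ S : ℝ, 0 ≤ S ∧ ∀ ξ v, ‖symbolData A δ M t₀ W (fun ξ => E ξ t₀) χ ξ v‖ ≤ S * ‖v‖ := by
  obtain ⟨X, hX⟩ := hχs.exists_bound_of_continuous hχ
  have hX0 : 0 ≤ X := (norm_nonneg _).trans (hX 0)
  refine ⟨X * ((∑ i, ‖W i‖) * (2 * ‖(M t₀)⁻¹‖)), by positivity, fun ξ v => ?_⟩
  rw [symbolData_eq, norm_mul]
  by_cases h0 : χ ξ = 0
  · rw [h0, norm_zero, zero_mul]
    positivity
  · rw [mul_assoc X]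
    refine mul_le_mul (hX ξ) ?_ (norm_nonneg _) hX0
    refine (norm_dotProduct_mulVec_le W _ _).trans ?_
    refine mul_le_mul ?_ (norm_act_fundamentalSolution_le hB1 (hE ξ) ht₀ v) (norm_nonneg _)
      (by positivity)
    refine mul_le_mul_of_nonneg_left ((norm_mul_le _ _).trans ?_) (by positivity)
    exact mul_le_mul_of_nonneg_right (hN ξ (hχ2 ξ h0)) (norm_nonneg _)

/-- Passing to the stated rate only uses `log(e + t) ≥ 1`. -/
theorem inv_sqrt_le_rate {C t u : ℝ} (hC : 0 ≤ C) (ht : 0 ≤ t) (hu : 0 ≤ u) :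
    C * (√(1 + t))⁻¹ * u ≤ C * (1 + t) ^ (-(1 / 2) : ℝ) * Real.log (Real.exp 1 + t) * u := by
  have h1 : (√(1 + t))⁻¹ = (1 + t) ^ (-(1 / 2) : ℝ) := by
    rw [Real.rpow_neg (by linarith), Real.sqrt_eq_rpow]
  have h2 : 1 ≤ Real.log (Real.exp 1 + t) := by
    rw [Real.le_log_iff_exp_le (by positivity)]
    linarith
  rw [← h1]
  exact mul_le_mul_of_nonneg_right (le_mul_of_one_le_right (by positivity) h2) hu

end Multipliers
end Diffusion
end

/-! ### Assembly of the diffusion phenomenon -/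

theorem mainTheorem9 {n d : ℕ} (hn : 1 ≤ n) [NeZero d]
    (A : Fin n → ℝ → Diffusion.Mat d) (B : ℝ → Diffusion.Mat d) (δ : Fin d → ℝ → ℝ)
    (hA : ∀ k, Diffusion.MatSymbolClass 0 (A k)) (hB : Diffusion.MatSymbolClass 0 B)
    (hB1 : Diffusion.CondB1 A B) (hB2 : Diffusion.CondB2 B δ) (hB3 : Diffusion.CondB3 A B) :
    -- a diagonaliser exists; what follows holds for each of them
    (∃ M : ℝ → Diffusion.Mat d, Diffusion.IsDiagonaliser B δ M) ∧
    ∀ M : ℝ → Diffusion.Mat d, Diffusion.IsDiagonaliser B δ M →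
      -- the coefficients of the parabolic problem are those of the corner entry of `F₂`
      ∃ (α : ℝ → Matrix (Fin n) (Fin n) ℂ) (β : ℝ → Fin n → ℂ) (γ : ℝ → ℂ),
        (∀ t : ℝ, 0 ≤ t → (α t).IsSymm ∧ ∀ ξ : Diffusion.Space n,
          Diffusion.cornerF A δ M 2 t ξ =
            I * ∑ i, ∑ j, α t i j * (ξ i : ℂ) * (ξ j : ℂ) + ∑ i, β t i * (ξ i : ℂ) + γ t) ∧
        ∃ c : ℝ, 0 < c ∧
          -- uniform parabolicity
          (∃ κ : ℝ, 0 < κ ∧ ∀ t : ℝ, 1 / c ≤ t → ∀ ξ : Diffusion.Space n,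
            κ * ‖ξ‖ ^ 2 ≤ (∑ i, ∑ j, α t i j * (ξ i : ℂ) * (ξ j : ℂ)).re) ∧
          -- `N₂` is invertible in the elliptic zone
          (∀ t : ℝ, 1 / c ≤ t → ∀ ξ : Diffusion.Space n, ‖ξ‖ ≤ c →
            IsUnit (Diffusion.matN A δ M 2 t ξ)) ∧
          ∀ t₀ : ℝ, 1 / c ≤ t₀ →
            -- the fundamental solutions `E(·, 0, ξ)` and `E₂(·, t₀, 0)`, and the limit `W₂(t₀)`
            ∃ (E : Diffusion.Space n → ℝ → Diffusion.Mat d) (E₂ : ℝ → Diffusion.Mat d)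
              (W : Fin d → ℂ),
              (∀ ξ, Diffusion.IsFundamentalSolution
                (fun t => Diffusion.symbolA A t ξ + I • B t) 0 (E ξ)) ∧
              Diffusion.IsFundamentalSolution
                (fun t => Diffusion.calD δ t + Diffusion.matF A δ M 2 t 0
                  + Diffusion.remainder A δ M 2 t 0) t₀ E₂ ∧
              Tendsto (fun t => fun j => (Diffusion.Xi A δ M 2 t t₀ 0)⁻¹ * E₂ t 0 j)
                atTop (𝓝 W) ∧
              ∀ χ : Diffusion.Space n → ℂ, ContDiff ℝ ∞ χ → χ =ᶠ[𝓝 0] (fun _ => 1) →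
                tsupport χ ⊆ Metric.ball 0 c →
                (∀ U₀ : Diffusion.L2 n (EuclideanSpace ℂ (Fin d)),
                  Diffusion.MultiplierDefined
                    (Diffusion.symbolData A δ M t₀ W (fun ξ => E ξ t₀) χ) U₀) ∧
                ∃ C : ℝ, ∀ (U₀ : Diffusion.L2 n (EuclideanSpace ℂ (Fin d)))
                  (U : ℝ → Diffusion.L2 n (EuclideanSpace ℂ (Fin d)))
                  (w : ℝ → Diffusion.L2 n ℂ),
                  Diffusion.IsSystemSolution A B U₀ U →
                  Diffusion.IsParabolicSolution α β γ t₀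
                    (Diffusion.fourierMultiplier
                      (Diffusion.symbolData A δ M t₀ W (fun ξ => E ξ t₀) χ) U₀) w →
                  ∀ t : ℝ, t₀ ≤ t →
                    Diffusion.MultiplierDefined (Diffusion.symbolK A δ M t) (w t) ∧
                    ‖U t - Diffusion.fourierMultiplier (Diffusion.symbolK A δ M t) (w t)‖ ≤
                      C * (1 + t) ^ (-(1 / 2) : ℝ) * Real.log (Real.exp 1 + t) * ‖U₀‖ := by
  refine ⟨Diffusion.exists_isDiagonaliser hB (fun t ht => (hB1 t ht).2.isHermitian) hB2,
    fun M hM => ⟨Diffusion.coefα A δ M, Diffusion.coefβ A δ M, Diffusion.coefγ δ M,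
      fun t ht => ⟨Diffusion.coefα_isSymm t, fun ξ => Diffusion.cornerF_eq hA hB hB2 hM ht ξ⟩, ?_⟩⟩
  obtain ⟨κ, hκ, T, hT, hpar⟩ := Diffusion.exists_parabolicity hA hB hB1 hB2 hB3 hM
  obtain ⟨c₁, hc₁, hN, ⟨K₀, hK₀, hK⟩, ⟨κ₁, hκ₁, K₁, hK₁, hΞ⟩, hlow⟩ :=
    Diffusion.exists_low_frequency hA hB hB1 hB2 hB3 hM
  -- One constant has to serve both the low-frequency asymptotics (`c₁`) and uniform parabolicity,
  -- which holds from time `T` on; the second entry gives `T ≤ 1/c`.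
  have hcpos : 0 < min c₁ (1 / (T + 1)) := lt_min hc₁ (by positivity)
  have hc1 : 1 / c₁ ≤ 1 / min c₁ (1 / (T + 1)) := one_div_le_one_div_of_le hcpos (min_le_left _ _)
  have hcT : T ≤ 1 / min c₁ (1 / (T + 1)) := by
    have := one_div_le_one_div_of_le hcpos (min_le_right c₁ (1 / (T + 1)))
    rw [one_div_one_div] at this
    linarith
  have hcle : min c₁ (1 / (T + 1)) ≤ c₁ := min_le_left _ _
  generalize min c₁ (1 / (T + 1)) = c at hcpos hc1 hcT hcle
  refine ⟨c, hcpos, ⟨κ, hκ, fun t ht ξ => ?_⟩,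
    fun t ht ξ hξ => (hN t (hc1.trans ht) ξ (hξ.trans hcle)).1, fun t₀ ht₀ => ?_⟩
  · rw [Diffusion.re_sum_coefα]
    exact hpar t (hcT.trans ht) ξ
  have ht₀1 : 1 / c₁ ≤ t₀ := hc1.trans ht₀
  have ht₀pos : 0 < t₀ := lt_of_lt_of_le (by positivity) ht₀
  choose E hE using Diffusion.exists_system_fundamentalSolution (n := n) hA hB
  obtain ⟨E₂, hE₂⟩ := Diffusion.exists_reduced_fundamentalSolution (n := n) (ξ := 0) hA hB hB2 hM
    ht₀pos.le (fun t ht => (hN t (ht₀1.trans ht) 0 (by rw [norm_zero]; exact hc₁.le)).1)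
  obtain ⟨W, hW, K₂, hK₂, hest⟩ := hlow t₀ ht₀1 E₂ hE₂
  refine ⟨E, E₂, W, hE, hE₂, hW, fun χ hχ hχ1 hχs => ?_⟩
  have hχ2 : ∀ ξ, χ ξ ≠ 0 → ‖ξ‖ ≤ c := fun ξ h => by
    simpa using (mem_ball_zero_iff.1 (hχs (subset_tsupport _ h))).le
  have hχc : HasCompactSupport χ :=
    HasCompactSupport.of_support_subset_isCompact (isCompact_closedBall (0 : Diffusion.Space n) c)
      fun ξ h => by simpa using hχ2 ξ h
  obtain ⟨S, hS0, hS⟩ := Diffusion.exists_norm_symbolData_le (c := c) hB1 W hE ht₀pos.le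
    (fun ξ hξ => (hN t₀ ht₀1 ξ (hξ.trans hcle)).2) hχ.continuous hχc hχ2
  have hdef : ∀ U₀ : Diffusion.L2 n (EuclideanSpace ℂ (Fin d)), Diffusion.MultiplierDefined
      (Diffusion.symbolData A δ M t₀ W (fun ξ => E ξ t₀) χ) U₀ := fun U₀ =>
    (Lp.memLp (𝓕 U₀ : Diffusion.L2 n (EuclideanSpace ℂ (Fin d)))).of_le_mul
      (Diffusion.aestronglyMeasurable_symbolData hA hB hB2 hM ht₀pos.le W
        (Diffusion.continuous_fundamentalSolution_apply hA hB1 hE ht₀pos.le) hχ.continuous _)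
      (Eventually.of_forall fun ξ => hS _ _)
  have hΞ₀ := hΞ t₀ ht₀1
  have hK' : ∀ t, t₀ ≤ t → ∀ ξ, ‖ξ‖ ≤ c → ∀ z, ‖Diffusion.symbolK A δ M t ξ z‖ ≤ K₀ * ‖z‖ :=
    fun t ht ξ hξ => hK t (ht₀1.trans ht) ξ (hξ.trans hcle)
  obtain ⟨C, hC, hsym⟩ := Diffusion.exists_symbol_estimate (c := c) hA hB hB1 hB3 hE ht₀pos.le hκ₁
    hK₁ hΞ₀ hK₀ hK' hK₂ (fun ξ hξ => hest ξ (hξ.trans hcle)) hχ1 hχ2 hS0 hS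
  have hΞ₁ : ∀ t, t₀ ≤ t → ∀ ξ, ‖Diffusion.Xi A δ M 2 t t₀ ξ‖ ≤ K₁ := fun t ht ξ => by
    refine (hΞ₀ t ht ξ).trans (mul_le_of_le_one_right hK₁.le (Real.exp_le_one_iff.2 ?_))
    have : 0 ≤ κ₁ * ‖ξ‖ ^ 2 * (t - t₀) := mul_nonneg (by positivity) (by linarith)
    linarith
  refine ⟨hdef, C, fun U₀ U w hU hw t ht => ?_⟩
  have ht' : 0 ≤ t := ht₀pos.le.trans ht
  have hwhat := Diffusion.fourier_parabolic_eq hA hB hB2 hM ht₀pos hΞ₁ hw ht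
  have hdata := Diffusion.fourier_fourierMultiplier (hdef U₀)
  -- The symbol `K` is controlled only for `‖ξ‖ ≤ c`. This suffices because the Fourier transform of
  -- `w(t)` is `Ξ₂` times that of the data, and so vanishes wherever `χ` does.
  have hmul : Diffusion.MultiplierDefined (Diffusion.symbolK A δ M t) (w t) := by
    refine (Lp.memLp (𝓕 (w t) : Diffusion.L2 n ℂ)).of_le_mul (c := K₀)
      (Diffusion.aestronglyMeasurable_symbolK hA hB hB2 hM ht' _) ?_
    filter_upwards [hwhat, hdata] with ξ h1 h2
    by_cases h0 : χ ((2 * Real.pi) • ξ) = 0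
    · rw [h1, h2, Diffusion.symbolData_eq, h0, zero_mul, mul_zero, Diffusion.symbolK, zero_smul,
        norm_zero, norm_zero, mul_zero]
    · exact hK' t ht _ (hχ2 _ h0) _
  refine ⟨hmul, le_trans ?_ (Diffusion.inv_sqrt_le_rate hC ht' (norm_nonneg U₀))⟩
  -- By Plancherel the claim becomes the pointwise symbol estimate at the frequency `2πξ`.
  rw [← Lp.norm_fourier_eq, Diffusion.fourier_sub_L2, ← Lp.norm_fourier_eq U₀]
  refine Lp.norm_le_mul_norm_of_ae_le_mul ?_
  filter_upwards [hwhat, hdata, Diffusion.fourier_fourierMultiplier hmul,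
    Diffusion.fourier_system_eq hA hB hB1 hE hU ht',
    Lp.coeFn_sub (𝓕 (U t) : Diffusion.L2 n (EuclideanSpace ℂ (Fin d)))
      (𝓕 (Diffusion.fourierMultiplier (Diffusion.symbolK A δ M t) (w t)))] with ξ h1 h2 h3 h4 h5
  rw [h5, Pi.sub_apply, h4, h3, h1, h2]
  exact hsym t ht _ _
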